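/- **Proposition 3.2.** Let $n\ge 2$. For $0<h\le 1$ write $\mathcal D_{x_j}=-ih\partial_{x_j}$, $\mathcal D_x^\alpha=(-ih)^{|\alpha|}\partial_x^\alpha$, $\langle x\rangle=(1+|x|^2)^{1/2}$, and let $$P(h)=\sum_{i,j=1}^n\mathcal D_{x_i}a_{ij}(x,h)\mathcal D_{x_j}+\sum_{j=1}^n\big(b_j(x,h)\mathcal D_{x_j}+\mathcal D_{x_j}b_j(x,h)\big)+V(x,h)$$ with real-valued coefficients $a_{ij}(\cdot,h),b_j(\cdot,h)\in C^1(\mathbf R^n)$, $V(\cdot,h)\in L^\infty(\mathbf R^n)$ of the form $a_{ij}=a^0_{ij}(x)+ha^1_{ij}(x,h)$, $b_j=b_j^0(x)+hb_j^1(x,h)$, $V=V^0(x)+hV^1(x,h)$, where $a^0_{ij},b^0_j,V^0\in C^1(\mathbf R^n)$ do not depend on $h$ and $a^1_{ij},b^1_j,V^1$ are in $L^\infty(\mathbf R^n)$ uniformly in $h$. Assume that $P(h)$ has a self-adjoint realization on $L^2(\mathbf R^n)$ (again denoted $P(h)$), that is, a self-adjoint operator whose domain contains $C_0^\infty(\mathbf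 R^n)$ and which acts there by the above expression, and assume: * (1.3) $\displaystyle\sum_{0\le|\alpha|\le2}\|\mathcal D_x^\alpha(P(h)\pm i)^{-1}\|_{L^2\to L^2}\le C$ with $C$ independent of $h$; * (1.4) there are $C>0$ and $\delta>1$ independent of $h$ such that, for $|\alpha|\le 1$, $$\sum_{i,j}\big|\partial_x^\alpha(a_{ij}(x,h)-\delta_{ij})\big|+\sum_j|\partial_x^\alpha b_j(x,h)|+|\partial_x^\alpha V^0(x)|+|V^1(x,h)|\le C\langle x\rangle^{-\delta},$$ where $\delta_{ij}$ is the Kronecker symbol; * (1.6) there are $E>0$ and $0<\varepsilon_0<E$ independent of $h$, and a function $\mu$ with $\mu(h)\ge h^{-1}$, such that, with $R_s(z,h)=\langle x\rangle^{-s}(P(h)-z)^{-1}\langle x\rangle^{-s}$ for $\operatorname{Im}z\ne0$, for every $s>1/2$ and $z\in[E-\varepsilon_0,E+\varepsilon_0]$ the limits $R_s^\pm(z,h)=\lim_{\varepsilon\to0^+}R_s(z\pm i\varepsilon,h)$ exist in the norm of $\mathcal L(L^2)$, are continuous in $z$, and satisfy $\|R_s^\pm(z,h)\|_{L^2\to L^2}\le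 C_s\,\mu(h)$ with $C_s$ independent of $z$ and $h$. Then for every $0\le s<\delta-1$, every $\epsilon>0$, every sign $\pm$ and every multi-index $|\alpha|\le2$, the operator $\mathcal D_x^\alpha R^\pm_{1/2+s+\epsilon}(z,h)$ is bounded on $L^2$ for $z\in(E-\varepsilon_0,E+\varepsilon_0)$, and $$\mathcal D_x^\alpha R^\pm_{1/2+s+\epsilon}(\cdot,h)\in C^s\big((E-\varepsilon_0,E+\varepsilon_0);\mathcal L(L^2)\big),\qquad \big\|\mathcal D_x^\alpha R^\pm_{1/2+s+\epsilon}(\cdot,h)\big\|_{C^s}\le C\mu(h)^{1+s},$$ with a constant $C>0$ independent of $h$. Here, with $m=\lfloor s\rfloor$, $C^s$ consists of the $m$ times continuously differentiable functions $F$ with finite norm $\|F\|_{C^s}=\sum_{j\le m}\sup\|F^{(j)}\|+[F^{(m)}]_{s-m}$, where $[G]_{\nu}=\sup_{z_1\ne z_2}\|G(z_1)-G(z_2)\|/|z_1-z_2|^{\nu}$ for $0<\nu<1$, and the last term is omitted if $s$ is an integer. -/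

import Mathlib

open Set Filter Topology MeasureTheory
open scoped NNReal ENNReal ContDiff SchwartzMap LineDeriv

noncomputable section

namespace Semiclassical

/-- The space `ℝⁿ` with its Euclidean norm. -/
abbrev Space (n : ℕ) : Type := EuclideanSpace ℝ (Fin n)

/-- The complex Hilbert space `L²(ℝⁿ)`. -/
abbrev L2 (n : ℕ) : Type := Lp ℂ 2 (volume : Measure (Space n))

/-- The `j`-th unit vector of `ℝⁿ`. -/
def unitVec {n : ℕ} (j : Fin n) : Space n := EuclideanSpace.single j (1 : ℝ)

/-- The power `⟨x⟩ ^ r = (1 + |x|²) ^ (r / 2)` of the Japanese bracket. -/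
def bracket {n : ℕ} (r : ℝ) (x : Space n) : ℝ := (1 + ‖x‖ ^ 2) ^ (r / 2)

/-- The weight `⟨x⟩ ^ (-s)`, `s ≥ 0`, is a bounded measurable function. -/
lemma memLp_bracket {n : ℕ} (s : ℝ≥0) :
    MemLp (fun x : Space n => ((bracket (-(s : ℝ)) x : ℝ) : ℂ)) ∞ volume := by
  have hcont : Continuous (fun x : Space n => ((bracket (-(s : ℝ)) x : ℝ) : ℂ)) := by
    unfold bracket
    refine Complex.continuous_ofReal.comp ?_
    refine Continuous.rpow_const (by fun_prop) (fun x => Or.inl ?_)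
    positivity
  refine memLp_top_of_bound hcont.aestronglyMeasurable 1 (Eventually.of_forall fun x => ?_)
  have h1 : (1 : ℝ) ≤ 1 + ‖x‖ ^ 2 := by nlinarith [sq_nonneg ‖x‖]
  have h0 : 0 ≤ bracket (-(s : ℝ)) x := by unfold bracket; positivity
  rw [Complex.norm_real, Real.norm_of_nonneg h0]
  refine Real.rpow_le_one_of_one_le_of_nonpos h1 ?_
  have := s.coe_nonneg
  linarith

/-- The bounded operator on `L²` of multiplication by `⟨x⟩ ^ (-s)`, `s ≥ 0`. -/
def weight {n : ℕ} (s : ℝ≥0) : L2 n →L[ℂ] L2 n :=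
  (ContinuousLinearMap.lsmul ℂ ℂ).holderL volume ∞ 2 2 ((memLp_bracket s).toLp _)

/-- Coefficients of the family of operators, in the form `a = a⁰ + h a¹`, `b = b⁰ + h b¹`,
`V = V⁰ + h V¹`; the components with index `1` have the parameter `h` as first argument. -/
structure Coefficients (n : ℕ) where
  a0 : Fin n → Fin n → Space n → ℝ
  a1 : ℝ → Fin n → Fin n → Space n → ℝ
  b0 : Fin n → Space n → ℝ
  b1 : ℝ → Fin n → Space n → ℝ
  V0 : Space n → ℝ
  V1 : ℝ → Space n → ℝ

namespace Coefficients

variable {n : ℕ} (c : Coefficients n)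

/-- `a_{ij}(x,h) = a⁰_{ij}(x) + h a¹_{ij}(x,h)`. -/
def a (h : ℝ) (i j : Fin n) (x : Space n) : ℝ := c.a0 i j x + h * c.a1 h i j x

/-- `b_j(x,h) = b⁰_j(x) + h b¹_j(x,h)`. -/
def b (h : ℝ) (j : Fin n) (x : Space n) : ℝ := c.b0 j x + h * c.b1 h j x

/-- `V(x,h) = V⁰(x) + h V¹(x,h)`. -/
def V (h : ℝ) (x : Space n) : ℝ := c.V0 x + h * c.V1 h x

/-- Regularity of the coefficients: `a_{ij}, b_j, a⁰_{ij}, b⁰_j, V⁰` are `C¹`, and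
`a¹_{ij}, b¹_j, V¹` are in `L^∞` uniformly in `0 < h ≤ 1`. -/
structure IsRegular : Prop where
  a0_C1 : ∀ i j, ContDiff ℝ 1 (c.a0 i j)
  b0_C1 : ∀ j, ContDiff ℝ 1 (c.b0 j)
  V0_C1 : ContDiff ℝ 1 c.V0
  a_C1 : ∀ h ∈ Ioc (0 : ℝ) 1, ∀ i j, ContDiff ℝ 1 (c.a h i j)
  b_C1 : ∀ h ∈ Ioc (0 : ℝ) 1, ∀ j, ContDiff ℝ 1 (c.b h j)
  V1_meas : ∀ h ∈ Ioc (0 : ℝ) 1, AEStronglyMeasurable (c.V1 h) volume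
  bdd : ∃ C : ℝ, ∀ h ∈ Ioc (0 : ℝ) 1, ∀ᵐ x : Space n,
    (∀ i j, |c.a1 h i j x| ≤ C) ∧ (∀ j, |c.b1 h j x| ≤ C) ∧ |c.V1 h x| ≤ C

/-- Short range condition: `a_{ij} - δ_{ij}`, `b_j`, `V⁰` and their first derivatives, and `V¹`,
are `O(⟨x⟩ ^ (-δ))`, uniformly in `0 < h ≤ 1`. -/
def IsShortRange (δ : ℝ) : Prop :=
  ∃ C : ℝ, ∀ h ∈ Ioc (0 : ℝ) 1,
    (∀ (i j : Fin n) (x : Space n),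
      |c.a h i j x - (if i = j then 1 else 0)| ≤ C * bracket (-δ) x ∧
      ‖fderiv ℝ (c.a h i j) x‖ ≤ C * bracket (-δ) x) ∧
    (∀ (j : Fin n) (x : Space n),
      |c.b h j x| ≤ C * bracket (-δ) x ∧ ‖fderiv ℝ (c.b h j) x‖ ≤ C * bracket (-δ) x) ∧
    (∀ x : Space n, |c.V0 x| ≤ C * bracket (-δ) x ∧ ‖fderiv ℝ c.V0 x‖ ≤ C * bracket (-δ) x) ∧
    (∀ᵐ x : Space n, |c.V1 h x| ≤ C * bracket (-δ) x)

end Coefficients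

/-- The classical semiclassical derivative `𝒟_{x_j} u = -i h ∂_{x_j} u`. -/
def semiD {n : ℕ} (h : ℝ) (j : Fin n) (u : Space n → ℂ) (x : Space n) : ℂ :=
  -Complex.I * (h : ℂ) * fderiv ℝ u x (unitVec j)

/-- The differential expression
`∑ 𝒟_i (a_{ij} 𝒟_j u) + ∑ (b_j 𝒟_j u + 𝒟_j (b_j u)) + V u`, for smooth `u`. -/
def Coefficients.expression {n : ℕ} (c : Coefficients n) (h : ℝ) (u : Space n → ℂ)
    (x : Space n) : ℂ :=
  (∑ i, ∑ j, semiD h i (fun y => (c.a h i j y : ℂ) * semiD h j u y) x) +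
    (∑ j, ((c.b h j x : ℂ) * semiD h j u x + semiD h j (fun y => (c.b h j y : ℂ) * u y) x)) +
    (c.V h x : ℂ) * u x

/-- `P` is a self-adjoint realization on `L²` of the differential expression with parameter `h`:
a self-adjoint (densely defined, in general unbounded) operator whose domain contains
`C₀^∞(ℝⁿ)` and which acts there as the differential expression. -/
def IsSelfAdjointRealization {n : ℕ} (c : Coefficients n) (h : ℝ) (P : L2 n →ₗ.[ℂ] L2 n) : Prop :=
  IsSelfAdjoint P ∧
    ∀ φ : Space n → ℂ, ContDiff ℝ ∞ φ → HasCompactSupport φ →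
      ∀ u : L2 n, u =ᵐ[volume] φ →
        ∃ hu : u ∈ P.domain, P ⟨u, hu⟩ =ᵐ[volume] c.expression h φ

/-- `R` is the bounded inverse of `P - z`. -/
def IsResolventAt {n : ℕ} (P : L2 n →ₗ.[ℂ] L2 n) (z : ℂ) (R : L2 n →L[ℂ] L2 n) : Prop :=
  (∀ f : L2 n, ∃ hf : R f ∈ P.domain, P ⟨R f, hf⟩ - z • R f = f) ∧
    ∀ u : P.domain, R (P u - z • (u : L2 n)) = u

lemma IsResolventAt.unique {n : ℕ} {P : L2 n →ₗ.[ℂ] L2 n} {z : ℂ} {R R' : L2 n →L[ℂ] L2 n}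
    (hR : IsResolventAt P z R) (hR' : IsResolventAt P z R') : R = R' := by
  ext1 f
  obtain ⟨hf, hfe⟩ := hR'.1 f
  have := hR.2 ⟨R' f, hf⟩
  rwa [hfe] at this

open Classical in
/-- The resolvent `(P - z)⁻¹` (the zero operator if `P - z` has no bounded inverse, which does not
happen for self-adjoint `P` and `Im z ≠ 0`). -/
def unboundedResolvent {n : ℕ} (P : L2 n →ₗ.[ℂ] L2 n) (z : ℂ) : L2 n →L[ℂ] L2 n :=
  if H : ∃ R, IsResolventAt P z R then H.choose else 0

/-- The weighted resolvent `R_s(z) = ⟨x⟩ ^ (-s) (P - z)⁻¹ ⟨x⟩ ^ (-s)`. -/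
def weightedResolvent {n : ℕ} (P : L2 n →ₗ.[ℂ] L2 n) (s : ℝ≥0) (z : ℂ) : L2 n →L[ℂ] L2 n :=
  weight s ∘L unboundedResolvent P z ∘L weight s

/-- The boundary value `R_s^±(z) = lim_{ε → 0⁺} R_s(z ± i ε)` in operator norm, where the sign is
given by `σ = 1` or `σ = -1`. -/
def boundaryResolvent {n : ℕ} (P : L2 n →ₗ.[ℂ] L2 n) (σ : ℝ) (s : ℝ≥0) (z : ℝ) :
    L2 n →L[ℂ] L2 n :=
  limUnder (𝓝[>] (0 : ℝ)) fun ε : ℝ =>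
    weightedResolvent P s ((z : ℂ) + (σ : ℂ) * (ε : ℂ) * Complex.I)

/-- `v = 𝒟_x^α u` in the sense of distributions, for `u, v ∈ L²`. The multi-index `α` of order `k`
is given by its list of directions: `𝒟_x^α = 𝒟_{x_{α 0}} ⋯ 𝒟_{x_{α (k-1)}}`, with
`𝒟_{x_j} = -i h ∂_{x_j}`. -/
def IsSemiDeriv {n k : ℕ} (h : ℝ) (α : Fin k → Fin n) (u v : L2 n) : Prop :=
  (v : 𝓢'(Space n, ℂ)) =
    (-Complex.I * (h : ℂ)) ^ k • ∂^{fun l => unitVec (α l)} (u : 𝓢'(Space n, ℂ))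

/-- `T = 𝒟_x^α A` as bounded operators on `L²`. -/
def IsSemiDerivComp {n k : ℕ} (h : ℝ) (α : Fin k → Fin n) (A T : L2 n →L[ℂ] L2 n) : Prop :=
  ∀ f : L2 n, IsSemiDeriv h α (A f) (T f)

/-- Ellipticity: `𝒟_x^α (P(h) ± i)⁻¹`, `|α| ≤ 2`, are bounded on `L²` uniformly in `0 < h ≤ 1`. -/
def IsElliptic {n : ℕ} (P : ℝ → L2 n →ₗ.[ℂ] L2 n) : Prop :=
  ∃ C : ℝ, ∀ h ∈ Ioc (0 : ℝ) 1, ∀ σ ∈ ({1, -1} : Set ℝ),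
    ∀ k ≤ 2, ∀ α : Fin k → Fin n, ∃ T : L2 n →L[ℂ] L2 n,
      IsSemiDerivComp h α (unboundedResolvent (P h) (-(σ : ℂ) * Complex.I)) T ∧ ‖T‖ ≤ C

/-- The limiting absorption hypothesis on `[E - ε₀, E + ε₀]`: for every `s > 1/2` the limits
`R_s^±(z,h)` exist, are continuous in `z`, and are bounded in norm by `C μ(h)`, with `C`
independent of `z` and `h`. -/
def LimitingAbsorption {n : ℕ} (P : ℝ → L2 n →ₗ.[ℂ] L2 n) (E ε₀ : ℝ) (μ : ℝ → ℝ) : Prop :=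
  ∀ s : ℝ≥0, 1 / 2 < s → ∃ C : ℝ, ∀ h ∈ Ioc (0 : ℝ) 1, ∀ σ ∈ ({1, -1} : Set ℝ),
    (∀ z ∈ Icc (E - ε₀) (E + ε₀),
      Tendsto (fun ε : ℝ => weightedResolvent (P h) s ((z : ℂ) + (σ : ℂ) * (ε : ℂ) * Complex.I))
        (𝓝[>] 0) (𝓝 (boundaryResolvent (P h) σ s z))) ∧
    ContinuousOn (boundaryResolvent (P h) σ s) (Icc (E - ε₀) (E + ε₀)) ∧
    ∀ z ∈ Icc (E - ε₀) (E + ε₀), ‖boundaryResolvent (P h) σ s z‖ ≤ C * μ h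

/-- The `C^s` norm on `U ⊆ ℝ` of `F : ℝ → X`: with `m = ⌊s⌋`, the sum over `j ≤ m` of the suprema
of the `j`-th derivatives and, if `s` is not an integer, of the Hölder seminorm of order `s - m`
of the `m`-th derivative. -/
def csNorm {X : Type*} [NormedAddCommGroup X] [NormedSpace ℝ X] (s : ℝ≥0) (U : Set ℝ)
    (F : ℝ → X) : ℝ≥0∞ :=
  (∑ j ∈ Finset.range (⌊s⌋₊ + 1), ⨆ z ∈ U, ‖iteratedDerivWithin j F U z‖ₑ) +
    if s = (⌊s⌋₊ : ℝ≥0) then 0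
    else eHolderNorm (s - (⌊s⌋₊ : ℝ≥0)) (U.domRestrict (iteratedDerivWithin ⌊s⌋₊ F U))

/-- `F ∈ C^s(U; X)`, for an open set `U ⊆ ℝ`: `F` is `⌊s⌋` times continuously differentiable on `U`
and its `C^s` norm is finite. -/
def MemCs {X : Type*} [NormedAddCommGroup X] [NormedSpace ℝ X] (s : ℝ≥0) (U : Set ℝ)
    (F : ℝ → X) : Prop :=
  ContDiffOn ℝ ⌊s⌋₊ F U ∧ csNorm s U F < ⊤

end Semiclassical

end

/-! Write R = (P - z)⁻¹. The j-th derivative of R in z is j! Rʲ⁺¹, so regularity of the boundary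
values is a question about weighted powers ⟨x⟩⁻ᵇ Rᵏ ⟨x⟩⁻ᵃ (`wres`) for z near the real interval,
uniformly in h.

The powers are controlled by the commutator with the generator A = x·∇ + n/2 of dilations: [P, A] =
2P - Q, where the short range condition makes the coefficients of Q of size ⟨x⟩¹⁻ᵟ. The sum of
Rᵏ⁻ⁱ⁺¹ [P, A] Rⁱ⁺¹ over i ≤ k telescopes, so 2(k+1)(z Rᵏ⁺² + Rᵏ⁺¹) = A Rᵏ⁺¹ - Rᵏ⁺¹ A + ∑ Rᵏ⁻ⁱ⁺¹ Q
Rⁱ⁺¹ (`IsModel.virial_identity`). Since z stays away from 0, Rᵏ⁺² is expressed by lower powers. In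
the terms with A, one power of the weight absorbs x, and the factor h⁻¹ hidden in A = (i/h) x·𝒟 +
n/2 is at most μ. In the terms with Q, the decay ⟨x⟩¹⁻ᵟ is divided between the two neighbouring
powers of R. Derivatives are removed by a weighted elliptic estimate (`IsModel.exists_norm_wt_le`).
Because V¹ is only bounded and measurable, the commutator is never formed as an operator: it is the
derivative at t = 0 of a quadratic form involving unitary dilations.

By induction ⟨x⟩⁻ᵇ Rʲ⁺¹ ⟨x⟩⁻ᵃ = O(μʲ⁺¹) for a, b > j + 1/2 and j < δ - 1 (`IsFamily.estimate`). The
start j = 0 needs bounds off the real axis, while the hypothesis only bounds boundary values. The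
quadratic forms of the weighted resolvent have nonnegative imaginary part in the upper half plane,
and a harmonic measure argument for such functions carries the boundary bound inside
(`exists_norm_wres_le`).

For the Hölder part, let m = ⌊s⌋ and 0 < ν < 1. The goal is ‖⟨x⟩⁻ᵃ Rᵐ⁺² ⟨x⟩⁻ᵃ‖ ≤ C μᵐ⁺² (|Im z|
μ)^(ν-1) for a > 1/2 + m + ν (`IsFamily.last_estimate`). The induction is repeated with a weaker
weight on one side, at the price of a factor (|Im z| μ)^(-(1-ν)/2); this handles the terms with Q,
because their total decay need only exceed m + ν. The remaining part is interpolated between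
Cauchy's estimate at weights near m + 1/2 and the commutator bound at weights near m + 3/2.

Integrating |Im z|^(ν-1) down to the axis gives boundary values of the first m derivatives, ν-Hölder
continuous with the right power of μ (`IsHolderFamily`). The operators 𝒟^α are added by writing
⟨x⟩⁻ᵃ (P + i)⁻¹ = (P + i)⁻¹ B, so that 𝒟^α falls on (P + i)⁻¹, where ellipticity bounds it. -/

noncomputable section

namespace Semiclassical

/-! ### Resolvent of an unbounded self-adjoint operator. -/

section Resolvent

open scoped ComplexConjugate InnerProductSpace

variable {n : ℕ} {P : L2 n →ₗ.[ℂ] L2 n}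

lemma _root_.IsSelfAdjoint.inner_apply_left (hP : IsSelfAdjoint P) (u v : P.domain) :
    inner ℂ (P u) (v : L2 n) = inner ℂ (u : L2 n) (P v) := by
  have h := LinearPMap.adjoint_isFormalAdjoint hP.dense_domain
  rw [LinearPMap.isSelfAdjoint_def.mp hP] at h
  exact h u v

/-- The domain of P is that of its adjoint. This is how vectors are shown to lie in the domain
without any regularity theory. -/
lemma _root_.IsSelfAdjoint.exists_apply_eq (hP : IsSelfAdjoint P) {u g : L2 n}
    (h : ∀ v : P.domain, inner ℂ g (v : L2 n) = inner ℂ u (P v)) :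
    ∃ hu : u ∈ P.domain, P ⟨u, hu⟩ = g := by
  have hmem : u ∈ (P.adjoint).domain := P.mem_adjoint_domain_of_exists u ⟨g, h⟩
  have happ := LinearPMap.adjoint_apply_eq hP.dense_domain ⟨u, hmem⟩ h
  have key : ∀ Q : L2 n →ₗ.[ℂ] L2 n, Q = P → ∀ hm : u ∈ Q.domain, Q ⟨u, hm⟩ = g →
      ∃ hu : u ∈ P.domain, P ⟨u, hu⟩ = g := by
    rintro Q rfl hm hg
    exact ⟨hm, hg⟩
  exact key _ (LinearPMap.isSelfAdjoint_def.mp hP) hmem happ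

lemma _root_.IsSelfAdjoint.im_inner_apply (hP : IsSelfAdjoint P) (u : P.domain) :
    (inner ℂ (u : L2 n) (P u)).im = 0 := by
  have h := hP.inner_apply_left u u
  have h2 := inner_conj_symm (𝕜 := ℂ) (u : L2 n) (P u)
  rw [h] at h2
  exact Complex.conj_eq_iff_im.mp h2

lemma _root_.IsSelfAdjoint.inner_apply_sub_smul_im (hP : IsSelfAdjoint P) (z : ℂ) (u : P.domain) :
    (inner ℂ (u : L2 n) (P u - z • (u : L2 n))).im = -z.im * ‖(u : L2 n)‖ ^ 2 := by
  have h : inner ℂ (u : L2 n) (u : L2 n) = ((‖(u : L2 n)‖ ^ 2 : ℝ) : ℂ) := by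
    rw [inner_self_eq_norm_sq_to_K]; push_cast; rfl
  rw [inner_sub_right, inner_smul_right, Complex.sub_im, hP.im_inner_apply, h,
    Complex.im_mul_ofReal]
  ring

/-- Since ⟨u, P u⟩ is real, the imaginary part of ⟨u, (P - z) u⟩ is -Im z ‖u‖²; Cauchy–Schwarz
concludes. -/
lemma _root_.IsSelfAdjoint.norm_le_apply_sub_smul (hP : IsSelfAdjoint P) (z : ℂ) (u : P.domain) :
    |z.im| * ‖(u : L2 n)‖ ≤ ‖P u - z • (u : L2 n)‖ := by
  rcases eq_or_ne ‖(u : L2 n)‖ 0 with h0 | h0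
  · rw [h0, mul_zero]; exact norm_nonneg _
  have h1 := hP.inner_apply_sub_smul_im z u
  have h2 : |(inner ℂ (u : L2 n) (P u - z • (u : L2 n))).im| ≤ _ :=
    (Complex.abs_im_le_norm _).trans (norm_inner_le_norm _ _)
  rw [h1, abs_mul, abs_neg, abs_of_nonneg (sq_nonneg ‖(u : L2 n)‖)] at h2
  have h3 : 0 < ‖(u : L2 n)‖ := lt_of_le_of_ne (norm_nonneg _) (Ne.symm h0)
  nlinarith

/-- The lower bound for P - z makes its range closed, and a vector orthogonal to the range is in the
kernel of P - conj z, which is trivial by the same lower bound. -/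
lemma _root_.IsSelfAdjoint.surjective_sub_smul (hP : IsSelfAdjoint P) {z : ℂ} (hz : z.im ≠ 0)
    (f : L2 n) : ∃ u : P.domain, P u - z • (u : L2 n) = f := by
  set L : P.domain →ₗ[ℂ] L2 n := P.toFun - z • P.domain.subtype with hL
  have hLa : ∀ u : P.domain, L u = P u - z • (u : L2 n) := fun u => rfl
  have hz' : 0 < |z.im| := abs_pos.mpr hz
  have hclosed : IsClosed (LinearMap.range L : Set (L2 n)) := by
    apply isClosed_of_closure_subset
    intro f hf
    obtain ⟨g, hg, hgf⟩ := mem_closure_iff_seq_limit.mp hf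
    choose u hu using hg
    have hcau : CauchySeq (fun k => (u k : L2 n)) := by
      have hgc := hgf.cauchySeq
      rw [Metric.cauchySeq_iff] at hgc ⊢
      intro ε hε
      obtain ⟨N, hN⟩ := hgc (|z.im| * ε) (by positivity)
      refine ⟨N, fun k hk l hl => ?_⟩
      have h1 := hN k hk l hl
      have h2 := hP.norm_le_apply_sub_smul z (u k - u l)
      rw [← hLa, map_sub, hu, hu] at h2
      rw [dist_eq_norm] at h1 ⊢
      have h3 : |z.im| * ‖(u k : L2 n) - u l‖ < |z.im| * ε := lt_of_le_of_lt h2 h1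
      exact lt_of_mul_lt_mul_left h3 hz'.le
    obtain ⟨u0, hu0⟩ := cauchySeq_tendsto_of_complete hcau
    have hP' : Tendsto (fun k => P (u k)) atTop (𝓝 (f + z • u0)) := by
      have : (fun k => P (u k)) = fun k => g k + z • (u k : L2 n) := by
        ext1 k
        rw [← hu k, hLa]; abel
      rw [this]
      exact hgf.add (hu0.const_smul z)
    have hv : ∀ v : P.domain, inner ℂ (f + z • u0) (v : L2 n) = inner ℂ u0 (P v) := by
      intro v
      have h1 : Tendsto (fun k => inner ℂ (P (u k)) (v : L2 n)) atTop
          (𝓝 (inner ℂ (f + z • u0) (v : L2 n))) := hP'.inner tendsto_const_nhds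
      have h2 : Tendsto (fun k => inner ℂ (u k : L2 n) (P v)) atTop
          (𝓝 (inner ℂ u0 (P v))) := hu0.inner tendsto_const_nhds
      refine tendsto_nhds_unique h1 (h2.congr fun k => (hP.inner_apply_left _ _).symm)
    obtain ⟨hm, he⟩ := hP.exists_apply_eq hv
    refine ⟨⟨u0, hm⟩, ?_⟩
    rw [hLa, he]; simp
  have hperp : (LinearMap.range L)ᗮ = ⊥ := by
    rw [Submodule.eq_bot_iff]
    intro g hg
    rw [Submodule.mem_orthogonal'] at hg
    have hv : ∀ v : P.domain, inner ℂ (conj z • g) (v : L2 n) = inner ℂ g (P v) := by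
      intro v
      have := hg _ ⟨v, rfl⟩
      rw [hLa, inner_sub_right, inner_smul_right, sub_eq_zero] at this
      rw [this, inner_smul_left, Complex.conj_conj]
    obtain ⟨hm, he⟩ := hP.exists_apply_eq hv
    have h1 := hP.norm_le_apply_sub_smul (conj z) ⟨g, hm⟩
    rw [he] at h1
    simp only [sub_self, norm_zero, Complex.conj_im, abs_neg] at h1
    have : ‖g‖ ≤ 0 := by
      by_contra h
      push Not at h
      have := mul_pos hz' h
      linarith
    exact norm_le_zero_iff.mp this
  have htop : LinearMap.range L = ⊤ := by
    have : CompleteSpace (LinearMap.range L) := hclosed.completeSpace_coe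
    rwa [Submodule.orthogonal_eq_bot_iff] at hperp
  obtain ⟨u, hu⟩ := LinearMap.range_eq_top.mp htop f
  exact ⟨u, hu⟩

lemma _root_.IsSelfAdjoint.exists_isResolventAt (hP : IsSelfAdjoint P) {z : ℂ} (hz : z.im ≠ 0) :
    ∃ R, IsResolventAt P z R := by
  have hz' : 0 < |z.im| := abs_pos.mpr hz
  choose u hu using fun f => hP.surjective_sub_smul hz f
  have hinj : ∀ v w : P.domain, P v - z • (v : L2 n) = P w - z • (w : L2 n) → v = w := by
    intro v w h
    have h1 := hP.norm_le_apply_sub_smul z (v - w)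
    have h2 : P (v - w) - z • ((v - w : P.domain) : L2 n) = 0 := by
      rw [LinearPMap.map_sub, Submodule.coe_sub, smul_sub]
      rw [← sub_eq_zero] at h
      rw [← h]; abel
    rw [h2, norm_zero] at h1
    have h3 : ‖((v - w : P.domain) : L2 n)‖ ≤ 0 := by
      by_contra hh
      push Not at hh
      have := mul_pos hz' hh
      linarith
    have h4 := norm_le_zero_iff.mp h3
    rw [Submodule.coe_sub, sub_eq_zero] at h4
    exact Subtype.ext h4
  let Rl : L2 n →ₗ[ℂ] L2 n :=
    { toFun := fun f => u f
      map_add' := fun f g => by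
        have : u (f + g) = u f + u g := by
          apply hinj
          rw [hu, LinearPMap.map_add, Submodule.coe_add, smul_add]
          nth_rewrite 1 [← hu f, ← hu g]
          abel
        rw [this, Submodule.coe_add]
      map_smul' := fun c f => by
        have : u (c • f) = c • u f := by
          apply hinj
          rw [hu, LinearPMap.map_smul, Submodule.coe_smul, smul_comm z c, ← smul_sub, hu]
        rw [this, Submodule.coe_smul]; rfl }
  refine ⟨Rl.mkContinuous (|z.im|⁻¹) fun f => ?_, fun f => ⟨(u f).2, hu f⟩, fun v => ?_⟩
  · have h1 := hP.norm_le_apply_sub_smul z (u f)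
    rw [hu] at h1
    change ‖(u f : L2 n)‖ ≤ _
    rw [inv_mul_eq_div, le_div_iff₀ hz']
    linarith
  · change (u _ : L2 n) = v
    rw [hinj _ v (hu _)]

lemma isResolventAt_unboundedResolvent (hP : IsSelfAdjoint P) {z : ℂ} (hz : z.im ≠ 0) :
    IsResolventAt P z (unboundedResolvent P z) := by
  have H := hP.exists_isResolventAt hz
  unfold unboundedResolvent
  rw [dif_pos H]
  exact H.choose_spec

lemma unboundedResolvent_mem (hP : IsSelfAdjoint P) {z : ℂ} (hz : z.im ≠ 0) (f : L2 n) :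
    unboundedResolvent P z f ∈ P.domain :=
  ((isResolventAt_unboundedResolvent hP hz).1 f).1

lemma apply_unboundedResolvent (hP : IsSelfAdjoint P) {z : ℂ} (hz : z.im ≠ 0) (f : L2 n)
    (hf : unboundedResolvent P z f ∈ P.domain) :
    P ⟨unboundedResolvent P z f, hf⟩ = z • unboundedResolvent P z f + f := by
  obtain ⟨_, h⟩ := (isResolventAt_unboundedResolvent hP hz).1 f
  rw [sub_eq_iff_eq_add] at h
  rw [h, add_comm]

lemma unboundedResolvent_apply_sub (hP : IsSelfAdjoint P) {z : ℂ} (hz : z.im ≠ 0)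
    (u : P.domain) : unboundedResolvent P z (P u - z • (u : L2 n)) = u :=
  (isResolventAt_unboundedResolvent hP hz).2 u

lemma norm_unboundedResolvent_le (hP : IsSelfAdjoint P) {z : ℂ} (hz : z.im ≠ 0) :
    ‖unboundedResolvent P z‖ ≤ |z.im|⁻¹ := by
  have hz' : 0 < |z.im| := abs_pos.mpr hz
  refine ContinuousLinearMap.opNorm_le_bound _ (by positivity) fun f => ?_
  have h1 := hP.norm_le_apply_sub_smul z ⟨_, unboundedResolvent_mem hP hz f⟩
  rw [apply_unboundedResolvent hP hz, add_sub_cancel_left] at h1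
  rw [inv_mul_eq_div, le_div_iff₀ hz']
  simp only at h1
  linarith

lemma inner_unboundedResolvent_left (hP : IsSelfAdjoint P) {z : ℂ} (hz : z.im ≠ 0) (f g : L2 n) :
    inner ℂ (unboundedResolvent P z f) g = inner ℂ f (unboundedResolvent P (conj z) g) := by
  have hz' : (conj z).im ≠ 0 := by simpa using hz
  have h := hP.inner_apply_left ⟨_, unboundedResolvent_mem hP hz f⟩
    ⟨_, unboundedResolvent_mem hP hz' g⟩
  rw [apply_unboundedResolvent hP hz, apply_unboundedResolvent hP hz', inner_add_left,
    inner_add_right, inner_smul_left, inner_smul_right] at h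
  exact (add_left_cancel h).symm

lemma adjoint_unboundedResolvent (hP : IsSelfAdjoint P) {z : ℂ} (hz : z.im ≠ 0) :
    ContinuousLinearMap.adjoint (unboundedResolvent P z) = unboundedResolvent P (conj z) := by
  symm
  rw [ContinuousLinearMap.eq_adjoint_iff]
  intro f g
  have hz' : (conj z).im ≠ 0 := by simpa using hz
  rw [inner_unboundedResolvent_left hP hz', Complex.conj_conj]

/-- With w = -i this carries regularity known for (P + i)⁻¹ over to (P - z)⁻¹, at the cost of a
factor on the right. -/
lemma unboundedResolvent_eq (hP : IsSelfAdjoint P) {z w : ℂ} (hz : z.im ≠ 0) (hw : w.im ≠ 0) :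
    unboundedResolvent P z =
      unboundedResolvent P w * (1 + (z - w) • unboundedResolvent P z) := by
  ext1 f
  have h := unboundedResolvent_apply_sub hP hw ⟨_, unboundedResolvent_mem hP hz f⟩
  rw [apply_unboundedResolvent hP hz] at h
  simp only at h
  rw [mul_apply_eq_comp, add_apply, one_apply_eq_self, smul_apply]
  nth_rewrite 1 [← h]
  congr 1
  rw [sub_smul]
  abel

lemma unboundedResolvent_sub (hP : IsSelfAdjoint P) {z w : ℂ} (hz : z.im ≠ 0) (hw : w.im ≠ 0) :
    unboundedResolvent P z - unboundedResolvent P w =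
      (z - w) • (unboundedResolvent P w * unboundedResolvent P z) := by
  nth_rewrite 1 [unboundedResolvent_eq hP hz hw]
  rw [mul_add, mul_one, add_sub_cancel_left, mul_smul_comm]

lemma continuousAt_unboundedResolvent (hP : IsSelfAdjoint P) {z : ℂ} (hz : z.im ≠ 0) :
    ContinuousAt (unboundedResolvent P) z := by
  have hz' : 0 < |z.im| := abs_pos.mpr hz
  have hev : ∀ᶠ w in 𝓝 z, |z.im| / 2 < |w.im| := by
    have : Tendsto (fun w : ℂ => |w.im|) (𝓝 z) (𝓝 |z.im|) :=
      (Complex.continuous_im.abs).tendsto z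
    exact this.eventually (lt_mem_nhds (by linarith))
  rw [ContinuousAt, tendsto_iff_norm_sub_tendsto_zero]
  have hlim : Tendsto (fun w : ℂ => ‖w - z‖ * (|z.im|⁻¹ * (|z.im| / 2)⁻¹)) (𝓝 z) (𝓝 0) := by
    have : Tendsto (fun w : ℂ => ‖w - z‖) (𝓝 z) (𝓝 0) :=
      tendsto_iff_norm_sub_tendsto_zero.mp tendsto_id
    simpa using this.mul_const _
  refine squeeze_zero' (Eventually.of_forall fun _ => norm_nonneg _) ?_ hlim
  filter_upwards [hev] with w hw
  have hw0 : w.im ≠ 0 := by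
    intro h
    rw [h, abs_zero] at hw
    linarith
  rw [unboundedResolvent_sub hP hw0 hz, norm_smul]
  gcongr
  refine (norm_mul_le _ _).trans ?_
  gcongr
  · exact norm_unboundedResolvent_le hP hz
  · refine (norm_unboundedResolvent_le hP hw0).trans ?_
    gcongr

lemma hasDerivAt_unboundedResolvent (hP : IsSelfAdjoint P) {z : ℂ} (hz : z.im ≠ 0) :
    HasDerivAt (unboundedResolvent P) (unboundedResolvent P z ^ 2) z := by
  rw [hasDerivAt_iff_tendsto_slope]
  have h1 : Tendsto (fun w => unboundedResolvent P z * unboundedResolvent P w) (𝓝[≠] z)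
      (𝓝 (unboundedResolvent P z ^ 2)) := by
    rw [pow_two]
    exact ((continuousAt_unboundedResolvent hP hz).tendsto.const_mul _).mono_left
      nhdsWithin_le_nhds
  refine h1.congr' ?_
  have hev : ∀ᶠ w in 𝓝[≠] z, w.im ≠ 0 :=
    nhdsWithin_le_nhds ((Complex.continuous_im.continuousAt).eventually_ne hz)
  filter_upwards [hev, self_mem_nhdsWithin] with w hw hne
  rw [slope_def_module, unboundedResolvent_sub hP hw hz, smul_smul, inv_mul_cancel₀, one_smul]
  exact sub_ne_zero.mpr hne

/-- Differentiation in z raises the power by one, which turns Hölder regularity in z into bounds for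
powers. -/
lemma hasDerivAt_unboundedResolvent_pow (hP : IsSelfAdjoint P) {z : ℂ} (hz : z.im ≠ 0) (k : ℕ) :
    HasDerivAt (fun w => unboundedResolvent P w ^ k) ((k : ℂ) • unboundedResolvent P z ^ (k + 1))
      z := by
  induction k with
  | zero => simpa using hasDerivAt_const z (1 : L2 n →L[ℂ] L2 n)
  | succ k ih =>
    have h := ih.mul (hasDerivAt_unboundedResolvent hP hz)
    refine (h.congr_deriv ?_).congr_of_eventuallyEq ?_
    · rw [smul_mul_assoc, ← pow_succ, ← pow_add, show k + 2 = k + 1 + 1 by ring]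
      push_cast
      rw [add_smul, one_smul]
    · exact Eventually.of_forall fun w => pow_succ _ _

end Resolvent

/-! ### Multiplication operators by bounded real functions. -/

section Multiplication

variable {n : ℕ}

/-- A real function defining a bounded multiplication operator on `L²`. -/
def IsMultiplier (f : Space n → ℝ) : Prop :=
  AEStronglyMeasurable f volume ∧ ∃ C : ℝ, ∀ᵐ x, |f x| ≤ C

lemma IsMultiplier.memLp {f : Space n → ℝ} (hf : IsMultiplier f) :
    MemLp (fun x => (f x : ℂ)) ∞ volume := by
  obtain ⟨hm, C, hC⟩ := hf
  refine memLp_top_of_bound (Complex.continuous_ofReal.comp_aestronglyMeasurable hm) C ?_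
  filter_upwards [hC] with x hx
  simpa using hx

lemma IsMultiplier.of_continuous {f : Space n → ℝ} (hf : Continuous f) {C : ℝ}
    (hC : ∀ x, |f x| ≤ C) : IsMultiplier f :=
  ⟨hf.aestronglyMeasurable, C, Eventually.of_forall hC⟩

lemma IsMultiplier.mul {f g : Space n → ℝ} (hf : IsMultiplier f) (hg : IsMultiplier g) :
    IsMultiplier (fun x => f x * g x) := by
  obtain ⟨hm, C, hC⟩ := hf
  obtain ⟨hm', C', hC'⟩ := hg
  refine ⟨hm.mul hm', C * C', ?_⟩
  filter_upwards [hC, hC'] with x h1 h2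
  rw [abs_mul]
  exact mul_le_mul h1 h2 (abs_nonneg _) ((abs_nonneg _).trans h1)

lemma IsMultiplier.add {f g : Space n → ℝ} (hf : IsMultiplier f) (hg : IsMultiplier g) :
    IsMultiplier (fun x => f x + g x) := by
  obtain ⟨hm, C, hC⟩ := hf
  obtain ⟨hm', C', hC'⟩ := hg
  refine ⟨hm.add hm', C + C', ?_⟩
  filter_upwards [hC, hC'] with x h1 h2
  exact (abs_add_le _ _).trans (add_le_add h1 h2)

lemma IsMultiplier.const (c : ℝ) : IsMultiplier (fun _ : Space n => c) :=
  .of_continuous continuous_const (fun _ => le_rfl)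

lemma IsMultiplier.const_mul {f : Space n → ℝ} (c : ℝ) (hf : IsMultiplier f) :
    IsMultiplier (fun x => c * f x) := (IsMultiplier.const c).mul hf

lemma IsMultiplier.sum {ι : Type*} (s : Finset ι) {f : ι → Space n → ℝ}
    (hf : ∀ i ∈ s, IsMultiplier (f i)) : IsMultiplier (fun x => ∑ i ∈ s, f i x) := by
  classical
  induction s using Finset.induction_on with
  | empty => simpa using IsMultiplier.const 0
  | insert i s hi ih =>
    simp only [Finset.sum_insert hi]
    exact (hf i (by simp)).add (ih fun j hj => hf j (by simp [hj]))

open Classical in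
/-- Multiplication by a bounded real function, as a bounded operator on `L²`. -/
def mulOp (f : Space n → ℝ) : L2 n →L[ℂ] L2 n :=
  -- The value 0 for other functions is a default, so the rules of calculation carry `IsMultiplier`
  -- hypotheses.
  if hf : IsMultiplier f then
    (ContinuousLinearMap.lsmul ℂ ℂ).holderL volume ∞ 2 2 (hf.memLp.toLp _) else 0

lemma coeFn_mulOp {f : Space n → ℝ} (hf : IsMultiplier f) (u : L2 n) :
    mulOp f u =ᵐ[volume] fun x => (f x : ℂ) * u x := by
  rw [mulOp, dif_pos hf, ContinuousLinearMap.holderL_apply_apply]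
  have h1 := ContinuousLinearMap.coeFn_holder (r := 2) (ContinuousLinearMap.lsmul ℂ ℂ)
    (hf.memLp.toLp _) u
  have h2 := hf.memLp.coeFn_toLp
  filter_upwards [h1, h2] with x h1 h2
  rw [h1, h2]
  simp

lemma mulOp_ext {f : Space n → ℝ} (hf : IsMultiplier f) {u v : L2 n}
    (h : ∀ᵐ x, (f x : ℂ) * u x = v x) : mulOp f u = v := by
  apply Lp.ext
  filter_upwards [coeFn_mulOp hf u, h] with x h1 h2
  rw [h1, h2]

lemma mulOp_mulOp {f g : Space n → ℝ} (hf : IsMultiplier f) (hg : IsMultiplier g) (u : L2 n) :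
    mulOp f (mulOp g u) = mulOp (fun x => f x * g x) u := by
  apply mulOp_ext hf
  filter_upwards [coeFn_mulOp hg u, coeFn_mulOp (hf.mul hg) u] with x h1 h2
  rw [h1, h2]
  push_cast
  ring

lemma mulOp_add {f g : Space n → ℝ} (hf : IsMultiplier f) (hg : IsMultiplier g) (u : L2 n) :
    mulOp (fun x => f x + g x) u = mulOp f u + mulOp g u := by
  apply mulOp_ext (hf.add hg)
  filter_upwards [coeFn_mulOp hf u, coeFn_mulOp hg u, Lp.coeFn_add (mulOp f u) (mulOp g u)]
    with x h1 h2 h3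
  rw [h3, Pi.add_apply, h1, h2]
  push_cast
  ring

lemma mulOp_const (c : ℝ) (u : L2 n) : mulOp (fun _ => c) u = (c : ℂ) • u := by
  apply mulOp_ext (IsMultiplier.const c)
  filter_upwards [Lp.coeFn_smul (c : ℂ) u] with x h1
  rw [h1]
  simp

lemma mulOp_const_mul {f : Space n → ℝ} (c : ℝ) (hf : IsMultiplier f) (u : L2 n) :
    mulOp (fun x => c * f x) u = (c : ℂ) • mulOp f u := by
  rw [← mulOp_const, mulOp_mulOp (IsMultiplier.const c) hf]

lemma mulOp_sum {ι : Type*} (s : Finset ι) {f : ι → Space n → ℝ}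
    (hf : ∀ i ∈ s, IsMultiplier (f i)) (u : L2 n) :
    mulOp (fun x => ∑ i ∈ s, f i x) u = ∑ i ∈ s, mulOp (f i) u := by
  classical
  induction s using Finset.induction_on with
  | empty => simpa using mulOp_const 0 u
  | insert i s hi ih =>
    simp only [Finset.sum_insert hi]
    rw [mulOp_add (hf i (by simp)) (IsMultiplier.sum s fun j hj => hf j (by simp [hj])),
      ih fun j hj => hf j (by simp [hj])]

lemma norm_mulOp_le_mul {f g : Space n → ℝ} (hf : IsMultiplier f) (hg : IsMultiplier g) {C : ℝ}
    (h : ∀ᵐ x, |f x| ≤ C * |g x|) (u : L2 n) : ‖mulOp f u‖ ≤ C * ‖mulOp g u‖ := by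
  apply Lp.norm_le_mul_norm_of_ae_le_mul
  filter_upwards [coeFn_mulOp hf u, coeFn_mulOp hg u, h] with x h1 h2 h3
  rw [h1, h2, norm_mul, norm_mul, Complex.norm_real, Complex.norm_real, ← mul_assoc]
  exact mul_le_mul_of_nonneg_right h3 (norm_nonneg _)

lemma norm_mulOp_le {f : Space n → ℝ} (hf : IsMultiplier f) {C : ℝ}
    (h : ∀ᵐ x, |f x| ≤ C) (u : L2 n) : ‖mulOp f u‖ ≤ C * ‖u‖ := by
  have := norm_mulOp_le_mul hf (IsMultiplier.const 1) (C := C) (by simpa using h) u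
  rwa [mulOp_const, Complex.ofReal_one, one_smul] at this

lemma inner_eq_integral (u v : L2 n) :
    inner ℂ u v = ∫ x, (starRingEnd ℂ) (u x) * v x := by
  rw [L2.inner_def]
  refine integral_congr_ae (Eventually.of_forall fun x => ?_)
  simp [mul_comm]

lemma norm_sq_eq_integral (u : L2 n) : ‖u‖ ^ 2 = ∫ x, ‖u x‖ ^ 2 := by
  have h : ((‖u‖ ^ 2 : ℝ) : ℂ) = inner ℂ u u := by
    rw [inner_self_eq_norm_sq_to_K]; push_cast; rfl
  have h2 : inner ℂ u u = ((∫ x, ‖u x‖ ^ 2 : ℝ) : ℂ) := by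
    rw [inner_eq_integral, ← integral_complex_ofReal]
    refine integral_congr_ae (Eventually.of_forall fun x => ?_)
    simp only
    rw [mul_comm, Complex.mul_conj, Complex.normSq_eq_norm_sq]
  exact_mod_cast h.trans h2

lemma inner_mulOp_left {f : Space n → ℝ} (hf : IsMultiplier f) (u v : L2 n) :
    inner ℂ (mulOp f u) v = inner ℂ u (mulOp f v) := by
  rw [inner_eq_integral, inner_eq_integral]
  refine integral_congr_ae ?_
  filter_upwards [coeFn_mulOp hf u, coeFn_mulOp hf v] with x h1 h2
  rw [h1, h2, map_mul, Complex.conj_ofReal]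
  ring

lemma adjoint_mulOp {f : Space n → ℝ} (hf : IsMultiplier f) :
    ContinuousLinearMap.adjoint (mulOp f) = mulOp f := by
  symm
  rw [ContinuousLinearMap.eq_adjoint_iff]
  exact inner_mulOp_left hf

/-- Dominated convergence for multiplication operators. -/
lemma tendsto_mulOp {ι : Type*} {l : Filter ι} [l.IsCountablyGenerated] {f : ι → Space n → ℝ}
    {g : Space n → ℝ} (hf : ∀ᶠ i in l, IsMultiplier (f i)) (hg : IsMultiplier g) {C : ℝ}
    (hC : ∀ᶠ i in l, ∀ᵐ x, |f i x| ≤ C) (hlim : ∀ᵐ x, Tendsto (fun i => f i x) l (𝓝 (g x)))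
    (u : L2 n) : Tendsto (fun i => mulOp (f i) u) l (𝓝 (mulOp g u)) := by
  obtain ⟨hgm, C', hC'⟩ := hg
  have hg : IsMultiplier g := ⟨hgm, C', hC'⟩
  have h1 : Tendsto (fun i => ∫ x, (f i x - g x) ^ 2 * ‖u x‖ ^ 2) l (𝓝 0) := by
    have h0 : (0 : ℝ) = ∫ _ : Space n, (0 : ℝ) := by simp
    rw [h0]
    refine tendsto_integral_filter_of_dominated_convergence
      (fun x => (|C| + |C'|) ^ 2 * ‖u x‖ ^ 2) ?_ ?_ ?_ ?_
    · filter_upwards [hf] with i hfi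
      exact ((hfi.1.sub hgm).pow 2).mul ((Lp.aestronglyMeasurable u).norm.pow 2)
    · filter_upwards [hC] with i hCi
      filter_upwards [hCi, hC'] with x h1 h2
      rw [Real.norm_of_nonneg (by positivity)]
      refine mul_le_mul_of_nonneg_right ?_ (sq_nonneg _)
      rw [← sq_abs (f i x - g x)]
      refine pow_le_pow_left₀ (abs_nonneg _) ((abs_sub _ _).trans ?_) 2
      exact add_le_add (h1.trans (le_abs_self _)) (h2.trans (le_abs_self _))
    · exact ((Lp.memLp u).integrable_norm_pow (by norm_num)).const_mul _
    · filter_upwards [hlim] with x hx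
      have : Tendsto (fun i => (f i x - g x) ^ 2 * ‖u x‖ ^ 2) l
          (𝓝 ((g x - g x) ^ 2 * ‖u x‖ ^ 2)) := ((hx.sub_const _).pow 2).mul_const _
      simpa using this
  rw [tendsto_iff_norm_sub_tendsto_zero]
  have h2 : Tendsto (fun i => ‖mulOp (f i) u - mulOp g u‖ ^ 2) l (𝓝 0) := by
    refine h1.congr' ?_
    filter_upwards [hf] with i hfi
    rw [norm_sq_eq_integral]
    refine integral_congr_ae ?_
    filter_upwards [coeFn_mulOp hfi u, coeFn_mulOp hg u,
      Lp.coeFn_sub (mulOp (f i) u) (mulOp g u)] with x h3 h4 h5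
    rw [h5, Pi.sub_apply, h3, h4, ← sub_mul, norm_mul, mul_pow, ← Complex.ofReal_sub,
      Complex.norm_real, Real.norm_eq_abs, sq_abs]
  have h3 := (Real.continuous_sqrt.tendsto 0).comp h2
  rw [Real.sqrt_zero] at h3
  refine h3.congr fun i => ?_
  simp [Real.sqrt_sq]

end Multiplication

/-! ### Powers of the Japanese bracket and weighted norms. -/

section Weight

variable {n : ℕ}

lemma one_le_one_add_norm_sq (x : Space n) : (1 : ℝ) ≤ 1 + ‖x‖ ^ 2 := by
  nlinarith [sq_nonneg ‖x‖]

lemma bracket_pos (r : ℝ) (x : Space n) : 0 < bracket r x := by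
  have := one_le_one_add_norm_sq x
  unfold bracket; positivity

lemma contDiff_bracket (r : ℝ) {m : WithTop ℕ∞} : ContDiff ℝ m (bracket (n := n) r) := by
  unfold bracket
  refine ContDiff.rpow_const_of_ne (contDiff_const.add (contDiff_norm_sq ℝ)) fun x => ?_
  have := one_le_one_add_norm_sq x
  positivity

lemma continuous_bracket (r : ℝ) : Continuous (bracket (n := n) r) :=
  (contDiff_bracket r (m := 0)).continuous

lemma bracket_add (r s : ℝ) (x : Space n) : bracket (r + s) x = bracket r x * bracket s x := by
  have := one_le_one_add_norm_sq x
  unfold bracket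
  rw [add_div, Real.rpow_add (by linarith)]

lemma bracket_rpow (r s : ℝ) (x : Space n) : bracket r x ^ s = bracket (r * s) x := by
  have := one_le_one_add_norm_sq x
  unfold bracket
  rw [← Real.rpow_mul (by linarith)]
  congr 1
  ring

@[simp]
lemma bracket_zero (x : Space n) : bracket 0 x = 1 := by simp [bracket]

lemma bracket_le_bracket {r s : ℝ} (h : r ≤ s) (x : Space n) : bracket r x ≤ bracket s x := by
  unfold bracket
  exact Real.rpow_le_rpow_of_exponent_le (one_le_one_add_norm_sq x) (by linarith)

lemma bracket_le_one {r : ℝ} (h : r ≤ 0) (x : Space n) : bracket r x ≤ 1 := by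
  simpa using bracket_le_bracket h x

lemma one_le_bracket {r : ℝ} (h : 0 ≤ r) (x : Space n) : 1 ≤ bracket r x := by
  simpa using bracket_le_bracket h x

lemma norm_le_bracket (x : Space n) : ‖x‖ ≤ bracket 1 x := by
  unfold bracket
  rw [← Real.sqrt_eq_rpow]
  exact Real.le_sqrt_of_sq_le (by linarith)

lemma abs_apply_le_bracket (x : Space n) (j : Fin n) : |x j| ≤ bracket 1 x :=
  (PiLp.norm_apply_le x j).trans (norm_le_bracket x)

lemma isMultiplier_bracket {r : ℝ} (h : r ≤ 0) : IsMultiplier (bracket (n := n) r) :=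
  .of_continuous (continuous_bracket r) (C := 1) fun x => by
    rw [abs_of_pos (bracket_pos r x)]; exact bracket_le_one h x

/-- Multiplication by `⟨x⟩ ^ (-a)`. -/
def wt (n : ℕ) (a : ℝ) : L2 n →L[ℂ] L2 n := mulOp (bracket (-a))

lemma isMultiplier_wt {a : ℝ} (h : 0 ≤ a) : IsMultiplier (bracket (n := n) (-a)) :=
  isMultiplier_bracket (by linarith)

/-- Exponents are shifted and interpolated in the sequel, so real exponents are more convenient than
nonnegative ones. -/
lemma weight_eq_wt (s : ℝ≥0) : weight (n := n) s = wt n s := by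
  rw [weight, wt, mulOp, dif_pos (isMultiplier_wt s.coe_nonneg)]

@[simp]
lemma wt_zero : wt n 0 = 1 := by
  ext1 u
  have : bracket (n := n) (-0) = fun _ => 1 := by ext1; simp
  rw [wt, this, mulOp_const]
  simp

lemma wt_add {a b : ℝ} (ha : 0 ≤ a) (hb : 0 ≤ b) : wt n (a + b) = wt n a * wt n b := by
  ext1 u
  rw [mul_apply_eq_comp, wt, wt, wt, mulOp_mulOp (isMultiplier_wt ha) (isMultiplier_wt hb)]
  congr 2
  ext1 x
  rw [← bracket_add]; ring_nf

lemma norm_wt_apply_le {a : ℝ} (ha : 0 ≤ a) (u : L2 n) : ‖wt n a u‖ ≤ ‖u‖ := by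
  have := norm_mulOp_le (isMultiplier_wt (n := n) ha) (C := 1) (Eventually.of_forall fun x => by
    rw [abs_of_pos (bracket_pos _ x)]; exact bracket_le_one (by linarith) x) u
  simpa [wt] using this

lemma norm_wt_le {a : ℝ} (ha : 0 ≤ a) : ‖wt n a‖ ≤ 1 :=
  ContinuousLinearMap.opNorm_le_bound _ zero_le_one fun u => by
    simpa using norm_wt_apply_le ha u

lemma norm_wt_apply_le_of_le {a b : ℝ} (ha : 0 ≤ a) (hab : a ≤ b) (u : L2 n) :
    ‖wt n b u‖ ≤ ‖wt n a u‖ := by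
  have := norm_mulOp_le_mul (isMultiplier_wt (n := n) (ha.trans hab)) (isMultiplier_wt ha) (C := 1)
    (Eventually.of_forall fun x => by
      rw [abs_of_pos (bracket_pos _ x), abs_of_pos (bracket_pos _ x), one_mul]
      exact bracket_le_bracket (by linarith) x) u
  simpa [wt] using this

lemma adjoint_wt {a : ℝ} (ha : 0 ≤ a) : ContinuousLinearMap.adjoint (wt n a) = wt n a :=
  adjoint_mulOp (isMultiplier_wt ha)

lemma inner_wt_left {a : ℝ} (ha : 0 ≤ a) (u v : L2 n) :
    inner ℂ (wt n a u) v = inner ℂ u (wt n a v) := inner_mulOp_left (isMultiplier_wt ha) u v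

/-- Hölder's inequality for weighted norms. -/
lemma norm_wt_mul_le {a θ : ℝ} (ha : 0 ≤ a) (hθ : 0 < θ) (hθ1 : θ < 1) (u : L2 n) :
    ‖wt n (θ * a) u‖ ≤ ‖wt n a u‖ ^ θ * ‖u‖ ^ (1 - θ) := by
  -- The integrand of the squared norm is (⟨x⟩⁻²ᵃ|u|²)^θ (|u|²)^(1-θ), to which Hölder's inequality
  -- applies with exponents 1/θ and 1/(1-θ).
  have key : ‖wt n (θ * a) u‖ ^ 2 ≤ (‖wt n a u‖ ^ 2) ^ θ * (‖u‖ ^ 2) ^ (1 - θ) := by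
    have hθa : 0 ≤ θ * a := by positivity
    have e1 : ‖wt n (θ * a) u‖ ^ 2 =
        ∫ x, ((bracket (-a) x ^ 2 * ‖u x‖ ^ 2) ^ θ) * ((‖u x‖ ^ 2) ^ (1 - θ)) := by
      rw [norm_sq_eq_integral]
      refine integral_congr_ae ?_
      filter_upwards [coeFn_mulOp (isMultiplier_wt (n := n) hθa) u] with x h1
      rw [wt, h1, norm_mul, mul_pow, Complex.norm_real, Real.norm_of_nonneg (bracket_pos _ _).le,
        Real.mul_rpow (by positivity) (by positivity), mul_assoc, ← Real.rpow_add_of_nonneg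
        (by positivity) hθ.le (by linarith), add_sub_cancel, Real.rpow_one]
      congr 1
      rw [← Real.rpow_natCast, ← Real.rpow_natCast, bracket_rpow, bracket_rpow, bracket_rpow]
      congr 1
      ring
    have e2 : ‖wt n a u‖ ^ 2 = ∫ x, bracket (-a) x ^ 2 * ‖u x‖ ^ 2 := by
      rw [norm_sq_eq_integral]
      refine integral_congr_ae ?_
      filter_upwards [coeFn_mulOp (isMultiplier_wt (n := n) ha) u] with x h1
      rw [wt, h1, norm_mul, mul_pow, Complex.norm_real, Real.norm_of_nonneg (bracket_pos _ _).le]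
    have i2 : Integrable (fun x => ‖u x‖ ^ 2) := (Lp.memLp u).integrable_norm_pow (by norm_num)
    have i1 : Integrable (fun x => bracket (-a) x ^ 2 * ‖u x‖ ^ 2) := by
      refine i2.mono' ?_ ?_
      · exact ((continuous_bracket _).pow 2).aestronglyMeasurable.mul
          ((Lp.aestronglyMeasurable u).norm.pow 2)
      · refine Eventually.of_forall fun x => ?_
        rw [Real.norm_of_nonneg (by positivity)]
        have := bracket_le_one (n := n) (r := -a) (by linarith) x
        have h0 := bracket_pos (-a) x
        have : bracket (-a) x ^ 2 ≤ 1 := by nlinarith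
        nlinarith [sq_nonneg ‖u x‖]
    rw [e1, e2, norm_sq_eq_integral u]
    have hp : (1 / θ).HolderConjugate (1 / (1 - θ)) := by
      rw [Real.holderConjugate_iff]
      constructor
      · rw [lt_div_iff₀ hθ]; linarith
      · simp
    have hθ2 : 0 < 1 - θ := by linarith
    have l : ∀ (f : Space n → ℝ) (τ : ℝ), 0 < τ → (∀ x, 0 ≤ f x) → Integrable f →
        MemLp (fun x => f x ^ τ) (ENNReal.ofReal (1 / τ)) volume := by
      intro f τ hτ hf hi
      have := (memLp_one_iff_integrable.2 hi).norm_rpow_div (ENNReal.ofReal τ)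
      rw [ENNReal.toReal_ofReal hτ.le] at this
      rw [ENNReal.ofReal_div_of_pos hτ, ENNReal.ofReal_one]
      simpa only [Real.norm_of_nonneg (hf _)] using this
    have l1 := l _ θ hθ (fun x => by positivity) i1
    have l2 := l _ (1 - θ) hθ2 (fun x => by positivity) i2
    have := integral_mul_le_Lp_mul_Lq_of_nonneg hp (Eventually.of_forall fun x => by positivity)
      (Eventually.of_forall fun x => by positivity) l1 l2
    refine this.trans (le_of_eq ?_)
    rw [one_div_one_div, one_div_one_div]
    congr 2
    · refine integral_congr_ae (Eventually.of_forall fun x => ?_)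
      simp only
      rw [← Real.rpow_mul (by positivity), mul_one_div_cancel hθ.ne', Real.rpow_one]
    · refine integral_congr_ae (Eventually.of_forall fun x => ?_)
      simp only
      rw [← Real.rpow_mul (by positivity), mul_one_div_cancel hθ2.ne', Real.rpow_one]
  have h2 : (‖wt n a u‖ ^ 2) ^ θ * (‖u‖ ^ 2) ^ (1 - θ) =
      (‖wt n a u‖ ^ θ * ‖u‖ ^ (1 - θ)) ^ 2 := by
    rw [mul_pow, ← Real.rpow_natCast, ← Real.rpow_natCast, ← Real.rpow_natCast,
      ← Real.rpow_natCast, ← Real.rpow_mul (norm_nonneg _), ← Real.rpow_mul (norm_nonneg _),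
      ← Real.rpow_mul (norm_nonneg _), ← Real.rpow_mul (norm_nonneg _)]
    ring_nf
  rw [h2] at key
  exact (pow_le_pow_iff_left₀ (norm_nonneg _) (by positivity) two_ne_zero).mp key

end Weight

/-! ### Weak derivatives as generators of translations. -/

section WeakDerivative

open scoped ComplexConjugate InnerProductSpace

variable {n : ℕ}

/-- A curve in a Hilbert space which is weakly differentiable against a dense set of vectors, with
derivative continuous at `0`, is differentiable at `0`. -/
lemma hasDerivAt_of_dense_inner {H : Type*} [NormedAddCommGroup H] [InnerProductSpace ℂ H]
    [NormedSpace ℝ H] [IsScalarTower ℝ ℂ H] {u V : ℝ → H} {S : Set H} (hS : Dense S)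
    (hder : ∀ ψ ∈ S, ∀ s, HasDerivAt (fun s => inner ℂ ψ (u s)) (inner ℂ ψ (V s)) s)
    (hV : ContinuousAt V 0) : HasDerivAt u (V 0) 0 := by
  rw [hasDerivAt_iff_isLittleO, Asymptotics.isLittleO_iff]
  intro ε hε
  obtain ⟨r, hr, hVr⟩ := Metric.continuousAt_iff.mp hV ε hε
  filter_upwards [Metric.ball_mem_nhds (0 : ℝ) hr] with t ht
  -- The mean value inequality is applied to the scalar functions with the linear part subtracted.
  -- The resulting bound is closed in ψ, hence passes from the dense set to all vectors.
  have key : ∀ ψ : H, ‖inner ℂ ψ (u t - u 0 - (t - 0) • V 0)‖ ≤ ε * ‖t - 0‖ * ‖ψ‖ := by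
    intro ψ
    have hcl : IsClosed {ψ : H | ‖inner ℂ ψ (u t - u 0 - (t - 0) • V 0)‖ ≤ ε * ‖t - 0‖ * ‖ψ‖} :=
      isClosed_le (by fun_prop) (by fun_prop)
    refine hcl.closure_subset_iff.mpr (fun ψ hψ => ?_) (hS ψ)
    have hd : ∀ s ∈ Metric.ball (0 : ℝ) r, HasDerivWithinAt
        (fun s : ℝ => inner ℂ ψ (u s) - (s : ℂ) * inner ℂ ψ (V 0))
        (inner ℂ ψ (V s) - inner ℂ ψ (V 0)) (Metric.ball (0 : ℝ) r) s := by
      intro s _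
      have h1 : HasDerivAt (fun s : ℝ => (s : ℂ) * inner ℂ ψ (V 0)) (1 * inner ℂ ψ (V 0)) s :=
        (Complex.ofRealCLM.hasDerivAt (x := s)).mul_const _
      rw [one_mul] at h1
      exact ((hder ψ hψ s).sub h1).hasDerivWithinAt
    have := Convex.norm_image_sub_le_of_norm_hasDerivWithin_le (C := ε * ‖ψ‖) hd
      (fun s hs => by
        rw [← inner_sub_right]
        refine (norm_inner_le_norm _ _).trans ?_
        have := hVr hs
        rw [dist_eq_norm] at this
        rw [mul_comm]
        gcongr) (convex_ball _ _) (Metric.mem_ball_self hr) ht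
    have e : inner ℂ ψ (u t - u 0 - (t - 0) • V 0) =
        (inner ℂ ψ (u t) - (t : ℂ) * inner ℂ ψ (V 0)) -
          (inner ℂ ψ (u 0) - ((0 : ℝ) : ℂ) * inner ℂ ψ (V 0)) := by
      rw [inner_sub_right, inner_sub_right, sub_zero, ← algebraMap_smul ℂ t, inner_smul_right,
        Complex.coe_algebraMap]
      simp
      ring
    rw [mem_ofPred_eq, e]
    linarith
  -- Testing against the remainder itself turns the weak bound into a norm bound.
  have h := key (u t - u 0 - (t - 0) • V 0)
  have h1 := inner_self_eq_norm_mul_norm (𝕜 := ℂ) (u t - u 0 - (t - 0) • V 0)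
  have h2 := (RCLike.re_le_norm _).trans h
  rw [h1] at h2
  rcases eq_or_lt_of_le (norm_nonneg (u t - u 0 - (t - 0) • V 0)) with h0 | h0
  · rw [← h0]; positivity
  · exact le_of_mul_le_mul_right h2 h0

/-- Differentiation under the integral sign. For parameters near s₀ all supports lie in one compact
set, so local integrability of u provides the dominating function. -/
lemma hasDerivAt_integral_of_compact {u : Space n → ℂ} (hu : LocallyIntegrable u)
    {g g' : ℝ → Space n → ℂ} (hg : Continuous (fun p : ℝ × Space n => g p.1 p.2))
    (hg' : Continuous (fun p : ℝ × Space n => g' p.1 p.2))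
    (hd : ∀ s x, HasDerivAt (fun t : ℝ => g t x) (g' s x) s) {K : Set (Space n)} (hK : IsCompact K)
    (s₀ : ℝ) (hs : ∀ s ∈ Icc (s₀ - 1) (s₀ + 1), ∀ x ∉ K, g s x = 0 ∧ g' s x = 0) :
    HasDerivAt (fun s => ∫ x, g s x * u x) (∫ x, g' s₀ x * u x) s₀ := by
  obtain ⟨M, hM⟩ := ((isCompact_Icc (a := s₀ - 1) (b := s₀ + 1)).prod hK).exists_bound_of_continuousOn
    hg'.continuousOn
  have hmem : Icc (s₀ - 1) (s₀ + 1) ∈ 𝓝 s₀ := Icc_mem_nhds (by linarith) (by linarith)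
  have hs0 : s₀ ∈ Icc (s₀ - 1) (s₀ + 1) := ⟨by linarith, by linarith⟩
  have hcont : ∀ s, Continuous (g s) := fun s => hg.comp (by fun_prop : Continuous fun x => (s, x))
  have hcont' : ∀ s, Continuous (g' s) := fun s => hg'.comp (by fun_prop : Continuous fun x => (s, x))
  have hum := hu.aestronglyMeasurable
  refine (hasDerivAt_integral_of_dominated_loc_of_deriv_le (𝕜 := ℝ) (E := ℂ) (μ := volume)
    (F := fun s x => g s x * u x) (F' := fun s x => g' s x * u x) (s := Icc (s₀ - 1) (s₀ + 1))
    (bound := K.indicator (fun x => |M| * ‖u x‖)) hmem ?_ ?_ ?_ ?_ ?_ ?_).2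
  · exact Eventually.of_forall fun s => (hcont s).aestronglyMeasurable.mul hum
  · have hcs : HasCompactSupport (g s₀) := HasCompactSupport.intro hK fun x hx => (hs s₀ hs0 x hx).1
    simpa [mul_comm] using hu.integrable_smul_left_of_hasCompactSupport (hcont s₀) hcs
  · exact (hcont' s₀).aestronglyMeasurable.mul hum
  · refine Eventually.of_forall fun x s hsm => ?_
    by_cases hx : x ∈ K
    · rw [indicator_of_mem hx, norm_mul]
      exact mul_le_mul_of_nonneg_right ((hM (s, x) ⟨hsm, hx⟩).trans (le_abs_self _)) (norm_nonneg _)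
    · rw [(hs s hsm x hx).2, zero_mul, norm_zero, indicator_of_notMem hx]
  · rw [integrable_indicator_iff hK.measurableSet]
    exact ((hu.integrableOn_isCompact hK).norm).const_mul _
  · exact Eventually.of_forall fun x s _ => (hd s x).mul_const _

/-- `v = 𝒟_{x_j} u` in the weak sense, tested against `C₀^∞`. -/
def HasD (h : ℝ) (j : Fin n) (u v : L2 n) : Prop :=
  ∀ φ : Space n → ℂ, ContDiff ℝ ∞ φ → HasCompactSupport φ →
    ∫ x, conj (φ x) * v x = ∫ x, conj (semiD h j φ x) * u x

/-- The set of (classes of) test functions. -/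
def testSet (n : ℕ) : Set (L2 n) :=
  {f | ∃ g : Space n → ℂ, f =ᵐ[volume] g ∧ HasCompactSupport g ∧ ContDiff ℝ ∞ g}

lemma dense_testSet : Dense (testSet n) := Lp.dense_hasCompactSupport_contDiff (by norm_num)

lemma inner_eq_integral_of_ae {ψ : L2 n} {φ : Space n → ℂ} (hψ : ψ =ᵐ[volume] φ) (u : L2 n) :
    inner ℂ ψ u = ∫ x, conj (φ x) * u x := by
  rw [inner_eq_integral]
  refine integral_congr_ae ?_
  filter_upwards [hψ] with x hx
  rw [hx]

lemma locallyIntegrable_L2 (u : L2 n) : LocallyIntegrable u :=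
  (Lp.memLp u).locallyIntegrable (by norm_num)

/-- Translation on `L²`. -/
def translate (b : Space n) : L2 n →ₗᵢ[ℂ] L2 n :=
  Lp.compMeasurePreservingₗᵢ ℂ (fun x => x + b) (measurePreserving_add_right volume b)

lemma coeFn_translate (b : Space n) (u : L2 n) :
    translate b u =ᵐ[volume] fun x => u (x + b) :=
  Lp.coeFn_compMeasurePreserving u (measurePreserving_add_right volume b)

@[simp]
lemma translate_zero (u : L2 n) : translate 0 u = u := by
  apply Lp.ext
  filter_upwards [coeFn_translate 0 u] with x hx
  rw [hx, add_zero]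

lemma continuous_translate_smul (b : Space n) (u : L2 n) :
    Continuous fun s : ℝ => translate (s • b) u := by
  refine Continuous.compMeasurePreservingLp (g := fun s : ℝ => ⟨fun x => x + s • b, by fun_prop⟩)
    continuous_const ?_ (fun s => measurePreserving_add_right volume (s • b)) (by norm_num)
  exact ContinuousMap.continuous_of_continuous_uncurry _ (by unfold Function.uncurry; simp; fun_prop)

/-- A weak derivative is automatically a strong limit of difference quotients, by
`hasDerivAt_of_dense_inner` and strong continuity of translations. The factor i/h inverts -ih. -/
lemma HasD.hasDerivAt_translate {h : ℝ} (hh : h ≠ 0) {j : Fin n} {u v : L2 n} (huv : HasD h j u v) :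
    HasDerivAt (fun s : ℝ => translate (s • unitVec j) u) ((Complex.I / h) • v) 0 := by
  have := hasDerivAt_of_dense_inner (u := fun s : ℝ => translate (s • unitVec j) u)
    (V := fun s : ℝ => (Complex.I / h) • translate (s • unitVec j) v) dense_testSet ?_ ?_
  · simpa using this
  · rintro ψ ⟨φ, hψ, hφc, hφ⟩ s
    have hT : ∀ (w : L2 n) (s : ℝ), inner ℂ ψ (translate (s • unitVec j) w) =
        ∫ x, conj (φ (x - s • unitVec j)) * w x := by
      intro w s
      rw [inner_eq_integral_of_ae hψ,
        ← integral_add_right_eq_self (fun x => conj (φ (x - s • unitVec j)) * w x) (s • unitVec j)]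
      refine integral_congr_ae ?_
      filter_upwards [coeFn_translate (s • unitVec j) w] with x hx
      rw [hx, add_sub_cancel_right]
    have hφd : ∀ x, DifferentiableAt ℝ φ x := fun x => (hφ.differentiable (by simp)) x
    have hφ' : Continuous (fun x => fderiv ℝ φ x (unitVec j)) :=
      (hφ.continuous_fderiv (by simp)).clm_apply continuous_const
    simp only [hT, inner_smul_right]
    have hder := hasDerivAt_integral_of_compact (locallyIntegrable_L2 u)
      (g := fun s x => conj (φ (x - s • unitVec j)))
      (g' := fun s x => -conj (fderiv ℝ φ (x - s • unitVec j) (unitVec j)))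
      (K := (fun p : ℝ × Space n => p.2 + p.1 • unitVec j) ''
        (Icc (s - 1) (s + 1) ×ˢ tsupport φ)) ?_ ?_ ?_ ?_ s ?_
    · convert hder using 1
      have hη := huv (fun x => φ (x - s • unitVec j)) (hφ.comp (contDiff_id.sub contDiff_const))
        (hφc.comp_homeomorph (Homeomorph.subRight (s • unitVec j)))
      rw [hη, ← integral_const_mul]
      refine integral_congr_ae (Eventually.of_forall fun x => ?_)
      simp only [semiD]
      rw [fderiv_comp_sub]
      simp only [map_mul, map_neg, Complex.conj_I, Complex.conj_ofReal]
      have : (h : ℂ) ≠ 0 := by exact_mod_cast hh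
      field_simp
      linear_combination (conj ((fderiv ℝ φ (x - s • unitVec j)) (unitVec j)) * u x) * Complex.I_sq
    · have := hφ.continuous
      fun_prop
    · exact (Complex.continuous_conj.comp (hφ'.comp (by fun_prop))).neg
    · intro s x
      have h1 : HasDerivAt (fun t : ℝ => x - t • unitVec j) (-unitVec j) s := by
        simpa using ((hasDerivAt_id s).smul_const (unitVec j)).const_sub x
      have h2 := (hφd (x - s • unitVec j)).hasFDerivAt.comp_hasDerivAt s h1
      have h3 := (Complex.conjCLE.toContinuousLinearMap.hasFDerivAt).comp_hasDerivAt s h2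
      simp only [ContinuousLinearEquiv.coe_coe, map_neg] at h3
      exact h3
    · exact (isCompact_Icc.prod hφc).image (by fun_prop)
    · intro t ht x hx
      have hx' : x - t • unitVec j ∉ tsupport φ := fun hm =>
        hx ⟨(t, x - t • unitVec j), ⟨ht, hm⟩, by simp⟩
      have h1 : φ (x - t • unitVec j) = 0 := image_eq_zero_of_notMem_tsupport hx'
      have h2 : fderiv ℝ φ (x - t • unitVec j) = 0 :=
        image_eq_zero_of_notMem_tsupport fun hm => hx' (tsupport_fderiv_subset ℝ hm)
      simp [h1, h2]
  · exact ((continuous_translate_smul (unitVec j) v).const_smul (Complex.I / (h : ℂ))).continuousAt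

/-- Symmetry of `𝒟_{x_j}`. -/
lemma HasD.inner_left {h : ℝ} (hh : h ≠ 0) {j : Fin n} {u v u' v' : L2 n} (hu : HasD h j u u')
    (hv : HasD h j v v') : inner ℂ u' v = inner ℂ u v' := by
  have h1 := (hu.hasDerivAt_translate hh).inner ℂ (hv.hasDerivAt_translate hh)
  -- Translations are isometric, so this pairing is constant; differentiating it at 0 is the
  -- integration by parts. No approximation by test functions is needed.
  have h2 : (fun s : ℝ => inner ℂ (translate (s • unitVec j) u) (translate (s • unitVec j) v)) =
      fun _ => inner ℂ u v := by
    ext1 s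
    exact (translate _).inner_map_map u v
  rw [h2] at h1
  have h3 := h1.unique (hasDerivAt_const 0 _)
  simp only [zero_smul, translate_zero, inner_smul_left, inner_smul_right, map_div₀,
    Complex.conj_I, Complex.conj_ofReal] at h3
  have hh' : (h : ℂ) ≠ 0 := by exact_mod_cast hh
  field_simp at h3
  have h4 : Complex.I * (inner ℂ u v' - inner ℂ u' v) = 0 := by linear_combination h3
  rcases mul_eq_zero.mp h4 with h5 | h5
  · exact absurd h5 Complex.I_ne_zero
  · exact (sub_eq_zero.mp h5).symm

end WeakDerivative

/-! ### Product rule, and comparison with classical and distributional derivatives. -/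

section ProductRule

open scoped ComplexConjugate InnerProductSpace

variable {n : ℕ}

lemma tendsto_mulOp_apply {ι : Type*} {l : Filter ι} [l.IsCountablyGenerated]
    {f : ι → Space n → ℝ} {g : Space n → ℝ} (hf : ∀ᶠ i in l, IsMultiplier (f i))
    (hg : IsMultiplier g) {C : ℝ} (hC : ∀ᶠ i in l, ∀ᵐ x, |f i x| ≤ C)
    (hlim : ∀ᵐ x, Tendsto (fun i => f i x) l (𝓝 (g x))) {u : ι → L2 n} {v : L2 n}
    (hu : Tendsto u l (𝓝 v)) : Tendsto (fun i => mulOp (f i) (u i)) l (𝓝 (mulOp g v)) := by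
  have h1 := tendsto_mulOp hf hg hC hlim v
  have h2 : Tendsto (fun i => mulOp (f i) (u i - v)) l (𝓝 0) := by
    have h3 : Tendsto (fun i => C * ‖u i - v‖) l (𝓝 0) := by
      simpa using (tendsto_iff_norm_sub_tendsto_zero.mp hu).const_mul C
    refine squeeze_zero_norm' ?_ h3
    filter_upwards [hf, hC] with i hi hCi
    exact norm_mulOp_le hi hCi _
  refine (h2.add h1).congr' ?_ |>.trans (by rw [zero_add])
  exact Eventually.of_forall fun i => by simp only [map_sub, sub_add_cancel]

/-- A `C¹` function which is bounded together with its first derivatives. -/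
structure IsC1Bounded (c : Space n → ℝ) : Prop where
  contDiff : ContDiff ℝ 1 c
  bdd : ∃ C, ∀ x, |c x| ≤ C
  fderiv_bdd : ∃ C, ∀ x, ‖fderiv ℝ c x‖ ≤ C

lemma IsC1Bounded.isMultiplier {c : Space n → ℝ} (hc : IsC1Bounded c) : IsMultiplier c :=
  .of_continuous hc.contDiff.continuous hc.bdd.choose_spec

lemma norm_unitVec (j : Fin n) : ‖(unitVec j : Space n)‖ = 1 := by
  simp [unitVec]

lemma abs_fderiv_unitVec_le (c : Space n → ℝ) (x : Space n) (j : Fin n) :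
    |fderiv ℝ c x (unitVec j)| ≤ ‖fderiv ℝ c x‖ := by
  simpa [norm_unitVec] using (fderiv ℝ c x).le_opNorm (unitVec j)

lemma IsC1Bounded.isMultiplier_fderiv {c : Space n → ℝ} (hc : IsC1Bounded c) (j : Fin n) :
    IsMultiplier (fun x => fderiv ℝ c x (unitVec j)) :=
  .of_continuous ((hc.contDiff.continuous_fderiv (by simp)).clm_apply continuous_const)
    fun x => (abs_fderiv_unitVec_le c x j).trans (hc.fderiv_bdd.choose_spec x)

lemma IsC1Bounded.mul {c d : Space n → ℝ} (hc : IsC1Bounded c) (hd : IsC1Bounded d) :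
    IsC1Bounded (fun x => c x * d x) := by
  obtain ⟨h1, ⟨C, hC⟩, C', hC'⟩ := hc
  obtain ⟨h2, ⟨D, hD⟩, D', hD'⟩ := hd
  refine ⟨h1.mul h2, ⟨C * D, fun x => ?_⟩, C * D' + D * C', fun x => ?_⟩
  · rw [abs_mul]
    exact mul_le_mul (hC x) (hD x) (abs_nonneg _) ((abs_nonneg _).trans (hC x))
  · rw [fderiv_fun_mul (h1.differentiable (by simp) x) (h2.differentiable (by simp) x)]
    refine (norm_add_le _ _).trans ?_
    rw [norm_smul, norm_smul, Real.norm_eq_abs, Real.norm_eq_abs]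
    exact add_le_add (mul_le_mul (hC x) (hD' x) (norm_nonneg _) ((abs_nonneg _).trans (hC x)))
      (mul_le_mul (hD x) (hC' x) (norm_nonneg _) ((abs_nonneg _).trans (hD x)))

lemma continuous_semiD (h : ℝ) (j : Fin n) {φ : Space n → ℂ} (hφ : ContDiff ℝ 1 φ) :
    Continuous (semiD h j φ) := by
  unfold semiD
  exact continuous_const.mul ((hφ.continuous_fderiv (by simp)).clm_apply continuous_const)

lemma hasCompactSupport_semiD (h : ℝ) (j : Fin n) {φ : Space n → ℂ} (hφ : HasCompactSupport φ) :
    HasCompactSupport (semiD h j φ) :=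
  (hφ.fderiv_apply ℝ (unitVec j)).mul_left

lemma contDiff_semiD (h : ℝ) (j : Fin n) {φ : Space n → ℂ} {m k : WithTop ℕ∞}
    (hφ : ContDiff ℝ k φ) (hm : m + 1 ≤ k) : ContDiff ℝ m (semiD h j φ) := by
  unfold semiD
  exact contDiff_const.mul ((hφ.fderiv_right hm).clm_apply contDiff_const)

/-- Classical derivatives of compactly supported functions are weak derivatives. -/
lemma hasD_of_classical {h : ℝ} {j : Fin n} {φ : Space n → ℂ} (hφ : ContDiff ℝ 1 φ)
    (hφc : HasCompactSupport φ) {u v : L2 n} (hu : u =ᵐ[volume] φ)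
    (hv : v =ᵐ[volume] semiD h j φ) : HasD h j u v := by
  intro η hη hηc
  have e1 : ∫ x, conj (η x) * v x =
      -Complex.I * h * ∫ x, conj (η x) * fderiv ℝ φ x (unitVec j) := by
    rw [← integral_const_mul]
    refine integral_congr_ae ?_
    filter_upwards [hv] with x hx
    rw [hx, semiD]; ring
  have hη1 : ContDiff ℝ 1 (fun x => conj (η x)) :=
    (Complex.conjCLE.contDiff).comp (hη.of_le (by exact_mod_cast le_top))
  have hηd : ∀ x, fderiv ℝ (fun x => conj (η x)) x (unitVec j) =
      conj (fderiv ℝ η x (unitVec j)) := by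
    intro x
    have h1 : HasFDerivAt η (fderiv ℝ η x) x := (hη.differentiable (by simp) x).hasFDerivAt
    have h2 := (Complex.conjCLE.toContinuousLinearMap.hasFDerivAt (x := η x)).comp x h1
    rw [show (fun x => conj (η x)) = Complex.conjCLE.toContinuousLinearMap ∘ η from rfl, h2.fderiv]
    simp
  have hηc' : HasCompactSupport (fun x => conj (η x)) := hηc.comp_left (map_zero _)
  have e2 : ∫ x, conj (semiD h j η x) * u x =
      Complex.I * h * ∫ x, fderiv ℝ (fun x => conj (η x)) x (unitVec j) * φ x := by
    rw [← integral_const_mul]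
    refine integral_congr_ae ?_
    filter_upwards [hu] with x hx
    rw [hx, semiD, hηd]
    simp only [map_mul, map_neg, Complex.conj_I, Complex.conj_ofReal]
    ring
  have cη' := (hη1.continuous_fderiv (by simp)).clm_apply (continuous_const (y := (unitVec j : Space n)))
  have cφ' := (hφ.continuous_fderiv (by simp)).clm_apply (continuous_const (y := (unitVec j : Space n)))
  have := integral_mul_fderiv_eq_neg_fderiv_mul_of_integrable (μ := volume)
    (f := fun x => conj (η x)) (g := φ) (v := unitVec j)
    ((cη'.mul hφ.continuous).integrable_of_hasCompactSupport hφc.mul_left)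
    ((hη1.continuous.mul cφ').integrable_of_hasCompactSupport hηc'.mul_right)
    ((hη1.continuous.mul hφ.continuous).integrable_of_hasCompactSupport hφc.mul_left)
    (fun x _ => hη1.differentiable (by simp) x) (fun x _ => hφ.differentiable (by simp) x)
  rw [e1, e2, this]
  ring

/-- The class in `L²` of a continuous function of compact support. -/
def toL2 (φ : Space n → ℂ) (hφ : Continuous φ) (hφc : HasCompactSupport φ) : L2 n :=
  (hφ.memLp_of_hasCompactSupport hφc).toLp φ

lemma coeFn_toL2 {φ : Space n → ℂ} (hφ : Continuous φ) (hφc : HasCompactSupport φ) :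
    toL2 φ hφ hφc =ᵐ[volume] φ := MemLp.coeFn_toLp _

lemma hasD_toL2 (h : ℝ) (j : Fin n) {φ : Space n → ℂ} (hφ : ContDiff ℝ 1 φ)
    (hφc : HasCompactSupport φ) : HasD h j (toL2 φ hφ.continuous hφc)
      (toL2 (semiD h j φ) (continuous_semiD h j hφ) (hasCompactSupport_semiD h j hφc)) :=
  hasD_of_classical hφ hφc (coeFn_toL2 _ _) (coeFn_toL2 _ _)

/-- Converse of `HasD.hasDerivAt_translate`: weak differentiability can be checked on difference
quotients, which is how the product rule is proved. -/
lemma hasD_of_hasDerivAt_translate {h : ℝ} (hh : h ≠ 0) {j : Fin n} {u w : L2 n}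
    (hw : HasDerivAt (fun s : ℝ => translate (s • unitVec j) u) w 0) :
    HasD h j u ((-Complex.I * h) • w) := by
  intro φ hφ hφc
  have hφ1 : ContDiff ℝ 1 φ := hφ.of_le (by exact_mod_cast le_top)
  have h1 := ((hasD_toL2 h j hφ1 hφc).hasDerivAt_translate hh).inner ℂ hw
  have h2 : (fun s : ℝ => inner ℂ (translate (s • unitVec j) (toL2 φ hφ1.continuous hφc))
      (translate (s • unitVec j) u)) = fun _ => inner ℂ (toL2 φ hφ1.continuous hφc) u := by
    ext1 s
    exact (translate _).inner_map_map _ u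
  rw [h2] at h1
  have h3 := h1.unique (hasDerivAt_const 0 _)
  rw [← inner_eq_integral_of_ae (coeFn_toL2 hφ1.continuous hφc),
    ← inner_eq_integral_of_ae (coeFn_toL2 (continuous_semiD h j hφ1)
      (hasCompactSupport_semiD h j hφc))]
  simp only [zero_smul, translate_zero, inner_smul_left, inner_smul_right, map_div₀,
    Complex.conj_I, Complex.conj_ofReal] at h3 ⊢
  have hh' : (h : ℂ) ≠ 0 := by exact_mod_cast hh
  field_simp at h3
  linear_combination (-Complex.I) * h3 -
    inner ℂ (toL2 (semiD h j φ) (continuous_semiD h j hφ1) (hasCompactSupport_semiD h j hφc)) u * Complex.I_sq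

lemma translate_mulOp {c : Space n → ℝ} (hc : IsMultiplier c)
    {b : Space n} (hc' : IsMultiplier fun x => c (x + b)) (u : L2 n) :
    translate b (mulOp c u) = mulOp (fun x => c (x + b)) (translate b u) := by
  symm
  apply mulOp_ext hc'
  have h1 := (measurePreserving_add_right volume b).quasiMeasurePreserving.ae
    (coeFn_mulOp hc u)
  filter_upwards [coeFn_translate b u, coeFn_translate b (mulOp c u), h1] with x h2 h3 h4
  rw [h2, h3, h4]

/-- The product rule for weak derivatives. -/
lemma HasD.mulOp {h : ℝ} (hh : h ≠ 0) {j : Fin n} {u v : L2 n} (huv : HasD h j u v)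
    {c : Space n → ℝ} (hc : IsC1Bounded c) :
    HasD h j (mulOp c u)
      (mulOp c v - (Complex.I * h) • mulOp (fun x => fderiv ℝ c x (unitVec j)) u) := by
  obtain ⟨C, hC⟩ := hc.bdd
  obtain ⟨C', hC'⟩ := hc.fderiv_bdd
  have hcc := hc.contDiff.continuous
  have hcm : ∀ b : Space n, IsMultiplier fun x => c (x + b) := fun b =>
    .of_continuous (by fun_prop) fun x => hC (x + b)
  have hder := huv.hasDerivAt_translate hh
  have key : HasDerivAt (fun s : ℝ => translate (s • unitVec j) (Semiclassical.mulOp c u))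
      (Semiclassical.mulOp c ((Complex.I / h) • v) +
        Semiclassical.mulOp (fun x => fderiv ℝ c x (unitVec j)) u) 0 := by
    rw [hasDerivAt_iff_tendsto_slope] at hder ⊢
    -- The difference quotient of c u is the translate of c times that of u, plus the quotient of c
    -- times u. Both converge by dominated convergence, as c and its gradient are bounded.
    have t1 : Tendsto (fun s : ℝ => Semiclassical.mulOp (fun x => c (x + s • unitVec j))
        (slope (fun s : ℝ => translate (s • unitVec j) u) 0 s)) (𝓝[≠] 0)
        (𝓝 (Semiclassical.mulOp c ((Complex.I / h) • v))) := by
      refine tendsto_mulOp_apply (C := C) (Eventually.of_forall fun s => hcm _) hc.isMultiplier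
        (Eventually.of_forall fun s => Eventually.of_forall fun x => hC _)
        (Eventually.of_forall fun x => ?_) hder
      have : Continuous fun s : ℝ => c (x + s • unitVec j) := by fun_prop
      simpa using (this.tendsto 0).mono_left nhdsWithin_le_nhds
    have hm2 : ∀ s : ℝ, IsMultiplier fun x => s⁻¹ * (c (x + s • unitVec j) + (-1) * c x) :=
      fun s => ((hcm _).add (hc.isMultiplier.const_mul _)).const_mul _
    have t2 : Tendsto (fun s : ℝ => Semiclassical.mulOp
        (fun x => s⁻¹ * (c (x + s • unitVec j) + (-1) * c x)) u) (𝓝[≠] 0)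
        (𝓝 (Semiclassical.mulOp (fun x => fderiv ℝ c x (unitVec j)) u)) := by
      refine tendsto_mulOp (C := C') (Eventually.of_forall hm2) (hc.isMultiplier_fderiv j)
        ?_ (Eventually.of_forall fun x => ?_) u
      · filter_upwards [self_mem_nhdsWithin] with s hs
        refine Eventually.of_forall fun x => ?_
        have := Convex.norm_image_sub_le_of_norm_fderiv_le (𝕜 := ℝ) (f := c) (C := C')
          (fun y _ => hc.contDiff.differentiable (by simp) y) (fun y _ => hC' y) convex_univ
          (mem_univ x) (mem_univ (x + s • unitVec j))
        rw [add_sub_cancel_left, norm_smul, norm_unitVec, mul_one, Real.norm_eq_abs] at this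
        rw [abs_mul, abs_inv, inv_mul_le_iff₀ (abs_pos.mpr hs), Real.norm_eq_abs] at *
        rw [neg_one_mul, ← sub_eq_add_neg]
        linarith
      · have h1 : HasDerivAt (fun s : ℝ => x + s • unitVec j) (unitVec j) 0 := by
          simpa using ((hasDerivAt_id (0 : ℝ)).smul_const (unitVec j : Space n)).const_add x
        have h2 : HasFDerivAt c (fderiv ℝ c x) (x + (0 : ℝ) • unitVec j) := by
          rw [zero_smul, add_zero]
          exact (hc.contDiff.differentiable (by simp) x).hasFDerivAt
        have h3 := h2.comp_hasDerivAt (0 : ℝ) h1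
        rw [hasDerivAt_iff_tendsto_slope] at h3
        refine h3.congr fun s => ?_
        simp [slope_def_field, div_eq_inv_mul]
        left; ring
    refine (t1.add t2).congr fun s => ?_
    rw [slope_def_module, slope_def_module, sub_zero, translate_mulOp hc.isMultiplier (hcm _),
      translate_mulOp hc.isMultiplier (hcm _), mulOp_const_mul s⁻¹ ((hcm _).add
        (hc.isMultiplier.const_mul _)), mulOp_add (hcm _) (hc.isMultiplier.const_mul _),
      mulOp_const_mul _ hc.isMultiplier, ← algebraMap_smul ℂ s⁻¹, ← algebraMap_smul ℂ s⁻¹, map_smul]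
    rw [map_sub]
    simp only [zero_smul, translate_zero, add_zero]
    module
  have := hasD_of_hasDerivAt_translate hh key
  convert this using 1
  rw [smul_add, map_smul, smul_smul, sub_eq_add_neg]
  have hh' : (h : ℂ) ≠ 0 := by exact_mod_cast hh
  congr 1
  · rw [show -Complex.I * h * (Complex.I / h) = 1 by field_simp; simp, one_smul]
  · rw [← neg_smul]; ring_nf

lemma hasD_of_inner {h : ℝ} {j : Fin n} {u v : L2 n} :
    HasD h j u v ↔ ∀ (φ : Space n → ℂ) (hφ : ContDiff ℝ ∞ φ) (hφc : HasCompactSupport φ),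
      inner ℂ (toL2 φ hφ.continuous hφc) v = inner ℂ (toL2 (semiD h j φ)
        (continuous_semiD h j (hφ.of_le (by exact_mod_cast le_top)))
        (hasCompactSupport_semiD h j hφc)) u := by
  refine forall_congr' fun φ => forall_congr' fun hφ => forall_congr' fun hφc => ?_
  rw [inner_eq_integral_of_ae (coeFn_toL2 _ _), inner_eq_integral_of_ae (coeFn_toL2 _ _)]

lemma HasD.unique {h : ℝ} {j : Fin n} {u v w : L2 n} (huv : HasD h j u v) (huw : HasD h j u w) :
    v = w := by
  rw [hasD_of_inner] at huv huw
  refine dense_testSet.eq_of_inner_right (𝕜 := ℂ) fun ψ hψ => ?_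
  obtain ⟨φ, hφ, hφc, hφs⟩ := hψ
  rw [show ψ = toL2 φ hφs.continuous hφc from
    Lp.ext (hφ.trans (coeFn_toL2 hφs.continuous hφc).symm), huv φ hφs hφc, huw φ hφs hφc]

/-- The conjugate of a test function is a Schwartz function, and the distribution is evaluated on
it. -/
lemma hasD_of_toTemperedDistribution {h : ℝ} {j : Fin n} {u v : L2 n}
    (huv : (v : 𝓢'(Space n, ℂ)) = (-Complex.I * (h : ℂ)) • ∂_{unitVec j} (u : 𝓢'(Space n, ℂ))) :
    HasD h j u v := by
  intro φ hφ hφc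
  have hc : HasCompactSupport (fun x => conj (φ x)) := hφc.comp_left (map_zero _)
  have hs : ContDiff ℝ ∞ (fun x => conj (φ x)) := (Complex.conjCLE.contDiff).comp hφ
  have h1 := DFunLike.congr_fun huv (hc.toSchwartzMap hs)
  have h2 : ∫ x, conj (φ x) * v x = ∫ x, conj (φ x) • v x := rfl
  rw [h2]
  rw [Lp.toTemperedDistribution_apply, smul_apply, TemperedDistribution.lineDerivOp_apply_apply,
    map_neg, Lp.toTemperedDistribution_apply, ← integral_neg, ← integral_smul] at h1
  refine h1.trans (integral_congr_ae (Eventually.of_forall fun x => ?_))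
  have h3 : (∂_{unitVec j} (hc.toSchwartzMap hs) : 𝓢(Space n, ℂ)) x =
      conj (fderiv ℝ φ x (unitVec j)) := by
    rw [SchwartzMap.lineDerivOp_apply_eq_fderiv]
    have h1 : HasFDerivAt φ (fderiv ℝ φ x) x := (hφ.differentiable (by simp) x).hasFDerivAt
    have h2 := (Complex.conjCLE.toContinuousLinearMap.hasFDerivAt (x := φ x)).comp x h1
    rw [show ((hc.toSchwartzMap hs : 𝓢(Space n, ℂ)) : Space n → ℂ) =
      Complex.conjCLE.toContinuousLinearMap ∘ φ from rfl, h2.fderiv]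
    simp
  simp only [h3, semiD, smul_eq_mul, map_mul, map_neg, Complex.conj_I, Complex.conj_ofReal]
  ring

lemma hasD_of_isSemiDeriv_one {h : ℝ} {α : Fin 1 → Fin n} {u v : L2 n}
    (huv : IsSemiDeriv h α u v) : HasD h (α 0) u v := by
  rw [IsSemiDeriv, LineDeriv.iteratedLineDerivOp_one, pow_one] at huv
  exact hasD_of_toTemperedDistribution huv

/-- The innermost direction is `α 1`: a second derivative is the `α 0` derivative of the first
derivative w. -/
lemma hasD_of_isSemiDeriv_two {h : ℝ} {α : Fin 2 → Fin n} {u w v : L2 n}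
    (huw : IsSemiDeriv h (fun _ : Fin 1 => α 1) u w) (huv : IsSemiDeriv h α u v) :
    HasD h (α 0) w v := by
  apply hasD_of_toTemperedDistribution
  rw [IsSemiDeriv, LineDeriv.iteratedLineDerivOp_one, pow_one] at huw
  rw [IsSemiDeriv, LineDeriv.iteratedLineDerivOp_succ_left, LineDeriv.iteratedLineDerivOp_one,
    pow_two] at huv
  rw [huv, huw, LineDeriv.lineDerivOp_smul, smul_smul]
  rfl

end ProductRule

/-! ### Unitary dilations and their generator. -/

section Dilation

open scoped ComplexConjugate InnerProductSpace

variable {n : ℕ}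

lemma quasiMeasurePreserving_exp_smul (t : ℝ) :
    Measure.QuasiMeasurePreserving (fun x : Space n => Real.exp t • x) volume volume := by
  refine ⟨by fun_prop, ?_⟩
  rw [Measure.map_addHaar_smul volume (Real.exp_pos t).ne']
  exact Measure.smul_absolutelyContinuous

lemma memLp_dilate (t : ℝ) (u : L2 n) :
    MemLp (fun x : Space n => ((Real.exp (n * t / 2) : ℝ) : ℂ) * u (Real.exp t • x)) 2 volume := by
  have h1 : MemLp u 2 (Measure.map (fun x : Space n => Real.exp t • x) volume) := by
    rw [Measure.map_addHaar_smul volume (Real.exp_pos t).ne']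
    exact (Lp.memLp u).smul_measure ENNReal.ofReal_ne_top
  exact (h1.comp_of_map (by fun_prop)).const_mul _

lemma integral_dilate {F : Type*} [NormedAddCommGroup F] [NormedSpace ℝ F] (t : ℝ)
    (f : Space n → F) :
    Real.exp (n * t) • ∫ x, f (Real.exp t • x) = ∫ x, f x := by
  rw [Measure.integral_comp_smul, smul_smul, finrank_euclideanSpace, Fintype.card_fin,
    abs_of_pos (by positivity), mul_comm (n : ℝ) t, Real.exp_mul, Real.rpow_natCast,
    mul_inv_cancel₀ (by positivity), one_smul]

/-- The unitary dilation `u ↦ exp (n t / 2) u (exp t • x)` on `L²`. -/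
def dilate (t : ℝ) : L2 n →ₗᵢ[ℂ] L2 n where
  toFun u := (memLp_dilate t u).toLp _
  map_add' u v := by
    rw [← MemLp.toLp_add]
    apply MemLp.toLp_congr
    filter_upwards [(quasiMeasurePreserving_exp_smul t).ae (Lp.coeFn_add u v)] with x hx
    rw [hx, Pi.add_apply, mul_add]; rfl
  map_smul' c u := by
    rw [RingHom.id_apply, ← MemLp.toLp_const_smul]
    apply MemLp.toLp_congr
    filter_upwards [(quasiMeasurePreserving_exp_smul t).ae (Lp.coeFn_smul c u)] with x hx
    rw [hx]
    simp only [Pi.smul_apply, smul_eq_mul]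
    ring
  norm_map' u := by
    rw [← pow_left_inj₀ (norm_nonneg _) (norm_nonneg _) two_ne_zero, norm_sq_eq_integral,
      norm_sq_eq_integral, ← integral_dilate t (fun x => ‖u x‖ ^ 2), ← integral_smul]
    refine integral_congr_ae ?_
    filter_upwards [(memLp_dilate t u).coeFn_toLp] with x hx
    simp only [LinearMap.coe_mk, AddHom.coe_mk]
    rw [hx, norm_mul, mul_pow, Complex.norm_real, Real.norm_of_nonneg (Real.exp_pos _).le,
      ← Real.exp_nat_mul, smul_eq_mul]
    congr 2
    push_cast
    ring

lemma coeFn_dilate (t : ℝ) (u : L2 n) :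
    dilate t u =ᵐ[volume] fun x => ((Real.exp (n * t / 2) : ℝ) : ℂ) * u (Real.exp t • x) :=
  (memLp_dilate t u).coeFn_toLp

@[simp]
lemma dilate_zero (u : L2 n) : dilate 0 u = u := by
  apply Lp.ext
  filter_upwards [coeFn_dilate 0 u] with x hx
  rw [hx]; simp

lemma inner_dilate_left (t : ℝ) (u v : L2 n) :
    inner ℂ (dilate t u) v = inner ℂ u (dilate (-t) v) := by
  rw [inner_eq_integral, inner_eq_integral, ← integral_dilate t (fun x => conj (u x) * _),
    ← integral_smul]
  refine integral_congr_ae ?_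
  filter_upwards [coeFn_dilate t u,
    (quasiMeasurePreserving_exp_smul t).ae (coeFn_dilate (-t) v)] with x h1 h2
  rw [h1, h2, smul_smul, ← Real.exp_add, neg_add_cancel, Real.exp_zero, one_smul, map_mul,
    Complex.conj_ofReal, ← Complex.coe_smul, smul_eq_mul]
  have : Real.exp (n * t / 2) = Real.exp (n * t) * Real.exp (n * -t / 2) := by
    rw [← Real.exp_add]; ring_nf
  rw [this]
  push_cast
  ring

lemma inner_dilate_right (t : ℝ) (u v : L2 n) :
    inner ℂ u (dilate t v) = inner ℂ (dilate (-t) u) v := by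
  rw [inner_dilate_left, neg_neg]

lemma mulOp_dilate {c : Space n → ℝ} (hc : IsMultiplier c) (t : ℝ)
    (hc' : IsMultiplier fun x => c (Real.exp t • x)) (u : L2 n) :
    dilate t (mulOp c u) = mulOp (fun x => c (Real.exp t • x)) (dilate t u) := by
  symm
  apply mulOp_ext hc'
  filter_upwards [coeFn_dilate t u, coeFn_dilate t (mulOp c u),
    (quasiMeasurePreserving_exp_smul t).ae (coeFn_mulOp hc u)] with x h1 h2 h3
  rw [h1, h2, h3]
  ring

/-- For a test function ψ the pairing of ψ with its dilate is a continuous parameter integral; since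
dilations preserve norms, its convergence to ‖ψ‖² forces strong convergence. Density extends this to
all of L². -/
lemma tendsto_dilate (u : L2 n) : Tendsto (fun t => dilate t u) (𝓝 0) (𝓝 u) := by
  have hdense : ∀ ψ ∈ testSet n, Tendsto (fun t => dilate t ψ) (𝓝 0) (𝓝 ψ) := by
    rintro ψ ⟨φ, hψ, hφc, hφ⟩
    have hcont := hφ.continuous
    have hlim : Tendsto (fun t => inner ℂ ψ (dilate t ψ)) (𝓝 0) (𝓝 (inner ℂ ψ ψ)) := by
      have e1 : ∀ t, inner ℂ ψ (dilate t ψ) =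
          ∫ x, conj (φ x) * (((Real.exp (n * t / 2) : ℝ) : ℂ) * φ (Real.exp t • x)) := by
        intro t
        rw [inner_eq_integral]
        refine integral_congr_ae ?_
        filter_upwards [hψ, coeFn_dilate t ψ, (quasiMeasurePreserving_exp_smul t).ae hψ]
          with x h1 h2 h3
        rw [h1, h2, h3]
      have hc : Continuous (fun t => inner ℂ ψ (dilate t ψ)) := by
        simp_rw [e1]
        have := continuous_parametric_integral_of_continuous (μ := volume) (s := tsupport φ)
          (f := fun t x => conj (φ x) * (((Real.exp (n * t / 2) : ℝ) : ℂ) * φ (Real.exp t • x)))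
          (by unfold Function.uncurry; simp only; fun_prop) hφc
        convert this using 2 with t
        rw [setIntegral_eq_integral_of_forall_compl_eq_zero]
        intro x hx
        rw [image_eq_zero_of_notMem_tsupport hx]; simp
      simpa using hc.tendsto 0
    rw [tendsto_iff_norm_sub_tendsto_zero]
    have h2 : Tendsto (fun t => ‖dilate t ψ - ψ‖ ^ 2) (𝓝 0) (𝓝 0) := by
      have e2 : ∀ t, ‖dilate t ψ - ψ‖ ^ 2 =
          2 * (inner ℂ ψ ψ).re - 2 * (inner ℂ ψ (dilate t ψ)).re := by
        intro t
        have h1 : (inner ℂ ψ ψ).re = ‖ψ‖ ^ 2 := inner_self_eq_norm_sq (𝕜 := ℂ) ψ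
        rw [norm_sub_sq (𝕜 := ℂ), LinearIsometry.norm_map, inner_re_symm (𝕜 := ℂ), h1]
        simp only [RCLike.re_to_complex]
        ring
      simp_rw [e2]
      have := ((Complex.continuous_re.tendsto _).comp hlim).const_mul 2 |>.const_sub
        (2 * (inner ℂ ψ ψ).re)
      simpa using this
    have h3 := (Real.continuous_sqrt.tendsto 0).comp h2
    rw [Real.sqrt_zero] at h3
    exact h3.congr fun i => by simp [Real.sqrt_sq]
  rw [Metric.tendsto_nhds]
  intro ε hε
  obtain ⟨ψ, hψ, hd⟩ := Metric.mem_closure_iff.mp (dense_testSet u) (ε / 3) (by positivity)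
  filter_upwards [Metric.tendsto_nhds.mp (hdense ψ hψ) (ε / 3) (by positivity)] with t ht
  have h1 : dist (dilate t u) (dilate t ψ) = dist u ψ := (dilate t).isometry.dist_eq u ψ
  calc dist (dilate t u) u ≤ dist (dilate t u) (dilate t ψ) + dist (dilate t ψ) ψ + dist ψ u :=
        dist_triangle4 _ _ _ _
    _ < ε / 3 + ε / 3 + ε / 3 := by
        rw [h1, dist_comm ψ u]
        gcongr
    _ = ε := by ring

lemma tendsto_dilate_apply {u : ℝ → L2 n} {v : L2 n} {l : Filter ℝ} (hl : l ≤ 𝓝 0)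
    (hu : Tendsto u l (𝓝 v)) : Tendsto (fun t => dilate t (u t)) l (𝓝 v) := by
  have h1 : Tendsto (fun t => dilate t (u t - v)) l (𝓝 0) := by
    rw [tendsto_zero_iff_norm_tendsto_zero]
    simp_rw [LinearIsometry.norm_map]
    exact tendsto_iff_norm_sub_tendsto_zero.mp hu
  have h2 := h1.add ((tendsto_dilate v).mono_left hl)
  rw [zero_add] at h2
  refine h2.congr fun t => ?_
  rw [map_sub, sub_add_cancel]

lemma semiD_comp_smul (h : ℝ) (j : Fin n) {φ : Space n → ℂ} (hφ : ContDiff ℝ 1 φ) (a : ℂ) (t : ℝ)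
    (x : Space n) : semiD h j (fun x => a * φ (Real.exp t • x)) x =
      Real.exp t * (a * semiD h j φ (Real.exp t • x)) := by
  have hd : HasFDerivAt (fun x : Space n => a * φ (Real.exp t • x))
      (a • ((fderiv ℝ φ (Real.exp t • x)).comp (Real.exp t • ContinuousLinearMap.id ℝ (Space n)))) x := by
    have h1 : HasFDerivAt (fun x : Space n => Real.exp t • x)
        (Real.exp t • ContinuousLinearMap.id ℝ (Space n)) x :=
      (hasFDerivAt_id x).const_smul (Real.exp t)
    exact ((hφ.differentiable (by simp) _).hasFDerivAt.comp x h1).const_mul a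
  unfold semiD
  rw [hd.fderiv]
  simp
  ring

lemma HasD.dilate {h : ℝ} {j : Fin n} {u v : L2 n} (huv : HasD h j u v) (t : ℝ) :
    HasD h j (dilate t u) (((Real.exp t : ℝ) : ℂ) • Semiclassical.dilate t v) := by
  rw [hasD_of_inner]
  intro φ hφ hφc
  have hφ1 : ContDiff ℝ 1 φ := hφ.of_le (by exact_mod_cast le_top)
  rw [inner_smul_right, inner_dilate_right, inner_dilate_right]
  have hη : ContDiff ℝ ∞ (fun x => ((Real.exp (n * -t / 2) : ℝ) : ℂ) * φ (Real.exp (-t) • x)) :=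
    contDiff_const.mul (hφ.comp (contDiff_id.const_smul (Real.exp (-t))))
  have hηc : HasCompactSupport
      (fun x => ((Real.exp (n * -t / 2) : ℝ) : ℂ) * φ (Real.exp (-t) • x)) :=
    (hφc.comp_smul (Real.exp_pos (-t)).ne').mul_left
  have h1 := huv _ hη hηc
  have e1 : inner ℂ (Semiclassical.dilate (-t) (toL2 φ hφ.continuous hφc)) v =
      ∫ x, conj (((Real.exp (n * -t / 2) : ℝ) : ℂ) * φ (Real.exp (-t) • x)) * v x := by
    apply inner_eq_integral_of_ae
    filter_upwards [coeFn_dilate (-t) (toL2 φ hφ.continuous hφc),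
      (quasiMeasurePreserving_exp_smul (-t)).ae (coeFn_toL2 hφ.continuous hφc)] with x h1 h2
    rw [h1, h2]
  rw [e1, h1, ← integral_const_mul, inner_eq_integral]
  refine integral_congr_ae ?_
  filter_upwards [coeFn_dilate (-t) (toL2 (semiD h j φ) (continuous_semiD h j hφ1)
      (hasCompactSupport_semiD h j hφc)),
      (quasiMeasurePreserving_exp_smul (-t)).ae (coeFn_toL2 (continuous_semiD h j hφ1)
      (hasCompactSupport_semiD h j hφc))] with x h1 h2
  rw [h1, h2, semiD_comp_smul h j hφ1, map_mul, Complex.conj_ofReal, ← mul_assoc, ← mul_assoc,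
    ← Complex.ofReal_mul, ← Real.exp_add, add_neg_cancel]
  simp

lemma isMultiplier_coord (k : Fin n) : IsMultiplier (fun x : Space n => x k * bracket (-1) x) :=
  .of_continuous (C := 1) ((by fun_prop : Continuous fun x : Space n => x k).mul
    (continuous_bracket _)) fun x => by
    rw [abs_mul, abs_of_pos (bracket_pos _ x)]
    have := mul_le_mul_of_nonneg_right (abs_apply_le_bracket x k) (bracket_pos (-1) x).le
    rwa [← bracket_add, add_neg_cancel, bracket_zero] at this

/-- `⟨x⟩⁻¹ A u`, where `A = x · ∇ + n / 2` and `d k = 𝒟_{x_k} u`. -/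
def dilGen (h : ℝ) (u : L2 n) (d : Fin n → L2 n) : L2 n :=
  (Complex.I / h) • ∑ k, mulOp (fun x => x k * bracket (-1) x) (d k) + ((n : ℂ) / 2) • wt n 1 u

/-- The quotient `⟨e^t x⟩⁻¹ / ⟨x⟩⁻¹`. -/
def bracketRatio (t : ℝ) (x : Space n) : ℝ := bracket (-1) (Real.exp t • x) * bracket 1 x

lemma bracketRatio_pos (t : ℝ) (x : Space n) : 0 < bracketRatio t x :=
  mul_pos (bracket_pos _ _) (bracket_pos _ _)

lemma bracketRatio_le {t : ℝ} (x : Space n) : bracketRatio t x ≤ Real.exp |t| := by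
  have h1 : bracket 1 x ≤ Real.exp |t| * bracket 1 (Real.exp t • x) := by
    have e : ∀ y : Space n, bracket 1 y = √(1 + ‖y‖ ^ 2) := fun y => by
      rw [bracket, Real.sqrt_eq_rpow]
    rw [e, e, Real.sqrt_le_left (by positivity), mul_pow, Real.sq_sqrt (by positivity), norm_smul,
      Real.norm_of_nonneg (Real.exp_pos t).le, mul_pow]
    have h2 : 1 ≤ Real.exp |t| ^ 2 := one_le_pow₀ (Real.one_le_exp (abs_nonneg _))
    have h3 : 1 ≤ Real.exp |t| ^ 2 * Real.exp t ^ 2 := by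
      rw [← mul_pow, ← Real.exp_add]
      exact one_le_pow₀ (Real.one_le_exp (by linarith [neg_abs_le t]))
    nlinarith [sq_nonneg ‖x‖]
  have h3 : bracket (-1) (Real.exp t • x) * bracket 1 (Real.exp t • x) = 1 := by
    rw [← bracket_add]; simp
  unfold bracketRatio
  have h4 := mul_le_mul_of_nonneg_left h1 (bracket_pos (-1) (Real.exp t • x)).le
  calc _ ≤ _ := h4
    _ = Real.exp |t| * (bracket (-1) (Real.exp t • x) * bracket 1 (Real.exp t • x)) := by ring
    _ = _ := by rw [h3, mul_one]

lemma isMultiplier_bracketRatio (t : ℝ) : IsMultiplier (bracketRatio (n := n) t) := by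
  have h1 : Continuous (fun x : Space n => bracketRatio t x) := by
    unfold bracketRatio
    exact ((continuous_bracket _).comp (continuous_const_smul _)).mul (continuous_bracket _)
  refine IsMultiplier.of_continuous h1 (C := Real.exp |t|) fun x => ?_
  rw [abs_of_pos (bracketRatio_pos t x)]
  exact bracketRatio_le x

lemma contDiff_dilate_family (t : ℝ) {η : Space n → ℂ} (hη : ContDiff ℝ ∞ η) :
    ContDiff ℝ ∞ (fun x => ((Real.exp (n * t / 2) : ℝ) : ℂ) * η (Real.exp t • x)) :=
  contDiff_const.mul (hη.comp (contDiff_id.const_smul (Real.exp t)))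

lemma hasDerivAt_dilate_family {η : Space n → ℂ} (hη : ContDiff ℝ ∞ η) (s : ℝ) (x : Space n) :
    HasDerivAt (fun s : ℝ => ((Real.exp (n * -s / 2) : ℝ) : ℂ) * η (Real.exp (-s) • x))
      (-(((Real.exp (n * -s / 2) : ℝ) : ℂ) * (n / 2 * η (Real.exp (-s) • x) +
        fderiv ℝ η (Real.exp (-s) • x) (Real.exp (-s) • x)))) s := by
  have h0 : HasDerivAt (fun s : ℝ => Real.exp (n * -s / 2))
      (Real.exp (n * -s / 2) * (-(n / 2))) s := by
    have : HasDerivAt (fun s : ℝ => (n : ℝ) * -s / 2) (-(n / 2 : ℝ)) s := by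
      exact (((hasDerivAt_neg s).const_mul (n : ℝ)).div_const 2).congr_deriv (by ring)
    exact this.exp
  have h1 : HasDerivAt (fun s : ℝ => Real.exp (-s) • x) ((Real.exp (-s) * -1) • x) s :=
    ((hasDerivAt_neg s).exp).smul_const x
  have h2 : HasDerivAt (fun s : ℝ => η (Real.exp (-s) • x))
      (fderiv ℝ η (Real.exp (-s) • x) ((Real.exp (-s) * -1) • x)) s :=
    ((hη.differentiable (by simp) (Real.exp (-s) • x)).hasFDerivAt).comp_hasDerivAt s h1
  refine (h0.ofReal_comp.mul h2).congr_deriv ?_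
  rw [mul_neg_one, neg_smul, map_neg]
  push_cast
  ring

lemma fderiv_self_eq_sum (η : Space n → ℂ) (x y : Space n) :
    fderiv ℝ η x y = ∑ k, y k * fderiv ℝ η x (unitVec k) := by
  have : y = ∑ k, y k • unitVec k := by
    ext i
    simp [unitVec, Pi.single_apply]
  conv_lhs => rw [this]
  rw [map_sum]
  simp

/-- A = x·∇ + n/2 is formally antisymmetric: moving x·∇ off the test function produces the
divergence n of x, which changes -n/2 into n/2. -/
lemma HasD.integral_dilation_generator {h : ℝ} (hh : h ≠ 0) {u : L2 n} {d : Fin n → L2 n}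
    (hd : ∀ k, HasD h k u (d k)) {θ : Space n → ℂ} (hθs : ContDiff ℝ ∞ θ)
    (hθc : HasCompactSupport θ) :
    ∫ x, conj (-((n : ℂ) / 2 * θ x + fderiv ℝ θ x x)) * u x =
      Complex.I / h * (∑ k, ∫ x, conj ((x k : ℂ) * θ x) * d k x) +
        (n : ℂ) / 2 * ∫ x, conj (θ x) * u x := by
  have hθ' : ∀ v : Space n, Continuous (fun x => fderiv ℝ θ x v) := fun v =>
    (hθs.continuous_fderiv (by simp)).clm_apply continuous_const
  have hθ0 := hθs.continuous
  have hint : ∀ g : Space n → ℂ, Continuous g → HasCompactSupport g →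
      Integrable (fun x => conj (g x) * u x) := by
    intro g hg hgc
    have := (locallyIntegrable_L2 u).integrable_smul_left_of_hasCompactSupport
      (Complex.continuous_conj.comp hg) (hgc.comp_left (map_zero conj))
    simpa [mul_comm] using this
  have hk' : ∀ k : Fin n, Integrable
      (fun x => conj (θ x + x k * fderiv ℝ θ x (unitVec k)) * u x) := fun k =>
    hint _ (hθ0.add ((Complex.continuous_ofReal.comp (by fun_prop)).mul (hθ' _)))
      (hθc.add (hθc.fderiv_apply ℝ (unitVec k)).mul_left)
  have e1 : ∀ k, ∫ x, conj ((x k : ℂ) * θ x) * d k x =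
      Complex.I * h * ∫ x, conj (θ x + x k * fderiv ℝ θ x (unitVec k)) * u x := by
    intro k
    have hks : ContDiff ℝ ∞ (fun x : Space n => ((x k : ℝ) : ℂ)) :=
      Complex.ofRealCLM.contDiff.comp (by fun_prop)
    rw [hd k _ (hks.mul hθs) hθc.mul_left, ← integral_const_mul]
    refine integral_congr_ae (Eventually.of_forall fun x => ?_)
    have hk : HasFDerivAt (fun x : Space n => ((x k : ℝ) : ℂ))
        (Complex.ofRealCLM.comp (EuclideanSpace.proj k : Space n →L[ℝ] ℝ)) x :=
      Complex.ofRealCLM.hasFDerivAt.comp x (EuclideanSpace.proj k : Space n →L[ℝ] ℝ).hasFDerivAt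
    have hprod : HasFDerivAt (fun x : Space n => ((x k : ℝ) : ℂ) * θ x) _ x :=
      hk.mul (hθs.differentiable (by simp) x).hasFDerivAt
    simp only [semiD]
    rw [hprod.fderiv]
    simp [unitVec]
    ring
  have e2 : ∑ k, ∫ x, conj (θ x + x k * fderiv ℝ θ x (unitVec k)) * u x =
      (n : ℂ) * (∫ x, conj (θ x) * u x) + ∫ x, conj (fderiv ℝ θ x x) * u x := by
    rw [← integral_const_mul, ← integral_add ((hint θ hθ0 hθc).const_mul _), ← integral_finsetSum]
    · refine integral_congr_ae (Eventually.of_forall fun x => ?_)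
      simp only
      rw [← Finset.sum_mul, ← map_sum, Finset.sum_add_distrib, ← fderiv_self_eq_sum]
      simp
      ring
    · exact fun k _ => hk' k
    · exact hint _ ((hθs.continuous_fderiv (by simp)).clm_apply continuous_id)
        (hθc.mono' fun x hx => by
          by_contra hm
          exact hx (by simp [image_eq_zero_of_notMem_tsupport
            fun hm' => hm (tsupport_fderiv_subset ℝ hm')]))
  have e3 : ∫ x, conj (-((n : ℂ) / 2 * θ x + fderiv ℝ θ x x)) * u x =
      -((n : ℂ) / 2 * ∫ x, conj (θ x) * u x) - ∫ x, conj (fderiv ℝ θ x x) * u x := by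
    have c2 : conj (2 : ℂ) = 2 := by simpa using Complex.conj_ofReal 2
    rw [← integral_const_mul, ← integral_neg, ← integral_sub]
    · refine integral_congr_ae (Eventually.of_forall fun x => ?_)
      simp [c2]
      ring
    · exact ((hint θ hθ0 hθc).const_mul _).neg
    · exact hint _ ((hθs.continuous_fderiv (by simp)).clm_apply continuous_id)
        (hθc.mono' fun x hx => by
          by_contra hm
          exact hx (by simp [image_eq_zero_of_notMem_tsupport
            fun hm' => hm (tsupport_fderiv_subset ℝ hm')]))
  rw [e3]
  simp_rw [e1]
  rw [← Finset.mul_sum, e2]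
  have hh' : (h : ℂ) ≠ 0 := by exact_mod_cast hh
  field_simp
  linear_combination (-2 * n * (∫ x, conj (θ x) * u x) -
    2 * ∫ x, conj (fderiv ℝ θ x x) * u x) * Complex.I_sq

lemma mulOp_bracketRatio_zero (w : L2 n) : mulOp (bracketRatio (-0)) w = w := by
  apply mulOp_ext (isMultiplier_bracketRatio _)
  refine Eventually.of_forall fun x => ?_
  rw [bracketRatio, neg_zero, Real.exp_zero, one_smul, ← bracket_add]
  simp

lemma continuousAt_dilate_bracketRatio (w : L2 n) :
    ContinuousAt (fun t : ℝ => dilate t (mulOp (bracketRatio (-t)) w)) 0 := by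
  have h0 : Tendsto (fun t : ℝ => mulOp (bracketRatio (-t)) w) (𝓝 0) (𝓝 w) := by
    have h1 : mulOp (fun _ => 1) w = w := by
      rw [mulOp_const]; simp
    nth_rewrite 2 [← h1]
    refine tendsto_mulOp (C := Real.exp 1)
      (Eventually.of_forall fun t => isMultiplier_bracketRatio _) (IsMultiplier.const 1) ?_ ?_ _
    · filter_upwards [Metric.ball_mem_nhds (0 : ℝ) one_pos] with t ht
      refine Eventually.of_forall fun x => ?_
      rw [abs_of_pos (bracketRatio_pos _ x)]
      refine (bracketRatio_le x).trans (Real.exp_le_exp.mpr ?_)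
      rw [Metric.mem_ball, dist_zero_right, Real.norm_eq_abs] at ht
      rw [abs_neg]; exact ht.le
    · refine Eventually.of_forall fun x => ?_
      have : Continuous fun t : ℝ => bracketRatio (-t) x := by
        unfold bracketRatio
        exact ((continuous_bracket _).comp (by fun_prop)).mul continuous_const
      have h2 := this.tendsto 0
      rwa [bracketRatio, neg_zero, Real.exp_zero, one_smul, ← bracket_add, neg_add_cancel,
        bracket_zero] at h2
  have h2 := tendsto_dilate_apply le_rfl h0
  rw [ContinuousAt, mulOp_bracketRatio_zero, dilate_zero]
  exact h2

/-- At time s the derivative is the dilate of A u. Moving ⟨x⟩⁻¹ through the dilation replaces it by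
⟨e⁻ˢ x⟩⁻¹, which `bracketRatio` writes as a bounded multiple of ⟨x⟩⁻¹; hence the derivative stays in
L² although A u need not. -/
lemma HasD.hasDerivAt_inner_dilate {h : ℝ} (hh : h ≠ 0) {u : L2 n} {d : Fin n → L2 n}
    (hd : ∀ k, HasD h k u (d k)) {ψ : L2 n} (hψ : ψ ∈ testSet n) (s : ℝ) :
    HasDerivAt (fun t : ℝ => inner ℂ ψ (wt n 1 (Semiclassical.dilate t u)))
      (inner ℂ ψ (Semiclassical.dilate s (Semiclassical.mulOp (bracketRatio (-s))
        (dilGen h u d)))) s := by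
  obtain ⟨φ, hψ, hφc, hφ⟩ := hψ
  have hρ := isMultiplier_wt (n := n) (zero_le_one)
  obtain ⟨η, hη⟩ : ∃ η : Space n → ℂ, η = fun x => ((bracket (-1) x : ℝ) : ℂ) * φ x := ⟨_, rfl⟩
  have hηs : ContDiff ℝ ∞ η := by
    rw [hη]; exact (Complex.ofRealCLM.contDiff.comp (contDiff_bracket (-1))).mul hφ
  have hηc : HasCompactSupport η := by rw [hη]; exact hφc.mul_left
  have hT : ∀ s : ℝ, inner ℂ ψ (wt n 1 (Semiclassical.dilate s u)) =
      ∫ x, conj (((Real.exp (n * -s / 2) : ℝ) : ℂ) * η (Real.exp (-s) • x)) * u x := by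
    intro s
    rw [wt, ← inner_mulOp_left hρ, inner_dilate_right]
    apply inner_eq_integral_of_ae
    filter_upwards [coeFn_dilate (-s) (Semiclassical.mulOp (bracket (-1)) ψ),
      (quasiMeasurePreserving_exp_smul (-s)).ae (coeFn_mulOp hρ ψ),
      (quasiMeasurePreserving_exp_smul (-s)).ae hψ] with x h1 h2 h3
    rw [h1, h2, h3, hη]
  simp_rw [hT]
  have hηcont := hηs.continuous
  have hη' := hηs.continuous_fderiv (by simp)
  have c1 : Continuous (fun p : ℝ × Space n => Real.exp (-p.1) • p.2) := by fun_prop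
  have c2 : Continuous (fun p : ℝ × Space n => ((Real.exp (n * -p.1 / 2) : ℝ) : ℂ)) := by fun_prop
  have hder := hasDerivAt_integral_of_compact (locallyIntegrable_L2 u)
    (g := fun s x => conj (((Real.exp (n * -s / 2) : ℝ) : ℂ) * η (Real.exp (-s) • x)))
    (g' := fun s x => conj (-(((Real.exp (n * -s / 2) : ℝ) : ℂ) *
      (n / 2 * η (Real.exp (-s) • x) + fderiv ℝ η (Real.exp (-s) • x) (Real.exp (-s) • x)))))
    (K := (fun p : ℝ × Space n => Real.exp p.1 • p.2) ''
      (Icc (s - 1) (s + 1) ×ˢ tsupport η))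
    (Complex.continuous_conj.comp (c2.mul (hηcont.comp c1)))
    (Complex.continuous_conj.comp (c2.mul ((continuous_const.mul (hηcont.comp c1)).add
      ((hη'.comp c1).clm_apply c1))).neg) ?_ ?_ s ?_
  · refine hder.congr_deriv ?_
    -- θ is the weighted test function transported to time s; the derivative of the family there is
    -- minus the generator applied to θ.
    obtain ⟨θ, hθ⟩ : ∃ θ : Space n → ℂ,
      θ = fun x => ((Real.exp (n * -s / 2) : ℝ) : ℂ) * η (Real.exp (-s) • x) := ⟨_, rfl⟩
    have hθx : ∀ x, ((Real.exp (n * -s / 2) : ℝ) : ℂ) * η (Real.exp (-s) • x) = θ x := by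
      intro x; rw [hθ]
    have hθs : ContDiff ℝ ∞ θ := by rw [hθ]; exact contDiff_dilate_family (-s) hηs
    have hθc : HasCompactSupport θ := by
      rw [hθ]; exact (hηc.comp_smul (Real.exp_pos (-s)).ne').mul_left
    have hθ' : ∀ x, ((Real.exp (n * -s / 2) : ℝ) : ℂ) *
        fderiv ℝ η (Real.exp (-s) • x) (Real.exp (-s) • x) = fderiv ℝ θ x x := by
      intro x
      have h1 : HasFDerivAt (fun x : Space n => Real.exp (-s) • x)
          (Real.exp (-s) • ContinuousLinearMap.id ℝ (Space n)) x :=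
        (hasFDerivAt_id x).const_smul (Real.exp (-s))
      have h2 : HasFDerivAt θ (((Real.exp (n * -s / 2) : ℝ) : ℂ) •
          (fderiv ℝ η (Real.exp (-s) • x)).comp
            (Real.exp (-s) • ContinuousLinearMap.id ℝ (Space n))) x := by
        rw [hθ]
        exact (((hηs.differentiable (by simp) (Real.exp (-s) • x)).hasFDerivAt).comp x
          h1).const_mul ((Real.exp (n * -s / 2) : ℝ) : ℂ)
      rw [h2.fderiv]
      simp
    have e1 : ∀ x, ((Real.exp (n * -s / 2) : ℝ) : ℂ) * (n / 2 * η (Real.exp (-s) • x) +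
        fderiv ℝ η (Real.exp (-s) • x) (Real.exp (-s) • x)) =
        (n : ℂ) / 2 * θ x + fderiv ℝ θ x x := by
      intro x
      rw [mul_add, hθ', ← hθx]; ring
    simp_rw [e1]
    rw [HasD.integral_dilation_generator hh hd hθs hθc]
    -- χ is the test vector once ⟨x⟩⁻¹ has been extracted from θ; pairing it with `dilGen` restores
    -- this weight.
    set χ : L2 n := Semiclassical.mulOp (bracketRatio (-s)) (Semiclassical.dilate (-s) ψ) with hχ
    have hχx : ∀ᵐ x, χ x * bracket (-1) x = θ x := by
      filter_upwards [coeFn_mulOp (isMultiplier_bracketRatio (-s)) (Semiclassical.dilate (-s) ψ),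
        coeFn_dilate (-s) ψ, (quasiMeasurePreserving_exp_smul (-s)).ae hψ] with x h1 h2 h3
      rw [hχ, h1, h2, h3, bracketRatio, ← hθx, hη]
      have : bracket 1 x * bracket (-1) x = 1 := by rw [← bracket_add]; simp
      have h4 : ((bracket 1 x : ℝ) : ℂ) * ((bracket (-1) x : ℝ) : ℂ) = 1 := by exact_mod_cast this
      push_cast
      linear_combination (((bracket (-1) (Real.exp (-s) • x) : ℝ) : ℂ) *
        (Complex.exp (n * -s / 2) * φ (Real.exp (-s) • x))) * h4
    rw [inner_dilate_right, ← inner_mulOp_left (isMultiplier_bracketRatio _), ← hχ, dilGen,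
      inner_add_right, inner_smul_right, inner_smul_right, inner_sum]
    congr 1
    · congr 1
      refine Finset.sum_congr rfl fun k _ => ?_
      rw [inner_eq_integral]
      refine integral_congr_ae ?_
      filter_upwards [hχx, coeFn_mulOp (isMultiplier_coord k) (d k)] with x h1 h2
      rw [h2, ← h1]
      simp
      ring
    · congr 1
      rw [inner_eq_integral]
      refine integral_congr_ae ?_
      filter_upwards [hχx, coeFn_mulOp hρ u] with x h1 h2
      rw [wt, h2, ← h1]
      simp
      ring
  · intro t x
    exact (Complex.conjCLE.toContinuousLinearMap.hasFDerivAt).comp_hasDerivAt t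
      (hasDerivAt_dilate_family hηs t x)
  · exact (isCompact_Icc.prod hηc).image (by fun_prop)
  · intro t ht x hx
    have hx' : Real.exp (-t) • x ∉ tsupport η := fun hm =>
      hx ⟨(t, Real.exp (-t) • x), ⟨ht, hm⟩, by simp [smul_smul, ← Real.exp_add]⟩
    have h1 : η (Real.exp (-t) • x) = 0 := image_eq_zero_of_notMem_tsupport hx'
    have h2 : fderiv ℝ η (Real.exp (-t) • x) = 0 :=
      image_eq_zero_of_notMem_tsupport fun hm => hx' (tsupport_fderiv_subset ℝ hm)
    simp [h1, h2]

/-- Dilations are strongly differentiable in the weighted space, on functions with weak first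
derivatives. -/
lemma HasD.hasDerivAt_dilate {h : ℝ} (hh : h ≠ 0) {u : L2 n} {d : Fin n → L2 n}
    (hd : ∀ k, HasD h k u (d k)) :
    HasDerivAt (fun t : ℝ => wt n 1 (Semiclassical.dilate t u)) (dilGen h u d) 0 := by
  have := hasDerivAt_of_dense_inner (u := fun t : ℝ => wt n 1 (Semiclassical.dilate t u))
    (V := fun t : ℝ => Semiclassical.dilate t (Semiclassical.mulOp (bracketRatio (-t))
      (dilGen h u d))) dense_testSet (fun ψ hψ s => HasD.hasDerivAt_inner_dilate hh hd hψ s)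
      (continuousAt_dilate_bracketRatio _)
  refine this.congr_deriv ?_
  rw [mulOp_bracketRatio_zero, dilate_zero]

end Dilation

/-! ### The abstract first order quadratic form. -/

section Model

open scoped ComplexConjugate InnerProductSpace

variable {n : ℕ}

lemma hasFDerivAt_bracket (r : ℝ) (x : Space n) :
    HasFDerivAt (bracket r) ((r * bracket (r - 2) x) • (innerSL ℝ x)) x := by
  have h0 := one_le_one_add_norm_sq x
  have h1 : HasFDerivAt (fun x : Space n => 1 + ‖x‖ ^ 2) (2 • innerSL ℝ x) x := by
    simpa using (hasStrictFDerivAt_norm_sq x).hasFDerivAt.const_add 1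
  have h2 := h1.rpow_const (p := r / 2) (Or.inl (by positivity))
  refine h2.congr_fderiv ?_
  rw [bracket, show (r - 2) / 2 = r / 2 - 1 by ring, ← Nat.cast_smul_eq_nsmul ℝ, smul_smul]
  congr 1
  push_cast
  ring

lemma fderiv_bracket_unitVec (r : ℝ) (x : Space n) (j : Fin n) :
    fderiv ℝ (bracket r) x (unitVec j) = r * (x j * bracket (r - 2) x) := by
  rw [(hasFDerivAt_bracket r x).fderiv]
  have h : inner ℝ x (unitVec j) = x j := by
    rw [unitVec, EuclideanSpace.inner_single_right]; simp
  simp only [smul_apply, innerSL_apply_apply, h, smul_eq_mul]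
  ring

lemma bracket_mul_bracket (r s : ℝ) (x : Space n) :
    bracket r x * bracket s x = bracket (r + s) x := (bracket_add r s x).symm

lemma norm_fderiv_bracket_le (r : ℝ) (x : Space n) :
    ‖fderiv ℝ (bracket r) x‖ ≤ |r| * bracket (r - 1) x := by
  rw [(hasFDerivAt_bracket r x).fderiv, norm_smul, innerSL_apply_norm, Real.norm_eq_abs, abs_mul,
    abs_of_pos (bracket_pos _ x), mul_assoc]
  refine mul_le_mul_of_nonneg_left ?_ (abs_nonneg _)
  calc _ ≤ bracket (r - 2) x * bracket 1 x :=
        mul_le_mul_of_nonneg_left (norm_le_bracket x) (bracket_pos _ x).le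
    _ = _ := by rw [bracket_mul_bracket]; ring_nf

lemma isC1Bounded_bracket {r : ℝ} (hr : r ≤ 0) : IsC1Bounded (bracket (n := n) r) where
  contDiff := contDiff_bracket r
  bdd := ⟨1, fun x => by rw [abs_of_pos (bracket_pos r x)]; exact bracket_le_one hr x⟩
  fderiv_bdd := ⟨|r|, fun x => (norm_fderiv_bracket_le r x).trans <|
    mul_le_of_le_one_right (abs_nonneg _) (bracket_le_one (by linarith) x)⟩

/-- The partial derivative `∂_α c` of order `0` or `1`, with the convention that it vanishes for
`α = none`. -/
def pderiv (c : Space n → ℝ) : Option (Fin n) → Space n → ℝ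
  | none => fun _ => 0
  | some j => fun x => fderiv ℝ c x (unitVec j)

lemma abs_pderiv_le (c : Space n → ℝ) (α : Option (Fin n)) (x : Space n) :
    |pderiv c α x| ≤ ‖fderiv ℝ c x‖ := by
  cases α with
  | none => simp [pderiv]
  | some j => exact abs_fderiv_unitVec_le c x j

lemma IsC1Bounded.isMultiplier_pderiv {c : Space n → ℝ} (hc : IsC1Bounded c)
    (α : Option (Fin n)) : IsMultiplier (pderiv c α) := by
  cases α with
  | none => exact IsMultiplier.const 0
  | some j => exact hc.isMultiplier_fderiv j

lemma abs_pderiv_bracket_le (r : ℝ) (α : Option (Fin n)) (x : Space n) :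
    |pderiv (bracket r) α x| ≤ |r| * bracket (r - 1) x :=
  (abs_pderiv_le _ _ _).trans (norm_fderiv_bracket_le r x)

lemma norm_fderiv_pderiv_bracket_le (r : ℝ) (α : Option (Fin n)) (x : Space n) :
    ‖fderiv ℝ (pderiv (bracket r) α) x‖ ≤ |r| * (1 + |r - 2|) * bracket (r - 2) x := by
  cases α with
  | none =>
    have : fderiv ℝ (pderiv (bracket (n := n) r) none) x = 0 := by
      unfold pderiv; simp
    rw [this, norm_zero]
    have := bracket_pos (r - 2) x
    positivity
  | some j =>
    have e : pderiv (bracket (n := n) r) (some j) = fun x => r * (x j * bracket (r - 2) x) := by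
      ext1 x; exact fderiv_bracket_unitVec r x j
    have h1 : HasFDerivAt (fun x : Space n => x j) (EuclideanSpace.proj j : Space n →L[ℝ] ℝ) x :=
      (EuclideanSpace.proj j : Space n →L[ℝ] ℝ).hasFDerivAt
    have h2 := (h1.mul (hasFDerivAt_bracket (r - 2) x)).const_mul r
    have h3 : HasFDerivAt (pderiv (bracket (n := n) r) (some j))
        (r • (x j • ((r - 2) * bracket (r - 2 - 2) x) • (innerSL ℝ) x +
          bracket (r - 2) x • EuclideanSpace.proj j)) x := by
      rw [e]; exact h2
    rw [h3.fderiv, norm_smul, Real.norm_eq_abs, mul_assoc]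
    refine mul_le_mul_of_nonneg_left ((norm_add_le _ _).trans ?_) (abs_nonneg _)
    have hb := bracket_pos (r - 2) x
    have hj : ‖(EuclideanSpace.proj j : Space n →L[ℝ] ℝ)‖ ≤ 1 :=
      ContinuousLinearMap.opNorm_le_bound _ zero_le_one fun y => by
        simpa using PiLp.norm_apply_le y j
    have h4 : ‖(r - 2) * bracket (r - 2 - 2) x‖ * ‖innerSL ℝ x‖ ≤ |r - 2| * bracket (r - 3) x := by
      have := norm_fderiv_bracket_le (r - 2) x
      rw [(hasFDerivAt_bracket (r - 2) x).fderiv, norm_smul] at this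
      convert this using 2
      ring_nf
    rw [norm_smul, norm_smul, norm_smul, Real.norm_of_nonneg hb.le, add_mul, one_mul, add_comm]
    refine add_le_add (mul_le_of_le_one_right hb.le hj) ?_
    calc _ ≤ bracket 1 x * (|r - 2| * bracket (r - 3) x) :=
          mul_le_mul (abs_apply_le_bracket x j) h4 (by positivity) (bracket_pos 1 x).le
      _ = |r - 2| * (bracket 1 x * bracket (r - 3) x) := by ring
      _ = _ := by rw [bracket_mul_bracket]; ring_nf

lemma contDiff_pderiv_bracket (r : ℝ) (α : Option (Fin n)) :
    ContDiff ℝ 1 (pderiv (bracket r) α) := by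
  cases α with
  | none => exact contDiff_const
  | some j =>
    have h : ContDiff ℝ 2 (bracket (n := n) r) := contDiff_bracket r
    exact (h.fderiv_right (m := 1) (by norm_num)).clm_apply contDiff_const

lemma isC1Bounded_pderiv_bracket {r : ℝ} (hr : r ≤ 0) (α : Option (Fin n)) :
    IsC1Bounded (pderiv (bracket (n := n) r) α) where
  contDiff := contDiff_pderiv_bracket r α
  bdd := ⟨|r|, fun x => (abs_pderiv_bracket_le r α x).trans <|
    mul_le_of_le_one_right (abs_nonneg _) (bracket_le_one (by linarith) x)⟩
  fderiv_bdd := ⟨|r| * (1 + |r - 2|), fun x => (norm_fderiv_pderiv_bracket_le r α x).trans <|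
    mul_le_of_le_one_right (by positivity) (bracket_le_one (by linarith) x)⟩

/-- `v = 𝒟_α u`, where `𝒟_none u = u`. -/
def HasDo (h : ℝ) (α : Option (Fin n)) (u v : L2 n) : Prop :=
  match α with
  | none => v = u
  | some j => HasD h j u v

lemma HasDo.inner_left {h : ℝ} (hh : h ≠ 0) {α : Option (Fin n)} {u v u' v' : L2 n}
    (hu : HasDo h α u u') (hv : HasDo h α v v') : inner ℂ u' v = inner ℂ u v' := by
  cases α with
  | none => cases hu; cases hv; rfl
  | some j => exact HasD.inner_left hh hu hv

lemma HasDo.mulOp {h : ℝ} (hh : h ≠ 0) {α : Option (Fin n)} {u v : L2 n} (huv : HasDo h α u v)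
    {c : Space n → ℝ} (hc : IsC1Bounded c) :
    HasDo h α (mulOp c u) (mulOp c v - (Complex.I * h) • mulOp (pderiv c α) u) := by
  cases α with
  | none =>
    cases huv
    change _ = _
    simp [pderiv, mulOp_const]
  | some j => exact HasD.mulOp hh huv hc

lemma HasDo.unique {h : ℝ} {α : Option (Fin n)} {u v w : L2 n} (huv : HasDo h α u v)
    (huw : HasDo h α u w) : v = w := by
  cases α with
  | none => cases huv; cases huw; rfl
  | some j => exact HasD.unique huv huw

/-- The order `0` or `1` of an index. -/
def ord (α : Option (Fin n)) : ℝ := if α.isSome then 1 else 0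

lemma HasDo.dilate {h : ℝ} {α : Option (Fin n)} {u v : L2 n} (huv : HasDo h α u v) (t : ℝ) :
    HasDo h α (dilate t u) (((Real.exp (ord α * t) : ℝ) : ℂ) • Semiclassical.dilate t v) := by
  cases α with
  | none => cases huv; change _ = _; simp [ord]
  | some j =>
    have := HasD.dilate (u := u) (v := v) huv t
    change HasD h j _ _
    simpa [ord] using this

/-- A self-adjoint operator given by a symmetric first order quadratic form with short range
coefficients, whose domain is controlled by derivatives of order two. -/
structure IsModel (h K δ : ℝ) (P : L2 n →ₗ.[ℂ] L2 n)
    (q : Option (Fin n) → Option (Fin n) → Space n → ℝ) (V₁ : Space n → ℝ)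
    (T : Option (Fin n) → L2 n →L[ℂ] L2 n) (T₂ : Fin n → L2 n →L[ℂ] L2 n) : Prop where
  h_pos : 0 < h
  h_le : h ≤ 1
  one_le_δ : 1 ≤ δ
  isSelfAdjoint : IsSelfAdjoint P
  q_contDiff : ∀ α β, ContDiff ℝ 1 (q α β)
  q_symm : ∀ α β, q α β = q β α
  q_le : ∀ α β x, |q α β x| ≤ K
  -- Entries of order below two decay themselves. For second order entries only the gradient decays;
  -- this suffices because their values cancel against 2P in the commutator with dilations.
  q_none_le : ∀ β x, |q none β x| ≤ K * bracket (-δ) x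
  fderiv_q_le : ∀ α β x, ‖fderiv ℝ (q α β) x‖ ≤ K * bracket (-δ) x
  V₁_meas : AEStronglyMeasurable V₁ volume
  V₁_le : ∀ᵐ x, |V₁ x| ≤ K * bracket (-δ) x
  T_none : T none = unboundedResolvent P (-Complex.I)
  hasDo_T : ∀ α f, HasDo h α (T none f) (T α f)
  hasD_T₂ : ∀ j f, HasD h j (T (some j) f) (T₂ j f)
  norm_T_le : ∀ α, ‖T α‖ ≤ K
  norm_T₂_le : ∀ j, ‖T₂ j‖ ≤ K
  -- The form is tested on every v with weak first derivatives, not only on the domain: dilates and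
  -- weighted vectors are inserted here.
  inner_apply : ∀ (u : P.domain) (v : L2 n) (d : Option (Fin n) → L2 n), (∀ α, HasDo h α v (d α)) →
    inner ℂ v (P u) = ∑ α, ∑ β, inner ℂ (d α) (mulOp (q α β) (T β (P u + Complex.I • (u : L2 n)))) +
      h * inner ℂ v (mulOp V₁ u)

namespace IsModel

variable {h K δ : ℝ} {P : L2 n →ₗ.[ℂ] L2 n} {q : Option (Fin n) → Option (Fin n) → Space n → ℝ}
  {V₁ : Space n → ℝ} {T : Option (Fin n) → L2 n →L[ℂ] L2 n} {T₂ : Fin n → L2 n →L[ℂ] L2 n}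

lemma K_nonneg (M : IsModel h K δ P q V₁ T T₂) : 0 ≤ K :=
  (abs_nonneg _).trans (M.q_le none none 0)

lemma isC1Bounded_q (M : IsModel h K δ P q V₁ T T₂) (α β : Option (Fin n)) :
    IsC1Bounded (q α β) where
  contDiff := M.q_contDiff α β
  bdd := ⟨K, M.q_le α β⟩
  fderiv_bdd := ⟨K, fun x => (M.fderiv_q_le α β x).trans <|
    mul_le_of_le_one_right M.K_nonneg (bracket_le_one (by linarith [M.one_le_δ]) x)⟩

lemma isMultiplier_V₁ (M : IsModel h K δ P q V₁ T T₂) : IsMultiplier V₁ := by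
  refine ⟨M.V₁_meas, K, ?_⟩
  filter_upwards [M.V₁_le] with x hx
  exact hx.trans (mul_le_of_le_one_right M.K_nonneg (bracket_le_one (by linarith [M.one_le_δ]) x))

/-- The derivative `𝒟_α u` for `u` in the domain. -/
def der (T : Option (Fin n) → L2 n →L[ℂ] L2 n) (α : Option (Fin n)) (u : P.domain) : L2 n :=
  T α (P u + Complex.I • (u : L2 n))

lemma T_none_apply (M : IsModel h K δ P q V₁ T T₂) (u : P.domain) :
    T none (P u + Complex.I • (u : L2 n)) = u := by
  rw [M.T_none]
  have := unboundedResolvent_apply_sub M.isSelfAdjoint (z := -Complex.I) (by simp) u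
  rwa [neg_smul, sub_neg_eq_add] at this

lemma der_none (M : IsModel h K δ P q V₁ T T₂) (u : P.domain) : der T none u = u :=
  M.T_none_apply u

lemma hasDo_der (M : IsModel h K δ P q V₁ T T₂) (α : Option (Fin n)) (u : P.domain) :
    HasDo h α (u : L2 n) (der T α u) := by
  have := M.hasDo_T α (P u + Complex.I • (u : L2 n))
  rwa [M.T_none_apply] at this

lemma inner_apply_right (M : IsModel h K δ P q V₁ T T₂) (u : P.domain) {v : L2 n}
    {d : Option (Fin n) → L2 n} (hd : ∀ α, HasDo h α v (d α)) :
    inner ℂ v (P u) = ∑ α, ∑ β, inner ℂ (d α) (mulOp (q α β) (der T β u)) +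
      h * inner ℂ v (mulOp V₁ u) := M.inner_apply u v d hd

lemma inner_apply_left (M : IsModel h K δ P q V₁ T T₂) (v : P.domain) {u : L2 n}
    {d : Option (Fin n) → L2 n} (hd : ∀ α, HasDo h α u (d α)) :
    inner ℂ (P v) u = ∑ α, ∑ β, inner ℂ (der T α v) (mulOp (q α β) (d β)) +
      h * inner ℂ (v : L2 n) (mulOp V₁ u) := by
  rw [← inner_conj_symm, M.inner_apply_right v hd, map_add, map_sum, Finset.sum_comm]
  congr 1
  · simp_rw [map_sum]
    refine Finset.sum_congr rfl fun α _ => Finset.sum_congr rfl fun β _ => ?_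
    rw [inner_conj_symm, inner_mulOp_left (M.isC1Bounded_q α β).isMultiplier, M.q_symm]
  · rw [map_mul, inner_conj_symm, Complex.conj_ofReal, inner_mulOp_left M.isMultiplier_V₁]

end IsModel

end Model

/-! ### Commutators with weights and the weighted elliptic estimate. -/

section Commutator

open scoped ComplexConjugate InnerProductSpace

variable {n : ℕ} {h K δ : ℝ} {P : L2 n →ₗ.[ℂ] L2 n}
  {q : Option (Fin n) → Option (Fin n) → Space n → ℝ}
  {V₁ : Space n → ℝ} {T : Option (Fin n) → L2 n →L[ℂ] L2 n} {T₂ : Fin n → L2 n →L[ℂ] L2 n}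

/-- The commutator of the operator with multiplication by `w`, in terms of derivatives. -/
def commutatorTerm (h : ℝ) (q : Option (Fin n) → Option (Fin n) → Space n → ℝ)
    (T : Option (Fin n) → L2 n →L[ℂ] L2 n) (w : Space n → ℝ) (u : P.domain) : L2 n :=
  -(Complex.I * (h : ℂ)) • ∑ α, ∑ β,
    (mulOp (fun x => q α β x * pderiv w β x) (IsModel.der T α u) +
      mulOp (fun x => q α β x * pderiv w α x) (IsModel.der T β u) -
      (Complex.I * (h : ℂ)) • mulOp (pderiv (fun x => q α β x * pderiv w β x) α) (u : L2 n))

namespace IsModel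

lemma isC1Bounded_q_mul (M : IsModel h K δ P q V₁ T T₂) {r : ℝ} (hr : r ≤ 0)
    (α β γ : Option (Fin n)) : IsC1Bounded (fun x => q α β x * pderiv (bracket r) γ x) :=
  (M.isC1Bounded_q α β).mul (isC1Bounded_pderiv_bracket hr γ)

/-- Membership in the domain comes from `IsSelfAdjoint.exists_apply_eq`, by computing both pairings
through the form. One integration by parts moves 𝒟_α from v onto (q ∂_β w) u, so first derivatives
of u and C¹ coefficients are enough. -/
lemma exists_apply_wt (M : IsModel h K δ P q V₁ T T₂) {a : ℝ} (ha : 0 ≤ a) (u : P.domain) :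
    ∃ hu : wt n a (u : L2 n) ∈ P.domain,
      P ⟨wt n a u, hu⟩ = wt n a (P u) + commutatorTerm h q T (bracket (-a)) u := by
  have hh := M.h_pos.ne'
  have hr : -a ≤ 0 := by linarith
  have hw := isC1Bounded_bracket (n := n) hr
  refine M.isSelfAdjoint.exists_apply_eq fun v => ?_
  have hU : ∀ β, HasDo h β (wt n a (u : L2 n)) (mulOp (bracket (-a)) (der T β u) -
      (Complex.I * h) • mulOp (pderiv (bracket (-a)) β) u) :=
    fun β => (M.hasDo_der β u).mulOp hh hw
  have hV : ∀ β, HasDo h β (wt n a (v : L2 n)) (mulOp (bracket (-a)) (der T β v) -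
      (Complex.I * h) • mulOp (pderiv (bracket (-a)) β) v) :=
    fun β => (M.hasDo_der β v).mulOp hh hw
  suffices H : inner ℂ (P v) (wt n a (u : L2 n)) =
      inner ℂ (v : L2 n) (wt n a (P u) + commutatorTerm h q T (bracket (-a)) u) by
    rw [← inner_conj_symm, ← H, inner_conj_symm]
  rw [M.inner_apply_left v hU, inner_add_right, ← inner_wt_left ha, M.inner_apply_right u hV,
    inner_wt_left ha, wt, mulOp_mulOp M.isMultiplier_V₁ hw.isMultiplier,
    mulOp_mulOp hw.isMultiplier M.isMultiplier_V₁, commutatorTerm, inner_smul_right, inner_sum]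
  simp_rw [inner_sum]
  rw [add_right_comm, Finset.mul_sum, ← Finset.sum_add_distrib]
  congr 1
  · refine Finset.sum_congr rfl fun α _ => ?_
    rw [Finset.mul_sum, ← Finset.sum_add_distrib]
    refine Finset.sum_congr rfl fun β _ => ?_
    have hq := (M.isC1Bounded_q α β).isMultiplier
    have hα := (isC1Bounded_pderiv_bracket (n := n) hr α).isMultiplier
    have hβ := (isC1Bounded_pderiv_bracket (n := n) hr β).isMultiplier
    have e1 := HasDo.inner_left hh (M.hasDo_der α v)
      ((M.hasDo_der α u).mulOp hh (M.isC1Bounded_q_mul hr α β β))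
    rw [inner_sub_right, inner_smul_right] at e1
    have e2 : inner ℂ (mulOp (bracket (-a)) (der T α v)) (mulOp (q α β) (der T β u)) =
        inner ℂ (der T α v) (mulOp (q α β) (mulOp (bracket (-a)) (der T β u))) := by
      rw [inner_mulOp_left hw.isMultiplier, mulOp_mulOp hw.isMultiplier hq,
        mulOp_mulOp hq hw.isMultiplier]
      simp_rw [mul_comm]
    have e3 : inner ℂ (mulOp (pderiv (bracket (-a)) α) (v : L2 n)) (mulOp (q α β) (der T β u)) =
        inner ℂ (v : L2 n) (mulOp (fun x => q α β x * pderiv (bracket (-a)) α x) (der T β u)) := by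
      rw [inner_mulOp_left hα, mulOp_mulOp hα hq]
      simp_rw [mul_comm]
    rw [map_sub, map_smul, mulOp_mulOp hq hβ, inner_sub_right, inner_smul_right, e1,
      inner_sub_left, inner_smul_left, e2, e3, inner_sub_right, inner_add_right, inner_smul_right,
      map_mul, Complex.conj_I, Complex.conj_ofReal]
    ring
  · simp_rw [mul_comm]

lemma norm_mulOp_q_mul_le (M : IsModel h K δ P q V₁ T T₂) {a : ℝ} (ha : 0 ≤ a)
    (α β γ : Option (Fin n)) (f : L2 n) :
    ‖mulOp (fun x => q α β x * pderiv (bracket (-a)) γ x) f‖ ≤ K * a * ‖wt n a f‖ := by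
  refine norm_mulOp_le_mul (M.isC1Bounded_q_mul (by linarith) α β γ).isMultiplier
    (isMultiplier_wt ha) (Eventually.of_forall fun x => ?_) f
  have hb : |pderiv (bracket (n := n) (-a)) γ x| ≤ a * bracket (-a) x := by
    refine (abs_pderiv_bracket_le _ _ _).trans ?_
    rw [abs_neg, abs_of_nonneg ha]
    exact mul_le_mul_of_nonneg_left (bracket_le_bracket (by linarith) x) ha
  rw [abs_mul, abs_of_pos (bracket_pos (-a) x), mul_assoc]
  exact mul_le_mul (M.q_le α β x) hb (abs_nonneg _) M.K_nonneg

lemma norm_mulOp_pderiv_q_mul_le (M : IsModel h K δ P q V₁ T T₂) {a : ℝ} (ha : 0 ≤ a)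
    (α β : Option (Fin n)) (f : L2 n) :
    ‖mulOp (pderiv (fun x => q α β x * pderiv (bracket (-a)) β x) α) f‖ ≤
      K * (a * (a + 4)) * ‖wt n a f‖ := by
  refine norm_mulOp_le_mul
    ((M.isC1Bounded_q_mul (by linarith) α β β).isMultiplier_pderiv α) (isMultiplier_wt ha)
    (Eventually.of_forall fun x => (abs_pderiv_le _ _ _).trans ?_) f
  have hc := bracket_pos (-a) x
  have hb : |pderiv (bracket (n := n) (-a)) β x| ≤ a * bracket (-a) x := by
    refine (abs_pderiv_bracket_le _ _ _).trans ?_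
    rw [abs_neg, abs_of_nonneg ha]
    exact mul_le_mul_of_nonneg_left (bracket_le_bracket (by linarith) x) ha
  have hb' : ‖fderiv ℝ (pderiv (bracket (n := n) (-a)) β) x‖ ≤
      a * (1 + (a + 2)) * bracket (-a) x := by
    refine (norm_fderiv_pderiv_bracket_le _ _ _).trans ?_
    rw [abs_neg, abs_of_nonneg ha, show -a - 2 = -(a + 2) by ring, abs_neg,
      abs_of_nonneg (by linarith : 0 ≤ a + 2)]
    exact mul_le_mul_of_nonneg_left (bracket_le_bracket (by linarith) x) (by positivity)
  have d1 : DifferentiableAt ℝ (q α β) x := (M.q_contDiff α β).differentiable one_ne_zero x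
  have d2 : DifferentiableAt ℝ (pderiv (bracket (n := n) (-a)) β) x :=
    (contDiff_pderiv_bracket (-a) β).differentiable one_ne_zero x
  have hq : ‖fderiv ℝ (q α β) x‖ ≤ K := (M.fderiv_q_le α β x).trans
    (mul_le_of_le_one_right M.K_nonneg (bracket_le_one (by linarith [M.one_le_δ]) x))
  rw [fderiv_fun_mul d1 d2, abs_of_pos hc]
  refine (norm_add_le _ _).trans ?_
  rw [norm_smul, norm_smul, Real.norm_eq_abs, Real.norm_eq_abs]
  calc _ ≤ K * (a * (1 + (a + 2)) * bracket (-a) x) + a * bracket (-a) x * K :=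
        add_le_add (mul_le_mul (M.q_le α β x) hb' (norm_nonneg _) M.K_nonneg)
          (mul_le_mul hb hq (norm_nonneg _) (by positivity))
    _ = _ := by ring

lemma norm_I_mul_h_le (M : IsModel h K δ P q V₁ T T₂) : ‖(Complex.I * (h : ℂ))‖ ≤ 1 := by
  rw [norm_mul, Complex.norm_I, one_mul, Complex.norm_real, Real.norm_of_nonneg M.h_pos.le]
  exact M.h_le

/-- Each term of the commutator contains a factor h ≤ 1 and a derivative of the weight, which is no
larger than a multiple of the weight. The constant precedes h and the model, as uniformity requires.
-/
lemma exists_norm_commutatorTerm_le (n : ℕ) {K a : ℝ} (hK : 0 ≤ K) (ha : 0 ≤ a) :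
    ∃ C : ℝ, 0 ≤ C ∧
    ∀ {h δ : ℝ} {P : L2 n →ₗ.[ℂ] L2 n} {q : Option (Fin n) → Option (Fin n) → Space n → ℝ}
      {V₁ : Space n → ℝ} {T : Option (Fin n) → L2 n →L[ℂ] L2 n} {T₂ : Fin n → L2 n →L[ℂ] L2 n},
      IsModel h K δ P q V₁ T T₂ → ∀ u : P.domain,
      ‖commutatorTerm h q T (bracket (-a)) u‖ ≤ C * ∑ α, ‖wt n a (der T α u)‖ := by
  obtain ⟨N, hN⟩ : ∃ N : ℝ, N = (Fintype.card (Option (Fin n)) : ℝ) := ⟨_, rfl⟩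
  have hN0 : 0 ≤ N := by rw [hN]; positivity
  refine ⟨N * (K * a + K * a + N * (K * (a * (a + 4)))), by positivity, ?_⟩
  intro h δ P q V₁ T T₂ M u
  have hh1 := M.norm_I_mul_h_le
  obtain ⟨D, hD⟩ : ∃ D : ℝ, D = ∑ α, ‖wt n a (der T α u)‖ := ⟨_, rfl⟩
  have hDu : ‖wt n a (u : L2 n)‖ ≤ D := by
    have := Finset.single_le_sum (f := fun α => ‖wt n a (der T α u)‖) (fun _ _ => norm_nonneg _)
      (Finset.mem_univ none)
    rw [hD]
    simpa only [M.der_none] using this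
  have h3 : ∀ α β, ‖mulOp (fun x => q α β x * pderiv (bracket (-a)) β x) (der T α u) +
      mulOp (fun x => q α β x * pderiv (bracket (-a)) α x) (der T β u) -
      (Complex.I * (h : ℂ)) • mulOp (pderiv (fun x => q α β x * pderiv (bracket (-a)) β x) α)
        (u : L2 n)‖ ≤ K * a * ‖wt n a (der T α u)‖ + K * a * ‖wt n a (der T β u)‖ +
        K * (a * (a + 4)) * D := by
    intro α β
    refine (norm_sub_le _ _).trans (add_le_add ((norm_add_le _ _).trans
      (add_le_add (M.norm_mulOp_q_mul_le ha _ _ _ _) (M.norm_mulOp_q_mul_le ha _ _ _ _))) ?_)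
    rw [norm_smul]
    refine (mul_le_of_le_one_left (norm_nonneg _) hh1).trans
      ((M.norm_mulOp_pderiv_q_mul_le ha _ _ _).trans ?_)
    exact mul_le_mul_of_nonneg_left hDu (by positivity)
  rw [commutatorTerm, neg_smul, norm_neg, norm_smul, ← hD]
  refine (mul_le_of_le_one_left (norm_nonneg _) hh1).trans ((norm_sum_le _ _).trans ?_)
  calc _ ≤ ∑ α, ∑ β, (K * a * ‖wt n a (der T α u)‖ + K * a * ‖wt n a (der T β u)‖ +
        K * (a * (a + 4)) * D) :=
        Finset.sum_le_sum fun α _ => (norm_sum_le _ _).trans (Finset.sum_le_sum fun β _ => h3 α β)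
    _ = _ := by
        simp only [Finset.sum_add_distrib, Finset.sum_const, Finset.card_univ, nsmul_eq_mul,
          ← Finset.mul_sum, ← hD, ← hN]
        ring

/-- ‖𝒟_j u‖² = ⟨u, 𝒟_j² u⟩, and 𝒟_j² (P + i)⁻¹ is bounded. The square root gained this way lets
first order commutators be absorbed. -/
lemma norm_sq_der_le (M : IsModel h K δ P q V₁ T T₂) (j : Fin n) (u : P.domain) :
    ‖der T (some j) u‖ ^ 2 ≤ K * ‖(u : L2 n)‖ * ‖P u + Complex.I • (u : L2 n)‖ := by
  have e := HasD.inner_left M.h_pos.ne' (M.hasDo_der (some j) u)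
    (M.hasD_T₂ j (P u + Complex.I • (u : L2 n)))
  change inner ℂ (der T (some j) u) (der T (some j) u) = _ at e
  have h1 : ‖der T (some j) u‖ ^ 2 = ‖inner ℂ (der T (some j) u) (der T (some j) u)‖ := by
    rw [inner_self_eq_norm_sq_to_K]
    simp
  rw [h1, e]
  calc _ ≤ ‖(u : L2 n)‖ * ‖T₂ j (P u + Complex.I • (u : L2 n))‖ := norm_inner_le_norm _ _
    _ ≤ ‖(u : L2 n)‖ * (K * ‖P u + Complex.I • (u : L2 n)‖) :=
        mul_le_mul_of_nonneg_left (ContinuousLinearMap.le_of_opNorm_le _ (M.norm_T₂_le j) _)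
          (norm_nonneg _)
    _ = _ := by ring

lemma norm_wt_der_le (M : IsModel h K δ P q V₁ T T₂) {a : ℝ} (ha : 0 ≤ a) (u : P.domain)
    (hu : wt n a (u : L2 n) ∈ P.domain) (j : Fin n) :
    ‖wt n a (der T (some j) u)‖ ≤ ‖der T (some j) ⟨wt n a u, hu⟩‖ + a * ‖wt n a (u : L2 n)‖ := by
  have hr : -a ≤ 0 := by linarith
  have e := HasDo.unique (M.hasDo_der (some j) ⟨wt n a u, hu⟩)
    ((M.hasDo_der (some j) u).mulOp M.h_pos.ne' (isC1Bounded_bracket hr))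
  have e' : wt n a (der T (some j) u) = der T (some j) ⟨wt n a u, hu⟩ +
      (Complex.I * h) • mulOp (pderiv (bracket (-a)) (some j)) (u : L2 n) := by
    rw [e, sub_add_cancel]; rfl
  rw [e']
  refine (norm_add_le _ _).trans (add_le_add le_rfl ?_)
  rw [norm_smul]
  refine (mul_le_of_le_one_left (norm_nonneg _) M.norm_I_mul_h_le).trans ?_
  refine norm_mulOp_le_mul (isC1Bounded_pderiv_bracket hr _).isMultiplier (isMultiplier_wt ha)
    (Eventually.of_forall fun x => (abs_pderiv_bracket_le _ _ _).trans ?_) _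
  rw [abs_neg, abs_of_nonneg ha, abs_of_pos (bracket_pos _ x)]
  exact mul_le_mul_of_nonneg_left (bracket_le_bracket (by linarith) x) ha

/-- Weighted elliptic estimate. -/
lemma exists_norm_wt_le (n : ℕ) {K a : ℝ} (hK : 0 ≤ K) (ha : 0 ≤ a) : ∃ C : ℝ, 0 ≤ C ∧
    ∀ {h δ : ℝ} {P : L2 n →ₗ.[ℂ] L2 n} {q : Option (Fin n) → Option (Fin n) → Space n → ℝ}
      {V₁ : Space n → ℝ} {T : Option (Fin n) → L2 n →L[ℂ] L2 n} {T₂ : Fin n → L2 n →L[ℂ] L2 n},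
      IsModel h K δ P q V₁ T T₂ → ∀ u : P.domain, ∃ hu : wt n a (u : L2 n) ∈ P.domain,
      ‖P ⟨wt n a u, hu⟩ + Complex.I • wt n a (u : L2 n)‖ ≤
        C * (‖wt n a (u : L2 n)‖ + ‖wt n a (P u)‖) ∧
      ∀ α, ‖wt n a (der T α u)‖ ≤ C * (‖wt n a (u : L2 n)‖ + ‖wt n a (P u)‖) := by
  obtain ⟨C₁, hC₁, H⟩ := exists_norm_commutatorTerm_le n hK ha
  -- B is the constant in (C₁ S)² ≤ B x N, where x = ‖⟨x⟩⁻ᵃ u‖, N = ‖(P + i)⟨x⟩⁻ᵃ u‖ and S is the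
  -- sum of the derivatives of ⟨x⟩⁻ᵃ u.
  obtain ⟨B, hB⟩ : ∃ B : ℝ, B = (C₁ * n) ^ 2 * K := ⟨_, rfl⟩
  have hB0 : 0 ≤ B := by rw [hB]; positivity
  obtain ⟨C₂, hC₂⟩ : ∃ C₂ : ℝ, C₂ = 2 * (1 + C₁ * (1 + n * a)) + B := ⟨_, rfl⟩
  have hC₂0 : 0 ≤ C₂ := by rw [hC₂]; positivity
  refine ⟨2 + C₂ + (1 + K + a) + K * (2 + C₂), by positivity, ?_⟩
  intro h δ P q V₁ T T₂ M u
  obtain ⟨hu, e⟩ := M.exists_apply_wt ha u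
  refine ⟨hu, ?_⟩
  obtain ⟨x, hx⟩ : ∃ x : ℝ, x = ‖wt n a (u : L2 n)‖ := ⟨_, rfl⟩
  obtain ⟨y, hy⟩ : ∃ y : ℝ, y = ‖wt n a (P u)‖ := ⟨_, rfl⟩
  obtain ⟨N, hN⟩ : ∃ N : ℝ, N = ‖P ⟨wt n a u, hu⟩ + Complex.I • wt n a (u : L2 n)‖ := ⟨_, rfl⟩
  obtain ⟨S, hS⟩ : ∃ S : ℝ, S = ∑ j, ‖der T (some j) ⟨wt n a u, hu⟩‖ := ⟨_, rfl⟩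
  have hx0 : 0 ≤ x := hx ▸ norm_nonneg _
  have hy0 : 0 ≤ y := hy ▸ norm_nonneg _
  have hN0 : 0 ≤ N := hN ▸ norm_nonneg _
  have hS0 : 0 ≤ S := hS ▸ Finset.sum_nonneg fun _ _ => norm_nonneg _
  have hS2 : S ^ 2 ≤ n ^ 2 * (K * x * N) := by
    rw [hS]
    refine sq_sum_le_card_mul_sum_sq.trans ?_
    calc _ ≤ (Finset.card (Finset.univ : Finset (Fin n)) : ℝ) * ∑ _j : Fin n, K * x * N := by
          gcongr with j
          have := M.norm_sq_der_le j ⟨wt n a u, hu⟩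
          rwa [← hN, ← hx] at this
      _ = _ := by simp; ring
  have hsum : ∑ α, ‖wt n a (der T α u)‖ ≤ x + (S + n * (a * x)) := by
    rw [Fintype.sum_option, M.der_none, ← hx]
    refine add_le_add le_rfl ?_
    calc _ ≤ ∑ j, (‖der T (some j) ⟨wt n a u, hu⟩‖ + a * ‖wt n a (u : L2 n)‖) :=
          Finset.sum_le_sum fun j _ => M.norm_wt_der_le ha u hu j
      _ = _ := by rw [Finset.sum_add_distrib, ← hS, ← hx]; simp
  have hN1 : N ≤ y + C₁ * (x + (S + n * (a * x))) + x := by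
    rw [hN, e]
    refine (norm_add_le _ _).trans (add_le_add ((norm_add_le _ _).trans (add_le_add hy.ge
      ((H M u).trans (mul_le_mul_of_nonneg_left hsum hC₁)))) ?_)
    rw [norm_smul, Complex.norm_I, one_mul, hx]
  -- By the arithmetic-geometric mean inequality the derivative part of the commutator is at most
  -- half of N, plus a multiple of x, and is absorbed on the left.
  have hCS : C₁ * S ≤ (N + B * x) / 2 := by
    refine abs_le_of_sq_le_sq' (?_ : (C₁ * S) ^ 2 ≤ ((N + B * x) / 2) ^ 2) (by positivity) |>.2
    have h1 : (C₁ * S) ^ 2 ≤ B * x * N := by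
      calc (C₁ * S) ^ 2 = C₁ ^ 2 * S ^ 2 := by ring
        _ ≤ C₁ ^ 2 * (n ^ 2 * (K * x * N)) := by gcongr
        _ = _ := by rw [hB]; ring
    nlinarith [sq_nonneg (N - B * x)]
  have hN2 : N ≤ 2 * y + C₂ * x := by
    rw [hC₂]; nlinarith
  have hN3 : N ≤ (2 + C₂) * (x + y) := by nlinarith
  have hN4 : ∀ α, ‖der T α ⟨wt n a u, hu⟩‖ ≤ K * N := fun α => by
    rw [hN]; exact ContinuousLinearMap.le_of_opNorm_le _ (M.norm_T_le α) _
  rw [← hN, ← hx, ← hy]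
  refine ⟨hN3.trans (mul_le_mul_of_nonneg_right ?_ (by positivity)), fun α => ?_⟩
  · nlinarith [mul_nonneg hK hC₂0]
  have hKN : K * N ≤ K * ((2 + C₂) * (x + y)) := mul_le_mul_of_nonneg_left hN3 hK
  have h5 : ‖wt n a (der T α u)‖ ≤ K * ((2 + C₂) * (x + y)) + (1 + a) * x := by
    cases α with
    | none =>
      rw [M.der_none, ← hx]
      have : 0 ≤ K * ((2 + C₂) * (x + y)) := by positivity
      nlinarith [mul_nonneg ha hx0]
    | some j =>
      have := M.norm_wt_der_le ha u hu j
      rw [← hx] at this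
      linarith [hN4 (some j)]
  refine h5.trans ?_
  have h6 : (1 + a) * x ≤ (1 + a) * (x + y) := by gcongr; linarith
  have h7 : 0 ≤ (2 + C₂ + K) * (x + y) := by positivity
  nlinarith

end IsModel

end Commutator

/-! ### Derivative of the dilated quadratic form. -/

section Dilation

open scoped ComplexConjugate InnerProductSpace

variable {n : ℕ} {h K δ : ℝ} {P : L2 n →ₗ.[ℂ] L2 n}
  {q : Option (Fin n) → Option (Fin n) → Space n → ℝ}
  {V₁ : Space n → ℝ} {T : Option (Fin n) → L2 n →L[ℂ] L2 n} {T₂ : Fin n → L2 n →L[ℂ] L2 n}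

lemma ord_nonneg (α : Option (Fin n)) : 0 ≤ ord α := by unfold ord; split_ifs <;> norm_num

lemma ord_le_one (α : Option (Fin n)) : ord α ≤ 1 := by unfold ord; split_ifs <;> norm_num

/-- The difference of a coefficient and its dilation. -/
def dilDiff (c : Space n → ℝ) (p r t : ℝ) (x : Space n) : ℝ :=
  Real.exp (-(p * t)) * c (Real.exp t • x) - Real.exp (r * t) * c x

lemma hasDerivAt_dilDiff {c : Space n → ℝ} (hc : ContDiff ℝ 1 c) (p r t : ℝ) (x : Space n) :
    HasDerivAt (fun t => dilDiff c p r t x)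
      (Real.exp (-(p * t)) * (-p) * c (Real.exp t • x) + Real.exp (-(p * t)) *
        fderiv ℝ c (Real.exp t • x) (Real.exp t • x) - Real.exp (r * t) * r * c x) t := by
  have h1 : HasDerivAt (fun t => Real.exp (-(p * t))) (Real.exp (-(p * t)) * (-p)) t := by
    have : HasDerivAt (fun t => -(p * t)) (-p) t := by
      simpa using (hasDerivAt_id t).const_mul (-p)
    exact this.exp
  have h2 : HasDerivAt (fun t => Real.exp (r * t)) (Real.exp (r * t) * r) t := by
    have : HasDerivAt (fun t => r * t) r t := by simpa using (hasDerivAt_id t).const_mul r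
    exact this.exp
  have h3 : HasDerivAt (fun t => c (Real.exp t • x))
      (fderiv ℝ c (Real.exp t • x) (Real.exp t • x)) t := by
    have h4 : HasFDerivAt c (fderiv ℝ c (Real.exp t • x)) (Real.exp t • x) :=
      (hc.differentiable one_ne_zero _).hasFDerivAt
    exact h4.comp_hasDerivAt t ((Real.hasDerivAt_exp t).smul_const x)
  exact (h1.mul h3).sub (h2.mul_const (c x))

lemma abs_fderiv_apply_self_le {c : Space n → ℝ} {K δ : ℝ}
    (hc : ∀ x, ‖fderiv ℝ c x‖ ≤ K * bracket (-δ) x) (x : Space n) :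
    |fderiv ℝ c x x| ≤ K * bracket (1 - δ) x := by
  have h1 := (fderiv ℝ c x).le_opNorm x
  have h0 := norm_le_bracket x
  have hb := bracket_pos 1 x
  calc |fderiv ℝ c x x| ≤ ‖fderiv ℝ c x‖ * ‖x‖ := h1
    _ ≤ K * bracket (-δ) x * bracket 1 x :=
        mul_le_mul (hc x) h0 (norm_nonneg _) ((norm_nonneg _).trans (hc x))
    _ = K * bracket (1 - δ) x := by
        rw [mul_assoc, bracket_mul_bracket]; ring_nf

/-- The mean value inequality in t gives a bound for the difference quotients uniform in x, as
dominated convergence requires. Only c and x·∇c must be bounded. -/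
lemma abs_dilDiff_le {c : Space n → ℝ} (hc : ContDiff ℝ 1 c) {K : ℝ} (hK : ∀ x, |c x| ≤ K)
    (hK' : ∀ x, |fderiv ℝ c x x| ≤ K) {p r : ℝ} (hp : 0 ≤ p) (hp1 : p ≤ 1) (hr : 0 ≤ r)
    (hr1 : r ≤ 1) {t : ℝ} (ht : |t| ≤ 1) (x : Space n) :
    |dilDiff c p r t x| ≤ 3 * Real.exp 1 * K * |t| := by
  have hK0 : 0 ≤ K := (abs_nonneg _).trans (hK 0)
  have key : ∀ s ∈ Icc (-1 : ℝ) 1, ‖Real.exp (-(p * s)) * (-p) * c (Real.exp s • x) +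
      Real.exp (-(p * s)) * fderiv ℝ c (Real.exp s • x) (Real.exp s • x) -
      Real.exp (r * s) * r * c x‖ ≤ 3 * Real.exp 1 * K := by
    intro s hs
    have e1 : Real.exp (-(p * s)) ≤ Real.exp 1 := Real.exp_le_exp.mpr (by
      nlinarith [hs.1, hs.2, mul_nonneg hp (by linarith [hs.1] : 0 ≤ 1 + s)])
    have e2 : Real.exp (r * s) ≤ Real.exp 1 := Real.exp_le_exp.mpr (by
      nlinarith [hs.1, hs.2, mul_nonneg hr (by linarith [hs.2] : 0 ≤ 1 - s)])
    have h1 : ‖Real.exp (-(p * s)) * (-p) * c (Real.exp s • x)‖ ≤ Real.exp 1 * K := by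
      rw [norm_mul, norm_mul, Real.norm_of_nonneg (Real.exp_pos _).le, norm_neg,
        Real.norm_of_nonneg hp]
      exact mul_le_mul ((mul_le_of_le_one_right (Real.exp_pos _).le hp1).trans e1) (hK _)
        (norm_nonneg _) (Real.exp_pos _).le
    have h2 : ‖Real.exp (-(p * s)) * fderiv ℝ c (Real.exp s • x) (Real.exp s • x)‖ ≤
        Real.exp 1 * K := by
      rw [norm_mul, Real.norm_of_nonneg (Real.exp_pos _).le]
      exact mul_le_mul e1 (hK' _) (norm_nonneg _) (Real.exp_pos _).le
    have h3 : ‖Real.exp (r * s) * r * c x‖ ≤ Real.exp 1 * K := by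
      rw [norm_mul, norm_mul, Real.norm_of_nonneg (Real.exp_pos _).le, Real.norm_of_nonneg hr]
      exact mul_le_mul ((mul_le_of_le_one_right (Real.exp_pos _).le hr1).trans e2) (hK _)
        (norm_nonneg _) (Real.exp_pos _).le
    refine (norm_sub_le _ _).trans ?_
    linarith [norm_add_le (Real.exp (-(p * s)) * (-p) * c (Real.exp s • x))
      (Real.exp (-(p * s)) * fderiv ℝ c (Real.exp s • x) (Real.exp s • x))]
  have h0 : dilDiff c p r 0 x = 0 := by simp [dilDiff]
  have := Convex.norm_image_sub_le_of_norm_hasDerivWithin_le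
    (fun s _ => (hasDerivAt_dilDiff hc p r s x).hasDerivWithinAt) key (convex_Icc (-1 : ℝ) 1)
    (show (0 : ℝ) ∈ Icc (-1 : ℝ) 1 by simp) (abs_le.mp ht)
  rwa [h0, sub_zero, sub_zero] at this

lemma isMultiplier_dilDiff {c : Space n → ℝ} (hc : Continuous c) {K : ℝ} (hK : ∀ x, |c x| ≤ K)
    (p r t : ℝ) : IsMultiplier (dilDiff c p r t) := by
  have h1 : IsMultiplier (fun x => c (Real.exp t • x)) :=
    .of_continuous (hc.comp (continuous_const_smul _)) fun x => hK _
  have h2 : IsMultiplier c := .of_continuous hc hK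
  have h3 := (h1.const_mul (Real.exp (-(p * t)))).add (h2.const_mul (-Real.exp (r * t)))
  convert h3 using 2 with x
  rw [dilDiff]; ring

/-- The derivative of the dilated coefficient. -/
def dilCoeff (c : Space n → ℝ) (p r : ℝ) (x : Space n) : ℝ :=
  fderiv ℝ c x x - (p + r) * c x

/-- The coefficient vanishes at t = 0, so its quotient converges boundedly while the dilate of y
merely converges to y. The vector y need not be differentiable along dilations; in the application
it is a first derivative. -/
lemma hasDerivAt_inner_mulOp_dilDiff {c : Space n → ℝ} (hc : ContDiff ℝ 1 c) {K : ℝ}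
    (hK : ∀ x, |c x| ≤ K) (hK' : ∀ x, |fderiv ℝ c x x| ≤ K) {p r : ℝ} (hp : 0 ≤ p) (hp1 : p ≤ 1)
    (hr : 0 ≤ r) (hr1 : r ≤ 1) (x y : L2 n) :
    HasDerivAt (fun t : ℝ => inner ℂ x (mulOp (dilDiff c p r t) (dilate t y)))
      (inner ℂ x (mulOp (dilCoeff c p r) y)) 0 := by
  have hm : ∀ t, IsMultiplier (dilDiff c p r t) := isMultiplier_dilDiff hc.continuous hK p r
  have hfd : Continuous (fun x => fderiv ℝ c x x) :=
    (hc.continuous_fderiv one_ne_zero).clm_apply continuous_id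
  have hg : IsMultiplier (dilCoeff c p r) := by
    have h1 : IsMultiplier (fun x => fderiv ℝ c x x) := .of_continuous hfd hK'
    have h2 : IsMultiplier c := .of_continuous hc.continuous hK
    have h3 := h1.add (h2.const_mul (-(p + r)))
    convert h3 using 2 with x
    rw [dilCoeff]; ring
  have h0 : dilDiff c p r 0 = fun _ => 0 := by ext1 x; simp [dilDiff]
  rw [hasDerivAt_iff_tendsto_slope]
  have hsmall : ∀ᶠ t : ℝ in 𝓝[≠] 0, |t| ≤ 1 ∧ t ≠ 0 := by
    refine (eventually_nhdsWithin_of_eventually_nhds ?_).and self_mem_nhdsWithin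
    filter_upwards [Metric.closedBall_mem_nhds (0 : ℝ) one_pos] with t ht
    simpa using ht
  have hlim : Tendsto (fun t : ℝ => inner ℂ x (mulOp (fun z => t⁻¹ * dilDiff c p r t z)
      (dilate t y))) (𝓝[≠] 0) (𝓝 (inner ℂ x (mulOp (dilCoeff c p r) y))) := by
    refine tendsto_const_nhds.inner (tendsto_mulOp_apply (C := 3 * Real.exp 1 * K)
      (Eventually.of_forall fun t => (hm t).const_mul _) hg ?_ ?_
      ((tendsto_dilate y).mono_left nhdsWithin_le_nhds))
    · filter_upwards [hsmall] with t ht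
      refine Eventually.of_forall fun z => ?_
      rw [abs_mul, abs_inv, inv_mul_le_iff₀ (abs_pos.mpr ht.2), mul_comm |t|]
      exact abs_dilDiff_le hc hK hK' hp hp1 hr hr1 ht.1 z
    · refine Eventually.of_forall fun z => ?_
      have h1 := hasDerivAt_iff_tendsto_slope.mp (hasDerivAt_dilDiff hc p r 0 z)
      refine (h1.congr fun t => ?_).trans (by simp [dilCoeff]; ring_nf)
      rw [slope_def_field, h0]
      simp [div_eq_inv_mul]
  refine hlim.congr fun t => ?_
  rw [slope_def_module, h0, mulOp_const, mulOp_const_mul _ (hm t), inner_smul_right]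
  simp


namespace IsModel

lemma isMultiplier_V₁_mul_bracket (M : IsModel h K δ P q V₁ T T₂) :
    IsMultiplier (fun x => V₁ x * bracket 1 x) := by
  refine ⟨M.V₁_meas.mul (continuous_bracket 1).aestronglyMeasurable, K, ?_⟩
  filter_upwards [M.V₁_le] with x hx
  have hb := bracket_pos 1 x
  rw [abs_mul, abs_of_pos hb]
  calc _ ≤ K * bracket (-δ) x * bracket 1 x := mul_le_mul_of_nonneg_right hx hb.le
    _ = K * bracket (-δ + 1) x := by rw [mul_assoc, bracket_mul_bracket]
    _ ≤ K := mul_le_of_le_one_right M.K_nonneg (bracket_le_one (by linarith [M.one_le_δ]) x)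

/-- V₁ cannot be differentiated. Its decay supplies the weight ⟨x⟩⁻¹ under which the dilates of the
vector are differentiable instead. -/
lemma mulOp_V₁ (M : IsModel h K δ P q V₁ T T₂) (u : L2 n) :
    mulOp V₁ u = mulOp (fun x => V₁ x * bracket 1 x) (wt n 1 u) := by
  rw [wt, mulOp_mulOp M.isMultiplier_V₁_mul_bracket (isMultiplier_wt zero_le_one)]
  congr 2
  ext1 x
  rw [mul_assoc, bracket_mul_bracket]; simp

/-- One power of the weight is spent on making the generator of dilations bounded by first
derivatives; a - 1 powers remain. -/
lemma hasDerivAt_inner_dilate_right {a : ℝ} (ha : 1 ≤ a) (M : IsModel h K δ P q V₁ T T₂)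
    (u : P.domain) (f : L2 n) :
    HasDerivAt (fun t : ℝ => inner ℂ (wt n a f) (dilate t (u : L2 n)))
      (inner ℂ (wt n (a - 1) f) (dilGen h u fun j => der T (some j) u)) 0 := by
  have h1 := HasD.hasDerivAt_dilate M.h_pos.ne' (fun j => M.hasDo_der (some j) u)
  have h2 := (HasDerivAt.inner ℂ (hasDerivAt_const (0 : ℝ) (wt n (a - 1) f)) h1)
  simp only [inner_zero_left, add_zero] at h2
  refine h2.congr_of_eventuallyEq (Eventually.of_forall fun t => ?_)
  dsimp only
  rw [← inner_wt_left zero_le_one, ← mul_apply_eq_comp, ← wt_add zero_le_one (by linarith)]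
  simp

lemma hasDerivAt_inner_dilate_neg_left {a : ℝ} (ha : 1 ≤ a) (M : IsModel h K δ P q V₁ T T₂)
    (u : P.domain) (f : L2 n) :
    HasDerivAt (fun t : ℝ => inner ℂ (dilate (-t) (u : L2 n)) (wt n a f))
      (-inner ℂ (dilGen h u fun j => der T (some j) u) (wt n (a - 1) f)) 0 := by
  have h1 := HasD.hasDerivAt_dilate M.h_pos.ne' (fun j => M.hasDo_der (some j) u)
  have h1' : HasDerivAt (fun t : ℝ => wt n 1 (dilate (-t) (u : L2 n)))
      (-(dilGen h u fun j => der T (some j) u)) 0 := by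
    have h3 : HasDerivAt (fun t : ℝ => wt n 1 (dilate t (u : L2 n)))
        (dilGen h u fun j => der T (some j) u) (-0) := by rwa [neg_zero]
    have h4 := h3.scomp (0 : ℝ) (hasDerivAt_neg (0 : ℝ))
    rw [neg_one_smul] at h4
    exact h4
  have h2 := (HasDerivAt.inner ℂ h1' (hasDerivAt_const (0 : ℝ) (wt n (a - 1) f)))
  simp only [inner_zero_right, zero_add, inner_neg_left] at h2
  refine h2.congr_of_eventuallyEq (Eventually.of_forall fun t => ?_)
  dsimp only
  rw [inner_wt_left zero_le_one, ← mul_apply_eq_comp, ← wt_add zero_le_one (by linarith)]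
  simp

lemma abs_fderiv_q_self_le (M : IsModel h K δ P q V₁ T T₂) (α β : Option (Fin n)) (x : Space n) :
    |fderiv ℝ (q α β) x x| ≤ K * bracket (1 - δ) x :=
  abs_fderiv_apply_self_le (M.fderiv_q_le α β) x

/-- The derivative at zero of the commutator with dilations, as a quadratic form. -/
lemma hasDerivAt_dilation_form (M : IsModel h K δ P q V₁ T T₂) (v u : P.domain) :
    HasDerivAt (fun t : ℝ => inner ℂ (dilate (-t) (v : L2 n)) (P u) -
        inner ℂ (P v) (dilate t (u : L2 n)))
      ((∑ α, ∑ β, inner ℂ (der T α v) (mulOp (dilCoeff (q α β) (ord α) (ord β)) (der T β u))) -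
        h * (inner ℂ (dilGen h v fun j => der T (some j) v)
            (mulOp (fun x => V₁ x * bracket 1 x) (u : L2 n)) +
          inner ℂ (mulOp (fun x => V₁ x * bracket 1 x) (v : L2 n))
            (dilGen h u fun j => der T (some j) u))) 0 := by
  have hK' : ∀ α β x, |fderiv ℝ (q α β) x x| ≤ K := fun α β x => (M.abs_fderiv_q_self_le α β x).trans
    (mul_le_of_le_one_right M.K_nonneg (bracket_le_one (by linarith [M.one_le_δ]) x))
  have d1 : HasDerivAt (fun t : ℝ => ∑ α, ∑ β, inner ℂ (der T α v)
      (mulOp (dilDiff (q α β) (ord α) (ord β) t) (dilate t (der T β u)))) _ 0 :=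
    HasDerivAt.fun_sum fun α (_ : α ∈ Finset.univ) => HasDerivAt.fun_sum fun β
      (_ : β ∈ Finset.univ) => hasDerivAt_inner_mulOp_dilDiff (M.q_contDiff α β) (M.q_le α β)
        (hK' α β) (ord_nonneg α) (ord_le_one α) (ord_nonneg β) (ord_le_one β) (der T α v) (der T β u)
  have hm := M.isMultiplier_V₁_mul_bracket
  have d2 : HasDerivAt (fun t : ℝ => inner ℂ (dilate (-t) (v : L2 n)) (mulOp V₁ (u : L2 n)))
      (-inner ℂ (dilGen h v fun j => der T (some j) v)
        (mulOp (fun x => V₁ x * bracket 1 x) (u : L2 n))) 0 := by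
    have := M.hasDerivAt_inner_dilate_neg_left le_rfl v
      (mulOp (fun x => V₁ x * bracket 1 x) (u : L2 n))
    simp only [sub_self, wt_zero, one_apply_eq_self] at this
    have e0 : mulOp V₁ (u : L2 n) = wt n 1 (mulOp (fun x => V₁ x * bracket 1 x) (u : L2 n)) := by
      rw [M.mulOp_V₁, wt, mulOp_mulOp hm (isMultiplier_wt zero_le_one),
        mulOp_mulOp (isMultiplier_wt zero_le_one) hm]
      simp_rw [mul_comm]
    rwa [e0]
  have d3 : HasDerivAt (fun t : ℝ => inner ℂ (v : L2 n) (mulOp V₁ (dilate t (u : L2 n))))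
      (inner ℂ (mulOp (fun x => V₁ x * bracket 1 x) (v : L2 n))
        (dilGen h u fun j => der T (some j) u)) 0 := by
    have := M.hasDerivAt_inner_dilate_right le_rfl u
      (mulOp (fun x => V₁ x * bracket 1 x) (v : L2 n))
    simp only [sub_self, wt_zero, one_apply_eq_self] at this
    convert this using 2 with t
    rw [inner_wt_left zero_le_one, inner_mulOp_left hm, M.mulOp_V₁]
  refine ((d1.add ((d2.sub d3).const_mul (h : ℂ))).congr_of_eventuallyEq
    (Eventually.of_forall fun t => ?_)).congr_deriv (by ring)
  have e1 := M.inner_apply_right u (v := dilate (-t) (v : L2 n))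
    (fun α => (M.hasDo_der α v).dilate (-t))
  have e2 := M.inner_apply_left v (u := dilate t (u : L2 n)) (fun α => (M.hasDo_der α u).dilate t)
  simp only [Pi.add_apply, Pi.sub_apply]
  rw [e1, e2, add_sub_add_comm, ← Finset.sum_sub_distrib, ← mul_sub]
  congr 1
  refine Finset.sum_congr rfl fun α _ => ?_
  rw [← Finset.sum_sub_distrib]
  refine Finset.sum_congr rfl fun β _ => ?_
  have hq := (M.isC1Bounded_q α β).isMultiplier
  have hqt : IsMultiplier fun x => q α β (Real.exp t • x) :=
    .of_continuous ((M.q_contDiff α β).continuous.comp (continuous_const_smul _))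
      fun x => M.q_le α β _
  -- Transporting the dilation from one side of the pairing to the other scales 𝒟_α and 𝒟_β by their
  -- orders, so that only the coefficient feels the difference.
  have e3 : mulOp (dilDiff (q α β) (ord α) (ord β) t) (dilate t (der T β u)) =
      ((Real.exp (ord α * -t) : ℝ) : ℂ) • dilate t (mulOp (q α β) (der T β u)) -
      ((Real.exp (ord β * t) : ℝ) : ℂ) • mulOp (q α β) (dilate t (der T β u)) := by
    have e4 : dilDiff (q α β) (ord α) (ord β) t = fun x =>
        Real.exp (ord α * -t) * q α β (Real.exp t • x) + -Real.exp (ord β * t) * q α β x := by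
      ext1 x
      rw [dilDiff, mul_neg]; ring
    rw [mulOp_dilate hq t hqt, e4, mulOp_add (hqt.const_mul _) (hq.const_mul _),
      mulOp_const_mul _ hqt, mulOp_const_mul _ hq, Complex.ofReal_neg, neg_smul, sub_eq_add_neg]
  rw [e3, map_smul, inner_sub_right, inner_smul_right, inner_smul_right, inner_smul_left,
    Complex.conj_ofReal, inner_dilate_right]

end IsModel

end Dilation

/-! ### The virial form and its short range remainder. -/

section Virial

open scoped ComplexConjugate InnerProductSpace

variable {n : ℕ} {h K δ : ℝ} {P : L2 n →ₗ.[ℂ] L2 n}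
  {q : Option (Fin n) → Option (Fin n) → Space n → ℝ}
  {V₁ : Space n → ℝ} {T : Option (Fin n) → L2 n →L[ℂ] L2 n} {T₂ : Fin n → L2 n →L[ℂ] L2 n}

/-- The first order contribution of the potential `V₁` to the virial form. -/
def potCoeff (V₁ : Space n → ℝ) : Option (Fin n) → Option (Fin n) → Space n → ℝ
  | some k, none => fun x => x k * V₁ x
  | none, some k => fun x => (-1) * (x k * V₁ x)
  | _, _ => fun _ => 0

/-- The zero order contribution of the potential `V₁` to the virial form. -/
def potConst (n : ℕ) (h : ℝ) : Option (Fin n) → Option (Fin n) → ℝ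
  | none, none => (2 - n) * h
  | _, _ => 0

/-- The real part of the coefficients of the virial form. -/
def virialCoeff (h : ℝ) (q : Option (Fin n) → Option (Fin n) → Space n → ℝ) (V₁ : Space n → ℝ)
    (α β : Option (Fin n)) (x : Space n) : ℝ :=
  dilCoeff (q α β) (ord α) (ord β) x + (2 * q α β x + potConst n h α β * V₁ x)

/-- The coefficients of the virial form, as operators. -/
def virialOp (h : ℝ) (q : Option (Fin n) → Option (Fin n) → Space n → ℝ) (V₁ : Space n → ℝ)
    (α β : Option (Fin n)) : L2 n →L[ℂ] L2 n :=
  mulOp (virialCoeff h q V₁ α β) + Complex.I • mulOp (potCoeff V₁ α β)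

lemma norm_inner_mulOp_le {r : Space n → ℝ} (hr : IsMultiplier r) {a b C : ℝ} (ha : 0 ≤ a)
    (hb : 0 ≤ b) (h : ∀ᵐ x, |r x| ≤ C * bracket (-(a + b)) x) (x y : L2 n) :
    ‖inner ℂ x (mulOp r y)‖ ≤ C * (‖wt n a x‖ * ‖wt n b y‖) := by
  have h1 : ∀ᵐ x, |r x * bracket a x| ≤ C * |bracket (-b) x| := by
    filter_upwards [h] with x hx
    rw [abs_mul, abs_of_pos (bracket_pos a x), abs_of_pos (bracket_pos _ x)]
    refine (mul_le_mul_of_nonneg_right hx (bracket_pos a x).le).trans_eq ?_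
    rw [mul_assoc, bracket_mul_bracket]; ring_nf
  have h2 : IsMultiplier (fun x => r x * bracket a x) := by
    refine ⟨hr.1.mul (continuous_bracket a).aestronglyMeasurable, |C|, ?_⟩
    filter_upwards [h1] with x hx
    refine hx.trans ?_
    rw [abs_of_pos (bracket_pos _ x)]
    exact (mul_le_mul_of_nonneg_right (le_abs_self C) (bracket_pos _ x).le).trans
      (mul_le_of_le_one_right (abs_nonneg _) (bracket_le_one (by linarith) x))
  have h3 : mulOp r y = wt n a (mulOp (fun x => r x * bracket a x) y) := by
    rw [wt, mulOp_mulOp (isMultiplier_wt ha) h2]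
    congr 2
    ext1 x
    rw [mul_comm, mul_assoc, bracket_mul_bracket]; simp
  rw [h3, ← inner_wt_left ha]
  refine (norm_inner_le_norm _ _).trans ?_
  calc _ ≤ ‖wt n a x‖ * (C * ‖wt n b y‖) :=
        mul_le_mul_of_nonneg_left (norm_mulOp_le_mul h2 (isMultiplier_wt hb) h1 y) (norm_nonneg _)
    _ = _ := by ring

namespace IsModel

lemma ae_abs_apply_mul_V₁_le (M : IsModel h K δ P q V₁ T T₂) (k : Fin n) :
    ∀ᵐ x : Space n, |x k * V₁ x| ≤ K * bracket (1 - δ) x := by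
  filter_upwards [M.V₁_le] with x hx
  rw [abs_mul]
  calc _ ≤ bracket 1 x * (K * bracket (-δ) x) :=
        mul_le_mul (abs_apply_le_bracket x k) hx (abs_nonneg _) (bracket_pos 1 x).le
    _ = K * (bracket 1 x * bracket (-δ) x) := by ring
    _ = _ := by rw [bracket_mul_bracket]; ring_nf

lemma ae_abs_potCoeff_le (M : IsModel h K δ P q V₁ T T₂) (α β : Option (Fin n)) :
    ∀ᵐ x : Space n, |potCoeff V₁ α β x| ≤ K * bracket (1 - δ) x := by
  have h0 : ∀ x : Space n, 0 ≤ K * bracket (1 - δ) x := fun x =>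
    mul_nonneg M.K_nonneg (bracket_pos _ x).le
  cases α with
  | none =>
    cases β with
    | none => exact Eventually.of_forall fun x => by simpa [potCoeff] using h0 x
    | some k => simpa [potCoeff] using M.ae_abs_apply_mul_V₁_le k
  | some k =>
    cases β with
    | none => exact M.ae_abs_apply_mul_V₁_le k
    | some k => exact Eventually.of_forall fun x => by simpa [potCoeff] using h0 x

lemma isMultiplier_apply_mul_V₁ (M : IsModel h K δ P q V₁ T T₂) (k : Fin n) :
    IsMultiplier (fun x : Space n => x k * V₁ x) := by
  refine ⟨(by fun_prop : Continuous fun x : Space n => x k).aestronglyMeasurable.mul M.V₁_meas,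
    K, ?_⟩
  filter_upwards [M.ae_abs_apply_mul_V₁_le k] with x hx
  exact hx.trans (mul_le_of_le_one_right M.K_nonneg (bracket_le_one (by linarith [M.one_le_δ]) x))

lemma isMultiplier_potCoeff (M : IsModel h K δ P q V₁ T T₂) (α β : Option (Fin n)) :
    IsMultiplier (potCoeff V₁ α β) := by
  cases α with
  | none =>
    cases β with
    | none => exact IsMultiplier.const 0
    | some k => exact (M.isMultiplier_apply_mul_V₁ k).const_mul _
  | some k =>
    cases β with
    | none => exact M.isMultiplier_apply_mul_V₁ k
    | some k => exact IsMultiplier.const 0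

lemma isMultiplier_dilCoeff (M : IsModel h K δ P q V₁ T T₂) (α β : Option (Fin n)) :
    IsMultiplier (dilCoeff (q α β) (ord α) (ord β)) := by
  have h1 : IsMultiplier (fun x => fderiv ℝ (q α β) x x) :=
    .of_continuous (((M.q_contDiff α β).continuous_fderiv one_ne_zero).clm_apply continuous_id)
      fun x => (M.abs_fderiv_q_self_le α β x).trans
        (mul_le_of_le_one_right M.K_nonneg (bracket_le_one (by linarith [M.one_le_δ]) x))
  have h3 := h1.add ((M.isC1Bounded_q α β).isMultiplier.const_mul (-(ord α + ord β)))
  convert h3 using 2 with x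
  rw [dilCoeff]; ring

lemma isMultiplier_virialCoeff (M : IsModel h K δ P q V₁ T T₂) (α β : Option (Fin n)) :
    IsMultiplier (virialCoeff h q V₁ α β) :=
  (M.isMultiplier_dilCoeff α β).add (((M.isC1Bounded_q α β).isMultiplier.const_mul 2).add
    (M.isMultiplier_V₁.const_mul (potConst n h α β)))

lemma abs_potConst_le (M : IsModel h K δ P q V₁ T T₂) (α β : Option (Fin n)) :
    |potConst n h α β| ≤ 2 + n := by
  have hn : (0 : ℝ) ≤ n := by positivity
  have h1 : |(2 - (n : ℝ)) * h| ≤ 2 + n := by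
    rw [abs_mul, abs_of_pos M.h_pos]
    refine (mul_le_of_le_one_right (abs_nonneg _) M.h_le).trans ?_
    exact abs_le.mpr ⟨by linarith, by linarith⟩
  cases α <;> cases β <;> simp only [potConst, abs_zero] <;> first | exact h1 | positivity

/-- For second order entries the term -2q of `dilCoeff` cancels 2q and only x·∇q is left; for the
other entries q itself decays. The constant 5 + n collects 1 from x·∇q, 2 from q and 2 + n from V₁.
-/
lemma ae_abs_virialCoeff_le (M : IsModel h K δ P q V₁ T T₂) (α β : Option (Fin n)) :
    ∀ᵐ x : Space n, |virialCoeff h q V₁ α β x| ≤ ((5 + n) * K) * bracket (1 - δ) x := by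
  filter_upwards [M.V₁_le] with x hV
  have hK := M.K_nonneg
  have hb : bracket (-δ) x ≤ bracket (1 - δ) x := bracket_le_bracket (by linarith) x
  have hb0 := bracket_pos (-δ) x
  have h1 := M.abs_fderiv_q_self_le α β x
  have h2 : |(2 - (ord α + ord β)) * q α β x| ≤ 2 * (K * bracket (-δ) x) := by
    have key : ∀ β, |q none β x| ≤ K * bracket (-δ) x := fun β => M.q_none_le β x
    have h0 : 0 ≤ K * bracket (-δ) x := by positivity
    cases α with
    | none =>
      rw [abs_mul]
      refine mul_le_mul ?_ (key β) (abs_nonneg _) zero_le_two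
      have := ord_nonneg β; have := ord_le_one β
      rw [show ord (none : Option (Fin n)) = 0 from rfl]
      exact abs_le.mpr ⟨by linarith, by linarith⟩
    | some k =>
      cases β with
      | none =>
        rw [abs_mul, M.q_symm]
        refine mul_le_mul ?_ (key _) (abs_nonneg _) zero_le_two
        rw [show ord (none : Option (Fin n)) = 0 from rfl, show ord (some k) = 1 from rfl]
        norm_num
      | some l =>
        rw [show ord (some k) = 1 from rfl, show ord (some l) = 1 from rfl]
        norm_num
        positivity
  have h3 : |potConst n h α β * V₁ x| ≤ (2 + n) * (K * bracket (-δ) x) := by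
    rw [abs_mul]
    exact mul_le_mul (M.abs_potConst_le α β) hV (abs_nonneg _) (by positivity)
  have h4 : K * bracket (-δ) x ≤ K * bracket (1 - δ) x := mul_le_mul_of_nonneg_left hb hK
  have h5 : virialCoeff h q V₁ α β x = fderiv ℝ (q α β) x x + (2 - (ord α + ord β)) * q α β x +
      potConst n h α β * V₁ x := by
    rw [virialCoeff, dilCoeff]; ring
  rw [h5]
  refine (abs_add_le _ _).trans ((add_le_add (abs_add_le _ _) le_rfl).trans ?_)
  have h6 : (2 + (n : ℝ)) * (K * bracket (-δ) x) ≤ (2 + n) * (K * bracket (1 - δ) x) := by gcongr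
  linarith

/-- The decay ⟨x⟩¹⁻ᵟ may be distributed freely between the two vectors. This is where the threshold
δ - 1 for the regularity comes from. -/
lemma norm_inner_virialOp_le (M : IsModel h K δ P q V₁ T T₂) {a b : ℝ} (ha : 0 ≤ a) (hb : 0 ≤ b)
    (hab : a + b = δ - 1) (α β : Option (Fin n)) (x y : L2 n) :
    ‖inner ℂ x (virialOp h q V₁ α β y)‖ ≤ ((6 + n) * K) * (‖wt n a x‖ * ‖wt n b y‖) := by
  have e : 1 - δ = -(a + b) := by linarith
  have h1 := norm_inner_mulOp_le (M.isMultiplier_virialCoeff α β) ha hb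
    (e ▸ M.ae_abs_virialCoeff_le α β) x y
  have h2 := norm_inner_mulOp_le (M.isMultiplier_potCoeff α β) ha hb
    (e ▸ M.ae_abs_potCoeff_le α β) x y
  rw [virialOp, add_apply, smul_apply, inner_add_right, inner_smul_right]
  refine (norm_add_le _ _).trans ?_
  rw [norm_mul, Complex.norm_I, one_mul]
  linarith

/-- The factor h in front of V₁ cancels the h⁻¹ in the generator of dilations, so V₁ contributes
bounded coefficients. -/
lemma h_smul_dilGen (M : IsModel h K δ P q V₁ T T₂) (u : L2 n) (d : Fin n → L2 n) :
    (h : ℂ) • dilGen h u d = Complex.I • ∑ k, mulOp (fun x => x k * bracket (-1) x) (d k) +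
      ((h * n / 2 : ℝ) : ℂ) • wt n 1 u := by
  have hh : (h : ℂ) ≠ 0 := by exact_mod_cast M.h_pos.ne'
  rw [dilGen, smul_add, smul_smul, smul_smul]
  congr 2
  · field_simp
  · push_cast; ring

lemma mulOp_coord_mulOp_V₁ (M : IsModel h K δ P q V₁ T T₂) (k : Fin n) (u : L2 n) :
    mulOp (fun x => x k * bracket (-1) x) (mulOp (fun x => V₁ x * bracket 1 x) u) =
      mulOp (fun x => x k * V₁ x) u := by
  rw [mulOp_mulOp (isMultiplier_coord k) M.isMultiplier_V₁_mul_bracket]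
  congr 2
  ext1 x
  rw [show x k * bracket (-1) x * (V₁ x * bracket 1 x) =
    x k * V₁ x * (bracket (-1) x * bracket 1 x) by ring, bracket_mul_bracket]
  simp

lemma h_mul_inner_dilGen (M : IsModel h K δ P q V₁ T T₂) (u v : L2 n) (d : Fin n → L2 n) :
    h * inner ℂ (mulOp (fun x => V₁ x * bracket 1 x) v) (dilGen h u d) =
      Complex.I * ∑ k, inner ℂ v (mulOp (fun x => x k * V₁ x) (d k)) +
        ((h * n / 2 : ℝ) : ℂ) * inner ℂ v (mulOp V₁ u) := by
  rw [← inner_smul_right, M.h_smul_dilGen, inner_add_right, inner_smul_right, inner_smul_right,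
    inner_sum]
  congr 2
  · refine Finset.sum_congr rfl fun k _ => ?_
    rw [← inner_mulOp_left (isMultiplier_coord k), M.mulOp_coord_mulOp_V₁,
      inner_mulOp_left (M.isMultiplier_apply_mul_V₁ k)]
  · rw [inner_mulOp_left M.isMultiplier_V₁_mul_bracket, M.mulOp_V₁]

lemma h_mul_inner_dilGen_left (M : IsModel h K δ P q V₁ T T₂) (u v : L2 n) (d : Fin n → L2 n) :
    h * inner ℂ (dilGen h v d) (mulOp (fun x => V₁ x * bracket 1 x) u) =
      -(Complex.I * ∑ k, inner ℂ (d k) (mulOp (fun x => x k * V₁ x) u)) +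
        ((h * n / 2 : ℝ) : ℂ) * inner ℂ v (mulOp V₁ u) := by
  have := congrArg conj (M.h_mul_inner_dilGen v u d)
  rw [map_mul, inner_conj_symm, Complex.conj_ofReal] at this
  rw [this, map_add, map_mul, map_mul, Complex.conj_I, Complex.conj_ofReal, inner_conj_symm,
    map_sum, neg_mul, inner_mulOp_left M.isMultiplier_V₁]
  simp_rw [inner_conj_symm, inner_mulOp_left (M.isMultiplier_apply_mul_V₁ _)]

/-- The quadratic form of the commutator with dilations. -/
lemma virial_form (M : IsModel h K δ P q V₁ T T₂) (v u : P.domain) :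
    (∑ α, ∑ β, inner ℂ (der T α v) (mulOp (dilCoeff (q α β) (ord α) (ord β)) (der T β u))) -
        h * (inner ℂ (dilGen h v fun j => der T (some j) v)
            (mulOp (fun x => V₁ x * bracket 1 x) (u : L2 n)) +
          inner ℂ (mulOp (fun x => V₁ x * bracket 1 x) (v : L2 n))
            (dilGen h u fun j => der T (some j) u)) =
      -2 * inner ℂ (v : L2 n) (P u) +
        ∑ α, ∑ β, inner ℂ (der T α v) (virialOp h q V₁ α β (der T β u)) := by
  have e1 : ∀ α β, inner ℂ (der T α v) (virialOp h q V₁ α β (der T β u)) =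
      inner ℂ (der T α v) (mulOp (dilCoeff (q α β) (ord α) (ord β)) (der T β u)) +
      2 * inner ℂ (der T α v) (mulOp (q α β) (der T β u)) +
      (potConst n h α β * inner ℂ (der T α v) (mulOp V₁ (der T β u)) +
        Complex.I * inner ℂ (der T α v) (mulOp (potCoeff V₁ α β) (der T β u))) := by
    intro α β
    have hq := (M.isC1Bounded_q α β).isMultiplier
    have hV := M.isMultiplier_V₁
    rw [virialOp, add_apply, smul_apply, inner_add_right, inner_smul_right]
    unfold virialCoeff
    rw [mulOp_add (M.isMultiplier_dilCoeff α β) ((hq.const_mul 2).add (hV.const_mul _)),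
      mulOp_add (hq.const_mul 2) (hV.const_mul _), mulOp_const_mul _ hq, mulOp_const_mul _ hV,
      inner_add_right, inner_add_right, inner_smul_right, inner_smul_right]
    push_cast
    ring
  have e2 : ∑ α, ∑ β, (potConst n h α β : ℂ) * inner ℂ (der T α v) (mulOp V₁ (der T β u)) =
      (((2 - n) * h : ℝ) : ℂ) * inner ℂ (v : L2 n) (mulOp V₁ (u : L2 n)) := by
    simp [Fintype.sum_option, potConst, M.der_none]
  have e3 : ∑ α, ∑ β, inner ℂ (der T α v) (mulOp (potCoeff V₁ α β) (der T β u)) =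
      (∑ k, inner ℂ (der T (some k) v) (mulOp (fun x => x k * V₁ x) (u : L2 n))) -
      ∑ k, inner ℂ (v : L2 n) (mulOp (fun x => x k * V₁ x) (der T (some k) u)) := by
    have h0 : ∀ w : L2 n, mulOp (fun _ => 0) w = 0 := fun w => by rw [mulOp_const]; simp
    simp only [Fintype.sum_option, potCoeff, M.der_none, h0, inner_zero_right, zero_add,
      Finset.sum_const_zero, add_zero]
    simp_rw [mulOp_const_mul (-1) (M.isMultiplier_apply_mul_V₁ _), inner_smul_right]
    rw [← Finset.mul_sum]
    push_cast
    ring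
  simp_rw [e1, Finset.sum_add_distrib, ← Finset.mul_sum]
  rw [e2, e3, mul_add, M.h_mul_inner_dilGen, M.h_mul_inner_dilGen_left,
    M.inner_apply_right u (fun α => M.hasDo_der α v)]
  push_cast
  ring

end IsModel

end Virial

/-! ### The virial identity for powers of the resolvent. -/

section VirialResolvent

open scoped ComplexConjugate InnerProductSpace

variable {n : ℕ} {h K δ : ℝ} {P : L2 n →ₗ.[ℂ] L2 n}
  {q : Option (Fin n) → Option (Fin n) → Space n → ℝ}
  {V₁ : Space n → ℝ} {T : Option (Fin n) → L2 n →L[ℂ] L2 n} {T₂ : Fin n → L2 n →L[ℂ] L2 n}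

/-- The derivative `𝒟_α (P - z)⁻¹`. -/
def derRes (P : L2 n →ₗ.[ℂ] L2 n) (T : Option (Fin n) → L2 n →L[ℂ] L2 n) (z : ℂ)
    (α : Option (Fin n)) : L2 n →L[ℂ] L2 n :=
  T α * (1 + (z + Complex.I) • unboundedResolvent P z)

/-- The sum of virial forms associated with the powers of the resolvent. -/
def virialSum (h : ℝ) (q : Option (Fin n) → Option (Fin n) → Space n → ℝ) (V₁ : Space n → ℝ)
    (P : L2 n →ₗ.[ℂ] L2 n) (T : Option (Fin n) → L2 n →L[ℂ] L2 n) (k : ℕ) (z : ℂ) :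
    L2 n →L[ℂ] L2 n :=
  ∑ i ∈ Finset.range (k + 1), ∑ α, ∑ β,
    ContinuousLinearMap.adjoint (derRes P T (conj z) α * unboundedResolvent P (conj z) ^ (k - i)) *
      virialOp h q V₁ α β * (derRes P T z β * unboundedResolvent P z ^ i)

lemma inner_virialSum (k : ℕ) (z : ℂ) (f g : L2 n) : inner ℂ g (virialSum h q V₁ P T k z f) =
    ∑ i ∈ Finset.range (k + 1), ∑ α, ∑ β,
      inner ℂ (derRes P T (conj z) α ((unboundedResolvent P (conj z) ^ (k - i)) g))
        (virialOp h q V₁ α β (derRes P T z β ((unboundedResolvent P z ^ i) f))) := by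
  simp only [virialSum, sum_apply, inner_sum, mul_apply_eq_comp,
    ContinuousLinearMap.adjoint_inner_right]

lemma unboundedResolvent_pow_succ_apply (P : L2 n →ₗ.[ℂ] L2 n) (z : ℂ) (k : ℕ) (x : L2 n) :
    unboundedResolvent P z ((unboundedResolvent P z ^ k) x) =
      (unboundedResolvent P z ^ (k + 1)) x := by
  rw [pow_succ', mul_apply_eq_comp]

lemma inner_unboundedResolvent_pow_left (hP : IsSelfAdjoint P) {z : ℂ} (hz : z.im ≠ 0) (k : ℕ)
    (f g : L2 n) : inner ℂ ((unboundedResolvent P (conj z) ^ k) f) g =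
      inner ℂ f ((unboundedResolvent P z ^ k) g) := by
  have hz' : (conj z).im ≠ 0 := by simpa using hz
  induction k generalizing f with
  | zero => simp
  | succ k ih =>
    rw [pow_succ, mul_apply_eq_comp, ih, inner_unboundedResolvent_left hP hz', Complex.conj_conj,
      pow_succ', mul_apply_eq_comp]

namespace IsModel

lemma der_resolvent (M : IsModel h K δ P q V₁ T T₂) {z : ℂ} (hz : z.im ≠ 0)
    (α : Option (Fin n)) (x : L2 n) :
    der T α ⟨unboundedResolvent P z x, unboundedResolvent_mem M.isSelfAdjoint hz x⟩ =
      derRes P T z α x := by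
  rw [der, apply_unboundedResolvent M.isSelfAdjoint hz, derRes, mul_apply_eq_comp, add_apply,
    smul_apply, one_apply_eq_self, add_smul]
  congr 1
  abel

/-- The derivative at t = 0 of a sum of dilated forms is computed twice: term by term through the
virial form, and after telescoping, when only the two end terms carrying weights survive. -/
lemma virial_identity_aux (M : IsModel h K δ P q V₁ T T₂) {z : ℂ} (hz : z.im ≠ 0) {a b : ℝ}
    (ha : 1 ≤ a) (hb : 1 ≤ b) (k : ℕ) (f g : L2 n) :
    ∑ i ∈ Finset.range (k + 1),
      (-2 * inner ℂ ((unboundedResolvent P (conj z) ^ (k - i + 1)) (wt n b g))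
          (z • (unboundedResolvent P z ^ (i + 1)) (wt n a f) +
            (unboundedResolvent P z ^ i) (wt n a f)) +
        ∑ α, ∑ β, inner ℂ (derRes P T (conj z) α ((unboundedResolvent P (conj z) ^ (k - i)) (wt n b g)))
          (virialOp h q V₁ α β (derRes P T z β ((unboundedResolvent P z ^ i) (wt n a f))))) =
      -inner ℂ (dilGen h ((unboundedResolvent P (conj z) ^ (k + 1)) (wt n b g))
          fun j => derRes P T (conj z) (some j) ((unboundedResolvent P (conj z) ^ k) (wt n b g)))
        (wt n (a - 1) f) -
      inner ℂ (wt n (b - 1) g) (dilGen h ((unboundedResolvent P z ^ (k + 1)) (wt n a f))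
          fun j => derRes P T z (some j) ((unboundedResolvent P z ^ k) (wt n a f))) := by
  have hz' : (conj z).im ≠ 0 := by simpa using hz
  have hP := M.isSelfAdjoint
  obtain ⟨U, hU⟩ : ∃ U : ℕ → L2 n, U = fun i => (unboundedResolvent P z ^ i) (wt n a f) := ⟨_, rfl⟩
  obtain ⟨V, hV⟩ : ∃ V : ℕ → L2 n, V = fun i => (unboundedResolvent P (conj z) ^ i) (wt n b g) :=
    ⟨_, rfl⟩
  have hUs : ∀ i, U (i + 1) = unboundedResolvent P z (U i) := fun i => by
    rw [hU]; simp only [pow_succ', mul_apply_eq_comp]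
  have hVs : ∀ i, V (i + 1) = unboundedResolvent P (conj z) (V i) := fun i => by
    rw [hV]; simp only [pow_succ', mul_apply_eq_comp]
  have hUm : ∀ i, U (i + 1) ∈ P.domain := fun i => hUs i ▸ unboundedResolvent_mem hP hz _
  have hVm : ∀ i, V (i + 1) ∈ P.domain := fun i => hVs i ▸ unboundedResolvent_mem hP hz' _
  have hUP : ∀ i, P ⟨U (i + 1), hUm i⟩ = z • U (i + 1) + U i := fun i => by
    have := apply_unboundedResolvent hP hz (U i) (unboundedResolvent_mem hP hz _)
    simp_rw [hUs]; exact this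
  have hVP : ∀ i, P ⟨V (i + 1), hVm i⟩ = conj z • V (i + 1) + V i := fun i => by
    have := apply_unboundedResolvent hP hz' (V i) (unboundedResolvent_mem hP hz' _)
    simp_rw [hVs]; exact this
  have hUd : ∀ i α, der T α ⟨U (i + 1), hUm i⟩ = derRes P T z α (U i) := fun i α => by
    rw [← M.der_resolvent hz]; simp_rw [hUs]
  have hVd : ∀ i α, der T α ⟨V (i + 1), hVm i⟩ = derRes P T (conj z) α (V i) := fun i α => by
    rw [← M.der_resolvent hz']; simp_rw [hVs]
  have hD : ∀ i, HasDerivAt (fun t : ℝ => inner ℂ (dilate (-t) (V (k - i + 1))) (P ⟨U (i + 1), hUm i⟩) -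
        inner ℂ (P ⟨V (k - i + 1), hVm _⟩) (dilate t (U (i + 1))))
      (-2 * inner ℂ (V (k - i + 1)) (z • U (i + 1) + U i) +
        ∑ α, ∑ β, inner ℂ (derRes P T (conj z) α (V (k - i)))
          (virialOp h q V₁ α β (derRes P T z β (U i)))) 0 := fun i => by
    have h1 := M.hasDerivAt_dilation_form ⟨V (k - i + 1), hVm _⟩ ⟨U (i + 1), hUm i⟩
    rw [M.virial_form] at h1
    simp only [hUd, hVd, hUP] at h1 ⊢
    exact h1
  have hL := HasDerivAt.fun_sum fun i (_ : i ∈ Finset.range (k + 1)) => hD i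
  -- The contributions of z cancel because z passes through the inner product with its conjugate,
  -- and what is left is a difference of consecutive terms.
  have e : ∀ t : ℝ, ∑ i ∈ Finset.range (k + 1),
      (inner ℂ (dilate (-t) (V (k - i + 1))) (P ⟨U (i + 1), hUm i⟩) -
        inner ℂ (P ⟨V (k - i + 1), hVm _⟩) (dilate t (U (i + 1)))) =
      inner ℂ (dilate (-t) (V (k + 1))) (wt n a f) - inner ℂ (wt n b g) (dilate t (U (k + 1))) := by
    intro t
    have h0 : U 0 = wt n a f := by rw [hU]; simp
    have h0' : V 0 = wt n b g := by rw [hV]; simp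
    have := Finset.sum_range_sub' (fun i => inner ℂ (V (k + 1 - i)) (dilate t (U i))) (k + 1)
    simp only [Nat.sub_zero, Nat.sub_self, h0, h0'] at this
    rw [← inner_dilate_right, ← this]
    refine Finset.sum_congr rfl fun i hi => ?_
    have hik : k + 1 - i = k - i + 1 := by
      have := Finset.mem_range.mp hi; omega
    rw [hik, Nat.add_sub_add_right, hUP, hVP, ← inner_dilate_right, map_add, map_smul,
      inner_add_right, inner_add_left, inner_smul_right, inner_smul_left, Complex.conj_conj]
    ring
  simp_rw [e] at hL
  have hR := (M.hasDerivAt_inner_dilate_neg_left ha ⟨V (k + 1), hVm k⟩ f).sub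
    (M.hasDerivAt_inner_dilate_right hb ⟨U (k + 1), hUm k⟩ g)
  simp only [hUd, hVd] at hR
  have := hL.unique hR
  subst hU hV
  exact this

/-- The virial identity for powers of the resolvent. -/
lemma virial_identity (M : IsModel h K δ P q V₁ T T₂) {z : ℂ} (hz : z.im ≠ 0) {a b : ℝ}
    (ha : 1 ≤ a) (hb : 1 ≤ b) (k : ℕ) (f g : L2 n) :
    inner ℂ g ((wt n b * ((2 * (k + 1 : ℂ)) • (z • unboundedResolvent P z ^ (k + 2) +
      unboundedResolvent P z ^ (k + 1)) - virialSum h q V₁ P T k z) * wt n a) f) =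
      inner ℂ (dilGen h ((unboundedResolvent P (conj z) ^ (k + 1)) (wt n b g))
          fun j => derRes P T (conj z) (some j) ((unboundedResolvent P (conj z) ^ k) (wt n b g)))
        (wt n (a - 1) f) +
      inner ℂ (wt n (b - 1) g) (dilGen h ((unboundedResolvent P z ^ (k + 1)) (wt n a f))
          fun j => derRes P T z (some j) ((unboundedResolvent P z ^ k) (wt n a f))) := by
  have h1 := M.virial_identity_aux hz ha hb k f g
  rw [Finset.sum_add_distrib, ← inner_virialSum] at h1
  have h2 : ∀ i ∈ Finset.range (k + 1),
      -2 * inner ℂ ((unboundedResolvent P (conj z) ^ (k - i + 1)) (wt n b g))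
          (z • (unboundedResolvent P z ^ (i + 1)) (wt n a f) +
            (unboundedResolvent P z ^ i) (wt n a f)) =
      -2 * (z * inner ℂ (wt n b g) ((unboundedResolvent P z ^ (k + 2)) (wt n a f)) +
        inner ℂ (wt n b g) ((unboundedResolvent P z ^ (k + 1)) (wt n a f))) := by
    intro i hi
    have hik : i ≤ k := by have := Finset.mem_range.mp hi; omega
    have hp : ∀ (m l : ℕ) (x : L2 n), (unboundedResolvent P z ^ m) ((unboundedResolvent P z ^ l) x) =
        (unboundedResolvent P z ^ (m + l)) x := fun m l x => by
      rw [pow_add, mul_apply_eq_comp]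
    rw [inner_unboundedResolvent_pow_left M.isSelfAdjoint hz, map_add, map_smul, hp, hp,
      inner_add_right, inner_smul_right, show k - i + 1 + (i + 1) = k + 2 by omega,
      show k - i + 1 + i = k + 1 by omega]
  rw [Finset.sum_congr rfl h2, Finset.sum_const, Finset.card_range, nsmul_eq_mul] at h1
  rw [mul_apply_eq_comp, mul_apply_eq_comp, ← inner_wt_left (by linarith), sub_apply, smul_apply,
    add_apply, smul_apply, inner_sub_right, inner_smul_right, inner_add_right, inner_smul_right]
  rw [Nat.cast_add, Nat.cast_one] at h1
  linear_combination -h1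

/-- The factor h⁻¹ arises from x·∇ = (i/h) x·𝒟; it is later replaced by μ. -/
lemma norm_wt_dilGen_le (M : IsModel h K δ P q V₁ T T₂) {c : ℝ} (hc : 0 ≤ c) (u : L2 n)
    (d : Fin n → L2 n) :
    ‖wt n c (dilGen h u d)‖ ≤ (1 + n) * h⁻¹ * (‖wt n c u‖ + ∑ k, ‖wt n c (d k)‖) := by
  have hh := M.h_pos
  have hh1 : 1 ≤ h⁻¹ := (one_le_inv₀ hh).mpr M.h_le
  have e1 : ∀ k, ‖wt n c (mulOp (fun x => x k * bracket (-1) x) (d k))‖ ≤ ‖wt n c (d k)‖ := by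
    intro k
    have hk := isMultiplier_coord (n := n) k
    have e : wt n c (mulOp (fun x => x k * bracket (-1) x) (d k)) =
        mulOp (fun x => x k * bracket (-1) x) (wt n c (d k)) := by
      rw [wt, mulOp_mulOp (isMultiplier_wt hc) hk, mulOp_mulOp hk (isMultiplier_wt hc)]
      simp_rw [mul_comm]
    rw [e]
    refine (norm_mulOp_le hk (C := 1) (Eventually.of_forall fun x => ?_) _).trans_eq (one_mul _)
    have := mul_le_mul_of_nonneg_right (abs_apply_le_bracket x k) (bracket_pos (-1) x).le
    rw [bracket_mul_bracket, add_neg_cancel, bracket_zero] at this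
    rwa [abs_mul, abs_of_pos (bracket_pos _ x)]
  have e2 : ‖wt n c (wt n 1 u)‖ ≤ ‖wt n c u‖ := by
    rw [← mul_apply_eq_comp, ← wt_add hc zero_le_one]
    exact norm_wt_apply_le_of_le hc (by linarith) u
  rw [dilGen, map_add, map_smul, map_smul, map_sum]
  refine (norm_add_le _ _).trans ?_
  rw [norm_smul, norm_smul]
  have e3 : ‖Complex.I / (h : ℂ)‖ = h⁻¹ := by
    rw [norm_div, Complex.norm_I, Complex.norm_real, Real.norm_of_nonneg hh.le, one_div]
  have e4 : ‖(n : ℂ) / 2‖ = n / 2 := by simp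
  rw [e3, e4]
  have e5 : ‖∑ k, wt n c (mulOp (fun x => x k * bracket (-1) x) (d k))‖ ≤ ∑ k, ‖wt n c (d k)‖ :=
    (norm_sum_le _ _).trans (Finset.sum_le_sum fun k _ => e1 k)
  have hS0 : 0 ≤ ∑ k, ‖wt n c (d k)‖ := Finset.sum_nonneg fun _ _ => norm_nonneg _
  have hn : (0 : ℝ) ≤ n := by positivity
  have hu0 := norm_nonneg (wt n c u)
  refine (add_le_add (mul_le_mul_of_nonneg_left e5 (by positivity : 0 ≤ h⁻¹))
    (mul_le_mul_of_nonneg_left e2 (by positivity : 0 ≤ (n : ℝ) / 2))).trans ?_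
  generalize ∑ k, ‖wt n c (d k)‖ = S at hS0 ⊢
  generalize ‖wt n c u‖ = x at hu0 ⊢
  have h1 : (n : ℝ) / 2 * x ≤ n * h⁻¹ * x := by
    refine mul_le_mul_of_nonneg_right ?_ hu0
    have := mul_le_mul_of_nonneg_left hh1 hn
    linarith
  have h2 : 0 ≤ h⁻¹ * x + n * h⁻¹ * S := by positivity
  linarith

end IsModel

/-- Weighted elliptic estimate for the resolvent. -/
lemma exists_norm_wt_derRes_le (n : ℕ) {K a Z : ℝ} (hK : 0 ≤ K) (ha : 0 ≤ a) (hZ : 0 ≤ Z) :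
    ∃ C : ℝ, 0 ≤ C ∧
    ∀ {h δ : ℝ} {P : L2 n →ₗ.[ℂ] L2 n} {q : Option (Fin n) → Option (Fin n) → Space n → ℝ}
      {V₁ : Space n → ℝ} {T : Option (Fin n) → L2 n →L[ℂ] L2 n} {T₂ : Fin n → L2 n →L[ℂ] L2 n},
      IsModel h K δ P q V₁ T T₂ → ∀ {z : ℂ}, z.im ≠ 0 → ‖z‖ ≤ Z → ∀ x α,
      ‖wt n a (derRes P T z α x)‖ ≤
        C * (‖wt n a (unboundedResolvent P z x)‖ + ‖wt n a x‖) := by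
  obtain ⟨C, hC, H⟩ := IsModel.exists_norm_wt_le n hK ha
  refine ⟨C * (2 + Z), by positivity, ?_⟩
  intro h δ P q V₁ T T₂ M z hz hzZ x α
  have hP := M.isSelfAdjoint
  obtain ⟨_, _, h1⟩ := H M ⟨_, unboundedResolvent_mem hP hz x⟩
  have h2 := h1 α
  rw [M.der_resolvent hz, apply_unboundedResolvent hP hz] at h2
  refine h2.trans ?_
  rw [mul_assoc]
  refine mul_le_mul_of_nonneg_left ?_ hC
  have h3 : ‖wt n a (z • unboundedResolvent P z x + x)‖ ≤
      Z * ‖wt n a (unboundedResolvent P z x)‖ + ‖wt n a x‖ := by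
    rw [map_add, map_smul]
    refine (norm_add_le _ _).trans (add_le_add ?_ le_rfl)
    rw [norm_smul]
    gcongr
  have := norm_nonneg (wt n a (unboundedResolvent P z x))
  have := norm_nonneg (wt n a x)
  dsimp only
  nlinarith


/-- The weighted power `⟨x⟩⁻ᵇ (P - z)⁻ᵏ ⟨x⟩⁻ᵃ` of the resolvent. -/
def wres (P : L2 n →ₗ.[ℂ] L2 n) (b : ℝ) (k : ℕ) (a : ℝ) (z : ℂ) : L2 n →L[ℂ] L2 n :=
  wt n b * unboundedResolvent P z ^ k * wt n a

lemma wres_apply (P : L2 n →ₗ.[ℂ] L2 n) (b : ℝ) (k : ℕ) (a : ℝ) (z : ℂ) (f : L2 n) :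
    wres P b k a z f = wt n b ((unboundedResolvent P z ^ k) (wt n a f)) := rfl

lemma adjoint_unboundedResolvent_pow (hP : IsSelfAdjoint P) {z : ℂ} (hz : z.im ≠ 0) (k : ℕ) :
    ContinuousLinearMap.adjoint (unboundedResolvent P z ^ k) =
      unboundedResolvent P (conj z) ^ k := by
  rw [← ContinuousLinearMap.star_eq_adjoint, star_pow, ContinuousLinearMap.star_eq_adjoint,
    adjoint_unboundedResolvent hP hz]

lemma adjoint_wres (hP : IsSelfAdjoint P) {z : ℂ} (hz : z.im ≠ 0) {a b : ℝ} (ha : 0 ≤ a)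
    (hb : 0 ≤ b) (k : ℕ) :
    ContinuousLinearMap.adjoint (wres P b k a z) = wres P a k b (conj z) := by
  rw [wres, wres, ← ContinuousLinearMap.star_eq_adjoint, star_mul, star_mul]
  simp only [ContinuousLinearMap.star_eq_adjoint]
  rw [adjoint_wt ha, adjoint_wt hb, adjoint_unboundedResolvent_pow hP hz, mul_assoc]

/-- Taking adjoints exchanges the two weights and conjugates z. -/
lemma norm_wres_conj (hP : IsSelfAdjoint P) {z : ℂ} (hz : z.im ≠ 0) {a b : ℝ} (ha : 0 ≤ a)
    (hb : 0 ≤ b) (k : ℕ) : ‖wres P b k a (conj z)‖ = ‖wres P a k b z‖ := by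
  rw [← adjoint_wres hP hz hb ha, LinearIsometryEquiv.norm_map]

lemma opNorm_le_of_inner {A : L2 n →L[ℂ] L2 n} {C : ℝ} (hC : 0 ≤ C)
    (h : ∀ f g, ‖inner ℂ g (A f)‖ ≤ C * (‖f‖ * ‖g‖)) : ‖A‖ ≤ C := by
  refine ContinuousLinearMap.opNorm_le_bound _ hC fun f => ?_
  rcases eq_or_ne (A f) 0 with h0 | h0
  · rw [h0, norm_zero]; positivity
  have h1 := h f (A f)
  rw [inner_self_eq_norm_sq_to_K, norm_pow, RCLike.norm_ofReal, abs_norm] at h1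
  have h2 := norm_pos_iff.mpr h0
  nlinarith

/-- The virial identity as an estimate for weighted powers of the resolvent. -/
lemma exists_norm_virial_le (n : ℕ) {K a b Z : ℝ} (hK : 0 ≤ K) (ha : 1 ≤ a) (hb : 1 ≤ b)
    (hZ : 0 ≤ Z) (k : ℕ) : ∃ C : ℝ, 0 ≤ C ∧
    ∀ {h δ : ℝ} {P : L2 n →ₗ.[ℂ] L2 n} {q : Option (Fin n) → Option (Fin n) → Space n → ℝ}
      {V₁ : Space n → ℝ} {T : Option (Fin n) → L2 n →L[ℂ] L2 n} {T₂ : Fin n → L2 n →L[ℂ] L2 n},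
      IsModel h K δ P q V₁ T T₂ → ∀ {z : ℂ}, z.im ≠ 0 → ‖z‖ ≤ Z →
      ‖wt n b * ((2 * (k + 1 : ℂ)) • (z • unboundedResolvent P z ^ (k + 2) +
        unboundedResolvent P z ^ (k + 1)) - virialSum h q V₁ P T k z) * wt n a‖ ≤
      C * h⁻¹ * (‖wres P (b - 1) (k + 1) a z‖ + ‖wres P (b - 1) k a z‖ +
        ‖wres P b (k + 1) (a - 1) z‖ + ‖wres P b k (a - 1) z‖) := by
  obtain ⟨C₁, hC₁, H₁⟩ := exists_norm_wt_derRes_le n hK (sub_nonneg.mpr ha) hZ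
  obtain ⟨C₂, hC₂, H₂⟩ := exists_norm_wt_derRes_le n hK (sub_nonneg.mpr hb) hZ
  refine ⟨(1 + n) * (1 + n * (C₁ + C₂)), by positivity, ?_⟩
  intro h δ P q V₁ T T₂ M z hz hzZ
  have hP := M.isSelfAdjoint
  have hh := M.h_pos
  have key : ∀ {w : ℂ} (_ : w.im ≠ 0) (_ : ‖w‖ ≤ Z) {c d C : ℝ} (_ : 0 ≤ c) (_ : 0 ≤ C)
      (_ : C ≤ C₁ + C₂)
      (_ : ∀ x α, ‖wt n c (derRes P T w α x)‖ ≤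
        C * (‖wt n c (unboundedResolvent P w x)‖ + ‖wt n c x‖)) (f : L2 n),
      ‖wt n c (dilGen h ((unboundedResolvent P w ^ (k + 1)) (wt n d f))
          fun j => derRes P T w (some j) ((unboundedResolvent P w ^ k) (wt n d f)))‖ ≤
        (1 + n) * (1 + n * (C₁ + C₂)) * h⁻¹ * ((‖wres P c (k + 1) d w‖ + ‖wres P c k d w‖) * ‖f‖) := by
    intro w hw hwZ c d C hc hC hCC hH f
    refine (M.norm_wt_dilGen_le hc _ _).trans ?_
    have e1 : ‖wt n c ((unboundedResolvent P w ^ (k + 1)) (wt n d f))‖ ≤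
        ‖wres P c (k + 1) d w‖ * ‖f‖ := (wres P c (k + 1) d w).le_opNorm f
    have e2 : ‖wt n c ((unboundedResolvent P w ^ k) (wt n d f))‖ ≤
        ‖wres P c k d w‖ * ‖f‖ := (wres P c k d w).le_opNorm f
    have e3 : ∀ j, ‖wt n c (derRes P T w (some j) ((unboundedResolvent P w ^ k) (wt n d f)))‖ ≤
        (C₁ + C₂) * ((‖wres P c (k + 1) d w‖ + ‖wres P c k d w‖) * ‖f‖) := by
      intro j
      refine (hH _ _).trans (mul_le_mul hCC ?_ (by positivity) (by positivity))
      rw [unboundedResolvent_pow_succ_apply, add_mul]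
      exact add_le_add e1 e2
    have e4 : ∑ j : Fin n, ‖wt n c (derRes P T w (some j)
        ((unboundedResolvent P w ^ k) (wt n d f)))‖ ≤
        n * ((C₁ + C₂) * ((‖wres P c (k + 1) d w‖ + ‖wres P c k d w‖) * ‖f‖)) := by
      refine (Finset.sum_le_sum fun j _ => e3 j).trans_eq ?_
      simp
    have e5 : 0 ≤ ‖wres P c k d w‖ * ‖f‖ := by positivity
    refine (mul_le_mul_of_nonneg_left (add_le_add e1 e4) (by positivity)).trans ?_
    have e6 : ‖wres P c (k + 1) d w‖ * ‖f‖ + n * ((C₁ + C₂) *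
        ((‖wres P c (k + 1) d w‖ + ‖wres P c k d w‖) * ‖f‖)) ≤
        (1 + n * (C₁ + C₂)) * ((‖wres P c (k + 1) d w‖ + ‖wres P c k d w‖) * ‖f‖) := by
      linarith
    refine (mul_le_mul_of_nonneg_left e6 (by positivity)).trans_eq ?_
    ring
  have hz' : (conj z).im ≠ 0 := by simpa using hz
  have hzZ' : ‖conj z‖ ≤ Z := by simpa using hzZ
  refine opNorm_le_of_inner (by positivity) fun f g => ?_
  rw [M.virial_identity hz ha hb]
  rw [← inner_conj_symm, inner_wt_left (by linarith), inner_wt_left (by linarith)]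
  refine (norm_add_le _ _).trans ?_
  rw [RCLike.norm_conj]
  have k1 := key hz' hzZ' (d := b) (sub_nonneg.mpr ha) hC₁ (by linarith) (H₁ M hz' hzZ') g
  have k2 := key hz hzZ (d := a) (sub_nonneg.mpr hb) hC₂ (by linarith) (H₂ M hz hzZ) f
  rw [norm_wres_conj hP hz (by linarith) (by linarith),
    norm_wres_conj hP hz (by linarith) (by linarith)] at k1
  refine (add_le_add ((norm_inner_le_norm _ _).trans (mul_le_mul_of_nonneg_left k1 (norm_nonneg _)))
    ((norm_inner_le_norm _ _).trans (mul_le_mul_of_nonneg_left k2 (norm_nonneg _)))).trans_eq ?_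
  ring

/-- Each summand is cut at the virial coefficient, whose decay is shared as p i + r i. The elliptic
estimate then removes the derivatives from both halves, at the price of also admitting the next
lower power of the resolvent. -/
lemma exists_norm_virialSum_le (n : ℕ) {K a b Z : ℝ} {p r : ℕ → ℝ} (hK : 0 ≤ K) (hb : 0 ≤ b)
    (hp : ∀ i, 0 ≤ p i) (hr : ∀ i, 0 ≤ r i) (hZ : 0 ≤ Z) (k : ℕ) : ∃ C : ℝ, 0 ≤ C ∧
    ∀ {h δ : ℝ} {P : L2 n →ₗ.[ℂ] L2 n} {q : Option (Fin n) → Option (Fin n) → Space n → ℝ}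
      {V₁ : Space n → ℝ} {T : Option (Fin n) → L2 n →L[ℂ] L2 n} {T₂ : Fin n → L2 n →L[ℂ] L2 n},
      IsModel h K δ P q V₁ T T₂ → (∀ i, i ≤ k → p i + r i = δ - 1) → ∀ {z : ℂ}, z.im ≠ 0 → ‖z‖ ≤ Z →
      ‖wt n b * virialSum h q V₁ P T k z * wt n a‖ ≤
      C * ∑ i ∈ Finset.range (k + 1), (‖wres P b (k - i + 1) (p i) z‖ + ‖wres P b (k - i) (p i) z‖) *
        (‖wres P (r i) (i + 1) a z‖ + ‖wres P (r i) i a z‖) := by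
  choose C₁ hC₁ H₁ using fun i => exists_norm_wt_derRes_le n hK (hp i) hZ
  choose C₂ hC₂ H₂ using fun i => exists_norm_wt_derRes_le n hK (hr i) hZ
  obtain ⟨N, hN⟩ : ∃ N : ℝ, N = (Fintype.card (Option (Fin n)) : ℝ) := ⟨_, rfl⟩
  have hN0 : 0 ≤ N := by rw [hN]; positivity
  have hC₃ : ∀ i, 0 ≤ C₁ i * C₂ i := fun i => mul_nonneg (hC₁ i) (hC₂ i)
  obtain ⟨C₃, hC₃e⟩ : ∃ C₃ : ℝ, C₃ = ∑ i ∈ Finset.range (k + 1), C₁ i * C₂ i := ⟨_, rfl⟩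
  have hC₃0 : 0 ≤ C₃ := hC₃e ▸ Finset.sum_nonneg fun i _ => hC₃ i
  refine ⟨N * (N * ((6 + n) * K * C₃)), by positivity, ?_⟩
  intro h δ P q V₁ T T₂ M hpr z hz hzZ
  have hP := M.isSelfAdjoint
  have hz' : (conj z).im ≠ 0 := by simpa using hz
  have hzZ' : ‖conj z‖ ≤ Z := by simpa using hzZ
  refine opNorm_le_of_inner (mul_nonneg (by positivity)
    (Finset.sum_nonneg fun i _ => by positivity)) fun f g => ?_
  rw [mul_apply_eq_comp, mul_apply_eq_comp, ← inner_wt_left hb, inner_virialSum]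
  have e1 : ∀ i j α, ‖wt n (p i)
      (derRes P T (conj z) α ((unboundedResolvent P (conj z) ^ j) (wt n b g)))‖ ≤
      C₁ i * ((‖wres P b (j + 1) (p i) z‖ + ‖wres P b j (p i) z‖) * ‖g‖) := by
    intro i j α
    refine (H₁ i M hz' hzZ' _ α).trans (mul_le_mul_of_nonneg_left ?_ (hC₁ i))
    rw [unboundedResolvent_pow_succ_apply, add_mul, ← norm_wres_conj hP hz hb (hp i),
      ← norm_wres_conj hP hz hb (hp i)]
    exact add_le_add ((wres P (p i) (j + 1) b (conj z)).le_opNorm g)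
      ((wres P (p i) j b (conj z)).le_opNorm g)
  have e2 : ∀ i α, ‖wt n (r i) (derRes P T z α ((unboundedResolvent P z ^ i) (wt n a f)))‖ ≤
      C₂ i * ((‖wres P (r i) (i + 1) a z‖ + ‖wres P (r i) i a z‖) * ‖f‖) := by
    intro i α
    refine (H₂ i M hz hzZ _ α).trans (mul_le_mul_of_nonneg_left ?_ (hC₂ i))
    rw [unboundedResolvent_pow_succ_apply, add_mul]
    exact add_le_add ((wres P (r i) (i + 1) a z).le_opNorm f) ((wres P (r i) i a z).le_opNorm f)
  rw [mul_assoc, Finset.sum_mul, Finset.mul_sum]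
  refine (norm_sum_le _ _).trans (Finset.sum_le_sum fun i hi => ?_)
  have hik : i ≤ k := Nat.lt_succ_iff.mp (Finset.mem_range.mp hi)
  have e3 : ∀ α β, ‖inner ℂ
      (derRes P T (conj z) α ((unboundedResolvent P (conj z) ^ (k - i)) (wt n b g)))
      (virialOp h q V₁ α β (derRes P T z β ((unboundedResolvent P z ^ i) (wt n a f))))‖ ≤
      (6 + n) * K * ((C₁ i * ((‖wres P b (k - i + 1) (p i) z‖ + ‖wres P b (k - i) (p i) z‖) * ‖g‖)) *
        (C₂ i * ((‖wres P (r i) (i + 1) a z‖ + ‖wres P (r i) i a z‖) * ‖f‖))) := fun α β => by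
    have := hC₁ i
    have := hK
    exact (M.norm_inner_virialOp_le (hp i) (hr i) (hpr i hik) α β _ _).trans
      (mul_le_mul_of_nonneg_left (mul_le_mul (e1 _ _ _) (e2 _ _) (norm_nonneg _) (by positivity))
        (by positivity))
  refine (norm_sum_le _ _).trans ((Finset.sum_le_sum fun α _ => (norm_sum_le _ _).trans
    (Finset.sum_le_sum fun β _ => e3 α β)).trans ?_)
  rw [Finset.sum_const, Finset.sum_const, Finset.card_univ, nsmul_eq_mul, nsmul_eq_mul, ← hN]
  have hi3 : C₁ i * C₂ i ≤ C₃ := by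
    rw [hC₃e]
    exact Finset.single_le_sum (f := fun i => C₁ i * C₂ i) (fun i _ => hC₃ i) hi
  have e4 : 0 ≤ N * (N * ((6 + n) * K * (((‖wres P b (k - i + 1) (p i) z‖ +
      ‖wres P b (k - i) (p i) z‖) * ‖g‖) * ((‖wres P (r i) (i + 1) a z‖ +
      ‖wres P (r i) i a z‖) * ‖f‖)))) := by positivity
  linarith [mul_le_mul_of_nonneg_right hi3 e4]

end VirialResolvent

/-! ### From the differential expression to a symmetric quadratic form. -/

section FormCoefficients

open scoped ComplexConjugate InnerProductSpace

variable {n : ℕ} {h K δ : ℝ} {P : L2 n →ₗ.[ℂ] L2 n}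

/-- The coefficients of the quadratic form of the differential expression, except for `h V¹`. -/
def Coefficients.form (c : Coefficients n) (h : ℝ) : Option (Fin n) → Option (Fin n) → Space n → ℝ
  -- The indices are exchanged because the expression is applied to the left vector: ⟨𝒟_i a_ij 𝒟_j
  -- φ, u⟩ = ⟨𝒟_j φ, a_ij 𝒟_i u⟩.
  | some j, some i => c.a h i j
  | some j, none => c.b h j
  | none, some j => c.b h j
  | none, none => c.V0

/-- The symmetrized coefficients of the quadratic form of the differential expression. -/
def Coefficients.symForm (c : Coefficients n) (h : ℝ) (α β : Option (Fin n)) (x : Space n) : ℝ :=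
  (1 / 2) * (c.form h α β x + c.form h β α x)

/-- Bounds for the coefficients at a fixed value of the parameter. -/
structure IsFormBounded (c : Coefficients n) (h K δ : ℝ) : Prop where
  contDiff : ∀ α β, ContDiff ℝ 1 (c.form h α β)
  le : ∀ α β x, |c.form h α β x| ≤ K
  none_le : ∀ β x, |c.form h none β x| ≤ K * bracket (-δ) x
  le_none : ∀ α x, |c.form h α none x| ≤ K * bracket (-δ) x
  fderiv_le : ∀ α β x, ‖fderiv ℝ (c.form h α β) x‖ ≤ K * bracket (-δ) x
  V1_meas : AEStronglyMeasurable (c.V1 h) volume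
  V1_le : ∀ᵐ x, |c.V1 h x| ≤ K * bracket (-δ) x

lemma exists_isFormBounded {c : Coefficients n} (hreg : c.IsRegular) (hδ : 0 ≤ δ)
    (hshort : c.IsShortRange δ) : ∃ K, ∀ h ∈ Ioc (0 : ℝ) 1, ∀ K' ≥ K, IsFormBounded c h K' δ := by
  obtain ⟨C, hC⟩ := hshort
  refine ⟨1 + |C|, fun h hh K' hK' => ?_⟩
  obtain ⟨h1, h2, h3, h4⟩ := hC h hh
  have hb : ∀ x : Space n, 0 < bracket (-δ) x := fun x => bracket_pos _ x
  have hb1 : ∀ x : Space n, bracket (-δ) x ≤ 1 := fun x => bracket_le_one (by linarith) x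
  have hCK : |C| + 1 ≤ K' := by linarith
  have hle : ∀ x : Space n, C * bracket (-δ) x ≤ K' * bracket (-δ) x := fun x =>
    mul_le_mul_of_nonneg_right (by linarith [le_abs_self C]) (hb x).le
  have hK0 : 0 ≤ K' := by linarith [abs_nonneg C]
  have hle1 : ∀ x : Space n, K' * bracket (-δ) x ≤ K' := fun x =>
    mul_le_of_le_one_right hK0 (hb1 x)
  have hf : ∀ α β x, ‖fderiv ℝ (c.form h α β) x‖ ≤ K' * bracket (-δ) x := by
    intro α β x
    rcases α with _ | j <;> rcases β with _ | i
    · exact (h3 x).2.trans (hle x)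
    · exact (h2 _ x).2.trans (hle x)
    · exact (h2 _ x).2.trans (hle x)
    · exact (h1 _ _ x).2.trans (hle x)
  have hn : ∀ β x, |c.form h none β x| ≤ K' * bracket (-δ) x := by
    intro β x
    rcases β with _ | i
    · exact (h3 x).1.trans (hle x)
    · exact (h2 _ x).1.trans (hle x)
  have hn' : ∀ α x, |c.form h α none x| ≤ K' * bracket (-δ) x := by
    intro β x
    rcases β with _ | i
    · exact (h3 x).1.trans (hle x)
    · exact (h2 _ x).1.trans (hle x)
  refine ⟨?_, ?_, hn, hn', hf, hreg.V1_meas h hh, ?_⟩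
  · intro α β
    rcases α with _ | j <;> rcases β with _ | i
    · exact hreg.V0_C1
    · exact hreg.b_C1 h hh _
    · exact hreg.b_C1 h hh _
    · exact hreg.a_C1 h hh _ _
  · intro α β x
    rcases α with _ | j
    · exact (hn β x).trans (hle1 x)
    rcases β with _ | i
    · exact (hn' _ x).trans (hle1 x)
    have h5 := (h1 i j x).1
    have h6 : C * bracket (-δ) x ≤ |C| :=
      (mul_le_mul_of_nonneg_right (le_abs_self C) (hb x).le).trans
        (mul_le_of_le_one_right (abs_nonneg C) (hb1 x))
    have h7 : |if i = j then (1 : ℝ) else 0| ≤ 1 := by split_ifs <;> simp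
    change |c.a h i j x| ≤ K'
    have h8 := abs_add_le (c.a h i j x - if i = j then 1 else 0) (if i = j then 1 else 0)
    rw [sub_add_cancel] at h8
    linarith
  · filter_upwards [h4] with x hx
    exact hx.trans (hle x)

namespace IsFormBounded

variable {c : Coefficients n}

lemma K_nonneg (hc : IsFormBounded c h K δ) : 0 ≤ K :=
  (abs_nonneg _).trans (hc.le none none 0)

lemma isC1Bounded_form (hc : IsFormBounded c h K δ) (hδ : 0 ≤ δ) (α β : Option (Fin n)) :
    IsC1Bounded (c.form h α β) where
  contDiff := hc.contDiff α β
  bdd := ⟨K, hc.le α β⟩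
  fderiv_bdd := ⟨K, fun x => (hc.fderiv_le α β x).trans <|
    mul_le_of_le_one_right hc.K_nonneg (bracket_le_one (by linarith) x)⟩

lemma fderiv_symForm (hc : IsFormBounded c h K δ) (α β : Option (Fin n)) (x : Space n) :
    HasFDerivAt (c.symForm h α β)
      ((1 / 2 : ℝ) • (fderiv ℝ (c.form h α β) x + fderiv ℝ (c.form h β α) x)) x := by
  have h1 : ∀ α β, HasFDerivAt (c.form h α β) (fderiv ℝ (c.form h α β) x) x := fun α β =>
    ((hc.contDiff α β).differentiable one_ne_zero x).hasFDerivAt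
  exact ((h1 α β).add (h1 β α)).const_mul (1 / 2)

lemma contDiff_symForm (hc : IsFormBounded c h K δ) (α β : Option (Fin n)) :
    ContDiff ℝ 1 (c.symForm h α β) :=
  contDiff_const.mul ((hc.contDiff α β).add (hc.contDiff β α))

lemma abs_half_add_le {x y C : ℝ} (hx : |x| ≤ C) (hy : |y| ≤ C) : |(1 / 2) * (x + y)| ≤ C := by
  rw [abs_le] at *
  constructor <;> linarith [hx.1, hx.2, hy.1, hy.2]

lemma norm_fderiv_symForm_le (hc : IsFormBounded c h K δ) (α β : Option (Fin n)) (x : Space n) :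
    ‖fderiv ℝ (c.symForm h α β) x‖ ≤ K * bracket (-δ) x := by
  rw [(hc.fderiv_symForm α β x).fderiv, norm_smul]
  have h1 := hc.fderiv_le α β x
  have h2 := hc.fderiv_le β α x
  have h3 := norm_add_le (fderiv ℝ (c.form h α β) x) (fderiv ℝ (c.form h β α) x)
  norm_num
  linarith

lemma isC1Bounded_symForm (hc : IsFormBounded c h K δ) (hδ : 0 ≤ δ) (α β : Option (Fin n)) :
    IsC1Bounded (c.symForm h α β) where
  contDiff := hc.contDiff_symForm α β
  bdd := ⟨K, fun x => abs_half_add_le (hc.le α β x) (hc.le β α x)⟩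
  fderiv_bdd := ⟨K, fun x => (hc.norm_fderiv_symForm_le α β x).trans <|
    mul_le_of_le_one_right hc.K_nonneg (bracket_le_one (by linarith) x)⟩

lemma isMultiplier_V1 (hc : IsFormBounded c h K δ) (hδ : 0 ≤ δ) : IsMultiplier (c.V1 h) := by
  refine ⟨hc.V1_meas, K, ?_⟩
  filter_upwards [hc.V1_le] with x hx
  exact hx.trans (mul_le_of_le_one_right hc.K_nonneg (bracket_le_one (by linarith) x))

end IsFormBounded

/-- The strong form of a second order quadratic form. -/
lemma exists_inner_eq_sum (hh : h ≠ 0) {r : Option (Fin n) → Option (Fin n) → Space n → ℝ}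
    (hr : ∀ α β, IsC1Bounded (r α β)) {d : Option (Fin n) → L2 n}
    (hd : ∀ β (j : Fin n), ∃ w, HasD h j (d β) w) :
    ∃ G : L2 n, ∀ (v : L2 n) (e : Option (Fin n) → L2 n), (∀ α, HasDo h α v (e α)) →
      inner ℂ v G = ∑ α, ∑ β, inner ℂ (e α) (mulOp (r α β) (d β)) := by
  have h1 : ∀ α β, ∃ g, HasDo h α (mulOp (r α β) (d β)) g := by
    intro α β
    cases α with
    | none => exact ⟨_, rfl⟩
    | some j =>
      obtain ⟨w, hw⟩ := hd β j
      exact ⟨_, HasD.mulOp hh hw (hr _ _)⟩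
  choose g hg using h1
  refine ⟨∑ α, ∑ β, g α β, fun v e he => ?_⟩
  simp only [inner_sum]
  exact Finset.sum_congr rfl fun α _ => Finset.sum_congr rfl fun β _ =>
    (HasDo.inner_left hh (he α) (hg α β)).symm

/-- Self-adjointness moves P onto the test function, where it acts classically; symmetry of weak
derivatives then puts one derivative on each side. -/
lemma inner_apply_toL2 {c : Coefficients n} (hc : IsFormBounded c h K δ) (hδ : 0 ≤ δ) (hh : h ≠ 0)
    (hP : IsSelfAdjointRealization c h P) {φ : Space n → ℂ} (hφ : ContDiff ℝ ∞ φ)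
    (hφc : HasCompactSupport φ) (u : P.domain) {d e : Option (Fin n) → L2 n}
    (hd : ∀ α, HasDo h α (u : L2 n) (d α))
    (he : ∀ α, HasDo h α (toL2 φ hφ.continuous hφc) (e α)) :
    inner ℂ (toL2 φ hφ.continuous hφc) (P u) =
      ∑ α, ∑ β, inner ℂ (e α) (mulOp (c.form h α β) (d β)) +
        h * inner ℂ (toL2 φ hφ.continuous hφc) (mulOp (c.V1 h) (u : L2 n)) := by
  have hφ1 : ContDiff ℝ 1 φ := hφ.of_le (by exact_mod_cast le_top)
  have hφ2 : ContDiff ℝ 2 φ := by exact_mod_cast contDiff_infty.mp hφ 2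
  have hm : ∀ α β, IsMultiplier (c.form h α β) := fun α β => (hc.isC1Bounded_form hδ α β).isMultiplier
  obtain ⟨φL, hφL⟩ : ∃ φL, φL = toL2 φ hφ.continuous hφc := ⟨_, rfl⟩
  have hφae : φL =ᵐ[volume] φ := hφL ▸ coeFn_toL2 _ _
  obtain ⟨hu, hPu⟩ := hP.2 φ hφ hφc φL hφae
  rw [← hφL] at he ⊢
  have he0 : e none = φL := he none
  have hd0 : d none = u := hd none
  have heae : ∀ j, e (some j) =ᵐ[volume] semiD h j φ := fun j => by
    have h1 : HasD h j φL _ := hφL ▸ hasD_toL2 h j hφ1 hφc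
    rw [HasD.unique (he (some j)) h1]
    exact coeFn_toL2 _ _
  have hA : ∀ i j, ∃ g : L2 n, HasD h i (mulOp (c.a h i j) (e (some j))) g ∧
      g =ᵐ[volume] semiD h i (fun y => (c.a h i j y : ℂ) * semiD h j φ y) := by
    intro i j
    have h1 : ContDiff ℝ 1 (fun y => (c.a h i j y : ℂ) * semiD h j φ y) :=
      (Complex.ofRealCLM.contDiff.comp (hc.contDiff (some j) (some i))).mul
        (contDiff_semiD h j hφ2 (by norm_num))
    have h2 : HasCompactSupport (fun y => (c.a h i j y : ℂ) * semiD h j φ y) :=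
      (hasCompactSupport_semiD h j hφc).mul_left
    refine ⟨toL2 _ (continuous_semiD h i h1) (hasCompactSupport_semiD h i h2),
      hasD_of_classical h1 h2 ?_ (coeFn_toL2 _ _), coeFn_toL2 _ _⟩
    filter_upwards [coeFn_mulOp (hm (some j) (some i)) (e (some j)), heae j] with x h3 h4
    rw [← h4]; exact h3
  have hB : ∀ j, ∃ g : L2 n, HasD h j (mulOp (c.b h j) φL) g ∧
      g =ᵐ[volume] semiD h j (fun y => (c.b h j y : ℂ) * φ y) := by
    intro j
    have h1 : ContDiff ℝ 1 (fun y => (c.b h j y : ℂ) * φ y) :=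
      (Complex.ofRealCLM.contDiff.comp (hc.contDiff (some j) none)).mul hφ1
    have h2 : HasCompactSupport (fun y => (c.b h j y : ℂ) * φ y) := hφc.mul_left
    refine ⟨toL2 _ (continuous_semiD h j h1) (hasCompactSupport_semiD h j h2),
      hasD_of_classical h1 h2 ?_ (coeFn_toL2 _ _), coeFn_toL2 _ _⟩
    filter_upwards [coeFn_mulOp (hm (some j) none) φL, hφae] with x h3 h4
    rw [← h4]; exact h3
  choose gA hgA hgA' using hA
  choose gB hgB hgB' using hB
  have hPφ : P ⟨φL, hu⟩ = (∑ i, ∑ j, gA i j) + (∑ j, (mulOp (c.b h j) (e (some j)) + gB j)) +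
      (mulOp c.V0 φL + (h : ℂ) • mulOp (c.V1 h) φL) := by
    apply Lp.ext
    have hsum : ∀ {ι : Type} (s : Finset ι) (f : ι → L2 n),
        (∑ i ∈ s, f i : L2 n) =ᵐ[volume] fun x => ∑ i ∈ s, f i x := fun s f => by
      refine (Lp.coeFn_finsetSum s f).trans (Eventually.of_forall fun x => ?_)
      simp
    have hsA : ∀ᵐ x, ∀ i j, gA i j x = semiD h i (fun y => (c.a h i j y : ℂ) * semiD h j φ y) x :=
      ae_all_iff.mpr fun i => ae_all_iff.mpr fun j => hgA' i j
    have hsB : ∀ᵐ x, ∀ j, gB j x = semiD h j (fun y => (c.b h j y : ℂ) * φ y) x :=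
      ae_all_iff.mpr fun j => hgB' j
    have hsb : ∀ᵐ x, ∀ j, mulOp (c.b h j) (e (some j)) x = (c.b h j x : ℂ) * semiD h j φ x :=
      ae_all_iff.mpr fun j => by
        filter_upwards [coeFn_mulOp (hm (some j) none) (e (some j)), heae j] with x h3 h4
        rw [← h4]; exact h3
    have hsA2 : ∀ᵐ x, ∀ i, (∑ j, gA i j : L2 n) x = ∑ j, gA i j x :=
      ae_all_iff.mpr fun i => hsum _ _
    have hsb2 : ∀ᵐ x, ∀ j, (mulOp (c.b h j) (e (some j)) + gB j : L2 n) x =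
        mulOp (c.b h j) (e (some j)) x + gB j x :=
      ae_all_iff.mpr fun j => Lp.coeFn_add _ _
    filter_upwards [hPu, hsA, hsB, hsb, hsA2, hsb2, hsum Finset.univ fun i => ∑ j, gA i j,
      hsum Finset.univ fun j => (mulOp (c.b h j) (e (some j)) + gB j), hφae,
      coeFn_mulOp (hm none none) φL, coeFn_mulOp (hc.isMultiplier_V1 hδ) φL,
      Lp.coeFn_smul (h : ℂ) (mulOp (c.V1 h) φL),
      Lp.coeFn_add (mulOp c.V0 φL) ((h : ℂ) • mulOp (c.V1 h) φL),
      Lp.coeFn_add (∑ i, ∑ j, gA i j) (∑ j, (mulOp (c.b h j) (e (some j)) + gB j)),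
      Lp.coeFn_add ((∑ i, ∑ j, gA i j) + (∑ j, (mulOp (c.b h j) (e (some j)) + gB j)))
        (mulOp c.V0 φL + (h : ℂ) • mulOp (c.V1 h) φL)] with x x1 x2 x3 x4 x5 x6 x7 x8 x9 x10 x11
        x12 x13 x14 x15
    rw [x15, Pi.add_apply, x14, Pi.add_apply, x13, Pi.add_apply, x12, Pi.smul_apply, x11, x7, x8, x1,
      Coefficients.expression, Coefficients.V]
    simp only [x2, x3, x4, x5, x6]
    change _ = _ + (mulOp (c.form h none none) φL x + _)
    rw [x10, x9, Coefficients.form, smul_eq_mul]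
    push_cast
    ring
  have hsa := hP.1.inner_apply_left ⟨φL, hu⟩ u
  have e1 : ∀ i j, inner ℂ (gA i j) (u : L2 n) =
      inner ℂ (e (some j)) (mulOp (c.a h i j) (d (some i))) := fun i j =>
    (HasD.inner_left hh (hgA i j) (hd (some i))).trans (inner_mulOp_left (hm (some j) (some i)) _ _)
  have e2 : ∀ j, inner ℂ (gB j) (u : L2 n) = inner ℂ φL (mulOp (c.b h j) (d (some j))) := fun j =>
    (HasD.inner_left hh (hgB j) (hd (some j))).trans (inner_mulOp_left (hm (some j) none) _ _)
  have e3 : ∀ j, inner ℂ (mulOp (c.b h j) (e (some j))) (u : L2 n) =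
      inner ℂ (e (some j)) (mulOp (c.b h j) (u : L2 n)) := fun j =>
    inner_mulOp_left (hm (some j) none) _ _
  have e4 : inner ℂ (mulOp c.V0 φL) (u : L2 n) = inner ℂ φL (mulOp c.V0 (u : L2 n)) :=
    inner_mulOp_left (hm none none) _ _
  change inner ℂ φL (P u) = _
  rw [← hsa, hPφ]
  simp only [inner_add_left, sum_inner, inner_smul_left, Complex.conj_ofReal, e1, e2, e3, e4,
    inner_mulOp_left (hc.isMultiplier_V1 hδ), Fintype.sum_option, Coefficients.form, he0, hd0,
    Finset.sum_add_distrib]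
  rw [Finset.sum_comm]
  ring


lemma exists_hasDo_toL2 {φ : Space n → ℂ} (h : ℝ) (hφ : ContDiff ℝ 1 φ) (hφc : HasCompactSupport φ)
    (α : Option (Fin n)) : ∃ e, HasDo h α (toL2 φ hφ.continuous hφc) e := by
  cases α with
  | none => exact ⟨_, rfl⟩
  | some j => exact ⟨_, hasD_toL2 h j hφ hφc⟩

/-- Because u has second derivatives, the form with u fixed is represented by an L² vector.
Comparison on test functions identifies P u, after which any v with first derivatives may be
inserted. -/
lemma inner_apply_form {c : Coefficients n} (hc : IsFormBounded c h K δ) (hδ : 0 ≤ δ) (hh : h ≠ 0)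
    (hP : IsSelfAdjointRealization c h P) (u : P.domain) {d : Option (Fin n) → L2 n}
    (hd : ∀ α, HasDo h α (u : L2 n) (d α)) (hd2 : ∀ β (j : Fin n), ∃ w, HasD h j (d β) w)
    {v : L2 n} {e : Option (Fin n) → L2 n} (he : ∀ α, HasDo h α v (e α)) :
    inner ℂ v (P u) = ∑ α, ∑ β, inner ℂ (e α) (mulOp (c.form h α β) (d β)) +
        h * inner ℂ v (mulOp (c.V1 h) (u : L2 n)) := by
  obtain ⟨G, hG⟩ := exists_inner_eq_sum hh (fun α β => hc.isC1Bounded_form hδ α β) hd2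
  have hPu : P u = G + (h : ℂ) • mulOp (c.V1 h) (u : L2 n) := by
    refine dense_testSet.eq_of_inner_right (𝕜 := ℂ) fun ψ hψ => ?_
    obtain ⟨φ, hφ, hφc, hφs⟩ := hψ
    rw [show ψ = toL2 φ hφs.continuous hφc from
      Lp.ext (hφ.trans (coeFn_toL2 hφs.continuous hφc).symm)]
    choose e he using exists_hasDo_toL2 h (hφs.of_le (by exact_mod_cast le_top) : ContDiff ℝ 1 φ) hφc
    rw [inner_apply_toL2 hc hδ hh hP hφs hφc u hd he, inner_add_right, hG _ _ he, inner_smul_right]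
  rw [hPu, inner_add_right, hG _ _ he, inner_smul_right]

/-- The matrix a_ij is not assumed symmetric. Self-adjointness makes the form Hermitian on the
domain, so it equals the average with its adjoint form, whose coefficients are transposed since they
are real. -/
lemma inner_apply_symForm {c : Coefficients n} (hc : IsFormBounded c h K δ) (hδ : 0 ≤ δ)
    (hh : h ≠ 0) (hP : IsSelfAdjointRealization c h P)
    (hreg : ∀ u : P.domain, ∃ d : Option (Fin n) → L2 n, (∀ α, HasDo h α (u : L2 n) (d α)) ∧
      ∀ β (j : Fin n), ∃ w, HasD h j (d β) w)
    (u : P.domain) {d : Option (Fin n) → L2 n} (hd : ∀ α, HasDo h α (u : L2 n) (d α))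
    {v : L2 n} {e : Option (Fin n) → L2 n} (he : ∀ α, HasDo h α v (e α)) :
    inner ℂ v (P u) = ∑ α, ∑ β, inner ℂ (e α) (mulOp (c.symForm h α β) (d β)) +
        h * inner ℂ v (mulOp (c.V1 h) (u : L2 n)) := by
  obtain ⟨d', hd', hd2⟩ := hreg u
  obtain rfl : d = d' := funext fun α => (hd α).unique (hd' α)
  obtain ⟨G, hG⟩ := exists_inner_eq_sum hh (fun α β => hc.isC1Bounded_symForm hδ α β) hd2
  have hV := hc.isMultiplier_V1 hδ
  have hPu : P u = G + (h : ℂ) • mulOp (c.V1 h) (u : L2 n) := by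
    refine hP.1.dense_domain.eq_of_inner_right (𝕜 := ℂ) fun w hw => ?_
    obtain ⟨e, he, he2⟩ := hreg ⟨w, hw⟩
    have h1 := inner_apply_form hc hδ hh hP u hd hd2 he
    have h2 := inner_apply_form hc hδ hh hP ⟨w, hw⟩ he he2 hd
    have h3 : inner ℂ w (P u) = conj (inner ℂ (u : L2 n) (P ⟨w, hw⟩)) := by
      rw [inner_conj_symm, hP.1.inner_apply_left]
    have h4 : ∀ α β, inner ℂ (e α) (mulOp (c.symForm h α β) (d β)) =
        (1 / 2) * (inner ℂ (e α) (mulOp (c.form h α β) (d β)) +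
          conj (inner ℂ (d β) (mulOp (c.form h β α) (e α)))) := by
      intro α β
      have hm1 := (hc.isC1Bounded_form hδ α β).isMultiplier
      have hm2 := (hc.isC1Bounded_form hδ β α).isMultiplier
      unfold Coefficients.symForm
      rw [mulOp_const_mul _ (hm1.add hm2), mulOp_add hm1 hm2, inner_smul_right, inner_add_right,
        inner_conj_symm, inner_mulOp_left hm2]
      push_cast
      ring
    have h5 : ∑ α, ∑ β, conj (inner ℂ (d β) (mulOp (c.form h β α) (e α))) =
        conj (∑ α, ∑ β, inner ℂ (d α) (mulOp (c.form h α β) (e β))) := by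
      rw [Finset.sum_comm]
      simp only [map_sum]
    have h6 : conj (inner ℂ (u : L2 n) (mulOp (c.V1 h) w)) =
        inner ℂ w (mulOp (c.V1 h) (u : L2 n)) := by
      rw [inner_conj_symm, inner_mulOp_left hV]
    rw [h2, map_add, map_mul, Complex.conj_ofReal, h6, ← h5] at h3
    rw [inner_add_right, hG _ _ he, inner_smul_right]
    simp only [h4, ← Finset.mul_sum, Finset.sum_add_distrib]
    linear_combination (1 / 2) * h1 + (1 / 2) * h3
  rw [hPu, inner_add_right, hG _ _ he, inner_smul_right]

set_option maxHeartbeats 1000000 in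
/-- Under the hypotheses of short range and ellipticity, the operators are models, uniformly in
the parameter. -/
theorem exists_isModel {c : Coefficients n} (hreg : c.IsRegular) (hδ : 1 ≤ δ)
    (hshort : c.IsShortRange δ) {P : ℝ → L2 n →ₗ.[ℂ] L2 n}
    (hP : ∀ h ∈ Ioc (0 : ℝ) 1, IsSelfAdjointRealization c h (P h)) (hell : IsElliptic P) :
    ∃ K : ℝ, 0 ≤ K ∧ ∀ h ∈ Ioc (0 : ℝ) 1, ∃ q V₁ T T₂, IsModel h K δ (P h) q V₁ T T₂ := by
  obtain ⟨K, hK⟩ := exists_isFormBounded hreg (by linarith : 0 ≤ δ) hshort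
  obtain ⟨C, hC⟩ := hell
  refine ⟨|K| + |C| + 1, by positivity, fun h hh => ?_⟩
  have hc := hK h hh (|K| + |C| + 1) (by linarith [le_abs_self K, abs_nonneg C])
  have hsa := (hP h hh).1
  have hz : (-Complex.I).im ≠ 0 := by simp
  have hCσ := hC h hh 1 (by simp)
  simp only [Complex.ofReal_one, neg_mul, one_mul] at hCσ
  have h1 := fun j : Fin n => hCσ 1 (by norm_num) (fun _ => j)
  -- `![j, i]` means 𝒟_j 𝒟_i, the derivative in direction i being the inner one.
  have h2 := fun j i : Fin n => hCσ 2 le_rfl ![j, i]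
  choose T₁ hT₁ hT₁n using h1
  choose T₂ hT₂ hT₂n using h2
  have hD1 : ∀ j f, HasD h j (unboundedResolvent (P h) (-Complex.I) f) (T₁ j f) := fun j f =>
    hasD_of_isSemiDeriv_one (hT₁ j f)
  have hD2 : ∀ j i f, HasD h j (T₁ i f) (T₂ j i f) := fun j i f =>
    hasD_of_isSemiDeriv_two (α := ![j, i]) (hT₁ i f) (hT₂ j i f)
  obtain ⟨T, hT⟩ : ∃ T : Option (Fin n) → L2 n →L[ℂ] L2 n, T = fun α =>
    match α with
    | none => unboundedResolvent (P h) (-Complex.I)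
    | some j => T₁ j := ⟨_, rfl⟩
  have hT0 : T none = unboundedResolvent (P h) (-Complex.I) := by rw [hT]
  have hTs : ∀ j, T (some j) = T₁ j := fun j => by rw [hT]
  have hdo : ∀ α f, HasDo h α (T none f) (T α f) := by
    intro α f
    cases α with
    | none => rfl
    | some j => rw [hT0, hTs]; exact hD1 j f
  have hCK : C ≤ |K| + |C| + 1 := by linarith [le_abs_self C, abs_nonneg K]
  have hu : ∀ u : (P h).domain, T none (P h u + Complex.I • (u : L2 n)) = u := by
    intro u
    rw [hT0]
    have := unboundedResolvent_apply_sub hsa hz u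
    rwa [neg_smul, sub_neg_eq_add] at this
  have hder : ∀ (u : (P h).domain) α, HasDo h α (u : L2 n) (T α (P h u + Complex.I • (u : L2 n))) :=
    fun u α => by
      have := hdo α (P h u + Complex.I • (u : L2 n))
      rwa [hu] at this
  refine ⟨c.symForm h, c.V1 h, T, fun j => T₂ j j, hh.1, hh.2, hδ, hsa, hc.contDiff_symForm,
    ?_, ?_, ?_, hc.norm_fderiv_symForm_le, hc.V1_meas, hc.V1_le, hT0, hdo, ?_, ?_, ?_, ?_⟩
  · intro α β
    ext1 x
    rw [Coefficients.symForm, Coefficients.symForm, add_comm]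
  · exact fun α β x => IsFormBounded.abs_half_add_le (hc.le α β x) (hc.le β α x)
  · exact fun β x => IsFormBounded.abs_half_add_le (hc.none_le β x) (hc.le_none β x)
  · intro j f
    rw [hTs]; exact hD2 j j f
  · intro α
    cases α with
    | none =>
      rw [hT0]
      refine (norm_unboundedResolvent_le hsa hz).trans ?_
      simp only [Complex.neg_im, Complex.I_im, abs_neg, abs_one, inv_one]
      linarith [abs_nonneg K, abs_nonneg C]
    | some j => rw [hTs]; exact (hT₁n j).trans hCK
  · exact fun j => (hT₂n j j).trans hCK
  · intro u v d hd
    refine inner_apply_symForm hc (by linarith) hh.1.ne' (hP h hh) (fun u => ?_) u (hder u) hd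
    refine ⟨_, hder u, fun β j => ?_⟩
    cases β with
    | none => exact ⟨_, by rw [hu]; exact hder u (some j)⟩
    | some i => exact ⟨_, by rw [hTs]; exact hD2 j i _⟩

end FormCoefficients

/-! ### Induction on the power of the resolvent. -/

section Induction

open scoped ComplexConjugate InnerProductSpace

/-- `F` is bounded on `S` by a constant multiple of `G`. -/
def UBdd {X : Type*} (S : Set X) (F G : X → ℝ) : Prop := ∃ C : ℝ, 0 ≤ C ∧ ∀ p ∈ S, F p ≤ C * G p

namespace UBdd

variable {X : Type*} {S : Set X} {F G H F' G' : X → ℝ}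

lemma of_le (h : ∀ p ∈ S, F p ≤ G p) : UBdd S F G :=
  ⟨1, zero_le_one, fun p hp => by rw [one_mul]; exact h p hp⟩

lemma trans (h₁ : UBdd S F G) (h₂ : UBdd S G H) : UBdd S F H := by
  obtain ⟨C, hC, h⟩ := h₁
  obtain ⟨C', hC', h'⟩ := h₂
  refine ⟨C * C', by positivity, fun p hp => (h p hp).trans ?_⟩
  rw [mul_assoc]
  exact mul_le_mul_of_nonneg_left (h' p hp) hC

lemma trans_le (h₁ : UBdd S F G) (h₂ : ∀ p ∈ S, G p ≤ H p) : UBdd S F H := h₁.trans (of_le h₂)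

lemma le_trans (h₁ : ∀ p ∈ S, F p ≤ G p) (h₂ : UBdd S G H) : UBdd S F H := (of_le h₁).trans h₂

lemma mono {S' : Set X} (h : UBdd S F G) (hS : S' ⊆ S) : UBdd S' F G := by
  obtain ⟨C, hC, h⟩ := h
  exact ⟨C, hC, fun p hp => h p (hS hp)⟩

lemma add (h₁ : UBdd S F H) (h₂ : UBdd S G H) : UBdd S (fun p => F p + G p) H := by
  obtain ⟨C, hC, h⟩ := h₁
  obtain ⟨C', hC', h'⟩ := h₂
  refine ⟨C + C', by positivity, fun p hp => ?_⟩
  rw [add_mul]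
  exact add_le_add (h p hp) (h' p hp)

lemma mul (h₁ : UBdd S F F') (h₂ : UBdd S G G') (hF : ∀ p ∈ S, 0 ≤ F p) (hG : ∀ p ∈ S, 0 ≤ G p) :
    UBdd S (fun p => F p * G p) (fun p => F' p * G' p) := by
  obtain ⟨C, hC, h⟩ := h₁
  obtain ⟨C', hC', h'⟩ := h₂
  refine ⟨C * C', by positivity, fun p hp => ?_⟩
  calc F p * G p ≤ (C * F' p) * (C' * G' p) :=
        mul_le_mul (h p hp) (h' p hp) (hG p hp) ((hF p hp).trans (h p hp))
    _ = _ := by ring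

lemma sum {ι : Type*} {s : Finset ι} {F : ι → X → ℝ} (hF : ∀ i ∈ s, UBdd S (F i) H)
    : UBdd S (fun p => ∑ i ∈ s, F i p) H := by
  classical
  induction s using Finset.induction_on with
  | empty => exact ⟨0, le_rfl, fun p _ => by simp⟩
  | insert i s hi ih =>
    have h1 := (hF i (Finset.mem_insert_self i s)).add
      (ih fun j hj => hF j (Finset.mem_insert_of_mem hj))
    simpa only [Finset.sum_insert hi] using h1

end UBdd

variable {n : ℕ} {P : ℝ → L2 n →ₗ.[ℂ] L2 n} {μ : ℝ → ℝ} {δ E ε₀ c₀ : ℝ}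
  {W : ℕ → ℝ × ℂ → L2 n →L[ℂ] L2 n}

/-- The region of parameters `(h, z)`: a neighbourhood of `[E - ε₀, E + ε₀]` of size `c₀ / μ`,
without the real axis. -/
def strip (μ : ℝ → ℝ) (E ε₀ c₀ : ℝ) : Set (ℝ × ℂ) :=
  {p | p.1 ∈ Ioc (0 : ℝ) 1 ∧ p.2.im ≠ 0 ∧ |p.2.re - E| ≤ ε₀ + |p.2.im| ∧ |p.2.im| * μ p.1 ≤ c₀}

/-- The norm of the weighted power of the resolvent. -/
def wnorm (P : ℝ → L2 n →ₗ.[ℂ] L2 n) (b : ℝ) (k : ℕ) (a : ℝ) (p : ℝ × ℂ) : ℝ :=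
  ‖wres (P p.1) b k a p.2‖

/-- The left hand side of the virial identity. -/
def virialLHS (P : ℝ → L2 n →ₗ.[ℂ] L2 n) (W : ℕ → ℝ × ℂ → L2 n →L[ℂ] L2 n) (k : ℕ) (p : ℝ × ℂ) :
    L2 n →L[ℂ] L2 n :=
  (2 * (k + 1 : ℂ)) • (p.2 • unboundedResolvent (P p.1) p.2 ^ (k + 2) +
    unboundedResolvent (P p.1) p.2 ^ (k + 1)) - W k p

/-- Estimates for a family of operators which imply estimates for powers of the resolvent. -/
structure IsFamily (P : ℝ → L2 n →ₗ.[ℂ] L2 n) (μ : ℝ → ℝ) (δ E ε₀ c₀ : ℝ)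
    (W : ℕ → ℝ × ℂ → L2 n →L[ℂ] L2 n) : Prop where
  isSelfAdjoint : ∀ h ∈ Ioc (0 : ℝ) 1, IsSelfAdjoint (P h)
  one_le_μ : ∀ h ∈ Ioc (0 : ℝ) 1, 1 ≤ μ h
  c₀_pos : 0 < c₀
  c₀_le_one : c₀ ≤ 1
  c₀_le : c₀ ≤ (E - ε₀) / 2
  ε₀_pos : 0 < ε₀
  base : ∀ a > 1 / 2, ∀ b > 1 / 2, UBdd (strip μ E ε₀ c₀) (wnorm P b 1 a) (fun p => μ p.1)
  virial : ∀ (k : ℕ) (a b : ℝ), 1 ≤ a → 1 ≤ b → UBdd (strip μ E ε₀ c₀)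
    (fun p => ‖wt n b * virialLHS P W k p * wt n a‖)
    (fun p => μ p.1 * (wnorm P (b - 1) (k + 1) a p + wnorm P (b - 1) k a p +
      wnorm P b (k + 1) (a - 1) p + wnorm P b k (a - 1) p))
  virialSum : ∀ (k : ℕ) (a b : ℝ) (c d : ℕ → ℝ), 0 ≤ a → 0 ≤ b → (∀ i, 0 ≤ c i) → (∀ i, 0 ≤ d i) →
    (∀ i, i ≤ k → c i + d i = δ - 1) → UBdd (strip μ E ε₀ c₀)
    (fun p => ‖wt n b * W k p * wt n a‖)
    (fun p => ∑ i ∈ Finset.range (k + 1), (wnorm P b (k - i + 1) (c i) p +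
      wnorm P b (k - i) (c i) p) * (wnorm P (d i) (i + 1) a p + wnorm P (d i) i a p))

namespace IsFamily

lemma E_sub_pos (Φ : IsFamily P μ δ E ε₀ c₀ W) : 0 < E - ε₀ := by
  linarith [Φ.c₀_pos, Φ.c₀_le]

lemma abs_im_le (Φ : IsFamily P μ δ E ε₀ c₀ W) {p : ℝ × ℂ} (hp : p ∈ strip μ E ε₀ c₀) :
    |p.2.im| ≤ c₀ :=
  (le_mul_of_one_le_right (abs_nonneg _) (Φ.one_le_μ _ hp.1)).trans hp.2.2.2

/-- Here E > ε₀ matters: the virial identity bounds z Rᵏ⁺², and one divides by z. -/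
lemma le_norm (Φ : IsFamily P μ δ E ε₀ c₀ W) {p : ℝ × ℂ} (hp : p ∈ strip μ E ε₀ c₀) :
    (E - ε₀) / 2 ≤ ‖p.2‖ := by
  have h1 := Φ.abs_im_le hp
  have h2 := (abs_le.mp hp.2.2.1).1
  have h3 := Complex.abs_re_le_norm p.2
  have h4 := le_abs_self p.2.re
  have := Φ.c₀_le
  linarith

lemma norm_le (Φ : IsFamily P μ δ E ε₀ c₀ W) {p : ℝ × ℂ} (hp : p ∈ strip μ E ε₀ c₀) :
    ‖p.2‖ ≤ E + ε₀ + 2 := by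
  have h1 := Φ.abs_im_le hp
  have h2 := abs_le.mp hp.2.2.1
  have h3 := Complex.norm_le_abs_re_add_abs_im p.2
  have h4 : |p.2.re| ≤ E + ε₀ + c₀ := abs_le.mpr ⟨by linarith [Φ.E_sub_pos, Φ.ε₀_pos, Φ.c₀_pos],
    by linarith⟩
  linarith [Φ.c₀_le_one]

lemma scaled_pos (Φ : IsFamily P μ δ E ε₀ c₀ W) {p : ℝ × ℂ} (hp : p ∈ strip μ E ε₀ c₀) :
    0 < |p.2.im| * μ p.1 :=
  mul_pos (abs_pos.mpr hp.2.1) (by linarith [Φ.one_le_μ _ hp.1])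

lemma one_le_rpow (Φ : IsFamily P μ δ E ε₀ c₀ W) {p : ℝ × ℂ} (hp : p ∈ strip μ E ε₀ c₀) {r : ℝ}
    (hr : 0 ≤ r) : 1 ≤ (|p.2.im| * μ p.1) ^ (-r) :=
  Real.one_le_rpow_of_pos_of_le_one_of_nonpos (Φ.scaled_pos hp)
    (hp.2.2.2.trans Φ.c₀_le_one) (by linarith)

/-- The factor by which estimates with a weaker weight are larger. -/
def loss (μ : ℝ → ℝ) (ν : ℝ) (p : ℝ × ℂ) : ℝ := (|p.2.im| * μ p.1) ^ (-((1 - ν) / 2))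

lemma one_le_loss (Φ : IsFamily P μ δ E ε₀ c₀ W) {p : ℝ × ℂ} (hp : p ∈ strip μ E ε₀ c₀) {ν : ℝ}
    (hν : ν ≤ 1) : 1 ≤ loss μ ν p := Φ.one_le_rpow hp (by linarith)

@[simp]
lemma loss_one (p : ℝ × ℂ) : loss μ 1 p = 1 := by simp [loss]

lemma conj_mem_strip {p : ℝ × ℂ} (hp : p ∈ strip μ E ε₀ c₀) :
    ((p.1, conj p.2) : ℝ × ℂ) ∈ strip μ E ε₀ c₀ := by
  simpa [strip] using hp

lemma UBdd_symm (Φ : IsFamily P μ δ E ε₀ c₀ W) {a b : ℝ} (ha : 0 ≤ a) (hb : 0 ≤ b) {k : ℕ}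
    {G : ℝ × ℂ → ℝ} (hG : ∀ p, G (p.1, conj p.2) = G p)
    (h : UBdd (strip μ E ε₀ c₀) (wnorm P b k a) G) : UBdd (strip μ E ε₀ c₀) (wnorm P a k b) G := by
  obtain ⟨C, hC, h⟩ := h
  refine ⟨C, hC, fun p hp => ?_⟩
  have h1 := h _ (conj_mem_strip hp)
  rw [hG] at h1
  rwa [wnorm, norm_wres_conj (Φ.isSelfAdjoint _ hp.1) hp.2.1 ha hb] at h1

/-- The estimate for the power `j + 1` of the resolvent. -/
def Est (P : ℝ → L2 n →ₗ.[ℂ] L2 n) (μ : ℝ → ℝ) (E ε₀ c₀ ν : ℝ) (j : ℕ) : Prop :=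
  -- For ν = 1 both thresholds are j + 1/2 and there is no loss. Smaller ν lowers the threshold of
  -- the left weight by (1 - ν)/2.
  ∀ a > 1 / 2 + (j : ℝ), ∀ b > j + ν / 2,
    UBdd (strip μ E ε₀ c₀) (wnorm P b (j + 1) a) (fun p => μ p.1 ^ (j + 1) * loss μ ν p)

lemma wnorm_zero_le {a b : ℝ} (ha : 0 ≤ a) (hb : 0 ≤ b) (p : ℝ × ℂ) : wnorm P b 0 a p ≤ 1 := by
  rw [wnorm, wres, pow_zero, mul_one]
  exact (norm_mul_le _ _).trans (mul_le_one₀ (norm_wt_le hb) (norm_nonneg _) (norm_wt_le ha))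

/-- Form of the induction hypothesis for the power i instead of j + 1, with i = 0 included; surplus
powers of μ are harmless as μ ≥ 1. -/
lemma estimate_pow (Φ : IsFamily P μ δ E ε₀ c₀ W) {ν : ℝ} (hν1 : ν ≤ 1) {j : ℕ}
    (H : ∀ i < j, Est P μ E ε₀ c₀ ν i) {i k : ℕ} (hi : i ≤ j) (hik : i ≤ k) {a b : ℝ} (ha : 0 ≤ a)
    (hb : 0 ≤ b) (ha' : (i : ℝ) - 1 / 2 < a) (hb' : i - 1 + ν / 2 < b) :
    UBdd (strip μ E ε₀ c₀) (wnorm P b i a) (fun p => μ p.1 ^ k * loss μ ν p) := by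
  have h1 : ∀ p ∈ strip μ E ε₀ c₀, μ p.1 ^ i * loss μ ν p ≤ μ p.1 ^ k * loss μ ν p := fun p hp =>
    mul_le_mul_of_nonneg_right (pow_le_pow_right₀ (Φ.one_le_μ _ hp.1) hik)
      (by linarith [Φ.one_le_loss hp hν1])
  refine UBdd.trans_le ?_ h1
  cases i with
  | zero =>
    refine UBdd.of_le fun p hp => (wnorm_zero_le ha hb p).trans ?_
    rw [pow_zero, one_mul]
    exact Φ.one_le_loss hp hν1
  | succ i =>
    push_cast at ha' hb'
    exact H i (by omega) a (by linarith) b (by linarith)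

/-- The virial identity is solved for z Rᵏ⁺² and divided by z. -/
lemma bound_succ (Φ : IsFamily P μ δ E ε₀ c₀ W) (k : ℕ) (a b : ℝ) :
    UBdd (strip μ E ε₀ c₀) (wnorm P b (k + 2) a) (fun p => ‖wt n b * virialLHS P W k p * wt n a‖ +
      ‖wt n b * W k p * wt n a‖ + wnorm P b (k + 1) a p) := by
  have hE := Φ.E_sub_pos
  refine ⟨2 / (E - ε₀), by positivity, fun p hp => ?_⟩
  have h1 : p.2 • wres (P p.1) b (k + 2) a p.2 = (2 * (k + 1 : ℂ))⁻¹ •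
      (wt n b * virialLHS P W k p * wt n a + wt n b * W k p * wt n a) -
      wres (P p.1) b (k + 1) a p.2 := by
    have h0 : (2 * (k + 1 : ℂ)) ≠ 0 := by
      have : (k + 1 : ℂ) ≠ 0 := by exact_mod_cast Nat.succ_ne_zero k
      simpa using this
    rw [virialLHS, mul_sub, sub_mul, sub_add_cancel, mul_smul_comm, smul_mul_assoc, smul_smul,
      inv_mul_cancel₀ h0, one_smul, mul_add, add_mul, mul_smul_comm, smul_mul_assoc, wres, wres,
      add_sub_cancel_right]
  have h2 : ‖p.2‖ * wnorm P b (k + 2) a p ≤ ‖wt n b * virialLHS P W k p * wt n a‖ +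
      ‖wt n b * W k p * wt n a‖ + wnorm P b (k + 1) a p := by
    rw [wnorm, ← norm_smul, h1]
    refine (norm_sub_le _ _).trans (add_le_add ?_ le_rfl)
    rw [norm_smul]
    have h3 : ‖(2 * (k + 1 : ℂ))⁻¹‖ ≤ 1 := by
      have h4 : (2 * (k + 1 : ℂ)) = ((2 * (k + 1) : ℕ) : ℂ) := by push_cast; ring
      rw [h4, norm_inv, Complex.norm_natCast]
      refine inv_le_one_of_one_le₀ ?_
      exact_mod_cast (by omega : 1 ≤ 2 * (k + 1))
    exact (mul_le_of_le_one_left (norm_nonneg _) h3).trans (norm_add_le _ _)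
  have h5 := Φ.le_norm hp
  rw [div_mul_eq_mul_div, le_div_iff₀ hE]
  have h6 : (E - ε₀) / 2 * wnorm P b (k + 2) a p ≤ ‖p.2‖ * wnorm P b (k + 2) a p :=
    mul_le_mul_of_nonneg_right h5 (norm_nonneg _)
  linarith

/-- In each product only the left factor, which carries the weak weight b, suffers the loss; the
right factor is estimated with ν = 1. -/
lemma bound_virialSum (Φ : IsFamily P μ δ E ε₀ c₀ W) {ν : ℝ} (hν0 : 0 < ν) (hν1 : ν ≤ 1) {k : ℕ}
    (hk : (k : ℝ) + 1 < δ - 1) (H₁ : ∀ i < k + 1, Est P μ E ε₀ c₀ 1 i)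
    (H : ∀ i < k + 1, Est P μ E ε₀ c₀ ν i) {a b : ℝ} (ha : 1 / 2 + (k : ℝ) < a)
    (hb : k + ν / 2 < b) : UBdd (strip μ E ε₀ c₀) (fun p => ‖wt n b * W k p * wt n a‖)
      (fun p => μ p.1 ^ (k + 2) * loss μ ν p) := by
  have hk0 : (0 : ℝ) ≤ k := by positivity
  -- The decay δ - 1 exceeds the needed total 1/2 + (k - i) + 1/2 + i = k + 1 by 2e, and each side
  -- receives e.
  obtain ⟨e, he, he0⟩ : ∃ e : ℝ, 2 * e = δ - 1 - (k + 1) ∧ 0 < e :=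
    ⟨(δ - 1 - (k + 1)) / 2, by ring, by linarith⟩
  refine (Φ.virialSum k a b (fun i => 1 / 2 + ((k - i : ℕ) : ℝ) + e) (fun i => 1 / 2 + i + e)
    (by linarith) (by linarith) (fun i => by positivity) (fun i => by positivity)
    (fun i hi => ?_)).trans (UBdd.sum fun i hi => ?_)
  · push_cast [Nat.cast_sub hi]; linarith
  have hik : i ≤ k := Nat.lt_succ_iff.mp (Finset.mem_range.mp hi)
  have hik' : (i : ℝ) ≤ k := by exact_mod_cast hik
  have hki : ((k - i : ℕ) : ℝ) ≤ k := by exact_mod_cast Nat.sub_le k i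
  have hki0 : (0 : ℝ) ≤ ((k - i : ℕ) : ℝ) := by positivity
  have hi0 : (0 : ℝ) ≤ i := by positivity
  have h1 : UBdd (strip μ E ε₀ c₀) (fun p => wnorm P b (k - i + 1) (1 / 2 + ((k - i : ℕ) : ℝ) + e) p +
      wnorm P b (k - i) (1 / 2 + ((k - i : ℕ) : ℝ) + e) p)
      (fun p => μ p.1 ^ (k - i + 1) * loss μ ν p) := by
    refine UBdd.add (Φ.estimate_pow hν1 H (by omega) le_rfl (by positivity) (by linarith) ?_ ?_)
      (Φ.estimate_pow hν1 H (by omega) (by omega) (by positivity) (by linarith) ?_ ?_) <;>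
      push_cast <;> linarith
  have h2 : UBdd (strip μ E ε₀ c₀) (fun p => wnorm P (1 / 2 + i + e) (i + 1) a p +
      wnorm P (1 / 2 + i + e) i a p) (fun p => μ p.1 ^ (i + 1) * loss μ 1 p) := by
    refine UBdd.add (Φ.estimate_pow le_rfl H₁ (by omega) le_rfl (by linarith) (by positivity) ?_ ?_)
      (Φ.estimate_pow le_rfl H₁ (by omega) (by omega) (by linarith) (by positivity) ?_ ?_) <;>
      push_cast <;> linarith
  refine (h1.mul h2 (fun p _ => add_nonneg (norm_nonneg _) (norm_nonneg _))
    (fun p _ => add_nonneg (norm_nonneg _) (norm_nonneg _))).trans_le fun p _ => le_of_eq ?_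
  rw [loss_one, mul_one, show k + 2 = (k - i + 1) + (i + 1) by omega, pow_add]
  ring

/-- The commutator with dilations lowers one weight and the power by one each, so the thresholds
match the induction hypothesis; the prefactor supplies the extra μ. -/
lemma estimate_succ (Φ : IsFamily P μ δ E ε₀ c₀ W) {ν : ℝ} (hν0 : 0 < ν) (hν1 : ν ≤ 1) {k : ℕ}
    (hk : (k : ℝ) + 1 < δ - 1) (H₁ : ∀ i < k + 1, Est P μ E ε₀ c₀ 1 i)
    (H : ∀ i < k + 1, Est P μ E ε₀ c₀ ν i) : Est P μ E ε₀ c₀ ν (k + 1) := by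
  intro a ha b hb
  push_cast at ha hb
  have hk0 : (0 : ℝ) ≤ k := by positivity
  refine (Φ.bound_succ k a b).trans (UBdd.add (UBdd.add ?_ ?_) ?_)
  · refine (Φ.virial k a b (by linarith) (by linarith)).trans ?_
    have h1 : UBdd (strip μ E ε₀ c₀) (fun p => wnorm P (b - 1) (k + 1) a p + wnorm P (b - 1) k a p +
      wnorm P b (k + 1) (a - 1) p + wnorm P b k (a - 1) p)
      (fun p => μ p.1 ^ (k + 1) * loss μ ν p) := by
      refine UBdd.add (UBdd.add (UBdd.add
        (Φ.estimate_pow hν1 H le_rfl le_rfl (by linarith) (by linarith) ?_ ?_)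
        (Φ.estimate_pow hν1 H (by omega) (by omega) (by linarith) (by linarith) ?_ ?_))
        (Φ.estimate_pow hν1 H le_rfl le_rfl (by linarith) (by linarith) ?_ ?_))
        (Φ.estimate_pow hν1 H (by omega) (by omega) (by linarith) (by linarith) ?_ ?_) <;>
        push_cast <;> linarith
    refine ((UBdd.of_le fun p _ => le_rfl : UBdd _ (fun p => μ p.1) (fun p => μ p.1)).mul h1
      (fun p hp => by linarith [Φ.one_le_μ _ hp.1]) (fun p _ => ?_)).trans_le fun p _ => le_of_eq ?_
    · exact add_nonneg (add_nonneg (add_nonneg (norm_nonneg _) (norm_nonneg _)) (norm_nonneg _))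
        (norm_nonneg _)
    · ring
  · exact Φ.bound_virialSum hν0 hν1 hk H₁ H (by linarith) (by linarith)
  · refine Φ.estimate_pow hν1 H le_rfl (by omega) (by linarith) (by linarith) ?_ ?_ <;>
      push_cast <;> linarith

lemma estimate_one_zero (Φ : IsFamily P μ δ E ε₀ c₀ W) : Est P μ E ε₀ c₀ 1 0 := by
  intro a ha b hb
  simp only [Nat.cast_zero, add_zero, zero_add] at ha hb
  simpa using Φ.base a ha b hb

/-- Bound of the resolvent with a weight on one side only. -/
lemma norm_resolvent_mul_wt_sq_le {P : L2 n →ₗ.[ℂ] L2 n} (hP : IsSelfAdjoint P) {z : ℂ}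
    (hz : z.im ≠ 0) {a : ℝ} (ha : 0 ≤ a) (f : L2 n) :
    |z.im| * ‖unboundedResolvent P z (wt n a f)‖ ^ 2 ≤ ‖wres P a 1 a z‖ * ‖f‖ ^ 2 := by
  have hm := unboundedResolvent_mem hP hz (wt n a f)
  have h1 := hP.inner_apply_sub_smul_im z ⟨_, hm⟩
  rw [apply_unboundedResolvent hP hz, add_sub_cancel_left] at h1
  replace h1 : (inner ℂ (unboundedResolvent P z (wt n a f)) (wt n a f)).im =
    -z.im * ‖unboundedResolvent P z (wt n a f)‖ ^ 2 := h1
  have h2 : |z.im| * ‖unboundedResolvent P z (wt n a f)‖ ^ 2 ≤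
      ‖inner ℂ (unboundedResolvent P z (wt n a f)) (wt n a f)‖ := by
    refine le_trans (le_of_eq ?_) (Complex.abs_im_le_norm _)
    rw [h1, abs_mul, abs_neg,
      abs_of_nonneg (sq_nonneg ‖unboundedResolvent P z (wt n a f)‖)]
  refine h2.trans ?_
  rw [← inner_wt_left ha]
  refine (norm_inner_le_norm _ _).trans ?_
  have h3 := (wres P a 1 a z).le_opNorm f
  rw [wres_apply, pow_one] at h3
  calc _ ≤ ‖wres P a 1 a z‖ * ‖f‖ * ‖f‖ := mul_le_mul_of_nonneg_right h3 (norm_nonneg _)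
    _ = _ := by ring

/-- Interpolation between the two-sided weighted bound of order μ and the bound (μ / |Im z|)^(1/2)
with no weight on the left. The product μ^ν (μ / |Im z|)^((1-ν)/2) equals μ (|Im z| μ)^(-(1-ν)/2).
-/
lemma estimate_zero (Φ : IsFamily P μ δ E ε₀ c₀ W) {ν : ℝ} (hν0 : 0 < ν) (hν1 : ν < 1) :
    Est P μ E ε₀ c₀ ν 0 := by
  intro a ha b hb
  simp only [Nat.cast_zero, add_zero, zero_add] at ha hb
  -- The weight b is written as ν (b / ν); the hypothesis b > ν / 2 is exactly admissibility of b /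
  -- ν in the two-sided bound.
  have hb1 : 1 / 2 < b / ν := by rw [lt_div_iff₀ hν0]; linarith
  obtain ⟨C₁, hC₁, h1⟩ := Φ.base a ha a ha
  obtain ⟨C₂, hC₂, h2⟩ := Φ.base a ha (b / ν) hb1
  refine ⟨C₂ ^ ν * (C₁ ^ (1 / 2 : ℝ)) ^ (1 - ν), by positivity, fun p hp => ?_⟩
  have hμ := Φ.one_le_μ _ hp.1
  have hμ0 : 0 < μ p.1 := by linarith
  have ht := Φ.scaled_pos hp
  have hy := abs_pos.mpr hp.2.1
  refine ContinuousLinearMap.opNorm_le_bound _ (by unfold loss; positivity) fun f => ?_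
  obtain ⟨g, hg⟩ : ∃ g, g = unboundedResolvent (P p.1) p.2 (wt n a f) := ⟨_, rfl⟩
  have e1 : wres (P p.1) b (0 + 1) a p.2 f = wt n (ν * (b / ν)) g := by
    rw [wres_apply, hg, mul_div_cancel₀ _ hν0.ne', zero_add, pow_one]
  have e2 : ‖wt n (b / ν) g‖ ≤ (C₂ * μ p.1) * ‖f‖ := by
    have h3 := (wres (P p.1) (b / ν) 1 a p.2).le_opNorm f
    rw [wres_apply, pow_one, ← hg] at h3
    exact h3.trans (mul_le_mul_of_nonneg_right (h2 p hp) (norm_nonneg _))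
  have e3 : ‖g‖ ≤ C₁ ^ (1 / 2 : ℝ) * (μ p.1 * (|p.2.im| * μ p.1) ^ (-(1 / 2 : ℝ))) * ‖f‖ := by
    have h4 := norm_resolvent_mul_wt_sq_le (Φ.isSelfAdjoint _ hp.1) hp.2.1
      (by linarith : 0 ≤ a) f
    rw [← hg] at h4
    have h5 := h4.trans (mul_le_mul_of_nonneg_right (h1 p hp) (sq_nonneg _))
    refine abs_le_of_sq_le_sq' (?_ : ‖g‖ ^ 2 ≤ _ ^ 2) (by positivity) |>.2
    rw [mul_pow, mul_pow, mul_pow, ← Real.rpow_mul_natCast hC₁, ← Real.rpow_mul_natCast ht.le]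
    norm_num
    rw [Real.rpow_neg_one, mul_inv, show C₁ * (μ p.1 ^ 2 * (|p.2.im|⁻¹ * (μ p.1)⁻¹)) * ‖f‖ ^ 2 =
      (C₁ * μ p.1 * ‖f‖ ^ 2) / |p.2.im| by field_simp]
    rw [le_div_iff₀ hy]
    linarith
  rw [e1]
  refine (norm_wt_mul_le (by positivity) hν0 hν1 g).trans ?_
  have h6 : 0 ≤ 1 - ν := by linarith
  calc _ ≤ ((C₂ * μ p.1) * ‖f‖) ^ ν *
        (C₁ ^ (1 / 2 : ℝ) * (μ p.1 * (|p.2.im| * μ p.1) ^ (-(1 / 2 : ℝ))) * ‖f‖) ^ (1 - ν) := by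
        gcongr
    _ = C₂ ^ ν * (C₁ ^ (1 / 2 : ℝ)) ^ (1 - ν) * ((μ p.1 ^ ν * μ p.1 ^ (1 - ν)) *
        ((|p.2.im| * μ p.1) ^ (-(1 / 2 : ℝ))) ^ (1 - ν)) * (‖f‖ ^ ν * ‖f‖ ^ (1 - ν)) := by
        rw [Real.mul_rpow (by positivity) (by positivity), Real.mul_rpow hC₂ hμ0.le,
          Real.mul_rpow (by positivity) (by positivity),
          Real.mul_rpow (by positivity) (by positivity),
          Real.mul_rpow hμ0.le (by positivity)]
        ring
    _ = _ := by
        have h7 : ‖f‖ ^ ν * ‖f‖ ^ (1 - ν) = ‖f‖ := by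
          rw [← Real.rpow_add' (norm_nonneg _) (by norm_num), add_sub_cancel, Real.rpow_one]
        rw [h7, ← Real.rpow_add hμ0, add_sub_cancel, Real.rpow_one, ← Real.rpow_mul ht.le]
        simp only [loss]
        ring_nf

/-- Estimates of powers of the resolvent. -/
theorem estimate (Φ : IsFamily P μ δ E ε₀ c₀ W) {ν : ℝ} (hν0 : 0 < ν) (hν1 : ν ≤ 1) (j : ℕ)
    (hj : (j : ℝ) < δ - 1) : Est P μ E ε₀ c₀ ν j := by
  -- The case ν = 1 is settled first because it enters the induction for ν < 1.
  have h1 : ∀ j : ℕ, (j : ℝ) < δ - 1 → Est P μ E ε₀ c₀ 1 j := by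
    intro j
    induction j using Nat.strong_induction_on with
    | _ j ih =>
      intro hj
      cases j with
      | zero => exact Φ.estimate_one_zero
      | succ k =>
        push_cast at hj
        have h2 : ∀ i < k + 1, Est P μ E ε₀ c₀ 1 i := fun i hi => ih i hi (by
          have : (i : ℝ) ≤ k := by exact_mod_cast Nat.lt_succ_iff.mp hi
          linarith)
        exact Φ.estimate_succ one_pos le_rfl hj h2 h2
  rcases hν1.eq_or_lt with rfl | hν1'
  · exact h1 j hj
  induction j using Nat.strong_induction_on with
  | _ j ih =>
    cases j with
    | zero => exact Φ.estimate_zero hν0 hν1'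
    | succ k =>
      push_cast at hj
      have hlt : ∀ i < k + 1, (i : ℝ) < δ - 1 := fun i hi => by
        have : (i : ℝ) ≤ k := by exact_mod_cast Nat.lt_succ_iff.mp hi
        linarith
      exact Φ.estimate_succ hν0 hν1 hj (fun i hi => h1 i (hlt i hi)) fun i hi => ih i hi (hlt i hi)

end IsFamily

end Induction

/-! ### Interpolation of weights by dyadic decomposition. -/

section Interpolation

open scoped ComplexConjugate InnerProductSpace

variable {n : ℕ}

/-- The indicator function of the dyadic block `2ᵏ ≤ ⟨x⟩ < 2ᵏ⁺¹`. -/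
def block (k : ℕ) (x : Space n) : ℝ :=
  Set.indicator {x : Space n | (2 : ℝ) ^ k ≤ bracket 1 x ∧ bracket 1 x < 2 ^ (k + 1)} 1 x

lemma measurable_block (k : ℕ) : Measurable (block (n := n) k) := by
  have hb : Measurable (bracket (n := n) 1) := (continuous_bracket 1).measurable
  exact measurable_one.indicator
    ((measurableSet_le measurable_const hb).inter (measurableSet_lt hb measurable_const))

lemma block_nonneg (k : ℕ) (x : Space n) : 0 ≤ block k x :=
  Set.indicator_nonneg (fun _ _ => zero_le_one) x

lemma bracket_eq_rpow (r : ℝ) (x : Space n) : bracket r x = bracket 1 x ^ r := by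
  rw [bracket_rpow, one_mul]

lemma block_mul_bracket_le_of_nonpos {r : ℝ} (hr : r ≤ 0) (k : ℕ) (x : Space n) :
    |block k x * bracket r x| ≤ ((2 : ℝ) ^ k) ^ r := by
  rw [abs_mul, abs_of_nonneg (block_nonneg k x), abs_of_pos (bracket_pos r x), block]
  by_cases hx : x ∈ {x : Space n | (2 : ℝ) ^ k ≤ bracket 1 x ∧ bracket 1 x < 2 ^ (k + 1)}
  · rw [Set.indicator_of_mem hx, Pi.one_apply, one_mul, bracket_eq_rpow]
    exact Real.rpow_le_rpow_of_nonpos (by positivity) hx.1 hr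
  · rw [Set.indicator_of_notMem hx, zero_mul]; positivity

lemma block_mul_bracket_le_of_nonneg {r : ℝ} (hr : 0 ≤ r) (k : ℕ) (x : Space n) :
    |block k x * bracket r x| ≤ ((2 : ℝ) ^ (k + 1)) ^ r := by
  rw [abs_mul, abs_of_nonneg (block_nonneg k x), abs_of_pos (bracket_pos r x), block]
  by_cases hx : x ∈ {x : Space n | (2 : ℝ) ^ k ≤ bracket 1 x ∧ bracket 1 x < 2 ^ (k + 1)}
  · rw [Set.indicator_of_mem hx, Pi.one_apply, one_mul, bracket_eq_rpow]
    exact Real.rpow_le_rpow (bracket_pos 1 x).le hx.2.le hr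
  · rw [Set.indicator_of_notMem hx, zero_mul]; positivity

lemma isMultiplier_block_mul (k : ℕ) (r : ℝ) :
    IsMultiplier (fun x : Space n => block k x * bracket r x) := by
  refine ⟨((measurable_block k).mul (continuous_bracket r).measurable).aestronglyMeasurable, ?_⟩
  rcases le_total r 0 with hr | hr
  · exact ⟨_, Eventually.of_forall (block_mul_bracket_le_of_nonpos hr k)⟩
  · exact ⟨_, Eventually.of_forall (block_mul_bracket_le_of_nonneg hr k)⟩

lemma isMultiplier_block (k : ℕ) : IsMultiplier (block (n := n) k) := by
  simpa using isMultiplier_block_mul (n := n) k 0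

lemma wt_block {a b : ℝ} (ha : 0 ≤ a) (hb : 0 ≤ b) (k : ℕ) (f : L2 n) :
    wt n a (mulOp (block k) f) = wt n b (mulOp (fun x => block k x * bracket (b - a) x) f) := by
  rw [wt, wt, mulOp_mulOp (isMultiplier_wt ha) (isMultiplier_block k),
    mulOp_mulOp (isMultiplier_wt hb) (isMultiplier_block_mul k _)]
  congr 2
  ext1 x
  rw [show bracket (-b) x * (block k x * bracket (b - a) x) =
    (bracket (-b) x * bracket (b - a) x) * block k x by ring, bracket_mul_bracket]
  ring_nf

lemma sum_block (N : ℕ) (x : Space n) : ∑ k ∈ Finset.range N, block k x =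
    Set.indicator {x : Space n | bracket 1 x < 2 ^ N} 1 x := by
  induction N with
  | zero =>
    have h1 := one_le_bracket zero_le_one x
    rw [Finset.sum_range_zero, Set.indicator_of_notMem]
    simp only [pow_zero, Set.mem_ofPred_eq, not_lt]
    exact h1
  | succ N ih =>
    have h2 : (2 : ℝ) ^ N ≤ 2 ^ (N + 1) := pow_le_pow_right₀ one_le_two (Nat.le_succ N)
    rw [Finset.sum_range_succ, ih, block]
    simp only [Set.indicator_apply, Set.mem_ofPred_eq, Pi.one_apply]
    by_cases h3 : bracket 1 x < 2 ^ N
    · have h4 : ¬ (2 ^ N ≤ bracket 1 x) := not_le.mpr h3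
      simp [h3, h4, h3.trans_le h2]
    · simp [h3, not_lt.mp h3]

lemma tendsto_sum_block (f : L2 n) :
    Tendsto (fun N : ℕ => ∑ k ∈ Finset.range N, mulOp (block k) f) atTop (𝓝 f) := by
  have e : ∀ N : ℕ, ∑ k ∈ Finset.range N, mulOp (block k) f =
      mulOp (fun x => ∑ k ∈ Finset.range N, block k x) f := fun N =>
    (mulOp_sum _ (fun k _ => isMultiplier_block k) f).symm
  simp_rw [e]
  have h1 : mulOp (fun _ => 1) f = f := by rw [mulOp_const]; simp
  nth_rewrite 2 [← h1]
  refine tendsto_mulOp (C := 1) (Eventually.of_forall fun N =>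
    IsMultiplier.sum _ fun k _ => isMultiplier_block k) (IsMultiplier.const 1)
    (Eventually.of_forall fun N => Eventually.of_forall fun x => ?_)
    (Eventually.of_forall fun x => ?_) f
  · rw [sum_block, Set.indicator_apply]
    split_ifs <;> simp
  · refine tendsto_const_nhds.congr' ?_
    have h2 := (tendsto_pow_atTop_atTop_of_one_lt (r := (2 : ℝ)) one_lt_two).eventually_gt_atTop
      (bracket 1 x)
    filter_upwards [h2] with N hN
    rw [sum_block, Set.indicator_of_mem]
    · rfl
    · exact hN

lemma le_rpow_mul_rpow {x X Y θ : ℝ} (hx : 0 ≤ x) (hX : x ≤ X) (hY : x ≤ Y) (hθ0 : 0 ≤ θ)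
    (hθ1 : θ ≤ 1) : x ≤ X ^ (1 - θ) * Y ^ θ := by
  have h1 : x = x ^ (1 - θ) * x ^ θ := by
    rw [← Real.rpow_add' hx (by norm_num), sub_add_cancel, Real.rpow_one]
  rw [h1]
  have h2 : 0 ≤ 1 - θ := by linarith
  have h3 : 0 ≤ X := hx.trans hX
  gcongr

/-- Two sided interpolation between weights. -/
lemma exists_norm_wt_mul_wt_le {a₀ a₁ a θ : ℝ} (h₀ : 0 ≤ a₀) (h₀a : a₀ ≤ a) (ha₁ : a ≤ a₁)
    (hθ0 : 0 < θ) (hθ1 : θ < 1) (hθ : (1 - θ) * a₀ + θ * a₁ < a) :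
    ∃ C : ℝ, 0 ≤ C ∧ ∀ (A : L2 n →L[ℂ] L2 n) (M₀ M₁ : ℝ), 0 ≤ M₀ → 0 ≤ M₁ →
      ‖wt n a₀ * A * wt n a₀‖ ≤ M₀ → ‖wt n a₁ * A * wt n a₁‖ ≤ M₁ →
      ‖wt n a * A * wt n a‖ ≤ C * (M₀ ^ (1 - θ) * M₁ ^ θ) := by
  -- r k is the geometric mean, with parameter θ, of the quotients of weights on the k-th block. The
  -- strict inequality on a makes it decay geometrically; this slack replaces complex interpolation.
  obtain ⟨r, hr⟩ : ∃ r : ℕ → ℝ, r = fun k => (((2 : ℝ) ^ k) ^ (a₀ - a)) ^ (1 - θ) *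
    (((2 : ℝ) ^ (k + 1)) ^ (a₁ - a)) ^ θ := ⟨_, rfl⟩
  have hr0 : ∀ k, 0 ≤ r k := fun k => by rw [hr]; positivity
  obtain ⟨e, he⟩ : ∃ e : ℝ, e = (1 - θ) * a₀ + θ * a₁ - a := ⟨_, rfl⟩
  have hre : ∀ k, r k = (2 : ℝ) ^ ((a₁ - a) * θ) * ((2 : ℝ) ^ e) ^ k := fun k => by
    have h2 : (0 : ℝ) < 2 := two_pos
    rw [hr]
    dsimp only
    rw [← Real.rpow_natCast 2 k, ← Real.rpow_natCast 2 (k + 1), ← Real.rpow_mul h2.le,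
      ← Real.rpow_mul h2.le, ← Real.rpow_mul h2.le, ← Real.rpow_mul h2.le, ← Real.rpow_add h2,
      ← Real.rpow_natCast (2 ^ e) k, ← Real.rpow_mul h2.le, ← Real.rpow_add h2, he]
    congr 1
    push_cast
    ring
  have hsum : Summable r := by
    have : r = fun k => (2 : ℝ) ^ ((a₁ - a) * θ) * ((2 : ℝ) ^ e) ^ k := funext hre
    rw [this]
    refine (summable_geometric_of_lt_one (by positivity) ?_).mul_left _
    exact Real.rpow_lt_one_of_one_lt_of_neg one_lt_two (by rw [he]; linarith)
  refine ⟨(∑' k, r k) * (∑' k, r k), mul_self_nonneg _, fun A M₀ M₁ hM₀ hM₁ hA₀ hA₁ => ?_⟩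
  have ha : 0 ≤ a := h₀.trans h₀a
  have ha1 : 0 ≤ a₁ := ha.trans ha₁
  have hterm : ∀ (b : ℝ) (_ : 0 ≤ b) (M : ℝ) (_ : ‖wt n b * A * wt n b‖ ≤ M) (c : ℕ → ℝ)
      (_ : ∀ k x, |block (n := n) k x * bracket (b - a) x| ≤ c k) (k l : ℕ) (f g : L2 n),
      ‖inner ℂ (mulOp (block k) g) ((wt n a * A * wt n a) (mulOp (block l) f))‖ ≤
        M * (c k * ‖g‖) * (c l * ‖f‖) := by
    intro b hb M hM c hc k l f g
    have hc0 : ∀ k, 0 ≤ c k := fun k => (abs_nonneg _).trans (hc k 0)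
    have hn : ∀ k f, ‖mulOp (fun x => block k x * bracket (b - a) x) f‖ ≤ c k * ‖f‖ := fun k f =>
      norm_mulOp_le (isMultiplier_block_mul k _) (Eventually.of_forall (hc k)) f
    rw [mul_apply_eq_comp, mul_apply_eq_comp, ← inner_wt_left ha, wt_block ha hb, wt_block ha hb,
      inner_wt_left hb, ← mul_apply_eq_comp, ← mul_apply_eq_comp]
    refine (norm_inner_le_norm _ _).trans ?_
    have h1 := ((wt n b * A) * wt n b).le_of_opNorm_le hM
      (mulOp (fun x => block l x * bracket (b - a) x) f)
    have hM0 : 0 ≤ M := (norm_nonneg _).trans hM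
    have h2 : ‖((wt n b * A) * wt n b) (mulOp (fun x => block l x * bracket (b - a) x) f)‖ ≤
        M * (c l * ‖f‖) := h1.trans (mul_le_mul_of_nonneg_left (hn l f) hM0)
    refine (mul_le_mul (hn k g) h2 (norm_nonneg _) (mul_nonneg (hc0 k) (norm_nonneg _))).trans_eq ?_
    ring
  -- The matrix element between two blocks obeys both bounds, hence their geometric mean, and the
  -- double sum factorizes.
  have hkl : ∀ (k l : ℕ) (f g : L2 n),
      ‖inner ℂ (mulOp (block k) g) ((wt n a * A * wt n a) (mulOp (block l) f))‖ ≤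
        (M₀ ^ (1 - θ) * M₁ ^ θ) * (‖g‖ * ‖f‖) * (r k * r l) := by
    intro k l f g
    have h1 := hterm a₀ h₀ M₀ hA₀ (fun k => ((2 : ℝ) ^ k) ^ (a₀ - a))
      (block_mul_bracket_le_of_nonpos (by linarith)) k l f g
    have h2 := hterm a₁ ha1 M₁ hA₁ (fun k => ((2 : ℝ) ^ (k + 1)) ^ (a₁ - a))
      (block_mul_bracket_le_of_nonneg (by linarith)) k l f g
    refine (le_rpow_mul_rpow (norm_nonneg _) h1 h2 hθ0.le hθ1.le).trans_eq ?_
    rw [hr]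
    have hf : ‖f‖ ^ (1 - θ) * ‖f‖ ^ θ = ‖f‖ := by
      rw [← Real.rpow_add' (norm_nonneg _) (by norm_num), sub_add_cancel, Real.rpow_one]
    have hg : ‖g‖ ^ (1 - θ) * ‖g‖ ^ θ = ‖g‖ := by
      rw [← Real.rpow_add' (norm_nonneg _) (by norm_num), sub_add_cancel, Real.rpow_one]
    nth_rewrite 3 [← hf]
    nth_rewrite 3 [← hg]
    rw [Real.mul_rpow (by positivity) (by positivity), Real.mul_rpow hM₀ (by positivity),
      Real.mul_rpow (by positivity) (norm_nonneg _), Real.mul_rpow (by positivity) (norm_nonneg _),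
      Real.mul_rpow (by positivity) (by positivity), Real.mul_rpow hM₁ (by positivity),
      Real.mul_rpow (by positivity) (norm_nonneg _), Real.mul_rpow (by positivity) (norm_nonneg _)]
    ring
  have hpart : ∀ (N : ℕ) (f g : L2 n), ‖inner ℂ (∑ k ∈ Finset.range N, mulOp (block k) g)
      ((wt n a * A * wt n a) (∑ l ∈ Finset.range N, mulOp (block l) f))‖ ≤
        (∑' k, r k) * (∑' k, r k) * (M₀ ^ (1 - θ) * M₁ ^ θ) * (‖f‖ * ‖g‖) := by
    intro N f g
    rw [map_sum, sum_inner]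
    simp_rw [inner_sum]
    refine (norm_sum_le _ _).trans ((Finset.sum_le_sum fun k _ => (norm_sum_le _ _).trans
      (Finset.sum_le_sum fun l _ => hkl k l f g)).trans ?_)
    have hs : ∑ k ∈ Finset.range N, r k ≤ ∑' k, r k := hsum.sum_le_tsum _ fun k _ => hr0 k
    have ht0 : 0 ≤ ∑' k, r k := tsum_nonneg hr0
    have hs0 : 0 ≤ ∑ k ∈ Finset.range N, r k := Finset.sum_nonneg fun k _ => hr0 k
    calc _ = (M₀ ^ (1 - θ) * M₁ ^ θ) * (‖g‖ * ‖f‖) *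
          ((∑ k ∈ Finset.range N, r k) * ∑ k ∈ Finset.range N, r k) := by
          simp_rw [← Finset.mul_sum, ← Finset.sum_mul]
      _ ≤ (M₀ ^ (1 - θ) * M₁ ^ θ) * (‖g‖ * ‖f‖) * ((∑' k, r k) * ∑' k, r k) := by gcongr
      _ = _ := by ring
  refine opNorm_le_of_inner (mul_nonneg (mul_self_nonneg _) (by positivity)) fun f g => ?_
  have hlim := ((tendsto_sum_block g).inner (𝕜 := ℂ)
    (((wt n a * A * wt n a).continuous.tendsto f).comp (tendsto_sum_block f))).norm
  exact le_of_tendsto hlim (Eventually.of_forall fun N => hpart N f g)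

end Interpolation

/-! ### The power with an integrable singularity at the real axis. -/

section LastStep

open scoped ComplexConjugate InnerProductSpace

variable {n : ℕ} {P : ℝ → L2 n →ₗ.[ℂ] L2 n} {μ : ℝ → ℝ} {δ E ε₀ c₀ : ℝ}
  {W : ℕ → ℝ × ℂ → L2 n →L[ℂ] L2 n}

/-- A rectangular neighbourhood of `[E - ε₀, E + ε₀]` without the real axis, of size `c₀ / μ`. -/
def rectangle (μ : ℝ → ℝ) (E ε₀ c₀ : ℝ) : Set (ℝ × ℂ) :=
  {p | p.1 ∈ Ioc (0 : ℝ) 1 ∧ p.2.im ≠ 0 ∧ |p.2.re - E| ≤ ε₀ ∧ |p.2.im| * μ p.1 ≤ c₀ / 2}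

lemma hasDerivAt_wres {P : L2 n →ₗ.[ℂ] L2 n} (hP : IsSelfAdjoint P) {z : ℂ} (hz : z.im ≠ 0)
    (b : ℝ) (k : ℕ) (a : ℝ) :
    HasDerivAt (wres P b k a) ((k : ℂ) • wres P b (k + 1) a z) z := by
  have h1 := ((hasDerivAt_unboundedResolvent_pow hP hz k).const_mul (wt n b)).mul_const (wt n a)
  refine h1.congr_deriv ?_
  rw [wres, mul_smul_comm, smul_mul_assoc]

lemma norm_wt_mul_wt_le_of_le {a a' b b' : ℝ} (ha : 0 ≤ a) (ha' : a ≤ a') (hb : 0 ≤ b)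
    (hb' : b ≤ b') (A : L2 n →L[ℂ] L2 n) : ‖wt n b' * A * wt n a'‖ ≤ ‖wt n b * A * wt n a‖ := by
  have e1 : wt n a' = wt n a * wt n (a' - a) := by
    rw [← wt_add ha (by linarith), add_sub_cancel]
  have e2 : wt n b' = wt n (b' - b) * wt n b := by
    rw [← wt_add (by linarith) hb, sub_add_cancel]
  rw [e1, e2, show wt n (b' - b) * wt n b * A * (wt n a * wt n (a' - a)) =
    wt n (b' - b) * ((wt n b * A * wt n a) * wt n (a' - a)) by simp only [mul_assoc]]
  have h1 : ‖wt n (b' - b)‖ ≤ 1 := norm_wt_le (by linarith)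
  have h2 : ‖wt n (a' - a)‖ ≤ 1 := norm_wt_le (by linarith)
  refine (norm_mul_le _ _).trans ((mul_le_of_le_one_left (norm_nonneg _) h1).trans ?_)
  exact (norm_mul_le _ _).trans (mul_le_of_le_one_right (norm_nonneg _) h2)

namespace IsFamily

lemma rectangle_subset (Φ : IsFamily P μ δ E ε₀ c₀ W) :
    rectangle μ E ε₀ c₀ ⊆ strip μ E ε₀ c₀ := fun p hp =>
  ⟨hp.1, hp.2.1, hp.2.2.1.trans (by linarith [abs_nonneg p.2.im]),
    hp.2.2.2.trans (by linarith [Φ.c₀_pos])⟩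

/-- In the disc of radius |Im z| / 2 the imaginary part stays between 1/2 and 3/2 of its value,
which c₀ / 2 against c₀ allows. The real part may leave the interval by at most |Im w|, which the
slanted sides of the strip permit. -/
lemma sphere_mem_strip (Φ : IsFamily P μ δ E ε₀ c₀ W) {p : ℝ × ℂ} (hp : p ∈ rectangle μ E ε₀ c₀)
    {w : ℂ} (hw : w ∈ Metric.closedBall p.2 (|p.2.im| / 2)) :
    ((p.1, w) : ℝ × ℂ) ∈ strip μ E ε₀ c₀ := by
  have hd : ‖w - p.2‖ ≤ |p.2.im| / 2 := by simpa [dist_eq_norm] using hw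
  have h1 : |w.im - p.2.im| ≤ |p.2.im| / 2 := (Complex.abs_im_le_norm (w - p.2)).trans hd
  have h2 : |w.re - p.2.re| ≤ |p.2.im| / 2 := (Complex.abs_re_le_norm (w - p.2)).trans hd
  have hy := abs_pos.mpr hp.2.1
  have h3 : |p.2.im| / 2 ≤ |w.im| := by
    have := abs_sub_abs_le_abs_sub p.2.im w.im
    rw [abs_sub_comm] at this
    linarith
  have h4 : |w.im| ≤ 3 / 2 * |p.2.im| := by
    have := abs_sub_abs_le_abs_sub w.im p.2.im
    linarith
  have hμ := Φ.one_le_μ _ hp.1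
  refine ⟨hp.1, abs_pos.mp (by linarith), ?_, ?_⟩
  · have := abs_sub_le w.re p.2.re E
    change |w.re - E| ≤ ε₀ + |w.im|
    linarith [hp.2.2.1]
  · have h5 := hp.2.2.2
    change |w.im| * μ p.1 ≤ c₀
    have : |w.im| * μ p.1 ≤ 3 / 2 * |p.2.im| * μ p.1 := by gcongr
    linarith [Φ.c₀_pos]

/-- Cauchy's estimate for the next power of the resolvent. -/
lemma cauchy_estimate (Φ : IsFamily P μ δ E ε₀ c₀ W) {m : ℕ} (hm : (m : ℝ) < δ - 1) {a b : ℝ}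
    (ha : 1 / 2 + (m : ℝ) < a) (hb : 1 / 2 + (m : ℝ) < b) :
    UBdd (rectangle μ E ε₀ c₀) (wnorm P b (m + 2) a)
      (fun p => μ p.1 ^ (m + 2) * (|p.2.im| * μ p.1) ^ (-1 : ℝ)) := by
  obtain ⟨C, hC, H⟩ := Φ.estimate one_pos le_rfl m hm a ha b (by linarith)
  refine ⟨2 * C, by positivity, fun p hp => ?_⟩
  have hy := abs_pos.mpr hp.2.1
  have hμ : 0 < μ p.1 := by linarith [Φ.one_le_μ _ hp.1]
  have hsa := Φ.isSelfAdjoint _ hp.1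
  have hmem : ∀ w ∈ Metric.closedBall p.2 (|p.2.im| / 2), w.im ≠ 0 := fun w hw =>
    (Φ.sphere_mem_strip hp hw).2.1
  have hd : DiffContOnCl ℂ (wres (P p.1) b (m + 1) a) (Metric.ball p.2 (|p.2.im| / 2)) := by
    refine DifferentiableOn.diffContOnCl fun w hw => ?_
    exact (hasDerivAt_wres hsa (hmem w (Metric.closure_ball_subset_closedBall hw)) b (m + 1)
      a).differentiableAt.differentiableWithinAt
  -- The derivative of Rᵐ⁺¹ is (m + 1) Rᵐ⁺², so a radius |Im z| / 2 costs the factor 2 / |Im z|.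
  have h1 := Complex.norm_deriv_le_of_forall_mem_sphere_norm_le (by positivity) hd
    (C := C * μ p.1 ^ (m + 1)) fun w hw => by
      have := H _ (Φ.sphere_mem_strip hp (Metric.sphere_subset_closedBall hw))
      simpa only [loss_one, mul_one, wnorm] using this
  rw [(hasDerivAt_wres hsa hp.2.1 b (m + 1) a).deriv, norm_smul, Complex.norm_natCast] at h1
  have h2 : wnorm P b (m + 2) a p ≤ ((m + 1 : ℕ) : ℝ) * ‖wres (P p.1) b (m + 1 + 1) a p.2‖ := by
    refine le_mul_of_one_le_left (norm_nonneg _) ?_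
    exact_mod_cast Nat.succ_le_succ (Nat.zero_le m)
  refine (h2.trans h1).trans_eq ?_
  simp only [Real.rpow_neg_one]
  field_simp
  ring

/-- Both factors are estimated with the weaker threshold, the left one through its adjoint. The two
losses multiply to (|Im z| μ)^(-(1-ν)), and the total decay needed drops from k + 1 to k + ν. -/
lemma bound_virialSum_both (Φ : IsFamily P μ δ E ε₀ c₀ W) {ν : ℝ} (hν0 : 0 < ν) (hν1 : ν ≤ 1)
    {k : ℕ} (hk : (k : ℝ) + ν < δ - 1) {a b : ℝ} (ha : 1 / 2 + (k : ℝ) < a)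
    (hb : 1 / 2 + (k : ℝ) < b) : UBdd (strip μ E ε₀ c₀) (fun p => ‖wt n b * W k p * wt n a‖)
      (fun p => μ p.1 ^ (k + 2) * (|p.2.im| * μ p.1) ^ (-(1 - ν))) := by
  have hk0 : (0 : ℝ) ≤ k := by positivity
  obtain ⟨e, he, he0⟩ : ∃ e : ℝ, 2 * e = δ - 1 - (k + ν) ∧ 0 < e :=
    ⟨(δ - 1 - (k + ν)) / 2, by ring, by linarith⟩
  have H : ∀ i < k + 1, Est P μ E ε₀ c₀ ν i := fun i hi => Φ.estimate hν0 hν1 i (by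
    have : (i : ℝ) ≤ k := by exact_mod_cast Nat.lt_succ_iff.mp hi
    linarith)
  refine (Φ.virialSum k a b (fun i => ((k - i : ℕ) : ℝ) + ν / 2 + e) (fun i => i + ν / 2 + e)
    (by linarith) (by linarith) (fun i => by positivity) (fun i => by positivity)
    (fun i hi => ?_)).trans (UBdd.sum fun i hi => ?_)
  · push_cast [Nat.cast_sub hi]; linarith
  have hik : i ≤ k := Nat.lt_succ_iff.mp (Finset.mem_range.mp hi)
  have hik' : (i : ℝ) ≤ k := by exact_mod_cast hik
  have hki : ((k - i : ℕ) : ℝ) ≤ k := by exact_mod_cast Nat.sub_le k i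
  have hki0 : (0 : ℝ) ≤ ((k - i : ℕ) : ℝ) := by positivity
  have hi0 : (0 : ℝ) ≤ i := by positivity
  have hsym : ∀ j : ℕ, ∀ p : ℝ × ℂ, (fun p : ℝ × ℂ => μ p.1 ^ j * loss μ ν p) (p.1, conj p.2) =
      (fun p : ℝ × ℂ => μ p.1 ^ j * loss μ ν p) p := fun j p => by simp [loss]
  have h1 : UBdd (strip μ E ε₀ c₀) (fun p => wnorm P b (k - i + 1) (((k - i : ℕ) : ℝ) + ν / 2 + e) p +
      wnorm P b (k - i) (((k - i : ℕ) : ℝ) + ν / 2 + e) p)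
      (fun p => μ p.1 ^ (k - i + 1) * loss μ ν p) := by
    refine UBdd.add (Φ.UBdd_symm (by linarith) (by positivity) (hsym _)
      (Φ.estimate_pow hν1 H (by omega) le_rfl (by linarith) (by positivity) ?_ ?_))
      (Φ.UBdd_symm (by linarith) (by positivity) (hsym _)
      (Φ.estimate_pow hν1 H (by omega) (by omega) (by linarith) (by positivity) ?_ ?_)) <;>
      push_cast <;> linarith
  have h2 : UBdd (strip μ E ε₀ c₀) (fun p => wnorm P (i + ν / 2 + e) (i + 1) a p +
      wnorm P (i + ν / 2 + e) i a p) (fun p => μ p.1 ^ (i + 1) * loss μ ν p) := by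
    refine UBdd.add (Φ.estimate_pow hν1 H (by omega) le_rfl (by linarith) (by positivity) ?_ ?_)
      (Φ.estimate_pow hν1 H (by omega) (by omega) (by linarith) (by positivity) ?_ ?_) <;>
      push_cast <;> linarith
  refine (h1.mul h2 (fun p _ => add_nonneg (norm_nonneg _) (norm_nonneg _))
    (fun p _ => add_nonneg (norm_nonneg _) (norm_nonneg _))).trans_le fun p hp => le_of_eq ?_
  have hl : loss μ ν p * loss μ ν p = (|p.2.im| * μ p.1) ^ (-(1 - ν)) := by
    rw [loss, ← Real.rpow_add (Φ.scaled_pos hp)]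
    ring_nf
  rw [show k + 2 = (k - i + 1) + (i + 1) by omega, pow_add, ← hl]
  ring

/-- Estimate of the power of the resolvent next to the last bounded one. -/
theorem last_estimate (Φ : IsFamily P μ δ E ε₀ c₀ W) {ν : ℝ} (hν0 : 0 < ν) (hν1 : ν < 1)
    {m : ℕ} (hm : (m : ℝ) + ν < δ - 1) {a : ℝ} (ha : 1 / 2 + (m : ℝ) + ν < a) :
    UBdd (rectangle μ E ε₀ c₀) (wnorm P a (m + 2) a)
      (fun p => μ p.1 ^ (m + 2) * (|p.2.im| * μ p.1) ^ (-(1 - ν))) := by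
  have hm0 : (0 : ℝ) ≤ m := by positivity
  have H₁ : ∀ i < m + 1, Est P μ E ε₀ c₀ 1 i := fun i hi => Φ.estimate one_pos le_rfl i (by
    have : (i : ℝ) ≤ m := by exact_mod_cast Nat.lt_succ_iff.mp hi
    linarith)
  have hscale : ∀ p ∈ rectangle μ E ε₀ c₀, 0 < |p.2.im| * μ p.1 := fun p hp =>
    Φ.scaled_pos (Φ.rectangle_subset hp)
  have hμ0 : ∀ p ∈ rectangle μ E ε₀ c₀, 0 < μ p.1 := fun p hp => by
    linarith [Φ.one_le_μ _ hp.1]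
  -- Larger weights only decrease the norm, and the interpolation needs a below the upper weight.
  wlog haa : a ≤ 3 / 2 + (m : ℝ) generalizing a
  · have h1 := this (a := 1 / 2 + m + (1 + ν) / 2) (by linarith) (by linarith)
    refine UBdd.le_trans (fun p _ => ?_) h1
    exact norm_wt_mul_wt_le_of_le (by linarith) (by linarith) (by linarith) (by linarith) _
  -- With a₀ and a₁ placed e above m + 1/2 and m + 3/2, the mean (1 - ν) a₀ + ν a₁ equals a - e,
  -- which gives the strict inequality for interpolation.
  obtain ⟨e, he, he0⟩ : ∃ e : ℝ, 2 * e = a - (1 / 2 + m + ν) ∧ 0 < e :=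
    ⟨(a - (1 / 2 + m + ν)) / 2, by ring, by linarith⟩
  obtain ⟨a₀, ha₀⟩ : ∃ a₀ : ℝ, a₀ = 1 / 2 + m + e := ⟨_, rfl⟩
  obtain ⟨a₁, ha₁⟩ : ∃ a₁ : ℝ, a₁ = 3 / 2 + m + e := ⟨_, rfl⟩
  have hM₁ : UBdd (rectangle μ E ε₀ c₀) (fun p => ‖wt n a₁ * virialLHS P W m p * wt n a₁‖)
      (fun p => μ p.1 ^ (m + 2)) := by
    refine UBdd.mono ?_ Φ.rectangle_subset
    refine (Φ.virial m a₁ a₁ (by linarith) (by linarith)).trans ?_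
    have h1 : UBdd (strip μ E ε₀ c₀) (fun p => wnorm P (a₁ - 1) (m + 1) a₁ p +
      wnorm P (a₁ - 1) m a₁ p + wnorm P a₁ (m + 1) (a₁ - 1) p + wnorm P a₁ m (a₁ - 1) p)
      (fun p => μ p.1 ^ (m + 1) * loss μ 1 p) := by
      refine UBdd.add (UBdd.add (UBdd.add
        (Φ.estimate_pow le_rfl H₁ le_rfl le_rfl (by linarith) (by linarith) ?_ ?_)
        (Φ.estimate_pow le_rfl H₁ (by omega) (by omega) (by linarith) (by linarith) ?_ ?_))
        (Φ.estimate_pow le_rfl H₁ le_rfl le_rfl (by linarith) (by linarith) ?_ ?_))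
        (Φ.estimate_pow le_rfl H₁ (by omega) (by omega) (by linarith) (by linarith) ?_ ?_) <;>
        push_cast <;> linarith
    refine ((UBdd.of_le fun p _ => le_rfl : UBdd _ (fun p => μ p.1) (fun p => μ p.1)).mul h1
      (fun p hp => by linarith [Φ.one_le_μ _ hp.1]) (fun p _ => ?_)).trans_le fun p _ => le_of_eq ?_
    · exact add_nonneg (add_nonneg (add_nonneg (norm_nonneg _) (norm_nonneg _)) (norm_nonneg _))
        (norm_nonneg _)
    · simp only [loss_one]; ring
  have hone : ∀ p ∈ rectangle μ E ε₀ c₀, μ p.1 ^ (m + 1) ≤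
      μ p.1 ^ (m + 2) * (|p.2.im| * μ p.1) ^ (-(1 - ν)) := fun p hp =>
    (pow_le_pow_right₀ (Φ.one_le_μ _ hp.1) (Nat.le_succ _)).trans
      (le_mul_of_one_le_right (pow_nonneg (hμ0 p hp).le _)
        (Φ.one_le_rpow (Φ.rectangle_subset hp) (by linarith)))
  have hle : ∀ p ∈ rectangle μ E ε₀ c₀, μ p.1 ^ (m + 2) * (|p.2.im| * μ p.1) ^ (-(1 - ν)) ≤
      μ p.1 ^ (m + 2) * (|p.2.im| * μ p.1) ^ (-1 : ℝ) := fun p hp =>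
    mul_le_mul_of_nonneg_left (Real.rpow_le_rpow_of_exponent_ge (hscale p hp)
      (((Φ.rectangle_subset hp).2.2.2).trans Φ.c₀_le_one) (by linarith)) (pow_nonneg (hμ0 p hp).le _)
  have hlow : ∀ b : ℝ, 1 / 2 + (m : ℝ) < b → UBdd (rectangle μ E ε₀ c₀) (wnorm P b (m + 1) b)
      (fun p => μ p.1 ^ (m + 2) * (|p.2.im| * μ p.1) ^ (-(1 - ν))) := fun b hb => by
    have h1 := H₁ m (by omega) b hb b (by linarith)
    simp only [loss_one, mul_one] at h1
    exact (h1.mono Φ.rectangle_subset).trans_le hone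
  have hsum : ∀ b : ℝ, 1 / 2 + (m : ℝ) < b → UBdd (rectangle μ E ε₀ c₀)
      (fun p => ‖wt n b * W m p * wt n b‖)
      (fun p => μ p.1 ^ (m + 2) * (|p.2.im| * μ p.1) ^ (-(1 - ν))) := fun b hb =>
    (Φ.bound_virialSum_both hν0 hν1.le hm hb hb).mono Φ.rectangle_subset
  -- At the weight a₀ the virial identity is of no use, as a₀ - 1 is below the threshold for Rᵐ⁺¹.
  -- The terms are bounded separately, Cauchy's estimate giving Rᵐ⁺².
  have hM₀ : UBdd (rectangle μ E ε₀ c₀) (fun p => ‖wt n a₀ * virialLHS P W m p * wt n a₀‖)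
      (fun p => μ p.1 ^ (m + 2) * (|p.2.im| * μ p.1) ^ (-1 : ℝ)) := by
    have h1 : UBdd (rectangle μ E ε₀ c₀) (fun p => ‖wt n a₀ * virialLHS P W m p * wt n a₀‖)
        (fun p => wnorm P a₀ (m + 2) a₀ p + wnorm P a₀ (m + 1) a₀ p +
          ‖wt n a₀ * W m p * wt n a₀‖) := by
      have hE := Φ.E_sub_pos
      have hε := Φ.ε₀_pos
      have hZ : 1 ≤ 2 * (m + 1) * (E + ε₀ + 2) := by nlinarith
      refine ⟨2 * (m + 1) * (E + ε₀ + 2), by linarith, fun p hp => ?_⟩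
      have h2 : wt n a₀ * virialLHS P W m p * wt n a₀ = (2 * (m + 1 : ℂ)) •
          (p.2 • wres (P p.1) a₀ (m + 2) a₀ p.2 + wres (P p.1) a₀ (m + 1) a₀ p.2) -
          wt n a₀ * W m p * wt n a₀ := by
        have h6 : wt n a₀ * (p.2 • unboundedResolvent (P p.1) p.2 ^ (m + 2) +
            unboundedResolvent (P p.1) p.2 ^ (m + 1)) * wt n a₀ =
            p.2 • wres (P p.1) a₀ (m + 2) a₀ p.2 + wres (P p.1) a₀ (m + 1) a₀ p.2 := by
          rw [mul_add, add_mul, mul_smul_comm, smul_mul_assoc, wres, wres]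
        rw [virialLHS, mul_sub, sub_mul, mul_smul_comm, smul_mul_assoc, h6]
      have h3 : ‖(2 * (m + 1 : ℂ))‖ = 2 * (m + 1) := by
        have h4 : (2 * (m + 1 : ℂ)) = ((2 * (m + 1) : ℕ) : ℂ) := by push_cast; ring
        rw [h4, Complex.norm_natCast]; push_cast; ring
      have h5 := Φ.norm_le (Φ.rectangle_subset hp)
      dsimp only
      rw [h2]
      refine (norm_sub_le _ _).trans ?_
      rw [norm_smul, h3, mul_add _ (wnorm P a₀ (m + 2) a₀ p + wnorm P a₀ (m + 1) a₀ p)]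
      refine add_le_add ?_ (le_mul_of_one_le_left (norm_nonneg _) hZ)
      rw [mul_assoc (2 * (m + 1 : ℝ)) (E + ε₀ + 2)]
      refine mul_le_mul_of_nonneg_left ((norm_add_le _ _).trans ?_)
        (by positivity : (0 : ℝ) ≤ 2 * (m + 1))
      rw [norm_smul, mul_add]
      exact add_le_add (mul_le_mul_of_nonneg_right h5 (norm_nonneg _))
        (le_mul_of_one_le_left (norm_nonneg _) (by linarith : (1 : ℝ) ≤ E + ε₀ + 2))
    refine h1.trans (UBdd.add (UBdd.add ?_ ((hlow a₀ (by linarith)).trans_le hle))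
      ((hsum a₀ (by linarith)).trans_le hle))
    exact Φ.cauchy_estimate (by linarith) (by linarith) (by linarith)
  -- Interpolation is applied to the whole commutator expression, since only this combination has a
  -- bound without loss at the weight a₁.
  have hM : UBdd (rectangle μ E ε₀ c₀) (fun p => ‖wt n a * virialLHS P W m p * wt n a‖)
      (fun p => μ p.1 ^ (m + 2) * (|p.2.im| * μ p.1) ^ (-(1 - ν))) := by
    obtain ⟨C, hC, hI⟩ := exists_norm_wt_mul_wt_le (n := n) (a₀ := a₀) (a₁ := a₁) (a := a) (θ := ν)
      (by linarith) (by linarith) (by linarith) hν0 hν1 (by rw [ha₀, ha₁]; linarith)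
    obtain ⟨C₀, hC₀, h0⟩ := hM₀
    obtain ⟨C₁, hC₁, h1⟩ := hM₁
    refine ⟨C * (C₀ ^ (1 - ν) * C₁ ^ ν), by positivity, fun p hp => ?_⟩
    have ht := hscale p hp
    have hμp : 0 < μ p.1 ^ (m + 2) := pow_pos (hμ0 p hp) _
    refine (hI _ _ _ (by positivity) (by positivity) (h0 p hp) (h1 p hp)).trans_eq ?_
    have h2 : (μ p.1 ^ (m + 2)) ^ (1 - ν) * (μ p.1 ^ (m + 2)) ^ ν = μ p.1 ^ (m + 2) := by
      rw [← Real.rpow_add hμp, sub_add_cancel, Real.rpow_one]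
    have h3 : ((|p.2.im| * μ p.1) ^ (-1 : ℝ)) ^ (1 - ν) = (|p.2.im| * μ p.1) ^ (-(1 - ν)) := by
      rw [← Real.rpow_mul ht.le, neg_one_mul]
    rw [Real.mul_rpow hC₀ (by positivity), Real.mul_rpow hμp.le (by positivity),
      Real.mul_rpow hC₁ hμp.le, h3]
    calc _ = C * (C₀ ^ (1 - ν) * C₁ ^ ν) * (((μ p.1 ^ (m + 2)) ^ (1 - ν) * (μ p.1 ^ (m + 2)) ^ ν) *
          (|p.2.im| * μ p.1) ^ (-(1 - ν))) := by ring
      _ = _ := by rw [h2]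
  exact ((Φ.bound_succ m a a).mono Φ.rectangle_subset).trans
    (UBdd.add (UBdd.add hM (hsum a (by linarith))) (hlow a (by linarith)))

end IsFamily

end LastStep

/-! ### Harmonic measure in the half plane. -/

section HalfPlane

open scoped ComplexConjugate InnerProductSpace

/-- The Cayley transform of the unit disc onto the half plane which maps `0` to `x₀ + i y₀`. -/
def cayley (x₀ y₀ : ℝ) (w : ℂ) : ℂ := x₀ + y₀ * (Complex.I * (1 + w) / (1 - w))

lemma cayley_im (x₀ y₀ : ℝ) (w : ℂ) :
    (cayley x₀ y₀ w).im = y₀ * ((1 - ‖w‖ ^ 2) / ‖1 - w‖ ^ 2) := by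
  rw [cayley, Complex.add_im, Complex.ofReal_im, zero_add, Complex.im_ofReal_mul]
  congr 1
  rw [Complex.div_im, ← Complex.normSq_eq_norm_sq, ← Complex.normSq_eq_norm_sq, ← sub_div]
  congr 1
  simp [Complex.normSq_apply]
  ring

lemma differentiableAt_cayley (x₀ y₀ : ℝ) {w : ℂ} (hw : w ≠ 1) :
    DifferentiableAt ℂ (cayley x₀ y₀) w := by
  have h : 1 - w ≠ 0 := sub_ne_zero.mpr hw.symm
  unfold cayley
  fun_prop (disch := assumption)

lemma cayley_circleMap (x₀ y₀ θ : ℝ) (hθ : Real.cos ((θ - Real.pi) / 2) ≠ 0) :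
    cayley x₀ y₀ (circleMap 0 1 θ) = ((x₀ + y₀ * Real.tan ((θ - Real.pi) / 2) : ℝ) : ℂ) := by
  obtain ⟨τ, hτ⟩ : ∃ τ : ℝ, τ = (θ - Real.pi) / 2 := ⟨_, rfl⟩
  rw [← hτ] at hθ ⊢
  -- With τ = (θ - π)/2 one has exp(iθ) = -exp(2iτ), so numerator and denominator of the Cayley
  -- transform share the factor exp(iτ) and their quotient is tan τ.
  have e1 : circleMap 0 1 θ = -(Complex.cos τ + Complex.sin τ * Complex.I) ^ 2 := by
    rw [← Complex.exp_mul_I, ← Complex.exp_nat_mul, circleMap,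
      show (θ : ℂ) * Complex.I = ((2 : ℕ) : ℂ) * (τ * Complex.I) + Real.pi * Complex.I by
        rw [hτ]; push_cast; ring, Complex.exp_add, Complex.exp_pi_mul_I]
    simp
  have hc : Complex.cos τ ≠ 0 := by rw [← Complex.ofReal_cos]; exact_mod_cast hθ
  have h1 := Complex.sin_sq_add_cos_sq (τ : ℂ)
  have hI := Complex.I_sq
  have e2 : Complex.cos τ + Complex.sin τ * Complex.I ≠ 0 := by
    rw [← Complex.exp_mul_I]; exact Complex.exp_ne_zero _
  have e3 : 1 - circleMap 0 1 θ =
      2 * Complex.cos τ * (Complex.cos τ + Complex.sin τ * Complex.I) := by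
    rw [e1]; linear_combination -h1 + Complex.sin τ ^ 2 * hI
  have e4 : Complex.I * (1 + circleMap 0 1 θ) =
      2 * Complex.sin τ * (Complex.cos τ + Complex.sin τ * Complex.I) := by
    rw [e1]; linear_combination (-Complex.I) * h1 -
      (2 * Complex.sin τ * Complex.cos τ + Complex.I * Complex.sin τ ^ 2) * hI
  rw [cayley, e3, e4]
  push_cast
  rw [Complex.tan_eq_sin_div_cos]
  field_simp

lemma tendsto_circleMap_one (θ : ℝ) :
    Tendsto (fun r : ℝ => circleMap 0 r θ) (𝓝[<] 1) (𝓝 (circleMap 0 1 θ)) := by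
  have : Continuous fun r : ℝ => circleMap 0 r θ := by unfold circleMap; fun_prop
  exact (this.tendsto 1).mono_left nhdsWithin_le_nhds

lemma circleMap_ne_one {θ : ℝ} (h0 : 0 < θ) (h2 : θ < 2 * Real.pi) : circleMap 0 1 θ ≠ 1 := by
  intro h
  have h1 : Complex.exp (θ * Complex.I) = 1 := by simpa [circleMap] using h
  rw [Complex.exp_eq_one_iff] at h1
  obtain ⟨k, hk⟩ := h1
  have h3 : θ = k * (2 * Real.pi) := by
    have := congrArg Complex.im hk
    simpa using this
  have hpi := Real.pi_pos
  have hk0 : (0 : ℝ) < k := by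
    by_contra hk'
    nlinarith [not_lt.mp hk']
  have hk1 : (k : ℝ) < 1 := by
    by_contra hk'
    nlinarith [not_lt.mp hk']
  have : (0 : ℤ) < k := by exact_mod_cast hk0
  have : k < (1 : ℤ) := by exact_mod_cast hk1
  omega

/-- Mean value inequality on a circle in the disc model of the half plane. -/
lemma integral_le_of_halfPlane {Φ : ℂ → ℂ} (hd : DifferentiableOn ℂ Φ {z | 0 < z.im})
    (h0 : ∀ z, 0 < z.im → 0 ≤ (Φ z).re) {x₀ y₀ : ℝ} (hy : 0 < y₀) {α β : ℝ} (hα : 0 < α)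
    (hαβ : α ≤ β) (hβ : β < 2 * Real.pi) {η : ℝ} (hη : 0 < η) :
    ∫ θ in α..β, min (Φ (cayley x₀ y₀ (circleMap 0 1 θ) + η * Complex.I)).re (1 / 8) ≤
      2 * Real.pi * (Φ (x₀ + y₀ * Complex.I + η * Complex.I)).re := by
  have him : ∀ w : ℂ, ‖w‖ ≤ 1 → 0 < (cayley x₀ y₀ w + η * Complex.I).im := fun w hw => by
    rw [Complex.add_im, cayley_im]
    have : 0 ≤ (1 - ‖w‖ ^ 2) / ‖1 - w‖ ^ 2 := div_nonneg (by nlinarith [norm_nonneg w]) (sq_nonneg _)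
    have h2 : 0 ≤ y₀ * ((1 - ‖w‖ ^ 2) / ‖1 - w‖ ^ 2) := mul_nonneg hy.le this
    simp
    linarith
  have hdw : ∀ w : ℂ, ‖w‖ ≤ 1 → w ≠ 1 →
      DifferentiableAt ℂ (fun w => Φ (cayley x₀ y₀ w + η * Complex.I)) w := fun w hw hw1 => by
    have h1 : DifferentiableAt ℂ Φ (cayley x₀ y₀ w + η * Complex.I) :=
      hd.differentiableAt ((isOpen_lt continuous_const Complex.continuous_im).mem_nhds (him w hw))
    exact DifferentiableAt.comp w h1 ((differentiableAt_cayley x₀ y₀ hw1).add_const _)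
  have hcirc : ∀ θ ∈ Icc α β, circleMap 0 1 θ ≠ 1 := fun θ hθ =>
    circleMap_ne_one (hα.trans_le hθ.1) (hθ.2.trans_lt hβ)
  -- On a circle of radius r < 1 the mean value property is exact, and positivity allows restricting
  -- to an arc. Truncation by 1/8 provides the domination for r → 1.
  have hmean : ∀ r ∈ Ioo (0 : ℝ) 1,
      ∫ θ in α..β, min (Φ (cayley x₀ y₀ (circleMap 0 r θ) + η * Complex.I)).re (1 / 8) ≤
        2 * Real.pi * (Φ (x₀ + y₀ * Complex.I + η * Complex.I)).re := by
    intro r hr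
    have hlt : ∀ w ∈ Metric.closedBall (0 : ℂ) r, ‖w‖ < 1 := fun w hw => by
      rw [mem_closedBall_zero_iff] at hw; exact hw.trans_lt hr.2
    have hne : ∀ w ∈ Metric.closedBall (0 : ℂ) r, w ≠ 1 := fun w hw h => by
      have := hlt w hw; rw [h, norm_one] at this; exact lt_irrefl _ this
    have hcont : Continuous fun θ : ℝ => Φ (cayley x₀ y₀ (circleMap 0 r θ) + η * Complex.I) := by
      refine continuous_iff_continuousAt.mpr fun θ => ?_
      have hm : circleMap 0 r θ ∈ Metric.closedBall (0 : ℂ) r :=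
        circleMap_mem_closedBall 0 hr.1.le θ
      exact ContinuousAt.comp (f := circleMap 0 r)
        (g := fun w => Φ (cayley x₀ y₀ w + η * Complex.I))
        (hdw _ (hlt _ hm).le (hne _ hm)).continuousAt (continuous_circleMap 0 r).continuousAt
    have hdc : DiffContOnCl ℂ (fun w => Φ (cayley x₀ y₀ w + η * Complex.I))
        (Metric.ball 0 |r|) := by
      rw [abs_of_pos hr.1]
      refine DifferentiableOn.diffContOnCl fun w hw => ?_
      have hm := Metric.closure_ball_subset_closedBall hw
      exact (hdw w (hlt w hm).le (hne w hm)).differentiableWithinAt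
    have h1 := hdc.circleAverage
    rw [Real.circleAverage_def] at h1
    have h2 : 2 * Real.pi * (Φ (x₀ + y₀ * Complex.I + η * Complex.I)).re =
        ∫ θ in (0 : ℝ)..2 * Real.pi, (Φ (cayley x₀ y₀ (circleMap 0 r θ) + η * Complex.I)).re := by
      have e0 : cayley x₀ y₀ 0 = x₀ + y₀ * Complex.I := by simp [cayley]
      rw [e0] at h1
      have h3 := Complex.reCLM.intervalIntegral_comp_comm
        (hcont.intervalIntegrable (μ := volume) 0 (2 * Real.pi))
      simp only [Complex.reCLM_apply] at h3
      rw [h3, ← h1, Complex.smul_re, smul_eq_mul, mul_inv_cancel_left₀ (by positivity)]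
    rw [h2]
    have hcr : Continuous fun θ : ℝ => (Φ (cayley x₀ y₀ (circleMap 0 r θ) + η * Complex.I)).re :=
      Complex.continuous_re.comp hcont
    refine (intervalIntegral.integral_mono_on hαβ ((hcr.min continuous_const).intervalIntegrable _ _)
      (hcr.intervalIntegrable _ _) fun θ _ => min_le_left _ _).trans ?_
    refine intervalIntegral.integral_mono_interval hα.le hαβ hβ.le
      (ae_of_all _ fun θ => h0 _ (him _ ?_)) (hcr.intervalIntegrable _ _)
    exact (hlt _ (circleMap_mem_closedBall 0 hr.1.le θ)).le
  have hlim : Tendsto (fun r : ℝ =>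
      ∫ θ in α..β, min (Φ (cayley x₀ y₀ (circleMap 0 r θ) + η * Complex.I)).re (1 / 8)) (𝓝[<] 1)
      (𝓝 (∫ θ in α..β, min (Φ (cayley x₀ y₀ (circleMap 0 1 θ) + η * Complex.I)).re (1 / 8))) := by
    have hev : ∀ᶠ r : ℝ in 𝓝[<] 1, r ∈ Ioo (0 : ℝ) 1 := Ioo_mem_nhdsLT one_pos
    refine intervalIntegral.tendsto_integral_filter_of_dominated_convergence (fun _ => 1 / 8)
      ?_ ?_ intervalIntegrable_const ?_
    · filter_upwards [hev] with r hr
      have hcont : Continuous fun θ : ℝ => Φ (cayley x₀ y₀ (circleMap 0 r θ) + η * Complex.I) := by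
        refine continuous_iff_continuousAt.mpr fun θ => ?_
        have hm : ‖circleMap 0 r θ‖ < 1 := by
          rw [norm_circleMap_zero, abs_of_pos hr.1]; exact hr.2
        have hne : circleMap 0 r θ ≠ 1 := fun h => by rw [h, norm_one] at hm; exact lt_irrefl _ hm
        exact ContinuousAt.comp (f := circleMap 0 r)
          (g := fun w => Φ (cayley x₀ y₀ w + η * Complex.I))
          (hdw _ hm.le hne).continuousAt (continuous_circleMap 0 r).continuousAt
      exact ((Complex.continuous_re.comp hcont).min continuous_const).aestronglyMeasurable
    · filter_upwards [hev] with r hr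
      refine ae_of_all _ fun θ _ => ?_
      have hm : ‖circleMap 0 r θ‖ ≤ 1 := by
        rw [norm_circleMap_zero, abs_of_pos hr.1]; exact hr.2.le
      rw [Real.norm_eq_abs, abs_of_nonneg (le_min (h0 _ (him _ hm)) (by norm_num))]
      exact min_le_right _ _
    · refine ae_of_all _ fun θ hθ => ?_
      rw [uIoc_of_le hαβ] at hθ
      have h1 := (hdw _ (by simp) (hcirc θ (Ioc_subset_Icc_self hθ))).continuousAt.tendsto.comp
        (tendsto_circleMap_one θ)
      exact ((Complex.continuous_re.tendsto _).comp h1).min tendsto_const_nhds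
  exact le_of_tendsto hlim (eventually_of_mem (Ioo_mem_nhdsLT one_pos) hmean)

/-- Lower bound of a positive harmonic function in terms of its boundary values on an interval. -/
lemma exists_le_re_of_halfPlane : ∃ κ : ℝ, 0 < κ ∧ ∀ {Φ : ℂ → ℂ},
    DifferentiableOn ℂ Φ {z | 0 < z.im} → (∀ z, 0 < z.im → 0 ≤ (Φ z).re) →
    ∀ {x₀ y₀ : ℝ}, 0 < y₀ → ∀ s ∈ ({1, -1} : Set ℝ),
    (∀ x : ℝ, |x - (x₀ + s * (3 / 2) * y₀)| ≤ y₀ / 2 →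
      ∀ᶠ η : ℝ in 𝓝[>] 0, 1 / 8 ≤ (Φ (x + η * Complex.I)).re) →
    κ ≤ (Φ (x₀ + y₀ * Complex.I)).re := by
  -- By scaling, the arc over the interval centred at x₀ + (3/2) s y₀ with half-length y₀ / 2 can be
  -- chosen independently of x₀ and y₀; hence κ is universal.
  have hsub : ∀ s : ℝ, ∃ α β : ℝ, 0 < α ∧ α < β ∧ β < 2 * Real.pi ∧ ∀ θ ∈ Icc α β,
      Real.cos ((θ - Real.pi) / 2) ≠ 0 ∧
        |Real.tan ((θ - Real.pi) / 2) - s * (3 / 2)| ≤ 1 / 2 := by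
    intro s
    have hpi := Real.pi_pos
    obtain ⟨θ₀, hθ₀⟩ : ∃ θ₀, θ₀ = Real.pi + 2 * Real.arctan (s * (3 / 2)) := ⟨_, rfl⟩
    have h1 := Real.arctan_lt_pi_div_two (s * (3 / 2))
    have h2 := Real.neg_pi_div_two_lt_arctan (s * (3 / 2))
    have e0 : (θ₀ - Real.pi) / 2 = Real.arctan (s * (3 / 2)) := by rw [hθ₀]; ring
    have hcos : Real.cos ((θ₀ - Real.pi) / 2) ≠ 0 := by
      rw [e0]; exact (Real.cos_arctan_pos _).ne'
    have hg : Continuous fun θ : ℝ => (θ - Real.pi) / 2 := by fun_prop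
    have ht : ContinuousAt (fun θ : ℝ => Real.tan ((θ - Real.pi) / 2)) θ₀ :=
      ContinuousAt.comp (f := fun θ : ℝ => (θ - Real.pi) / 2) (g := Real.tan)
        (Real.continuousAt_tan.mpr hcos) hg.continuousAt
    have hc : ContinuousAt (fun θ : ℝ => Real.cos ((θ - Real.pi) / 2)) θ₀ :=
      (Real.continuous_cos.comp hg).continuousAt
    have hev : ∀ᶠ θ in 𝓝 θ₀, (Real.cos ((θ - Real.pi) / 2) ≠ 0 ∧
        |Real.tan ((θ - Real.pi) / 2) - s * (3 / 2)| ≤ 1 / 2) ∧ θ ∈ Ioo 0 (2 * Real.pi) := by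
      refine ((hc.eventually_ne hcos).and ?_).and (Ioo_mem_nhds (by linarith) (by linarith))
      have h3 := Metric.tendsto_nhds.mp ht (1 / 2) (by norm_num)
      filter_upwards [h3] with θ h
      rw [e0, Real.tan_arctan, Real.dist_eq] at h
      exact h.le
    obtain ⟨e, he, hball⟩ := Metric.eventually_nhds_iff_ball.mp hev
    have hmem : ∀ θ ∈ Icc (θ₀ - e / 2) (θ₀ + e / 2), θ ∈ Metric.ball θ₀ e := fun θ hθ => by
      rw [Metric.mem_ball, Real.dist_eq, abs_lt]; constructor <;> linarith [hθ.1, hθ.2]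
    refine ⟨θ₀ - e / 2, θ₀ + e / 2, ?_, by linarith, ?_, fun θ hθ => (hball θ (hmem θ hθ)).1⟩
    · exact (hball _ (hmem _ ⟨le_rfl, by linarith⟩)).2.1
    · exact (hball _ (hmem _ ⟨by linarith, le_rfl⟩)).2.2
  have hmain : ∀ s : ℝ, ∃ κ : ℝ, 0 < κ ∧ ∀ {Φ : ℂ → ℂ},
    DifferentiableOn ℂ Φ {z | 0 < z.im} → (∀ z, 0 < z.im → 0 ≤ (Φ z).re) →
    ∀ {x₀ y₀ : ℝ}, 0 < y₀ →
    (∀ x : ℝ, |x - (x₀ + s * (3 / 2) * y₀)| ≤ y₀ / 2 →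
      ∀ᶠ η : ℝ in 𝓝[>] 0, 1 / 8 ≤ (Φ (x + η * Complex.I)).re) →
    κ ≤ (Φ (x₀ + y₀ * Complex.I)).re := by
    intro s
    obtain ⟨α, β, hα, hαβ, hβ, hθ⟩ := hsub s
    have hpi := Real.pi_pos
    -- The arc length times the boundary bound 1/8, divided by 2π.
    refine ⟨(β - α) / (16 * Real.pi), div_pos (by linarith) (by linarith), ?_⟩
    intro Φ hd h0 x₀ y₀ hy H
    have hx : ∀ θ ∈ Icc α β, |(x₀ + y₀ * Real.tan ((θ - Real.pi) / 2)) -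
        (x₀ + s * (3 / 2) * y₀)| ≤ y₀ / 2 := fun θ h => by
      have := (hθ θ h).2
      rw [show x₀ + y₀ * Real.tan ((θ - Real.pi) / 2) - (x₀ + s * (3 / 2) * y₀) =
        y₀ * (Real.tan ((θ - Real.pi) / 2) - s * (3 / 2)) by ring, abs_mul, abs_of_pos hy]
      nlinarith
    have hcΦ : ∀ z : ℂ, 0 < z.im → ContinuousAt Φ z := fun z hz =>
      (hd.differentiableAt ((isOpen_lt continuous_const
        Complex.continuous_im).mem_nhds hz)).continuousAt
    have hlim : Tendsto (fun η : ℝ => ∫ θ in α..β,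
        min (Φ (cayley x₀ y₀ (circleMap 0 1 θ) + η * Complex.I)).re (1 / 8)) (𝓝[>] 0)
        (𝓝 (∫ θ in α..β, (1 / 8 : ℝ))) := by
      refine intervalIntegral.tendsto_integral_filter_of_dominated_convergence (fun _ => 1 / 8)
        ?_ ?_ intervalIntegrable_const ?_
      · filter_upwards [self_mem_nhdsWithin] with η hη
        refine ContinuousOn.aestronglyMeasurable ?_ measurableSet_uIoc
        rw [uIoc_of_le hαβ.le]
        refine ContinuousOn.inf (fun θ h => ?_) continuousOn_const
        have h' := Ioc_subset_Icc_self h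
        have hcos := (hθ θ h').1
        refine ContinuousAt.continuousWithinAt ?_
        have hne := circleMap_ne_one (hα.trans_le h'.1) (h'.2.trans_lt hβ)
        have h1 : ContinuousAt (fun θ : ℝ => cayley x₀ y₀ (circleMap 0 1 θ) + η * Complex.I) θ :=
          (ContinuousAt.comp (f := circleMap 0 1) (g := cayley x₀ y₀)
            (differentiableAt_cayley x₀ y₀ hne).continuousAt
            (continuous_circleMap 0 1).continuousAt).add continuousAt_const
        refine Complex.continuous_re.continuousAt.comp (ContinuousAt.comp (hcΦ _ ?_) h1)
        rw [cayley_circleMap _ _ _ hcos, Complex.add_im, Complex.ofReal_im, zero_add]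
        simpa using hη
      · filter_upwards [self_mem_nhdsWithin] with η hη
        refine ae_of_all _ fun θ h => ?_
        rw [uIoc_of_le hαβ.le] at h
        have hcos := (hθ θ (Ioc_subset_Icc_self h)).1
        rw [Real.norm_eq_abs, abs_of_nonneg (le_min (h0 _ ?_) (by norm_num))]
        · exact min_le_right _ _
        · rw [cayley_circleMap _ _ _ hcos]
          rw [Complex.add_im, Complex.ofReal_im, zero_add]
          simpa using hη
      · refine ae_of_all _ fun θ h => ?_
        rw [uIoc_of_le hαβ.le] at h
        have h' := Ioc_subset_Icc_self h
        refine tendsto_const_nhds.congr' ?_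
        filter_upwards [H _ (hx θ h')] with η hη
        rw [cayley_circleMap _ _ _ (hθ θ h').1, min_eq_right hη]
    have hlim2 : Tendsto (fun η : ℝ => 2 * Real.pi *
        (Φ (x₀ + y₀ * Complex.I + η * Complex.I)).re) (𝓝[>] 0)
        (𝓝 (2 * Real.pi * (Φ (x₀ + y₀ * Complex.I)).re)) := by
      refine Tendsto.mul tendsto_const_nhds ((Complex.continuous_re.tendsto _).comp ?_)
      refine (hcΦ _ (by simpa using hy)).tendsto.comp ?_
      have : Continuous fun η : ℝ => (x₀ + y₀ * Complex.I + η * Complex.I : ℂ) := by fun_prop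
      have h1 := (this.tendsto 0).mono_left (nhdsWithin_le_nhds (s := Ioi 0))
      simpa using h1
    have h1 := le_of_tendsto_of_tendsto hlim hlim2 (by
      filter_upwards [self_mem_nhdsWithin] with η hη
      exact integral_le_of_halfPlane hd h0 hy hα hαβ.le hβ hη)
    rw [intervalIntegral.integral_const, smul_eq_mul] at h1
    rw [div_le_iff₀ (by positivity)]
    linarith
  obtain ⟨κ₁, h1, H1⟩ := hmain 1
  obtain ⟨κ₂, h2, H2⟩ := hmain (-1)
  refine ⟨min κ₁ κ₂, lt_min h1 h2, fun {Φ} hd h0 {x₀ y₀} hy s hs H => ?_⟩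
  rcases hs with rfl | rfl
  · exact (min_le_left _ _).trans (H1 hd h0 hy H)
  · exact (min_le_right _ _).trans (H2 hd h0 hy H)

end HalfPlane

/-! ### Resolvent bounds off the real axis from the boundary values. -/

section ResolventBound

open scoped ComplexConjugate InnerProductSpace

variable {n : ℕ}

/-- Its sign shows that the diagonal matrix elements of the weighted resolvent map the upper half
plane into its closure. -/
lemma im_inner_wres {P : L2 n →ₗ.[ℂ] L2 n} (hP : IsSelfAdjoint P) {a : ℝ} (ha : 0 ≤ a) {z : ℂ}
    (hz : z.im ≠ 0) (u : L2 n) : (inner ℂ u (wres P a 1 a z u)).im =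
      z.im * ‖unboundedResolvent P z (wt n a u)‖ ^ 2 := by
  have hm := unboundedResolvent_mem hP hz (wt n a u)
  have h1 := hP.inner_apply_sub_smul_im z ⟨_, hm⟩
  rw [apply_unboundedResolvent hP hz, add_sub_cancel_left] at h1
  replace h1 : (inner ℂ (unboundedResolvent P z (wt n a u)) (wt n a u)).im =
    -z.im * ‖unboundedResolvent P z (wt n a u)‖ ^ 2 := h1
  rw [wres_apply, pow_one, ← inner_wt_left ha, ← inner_conj_symm, Complex.conj_im, h1]
  ring

/-- Bounds for the boundary values of the weighted resolvent imply bounds near the real axis. -/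
lemma exists_norm_wres_le (n : ℕ) : ∃ C : ℝ, 0 ≤ C ∧ ∀ {P : L2 n →ₗ.[ℂ] L2 n}, IsSelfAdjoint P →
    ∀ {a M E ε₀ : ℝ}, 0 ≤ a → 0 < M → (∀ x ∈ Icc (E - ε₀) (E + ε₀), ∃ L : L2 n →L[ℂ] L2 n,
      Tendsto (fun η : ℝ => wres P a 1 a (x + η * Complex.I)) (𝓝[>] 0) (𝓝 L) ∧ ‖L‖ ≤ M) →
    ∀ {z : ℂ}, 0 < z.im → |z.re - E| ≤ ε₀ + z.im → z.im ≤ ε₀ / 2 →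
      ‖wres P a 1 a z‖ ≤ C * M := by
  obtain ⟨κ, hκ, H⟩ := exists_le_re_of_halfPlane
  refine ⟨4 * (1 / κ + 1), by positivity, fun {P} hP {a M E ε₀} ha hM hlim {z} hz hzE hzε => ?_⟩
  have hF : ∀ u : L2 n, ‖inner ℂ u (wres P a 1 a z u)‖ ≤ (1 / κ + 1) * M * ‖u‖ ^ 2 := by
    intro u
    rcases eq_or_ne u 0 with rfl | hu
    · simp
    have hu0 : 0 < ‖u‖ := norm_pos_iff.mpr hu
    obtain ⟨N, hN⟩ : ∃ N : ℝ, N = M * ‖u‖ ^ 2 := ⟨_, rfl⟩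
    have hN0 : 0 < N := by rw [hN]; positivity
    -- F has nonnegative imaginary part, so iN / (F + iN) has nonnegative real part. A lower bound
    -- for this real part is an upper bound for |F|.
    obtain ⟨F, hFdef⟩ : ∃ F : ℂ → ℂ, F = fun z => inner ℂ u (wres P a 1 a z u) := ⟨_, rfl⟩
    have him : ∀ z : ℂ, 0 < z.im → 0 ≤ (F z).im := fun z hz => by
      rw [hFdef]; dsimp only
      rw [im_inner_wres hP ha hz.ne']; positivity
    have hden : ∀ z : ℂ, 0 < z.im → N ≤ ‖F z + Complex.I * N‖ := fun z hz => by
      have h1 := Complex.abs_im_le_norm (F z + Complex.I * N)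
      have h2 : (F z + Complex.I * N).im = (F z).im + N := by simp
      rw [h2, abs_of_nonneg (by linarith [him z hz])] at h1
      linarith [him z hz]
    have hden0 : ∀ z : ℂ, 0 < z.im → F z + Complex.I * N ≠ 0 := fun z hz h => by
      have := hden z hz; rw [h, norm_zero] at this; linarith
    have hre : ∀ z : ℂ, (Complex.I * N / (F z + Complex.I * N)).re =
        N * ((F z).im + N) / ‖F z + Complex.I * N‖ ^ 2 := fun z => by
      rw [Complex.div_re, ← Complex.normSq_eq_norm_sq]
      simp
    have hd : DifferentiableOn ℂ (fun z => Complex.I * N / (F z + Complex.I * N))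
        {z | 0 < z.im} := fun z hz => by
      have hz : 0 < z.im := hz
      have h1 : DifferentiableAt ℂ F z := by
        rw [hFdef]
        exact (innerSL ℂ u).differentiable.differentiableAt.comp z
          ((hasDerivAt_wres hP hz.ne' a 1 a).differentiableAt.clm_apply (differentiableAt_const u))
      exact ((differentiableAt_const _).div (h1.add_const _) (hden0 z hz)).differentiableWithinAt
    have hbd : ∀ x ∈ Icc (E - ε₀) (E + ε₀), ∀ᶠ η : ℝ in 𝓝[>] 0,
        1 / 8 ≤ (Complex.I * N / (F (x + η * Complex.I) + Complex.I * N)).re := by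
      intro x hx
      obtain ⟨L, hL, hLM⟩ := hlim x hx
      -- With the margin 11/10, |F + iN| is at most 21/10 N, and N² / (21/10 N)² = 100/441 exceeds
      -- 1/8.
      have h1 := hL.norm.eventually_lt_const (by linarith : ‖L‖ < 11 / 10 * M)
      filter_upwards [h1, self_mem_nhdsWithin] with η h1 hη
      have hη' : 0 < (x + η * Complex.I : ℂ).im := by simpa using hη
      have h2 : ‖F (x + η * Complex.I)‖ ≤ 11 / 10 * N := by
        rw [hFdef, hN]
        refine (norm_inner_le_norm _ _).trans ?_
        have h3 := (wres P a 1 a (x + η * Complex.I)).le_of_opNorm_le h1.le u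
        nlinarith
      have h3 : ‖F (x + η * Complex.I) + Complex.I * N‖ ≤ 21 / 10 * N := by
        refine (norm_add_le _ _).trans ?_
        rw [norm_mul, Complex.norm_I, one_mul, Complex.norm_real, Real.norm_of_nonneg hN0.le]
        linarith
      have h4 := him _ hη'
      have h5 := hden _ hη'
      rw [hre, le_div_iff₀ (pow_pos (hN0.trans_le h5) 2)]
      have h6 : ‖F (x + η * Complex.I) + Complex.I * N‖ ^ 2 ≤ (21 / 10 * N) ^ 2 :=
        pow_le_pow_left₀ (norm_nonneg _) h3 2
      nlinarith
    have hnn : ∀ z : ℂ, 0 < z.im → 0 ≤ (Complex.I * N / (F z + Complex.I * N)).re := fun z hz => by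
      rw [hre]
      have := him z hz
      positivity
    have hzeq : ((z.re : ℂ) + z.im * Complex.I) = z := Complex.re_add_im z
    have hκle : κ ≤ (Complex.I * N / (F z + Complex.I * N)).re := by
      have habs := abs_le.mp hzE
      -- The sign points from Re z towards E. The interval of distances from Im z to 2 Im z in that
      -- direction lies in [E - ε₀, E + ε₀], even when Re z is outside it by Im z.
      have hfin : ∃ s ∈ ({1, -1} : Set ℝ), ∀ x : ℝ, |x - (z.re + s * (3 / 2) * z.im)| ≤ z.im / 2 →
          x ∈ Icc (E - ε₀) (E + ε₀) := by
        rcases le_total z.re E with h | h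
        · refine ⟨1, by simp, fun x hx => ?_⟩
          have := abs_le.mp hx
          constructor <;> linarith
        · refine ⟨-1, by simp, fun x hx => ?_⟩
          have := abs_le.mp hx
          constructor <;> linarith
      obtain ⟨s, hs, hx⟩ := hfin
      have h1 := H hd hnn (x₀ := z.re) hz s hs fun x h => hbd x (hx x h)
      rwa [hzeq] at h1
    have h1 : κ ≤ N / ‖F z + Complex.I * N‖ := by
      refine hκle.trans ((Complex.re_le_norm _).trans_eq ?_)
      rw [norm_div, norm_mul, Complex.norm_I, one_mul, Complex.norm_real,
        Real.norm_of_nonneg hN0.le]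
    have h2 : ‖F z + Complex.I * N‖ ≤ N / κ := by
      rw [le_div_iff₀ (hN0.trans_le (hden z hz))] at h1
      rw [le_div_iff₀ hκ]
      linarith
    have h3 : ‖F z‖ ≤ N / κ + N := by
      have h4 := norm_sub_le (F z + Complex.I * N) (Complex.I * N)
      rw [add_sub_cancel_right, norm_mul, Complex.norm_I, one_mul, Complex.norm_real,
        Real.norm_of_nonneg hN0.le] at h4
      linarith
    rw [hFdef] at h3
    refine h3.trans_eq ?_
    rw [hN]
    ring
  obtain ⟨B, hB⟩ : ∃ B : ℝ, B = (1 / κ + 1) * M := ⟨_, rfl⟩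
  have hB0 : 0 ≤ B := by rw [hB]; positivity
  rw [show 4 * (1 / κ + 1) * M = 4 * B by rw [hB]; ring]
  -- Polarization: four values of the quadratic form at vectors of norm at most 2, each at most 4B,
  -- divided by 4.
  refine ContinuousLinearMap.opNorm_le_of_re_inner_le (𝕜 := ℂ) (by positivity) fun x y hx hy => ?_
  have h1 : ∀ u : L2 n, ‖u‖ ≤ 2 → ‖inner ℂ (wres P a 1 a z u) u‖ ≤ 4 * B := fun u hu => by
    rw [norm_inner_symm]
    refine (hF u).trans ?_
    rw [← hB]
    have : ‖u‖ ^ 2 ≤ 2 ^ 2 := pow_le_pow_left₀ (norm_nonneg _) hu 2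
    nlinarith
  have hIy : ‖Complex.I • y‖ = 1 := by rw [norm_smul, Complex.norm_I, one_mul, hy]
  have n1 := h1 (x + y) ((norm_add_le _ _).trans (by rw [hx, hy]; norm_num))
  have n2 := h1 (x - y) ((norm_sub_le _ _).trans (by rw [hx, hy]; norm_num))
  have n3 := h1 (x + Complex.I • y) ((norm_add_le _ _).trans (by rw [hx, hIy]; norm_num))
  have n4 := h1 (x - Complex.I • y) ((norm_sub_le _ _).trans (by rw [hx, hIy]; norm_num))
  have h2 := inner_map_polarization' (wres P a 1 a z : L2 n →ₗ[ℂ] L2 n) x y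
  simp only [ContinuousLinearMap.coe_coe] at h2
  refine (Complex.re_le_norm _).trans ?_
  rw [h2, norm_div]
  have h4 : ‖(4 : ℂ)‖ = 4 := by norm_num
  rw [h4, div_le_iff₀ (by norm_num)]
  have hI : ∀ w : ℂ, ‖Complex.I * w‖ = ‖w‖ := fun w => by rw [norm_mul, Complex.norm_I, one_mul]
  refine (norm_add_le _ _).trans ?_
  refine (add_le_add (norm_sub_le _ _) le_rfl).trans ?_
  refine (add_le_add (add_le_add (norm_sub_le _ _) le_rfl) le_rfl).trans ?_
  rw [hI, hI]
  linarith

lemma weightedResolvent_eq_wres (P : L2 n →ₗ.[ℂ] L2 n) (s : ℝ≥0) (z : ℂ) :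
    weightedResolvent P s z = wres P s 1 s z := by
  rw [wres, pow_one, weightedResolvent, weight_eq_wt]
  rfl

/-- The hypotheses on the operator imply the estimates for powers of the resolvent. -/
theorem exists_isFamily {c : Coefficients n} (hreg : c.IsRegular) {δ : ℝ} (hδ : 1 < δ)
    (hshort : c.IsShortRange δ) {P : ℝ → L2 n →ₗ.[ℂ] L2 n}
    (hP : ∀ h ∈ Ioc (0 : ℝ) 1, IsSelfAdjointRealization c h (P h)) (hell : IsElliptic P)
    {E ε₀ : ℝ} (hε₀ : 0 < ε₀) (hE : ε₀ < E) {μ : ℝ → ℝ} (hμ : ∀ h ∈ Ioc (0 : ℝ) 1, h⁻¹ ≤ μ h)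
    (hlap : LimitingAbsorption P E ε₀ μ) : ∃ c₀ W, IsFamily P μ δ E ε₀ c₀ W := by
  obtain ⟨K, hK, hmod⟩ := exists_isModel hreg hδ.le hshort hP hell
  choose! q V₁ T T₂ hM using hmod
  -- The three constraints make the losses at least 1, keep z within the height for the harmonic
  -- measure argument, and keep z away from 0.
  obtain ⟨c₀, hc₀⟩ : ∃ c₀, c₀ = min 1 (min (ε₀ / 2) ((E - ε₀) / 2)) := ⟨_, rfl⟩
  have hc₀1 : c₀ ≤ 1 := hc₀ ▸ min_le_left _ _
  have hc₀2 : c₀ ≤ ε₀ / 2 := hc₀ ▸ (min_le_right _ _).trans (min_le_left _ _)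
  have hc₀3 : c₀ ≤ (E - ε₀) / 2 := hc₀ ▸ (min_le_right _ _).trans (min_le_right _ _)
  have hc₀0 : 0 < c₀ := hc₀ ▸ lt_min one_pos (lt_min (by linarith) (by linarith))
  have hμ1 : ∀ h ∈ Ioc (0 : ℝ) 1, 1 ≤ μ h := fun h hh =>
    ((one_le_inv₀ hh.1).mpr hh.2).trans (hμ h hh)
  have him : ∀ p ∈ strip μ E ε₀ c₀, |p.2.im| ≤ c₀ := fun p hp =>
    (le_mul_of_one_le_right (abs_nonneg _) (hμ1 _ hp.1)).trans hp.2.2.2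
  have hZ : ∀ p ∈ strip μ E ε₀ c₀, ‖p.2‖ ≤ E + ε₀ + 2 := fun p hp => by
    have h2 := abs_le.mp hp.2.2.1
    have h3 := Complex.norm_le_abs_re_add_abs_im p.2
    have h1 := him p hp
    have h4 : |p.2.re| ≤ E + ε₀ + c₀ := abs_le.mpr ⟨by linarith, by linarith⟩
    linarith
  refine ⟨c₀, fun k p => virialSum p.1 (q p.1) (V₁ p.1) (P p.1) (T p.1) k p.2,
    fun h hh => (hP h hh).1, hμ1, hc₀0, hc₀1, hc₀3, hε₀, ?_, ?_, ?_⟩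
  · intro a ha b hb
    obtain ⟨C, hC, H⟩ := exists_norm_wres_le n
    -- The quadratic form argument requires equal weights on both sides.
    obtain ⟨t, ht⟩ : ∃ t : ℝ≥0, (t : ℝ) = min a b :=
      ⟨⟨min a b, le_min (by linarith) (by linarith)⟩, rfl⟩
    have ht2 : 1 / 2 < (t : ℝ) := ht ▸ lt_min ha hb
    obtain ⟨C', H'⟩ := hlap t (by rw [← NNReal.coe_lt_coe]; simpa using ht2)
    refine ⟨C * (|C'| + 1), by positivity, fun p hp => ?_⟩
    have hμp := hμ1 _ hp.1
    obtain ⟨hl, -, hl2⟩ := H' p.1 hp.1 1 (by simp)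
    have hub : ∀ z : ℂ, 0 < z.im → |z.re - E| ≤ ε₀ + z.im → z.im ≤ ε₀ / 2 →
        ‖wres (P p.1) t 1 t z‖ ≤ C * ((|C'| + 1) * μ p.1) := by
      intro z h1 h2 h3
      refine H (hP p.1 hp.1).1 t.coe_nonneg (by positivity) (fun x hx =>
        ⟨boundaryResolvent (P p.1) 1 t x, ?_, ?_⟩) h1 h2 h3
      · have := hl x hx
        simp only [weightedResolvent_eq_wres, Complex.ofReal_one, one_mul] at this
        exact this
      · refine (hl2 x hx).trans ?_
        have := le_abs_self C'
        nlinarith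
    have hmono : wnorm P b 1 a p ≤ ‖wres (P p.1) t 1 t p.2‖ :=
      norm_wt_mul_wt_le_of_le t.coe_nonneg (ht ▸ min_le_left _ _) t.coe_nonneg
        (ht ▸ min_le_right _ _) _
    rw [mul_assoc]
    refine hmono.trans ?_
    have h3 := (him p hp).trans hc₀2
    rcases lt_or_gt_of_ne hp.2.1 with h | h
    -- The lower half plane is reached by adjoints from the upper one.
    · rw [← norm_wres_conj (hP p.1 hp.1).1 hp.2.1 t.coe_nonneg t.coe_nonneg]
      have h2 := hp.2.2.1
      rw [abs_of_neg h] at h2 h3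
      exact hub _ (by simpa using h) (by simpa using h2) (by simpa using h3)
    · have h2 := hp.2.2.1
      rw [abs_of_pos h] at h2 h3
      exact hub _ h h2 h3
  · intro k a b ha hb
    obtain ⟨C, hC, H⟩ := exists_norm_virial_le n hK ha hb
      (by linarith : 0 ≤ E + ε₀ + 2) k
    refine ⟨C, hC, fun p hp => (H (hM p.1 hp.1) hp.2.1 (hZ p hp)).trans ?_⟩
    rw [mul_assoc]
    refine mul_le_mul_of_nonneg_left (mul_le_mul_of_nonneg_right (hμ _ hp.1) ?_) hC
    positivity
  · intro k a b c d ha hb hc hd hcd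
    obtain ⟨C, hC, H⟩ := exists_norm_virialSum_le n (a := a) hK hb hc hd
      (by linarith : 0 ≤ E + ε₀ + 2) k
    exact ⟨C, hC, fun p hp => H (hM p.1 hp.1) hcd hp.2.1 (hZ p hp)⟩

end ResolventBound

/-! ### Hölder boundary values from bounds on normal derivatives. -/

section BoundaryValues

variable {X : Type*} [NormedAddCommGroup X] [NormedSpace ℝ X]

/-- The primitive of D y^(ν-1) dominates g by a mean value inequality, so no integral of the
derivative is needed. -/
lemma norm_sub_le_rpow {g g' : ℝ → X} {ν D y₁ y₂ : ℝ} (hν : 0 < ν) (hy₁ : 0 < y₁) (hy : y₁ ≤ y₂)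
    (hg : ∀ y ∈ Icc y₁ y₂, HasDerivAt g (g' y) y)
    (hD : ∀ y ∈ Icc y₁ y₂, ‖g' y‖ ≤ D * y ^ (ν - 1)) :
    ‖g y₂ - g y₁‖ ≤ D / ν * (y₂ ^ ν - y₁ ^ ν) := by
  have hpos : ∀ y ∈ Icc y₁ y₂, 0 < y := fun y h => hy₁.trans_le h.1
  have hB : ∀ y ∈ Icc y₁ y₂, HasDerivAt (fun y : ℝ => D / ν * (y ^ ν - y₁ ^ ν))
      (D * y ^ (ν - 1)) y := fun y h => by
    have h1 := ((Real.hasDerivAt_rpow_const (p := ν) (Or.inl (hpos y h).ne')).sub_const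
      (y₁ ^ ν)).const_mul (D / ν)
    refine h1.congr_deriv ?_
    field_simp
  refine image_norm_le_of_norm_deriv_right_le_deriv_boundary' (f := fun y => g y - g y₁) (f' := g')
    (B := fun y : ℝ => D / ν * (y ^ ν - y₁ ^ ν)) (B' := fun y : ℝ => D * y ^ (ν - 1))
    (fun y h => ((hg y h).sub_const _).continuousAt.continuousWithinAt)
    (fun y h => ((hg y (Ico_subset_Icc_self h)).sub_const _).hasDerivWithinAt) (by simp)
    (fun y h => (hB y h).continuousAt.continuousWithinAt)
    (fun y h => (hB y (Ico_subset_Icc_self h)).hasDerivWithinAt)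
    (fun y h => hD y (Ico_subset_Icc_self h)) ⟨hy, le_rfl⟩

/-- A sequence of successive derivatives of a function on the half plane, with bounds on the part
of the half plane over the interval `[α, β]`, of height `ℓ`. -/
structure IsHolderFamily (g : ℕ → ℝ → ℝ → X) (α β ℓ ν : ℝ) (m : ℕ) (D : ℕ → ℝ) : Prop where
  ν_pos : 0 < ν
  ℓ_pos : 0 < ℓ
  deriv_left : ∀ j x y, 0 < y → HasDerivAt (fun x => g j x y) (g (j + 1) x y) x
  deriv_right : ∀ j x y, 0 < y → ∃ d, HasDerivAt (fun y => g j x y) d y ∧ ‖d‖ = ‖g (j + 1) x y‖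
  norm_le : ∀ j ≤ m, ∀ x ∈ Icc α β, ∀ y ∈ Ioc 0 ℓ, ‖g (j + 1) x y‖ ≤ D j * y ^ (ν - 1)

namespace IsHolderFamily

variable {g : ℕ → ℝ → ℝ → X} {α β ℓ ν : ℝ} {m : ℕ} {D : ℕ → ℝ}

lemma norm_sub_le (hg : IsHolderFamily g α β ℓ ν m D) {j : ℕ} (hj : j ≤ m) {x : ℝ}
    (hx : x ∈ Icc α β) {y₁ y₂ : ℝ} (hy₁ : 0 < y₁) (hy : y₁ ≤ y₂) (hy₂ : y₂ ≤ ℓ) :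
    ‖g j x y₂ - g j x y₁‖ ≤ D j / ν * (y₂ ^ ν - y₁ ^ ν) := by
  choose! d hd hn using hg.deriv_right j x
  refine norm_sub_le_rpow hg.ν_pos hy₁ hy (g' := d) (fun y h => hd y (hy₁.trans_le h.1))
    fun y h => ?_
  rw [hn y (hy₁.trans_le h.1)]
  exact hg.norm_le j hj x hx y ⟨hy₁.trans_le h.1, h.2.trans hy₂⟩

lemma D_nonneg (hg : IsHolderFamily g α β ℓ ν m D) {j : ℕ} (hj : j ≤ m) {x : ℝ}
    (hx : x ∈ Icc α β) : 0 ≤ D j := by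
  have h1 := (norm_nonneg _).trans (hg.norm_le j hj x hx ℓ ⟨hg.ℓ_pos, le_rfl⟩)
  exact nonneg_of_mul_nonneg_left h1 (Real.rpow_pos_of_pos hg.ℓ_pos _)

lemma norm_sub_le' (hg : IsHolderFamily g α β ℓ ν m D) {j : ℕ} (hj : j ≤ m) {x : ℝ}
    (hx : x ∈ Icc α β) {y₁ y₂ : ℝ} (hy₁ : 0 < y₁) (hy : y₁ ≤ y₂) (hy₂ : y₂ ≤ ℓ) :
    ‖g j x y₂ - g j x y₁‖ ≤ D j / ν * y₂ ^ ν := by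
  refine (hg.norm_sub_le hj hx hy₁ hy hy₂).trans ?_
  have h1 := div_nonneg (hg.D_nonneg hj hx) hg.ν_pos.le
  have h2 : 0 ≤ y₁ ^ ν := Real.rpow_nonneg hy₁.le _
  exact mul_le_mul_of_nonneg_left (by linarith) h1

lemma exists_tendsto [CompleteSpace X] (hg : IsHolderFamily g α β ℓ ν m D) {j : ℕ} (hj : j ≤ m)
    {x : ℝ} (hx : x ∈ Icc α β) : ∃ H, Tendsto (g j x) (𝓝[>] 0) (𝓝 H) := by
  refine cauchy_map_iff_exists_tendsto.mp (Metric.cauchy_iff.mpr ⟨inferInstance, fun e he => ?_⟩)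
  have hlim : Tendsto (fun y : ℝ => D j / ν * y ^ ν) (𝓝[>] 0) (𝓝 0) := by
    have h1 : Tendsto (fun y : ℝ => y ^ ν) (𝓝[>] 0) (𝓝 ((0 : ℝ) ^ ν)) :=
      ((Real.continuousAt_rpow_const 0 ν (Or.inr hg.ν_pos.le)).tendsto).mono_left
        nhdsWithin_le_nhds
    rw [Real.zero_rpow hg.ν_pos.ne'] at h1
    simpa using h1.const_mul (D j / ν)
  obtain ⟨y₀, hy₀, hy₀ℓ⟩ := ((hlim.eventually_lt_const (by linarith : (0 : ℝ) < e / 2)).and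
    (Ioc_mem_nhdsGT hg.ℓ_pos)).exists
  refine ⟨g j x '' Ioc 0 y₀, image_mem_map (Ioc_mem_nhdsGT hy₀ℓ.1), ?_⟩
  have key : ∀ y ∈ Ioc 0 y₀, dist (g j x y) (g j x y₀) < e / 2 := fun y hy => by
    rw [dist_comm, dist_eq_norm]
    exact (hg.norm_sub_le' hj hx hy.1 hy.2 hy₀ℓ.2).trans_lt hy₀
  rintro _ ⟨y₁, h1, rfl⟩ _ ⟨y₂, h2, rfl⟩
  have := dist_triangle_right (g j x y₁) (g j x y₂) (g j x y₀)
  linarith [key y₁ h1, key y₂ h2]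

/-- The boundary values. -/
def boundary (g : ℕ → ℝ → ℝ → X) (j : ℕ) (x : ℝ) : X := limUnder (𝓝[>] (0 : ℝ)) (g j x)

variable [CompleteSpace X]

lemma tendsto_boundary (hg : IsHolderFamily g α β ℓ ν m D) {j : ℕ} (hj : j ≤ m) {x : ℝ}
    (hx : x ∈ Icc α β) : Tendsto (g j x) (𝓝[>] 0) (𝓝 (boundary g j x)) :=
  tendsto_nhds_limUnder (hg.exists_tendsto hj hx)

lemma norm_sub_boundary_le (hg : IsHolderFamily g α β ℓ ν m D) {j : ℕ} (hj : j ≤ m) {x : ℝ}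
    (hx : x ∈ Icc α β) {y : ℝ} (hy : y ∈ Ioc 0 ℓ) :
    ‖g j x y - boundary g j x‖ ≤ D j / ν * y ^ ν :=
  le_of_tendsto ((tendsto_const_nhds.sub (hg.tendsto_boundary hj hx)).norm) <| by
    filter_upwards [Ioc_mem_nhdsGT hy.1] with y₁ hy₁
    exact hg.norm_sub_le' hj hx hy₁.1 hy₁.2 hy.2

lemma norm_boundary_le (hg : IsHolderFamily g α β ℓ ν m D) {j : ℕ} (hj : j ≤ m) {x : ℝ}
    (hx : x ∈ Icc α β) {A : ℝ} (hA : ∀ y ∈ Ioc 0 ℓ, ‖g j x y‖ ≤ A) : ‖boundary g j x‖ ≤ A :=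
  le_of_tendsto (hg.tendsto_boundary hj hx).norm
    (eventually_of_mem (Ioc_mem_nhdsGT hg.ℓ_pos) hA)

/-- The functions and their x-derivatives converge as y → 0, the latter uniformly at the rate y^ν.
-/
lemma hasDerivAt_boundary (hg : IsHolderFamily g α β ℓ ν m D) {j : ℕ} (hj : j + 1 ≤ m) {x : ℝ}
    (hx : x ∈ Ioo α β) : HasDerivAt (boundary g j) (boundary g (j + 1) x) x := by
  refine hasDerivAt_of_tendstoUniformlyOn (l := 𝓝[>] (0 : ℝ)) (s := Ioo α β) isOpen_Ioo
    (f := fun y x => g j x y) (f' := fun y x => g (j + 1) x y) (g := boundary g j)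
    (g' := boundary g (j + 1)) ?_ ?_ ?_ hx
  · rw [Metric.tendstoUniformlyOn_iff]
    intro e he
    have hlim : Tendsto (fun y : ℝ => D (j + 1) / ν * y ^ ν) (𝓝[>] 0) (𝓝 0) := by
      have h1 : Tendsto (fun y : ℝ => y ^ ν) (𝓝[>] 0) (𝓝 ((0 : ℝ) ^ ν)) :=
        ((Real.continuousAt_rpow_const 0 ν (Or.inr hg.ν_pos.le)).tendsto).mono_left
          nhdsWithin_le_nhds
      rw [Real.zero_rpow hg.ν_pos.ne'] at h1
      simpa using h1.const_mul (D (j + 1) / ν)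
    filter_upwards [hlim.eventually_lt_const he, Ioc_mem_nhdsGT hg.ℓ_pos] with y hy hyℓ x hx
    rw [dist_comm, dist_eq_norm]
    exact (hg.norm_sub_boundary_le hj (Ioo_subset_Icc_self hx) hyℓ).trans_lt hy
  · filter_upwards [self_mem_nhdsWithin] with y hy x _
    exact hg.deriv_left j x y hy
  · exact fun x hx => hg.tendsto_boundary (by omega) (Ioo_subset_Icc_self hx)

/-- The two points are joined through the height y = |x₁ - x₂|: each vertical path costs D/ν y^ν and
the horizontal one D y^(ν-1) |x₁ - x₂|. -/
lemma holder_boundary_of_le (hg : IsHolderFamily g α β ℓ ν m D) {j : ℕ} (hj : j ≤ m) {x₁ x₂ : ℝ}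
    (hx₁ : x₁ ∈ Icc α β) (hx₂ : x₂ ∈ Icc α β) (h : |x₁ - x₂| ≤ ℓ) :
    ‖boundary g j x₁ - boundary g j x₂‖ ≤ D j * (2 / ν + 1) * |x₁ - x₂| ^ ν := by
  rcases eq_or_ne x₁ x₂ with rfl | hne
  · simp [Real.zero_rpow hg.ν_pos.ne']
  have hy : 0 < |x₁ - x₂| := abs_pos.mpr (sub_ne_zero.mpr hne)
  have hyℓ : |x₁ - x₂| ∈ Ioc 0 ℓ := ⟨hy, h⟩
  have h1 := hg.norm_sub_boundary_le hj hx₁ hyℓ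
  have h2 := hg.norm_sub_boundary_le hj hx₂ hyℓ
  have h3 : ‖g j x₁ |x₁ - x₂| - g j x₂ |x₁ - x₂|‖ ≤ D j * |x₁ - x₂| ^ (ν - 1) * ‖x₁ - x₂‖ :=
    (convex_Icc α β).norm_image_sub_le_of_norm_hasDerivWithin_le
      (f := fun x => g j x |x₁ - x₂|) (f' := fun x => g (j + 1) x |x₁ - x₂|)
      (fun x _ => (hg.deriv_left j x _ hy).hasDerivWithinAt)
      (fun x hx => hg.norm_le j hj x hx _ hyℓ) hx₂ hx₁
  have h4 : |x₁ - x₂| ^ (ν - 1) * ‖x₁ - x₂‖ = |x₁ - x₂| ^ ν := by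
    rw [Real.norm_eq_abs, ← Real.rpow_add_one hy.ne', sub_add_cancel]
  rw [mul_assoc, h4] at h3
  have e : boundary g j x₁ - boundary g j x₂ = -(g j x₁ |x₁ - x₂| - boundary g j x₁) +
      (g j x₁ |x₁ - x₂| - g j x₂ |x₁ - x₂|) + (g j x₂ |x₁ - x₂| - boundary g j x₂) := by abel
  rw [e]
  refine (norm_add₃_le).trans ?_
  rw [norm_neg]
  refine (add_le_add (add_le_add h1 h3) h2).trans_eq ?_
  ring

lemma continuousOn_boundary (hg : IsHolderFamily g α β ℓ ν m D) {j : ℕ} (hj : j ≤ m) :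
    ContinuousOn (boundary g j) (Icc α β) := by
  intro x hx
  rw [ContinuousWithinAt, tendsto_iff_norm_sub_tendsto_zero]
  have h1 : Tendsto (fun x' : ℝ => D j * (2 / ν + 1) * |x' - x| ^ ν) (𝓝[Icc α β] x) (𝓝 0) := by
    have h2 : ContinuousAt (fun x' : ℝ => D j * (2 / ν + 1) * |x' - x| ^ ν) x :=
      (((continuous_id.sub continuous_const).abs).rpow_const
        (fun _ => Or.inr hg.ν_pos.le)).continuousAt.const_mul _
    have h3 := h2.tendsto
    simp only [sub_self, abs_zero, Real.zero_rpow hg.ν_pos.ne', mul_zero] at h3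
    exact h3.mono_left nhdsWithin_le_nhds
  refine squeeze_zero' (Eventually.of_forall fun _ => norm_nonneg _) ?_ h1
  have h4 : ∀ᶠ x' in 𝓝[Icc α β] x, |x' - x| ≤ ℓ := by
    refine nhdsWithin_le_nhds ?_
    filter_upwards [Metric.ball_mem_nhds x hg.ℓ_pos] with x' hx'
    rw [Metric.mem_ball, Real.dist_eq] at hx'
    exact hx'.le
  filter_upwards [h4, self_mem_nhdsWithin] with x' h h'
  exact hg.holder_boundary_of_le hj h' hx h

/-- For points further apart than ℓ the sup bound A is used; the factor ℓ^(-ν) later contributes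
μ^ν. -/
lemma holder_boundary (hg : IsHolderFamily g α β ℓ ν m D) {j : ℕ} (hj : j ≤ m) {A : ℝ}
    (hA : ∀ x ∈ Icc α β, ∀ y ∈ Ioc 0 ℓ, ‖g j x y‖ ≤ A) {x₁ x₂ : ℝ}
    (hx₁ : x₁ ∈ Icc α β) (hx₂ : x₂ ∈ Icc α β) :
    ‖boundary g j x₁ - boundary g j x₂‖ ≤
      (D j * (2 / ν + 1) + 2 * A * ℓ ^ (-ν)) * |x₁ - x₂| ^ ν := by
  have hA0 : 0 ≤ A := (norm_nonneg _).trans (hA x₁ hx₁ ℓ ⟨hg.ℓ_pos, le_rfl⟩)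
  have hD := hg.D_nonneg hj hx₁
  have hν := hg.ν_pos
  have hℓ := hg.ℓ_pos
  rw [add_mul]
  rcases le_or_gt |x₁ - x₂| ℓ with h | h
  · refine (hg.holder_boundary_of_le hj hx₁ hx₂ h).trans (le_add_of_nonneg_right ?_)
    positivity
  · have h1 : ‖boundary g j x₁ - boundary g j x₂‖ ≤ 2 * A := by
      refine (_root_.norm_sub_le _ _).trans ?_
      linarith [hg.norm_boundary_le hj hx₁ (hA x₁ hx₁), hg.norm_boundary_le hj hx₂ (hA x₂ hx₂)]
    have h2 : 1 ≤ ℓ ^ (-ν) * |x₁ - x₂| ^ ν := by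
      rw [Real.rpow_neg hℓ.le, inv_mul_eq_div, one_le_div (by positivity)]
      exact Real.rpow_le_rpow hℓ.le h.le hν.le
    have h3 : 0 ≤ D j * (2 / ν + 1) * |x₁ - x₂| ^ ν := by positivity
    have h4 : 2 * A ≤ 2 * A * (ℓ ^ (-ν) * |x₁ - x₂| ^ ν) := le_mul_of_one_le_right (by linarith) h2
    rw [mul_assoc (2 * A)]
    linarith

lemma iteratedDerivWithin_boundary (hg : IsHolderFamily g α β ℓ ν m D) {j : ℕ} (hj : j ≤ m) :
    EqOn (iteratedDerivWithin j (boundary g 0) (Ioo α β)) (boundary g j) (Ioo α β) := by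
  induction j with
  | zero => intro x _; rw [iteratedDerivWithin_zero]
  | succ j ih =>
    intro x hx
    rw [iteratedDerivWithin_succ, derivWithin_congr (ih (by omega)) (ih (by omega) hx)]
    exact (hg.hasDerivAt_boundary hj hx).hasDerivWithinAt.derivWithin
      (isOpen_Ioo.uniqueDiffWithinAt hx)

lemma contDiffOn_boundary (hg : IsHolderFamily g α β ℓ ν m D) :
    ContDiffOn ℝ m (boundary g 0) (Ioo α β) := by
  refine contDiffOn_of_continuousOn_differentiableOn_deriv (n := (m : ℕ∞)) (fun j hj => ?_)
    fun j hj => ?_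
  · have hj' : j ≤ m := by exact_mod_cast hj
    exact ((hg.continuousOn_boundary hj').mono Ioo_subset_Icc_self).congr
      (hg.iteratedDerivWithin_boundary hj')
  · have hj' : j < m := by exact_mod_cast hj
    intro x hx
    exact ((hg.hasDerivAt_boundary hj' hx).hasDerivWithinAt.congr
      (hg.iteratedDerivWithin_boundary hj'.le)
      (hg.iteratedDerivWithin_boundary hj'.le hx)).differentiableWithinAt

/-- Bound of the `C^s` norm of the boundary values. -/
lemma csNorm_boundary_le {s : ℝ≥0} (hg : IsHolderFamily g α β ℓ ν ⌊s⌋₊ D)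
    (hsν : s ≠ (⌊s⌋₊ : ℝ≥0) → (s : ℝ) = ⌊s⌋₊ + ν) {A : ℕ → ℝ}
    (hA : ∀ j ≤ ⌊s⌋₊, ∀ x ∈ Icc α β, ∀ y ∈ Ioc 0 ℓ, ‖g j x y‖ ≤ A j) {B : ℝ}
    (hA0 : ∀ j ≤ ⌊s⌋₊, A j ≤ B)
    (hB : s ≠ (⌊s⌋₊ : ℝ≥0) → D ⌊s⌋₊ * (2 / ν + 1) + 2 * A ⌊s⌋₊ * ℓ ^ (-ν) ≤ B) :
    csNorm s (Ioo α β) (boundary g 0) ≤ ENNReal.ofReal ((⌊s⌋₊ + 2) * B) := by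
  rcases (Ioo α β).eq_empty_or_nonempty with he | ⟨x₀, hx₀⟩
  · have : IsEmpty (Ioo α β) := by rw [he]; infer_instance
    have h1 : eHolderNorm (s - (⌊s⌋₊ : ℝ≥0)) ((Ioo α β).domRestrict
        (iteratedDerivWithin ⌊s⌋₊ (boundary g 0) (Ioo α β))) = 0 := by
      refine le_antisymm ?_ zero_le
      exact (HolderWith.eHolderNorm_le (C := 0) fun x => isEmptyElim x)
    rw [csNorm, h1, he]
    simp
  have hx₀' := Ioo_subset_Icc_self hx₀
  have hnn : ∀ j ≤ ⌊s⌋₊, 0 ≤ A j := fun j hj =>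
    (norm_nonneg _).trans (hA j hj x₀ hx₀' ℓ ⟨hg.ℓ_pos, le_rfl⟩)
  have hB0 : 0 ≤ B := (hnn 0 (Nat.zero_le _)).trans (hA0 0 (Nat.zero_le _))
  have h1 : ∑ j ∈ Finset.range (⌊s⌋₊ + 1), ⨆ z ∈ Ioo α β,
      ‖iteratedDerivWithin j (boundary g 0) (Ioo α β) z‖ₑ ≤
      ∑ j ∈ Finset.range (⌊s⌋₊ + 1), ENNReal.ofReal B := by
    refine Finset.sum_le_sum fun j hj => iSup₂_le fun z hz => ?_
    have hj' : j ≤ ⌊s⌋₊ := Nat.lt_succ_iff.mp (Finset.mem_range.mp hj)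
    rw [hg.iteratedDerivWithin_boundary hj' hz, ← ofReal_norm]
    exact ENNReal.ofReal_le_ofReal ((hg.norm_boundary_le hj' (Ioo_subset_Icc_self hz)
      (hA j hj' z (Ioo_subset_Icc_self hz))).trans (hA0 j hj'))
  have h2 : (if s = (⌊s⌋₊ : ℝ≥0) then 0 else eHolderNorm (s - (⌊s⌋₊ : ℝ≥0))
      ((Ioo α β).domRestrict (iteratedDerivWithin ⌊s⌋₊ (boundary g 0) (Ioo α β)))) ≤
      ENNReal.ofReal B := by
    split_ifs with hs
    · exact zero_le
    have hν : ((s - (⌊s⌋₊ : ℝ≥0) : ℝ≥0) : ℝ) = ν := by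
      rw [NNReal.coe_sub (Nat.floor_le zero_le), hsν hs, NNReal.coe_natCast]
      ring
    refine HolderWith.eHolderNorm_le (C := B.toNNReal) fun x₁ x₂ => ?_
    rw [hν, Set.domRestrict_apply, Set.domRestrict_apply,
      hg.iteratedDerivWithin_boundary le_rfl x₁.2, hg.iteratedDerivWithin_boundary le_rfl x₂.2,
      edist_dist, edist_dist, ENNReal.ofReal_rpow_of_nonneg dist_nonneg hg.ν_pos.le]
    change _ ≤ ENNReal.ofReal B * _
    rw [← ENNReal.ofReal_mul hB0]
    refine ENNReal.ofReal_le_ofReal ?_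
    rw [dist_eq_norm]
    have h3 := hg.holder_boundary le_rfl (hA _ le_rfl) (Ioo_subset_Icc_self x₁.2)
      (Ioo_subset_Icc_self x₂.2)
    refine h3.trans ?_
    rw [Subtype.dist_eq, Real.dist_eq]
    exact mul_le_mul_of_nonneg_right (hB hs) (Real.rpow_nonneg (abs_nonneg _) _)
  refine (add_le_add h1 h2).trans_eq ?_
  rw [Finset.sum_const, Finset.card_range, nsmul_eq_mul, ← ENNReal.ofReal_natCast,
    ← ENNReal.ofReal_mul (by positivity), ← ENNReal.ofReal_add (by positivity) hB0]
  congr 1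
  push_cast
  ring

end IsHolderFamily

end BoundaryValues

/-! ### Closedness of distributional derivatives. -/

section SemiDeriv

variable {n : ℕ}

/-- The embedding of L² into tempered distributions and differentiation there are continuous. Thus
derivatives of the resolvent off the axis pass to its boundary values. -/
lemma isSemiDeriv_of_tendsto {ι : Type*} {l : Filter ι} [l.NeBot] {h : ℝ} {k : ℕ}
    {α : Fin k → Fin n} {u v : ι → L2 n} {u₀ v₀ : L2 n} (huv : ∀ᶠ i in l, IsSemiDeriv h α (u i) (v i))
    (hu : Tendsto u l (𝓝 u₀)) (hv : Tendsto v l (𝓝 v₀)) : IsSemiDeriv h α u₀ v₀ := by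
  have hc := (Lp.toTemperedDistributionCLM ℂ (volume : Measure (Space n)) 2).continuous
  have h1 := (hc.tendsto v₀).comp hv
  have h2 := (((LineDeriv.iteratedLineDerivOpCLM ℂ 𝓢'(Space n, ℂ)
    (fun l => unitVec (α l))).continuous.tendsto _).comp ((hc.tendsto u₀).comp hu)).const_smul
      ((-Complex.I * (h : ℂ)) ^ k)
  refine tendsto_nhds_unique (h1.congr' ?_) h2
  filter_upwards [huv] with i hi
  exact hi

end SemiDeriv

/-! ### Derivatives of the weighted resolvent. -/

section WeightedDerivatives

variable {n : ℕ}

/-- Conjugation of a weight with the resolvent is bounded. -/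
lemma exists_mul_weight (n : ℕ) {K a : ℝ} (hK : 0 ≤ K) (ha : 0 ≤ a) : ∃ C : ℝ, 0 ≤ C ∧
    ∀ {h δ : ℝ} {P : L2 n →ₗ.[ℂ] L2 n} {q : Option (Fin n) → Option (Fin n) → Space n → ℝ}
      {V₁ : Space n → ℝ} {T : Option (Fin n) → L2 n →L[ℂ] L2 n} {T₂ : Fin n → L2 n →L[ℂ] L2 n},
      IsModel h K δ P q V₁ T T₂ → ∃ B : L2 n →L[ℂ] L2 n,
        wt n a * unboundedResolvent P (-Complex.I) = unboundedResolvent P (-Complex.I) * B ∧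
        ∀ u : P.domain, ‖B (P u + Complex.I • (u : L2 n))‖ ≤
          C * (‖wt n a (u : L2 n)‖ + ‖wt n a (P u)‖) := by
  obtain ⟨C, hC, H⟩ := IsModel.exists_norm_wt_le n hK ha
  refine ⟨C, hC, fun {h δ P q V₁ T T₂} M => ?_⟩
  have hP := M.isSelfAdjoint
  have hz : (-Complex.I).im ≠ 0 := by simp
  have hRI : ∀ u : P.domain,
      unboundedResolvent P (-Complex.I) (P u + Complex.I • (u : L2 n)) = u := fun u => by
    have := unboundedResolvent_apply_sub hP hz u
    rwa [neg_smul, sub_neg_eq_add] at this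
  obtain ⟨r, hr⟩ : ∃ r : L2 n → P.domain, ∀ f, (r f : L2 n) = unboundedResolvent P (-Complex.I) f :=
    ⟨fun f => ⟨_, unboundedResolvent_mem hP hz f⟩, fun f => rfl⟩
  have hPr : ∀ f, P (r f) + Complex.I • (r f : L2 n) = f := fun f => by
    have h1 : r f = ⟨_, unboundedResolvent_mem hP hz f⟩ := Subtype.ext (hr f)
    rw [h1, apply_unboundedResolvent hP hz]
    simp
  have hmem : ∀ u : P.domain, wt n a (u : L2 n) ∈ P.domain := fun u => (H M u).1
  -- b is (P + i) ⟨x⟩⁻ᵃ (P + i)⁻¹, defined everywhere because the weight preserves the domain.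
  obtain ⟨b, hb⟩ : ∃ b : L2 n → L2 n, ∀ f, b f = P ⟨wt n a (r f), hmem (r f)⟩ +
      Complex.I • wt n a (r f : L2 n) := ⟨_, fun f => rfl⟩
  have hbR : ∀ f, unboundedResolvent P (-Complex.I) (b f) = wt n a (r f : L2 n) := fun f => by
    rw [hb]; exact hRI ⟨wt n a (r f), hmem (r f)⟩
  -- Linearity of b is checked after applying the injective operator (P + i)⁻¹.
  have hinj : ∀ f g, unboundedResolvent P (-Complex.I) f = unboundedResolvent P (-Complex.I) g →
      f = g := fun f g hfg => by
    have h1 : r f = r g := Subtype.ext (by rw [hr, hr, hfg])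
    rw [← hPr f, ← hPr g, h1]
  have hbd : ∀ f, ‖b f‖ ≤ C * (‖wt n a (r f : L2 n)‖ + ‖wt n a (P (r f))‖) := fun f => by
    rw [hb]; exact (H M (r f)).2.1
  have hRle : ‖unboundedResolvent P (-Complex.I)‖ ≤ 1 := by
    simpa using norm_unboundedResolvent_le hP hz
  have hb3 : ∀ f, ‖b f‖ ≤ 3 * C * ‖f‖ := fun f => by
    have h1 : ‖(r f : L2 n)‖ ≤ ‖f‖ := by
      rw [hr]
      simpa using (unboundedResolvent P (-Complex.I)).le_of_opNorm_le hRle f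
    have h2 : ‖P (r f)‖ ≤ 2 * ‖f‖ := by
      rw [eq_sub_of_add_eq (hPr f)]
      refine (norm_sub_le _ _).trans ?_
      rw [norm_smul, Complex.norm_I]
      linarith
    have h3 := norm_wt_apply_le ha (r f : L2 n)
    have h4 := norm_wt_apply_le ha (P (r f))
    refine (hbd f).trans ?_
    rw [mul_comm 3 C, mul_assoc]
    exact mul_le_mul_of_nonneg_left (by linarith) hC
  refine ⟨LinearMap.mkContinuous
    { toFun := b
      map_add' := fun f g => hinj _ _ (by
        rw [map_add, hbR, hbR, hbR, hr, hr, hr, map_add, map_add])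
      map_smul' := fun t f => hinj _ _ (by
        rw [RingHom.id_apply, map_smul, hbR, hbR, hr, hr, map_smul, map_smul]) }
    (3 * C) hb3, ?_, fun u => ?_⟩
  · ext1 f
    rw [mul_apply_eq_comp, mul_apply_eq_comp, ← hr]
    exact (hbR f).symm
  · have h1 : r (P u + Complex.I • (u : L2 n)) = u := Subtype.ext (by rw [hr, hRI])
    have h2 := hbd (P u + Complex.I • (u : L2 n))
    rw [h1] at h2
    exact h2

/-- A derivative `T = 𝒟^α (P + i)⁻¹` composed with the `j`-th derivative of the weighted resolvent;
`B` is the conjugation of the weight with `P + i`. -/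
def derivRes (P : L2 n →ₗ.[ℂ] L2 n) (a : ℝ) (T B : L2 n →L[ℂ] L2 n) (j : ℕ) (z : ℂ) :
    L2 n →L[ℂ] L2 n :=
  (j.factorial : ℂ) • (T * B * (unboundedResolvent P z ^ j +
    (z + Complex.I) • unboundedResolvent P z ^ (j + 1)) * wt n a)

/-- By Leibniz, the j-th derivative of 1 + (z + i) R is j! (Rʲ + (z + i) Rʲ⁺¹); the factorial in the
definition makes the family closed under differentiation. -/
lemma hasDerivAt_derivRes {P : L2 n →ₗ.[ℂ] L2 n} (hP : IsSelfAdjoint P) (a : ℝ)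
    (T B : L2 n →L[ℂ] L2 n) (j : ℕ) {z : ℂ} (hz : z.im ≠ 0) :
    HasDerivAt (derivRes P a T B j) (derivRes P a T B (j + 1) z) z := by
  have h1 := hasDerivAt_unboundedResolvent_pow hP hz j
  have h2 := ((hasDerivAt_id z).add_const Complex.I).smul
    (hasDerivAt_unboundedResolvent_pow hP hz (j + 1))
  have h3 := (((h1.add h2).const_mul (T * B)).mul_const (wt n a)).const_smul (j.factorial : ℂ)
  refine h3.congr_deriv ?_
  rw [derivRes, Nat.factorial_succ, Nat.cast_mul, mul_comm ((j + 1 : ℕ) : ℂ), mul_smul,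
    ← smul_mul_assoc ((j + 1 : ℕ) : ℂ), ← mul_smul_comm ((j + 1 : ℕ) : ℂ)]
  congr 4
  rw [Nat.cast_add, Nat.cast_one, id]
  module

lemma isSemiDerivComp_derivRes {P : L2 n →ₗ.[ℂ] L2 n} (hP : IsSelfAdjoint P) {a h : ℝ} {k : ℕ}
    {α : Fin k → Fin n} {T B : L2 n →L[ℂ] L2 n}
    (hB : wt n a * unboundedResolvent P (-Complex.I) = unboundedResolvent P (-Complex.I) * B)
    (hT : IsSemiDerivComp h α (unboundedResolvent P (-Complex.I)) T) {z : ℂ} (hz : z.im ≠ 0) :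
    IsSemiDerivComp h α (wres P a 1 a z) (derivRes P a T B 0 z) := by
  intro f
  have h0 : (-Complex.I).im ≠ 0 := by simp
  have h1 := hT (B ((1 + (z + Complex.I) • unboundedResolvent P z) (wt n a f)))
  have h2 : unboundedResolvent P (-Complex.I)
      (B ((1 + (z + Complex.I) • unboundedResolvent P z) (wt n a f))) = wres P a 1 a z f := by
    have h3 := unboundedResolvent_eq hP hz h0
    rw [sub_neg_eq_add] at h3
    rw [← mul_apply_eq_comp, ← hB, mul_apply_eq_comp, wres_apply, pow_one]
    congr 1
    nth_rewrite 2 [h3]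
    rfl
  rw [h2] at h1
  have h4 : derivRes P a T B 0 z f =
      T (B ((1 + (z + Complex.I) • unboundedResolvent P z) (wt n a f))) := by
    rw [derivRes, Nat.factorial_zero, Nat.cast_one, one_smul, pow_zero, zero_add, pow_one]
    rfl
  rwa [h4]

/-- The factor Rʲ + (z + i) Rʲ⁺¹ equals (P + i) Rʲ⁺¹, which is the form in which B has a weighted
bound; the estimate thus involves only weighted powers. -/
lemma norm_derivRes_le {P : L2 n →ₗ.[ℂ] L2 n} (hP : IsSelfAdjoint P) {a C C' Z : ℝ}
    {T B : L2 n →L[ℂ] L2 n} (hC : 0 ≤ C) (hT : ‖T‖ ≤ C')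
    (hB : ∀ u : P.domain, ‖B (P u + Complex.I • (u : L2 n))‖ ≤
      C * (‖wt n a (u : L2 n)‖ + ‖wt n a (P u)‖)) (j : ℕ) {z : ℂ} (hz : z.im ≠ 0)
    (hZ : ‖z‖ ≤ Z) : ‖derivRes P a T B j z‖ ≤ j.factorial * C' * (C * (1 + Z)) *
      (‖wres P a (j + 1) a z‖ + ‖wres P a j a z‖) := by
  have hZ0 : 0 ≤ Z := (norm_nonneg z).trans hZ
  have hC' : 0 ≤ C' := (norm_nonneg T).trans hT
  refine ContinuousLinearMap.opNorm_le_bound _ (by positivity) fun f => ?_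
  obtain ⟨x, hx⟩ : ∃ x, x = (unboundedResolvent P z ^ j) (wt n a f) := ⟨_, rfl⟩
  have h1 := hB ⟨_, unboundedResolvent_mem hP hz x⟩
  rw [apply_unboundedResolvent hP hz] at h1
  have e1 : derivRes P a T B j z f = (j.factorial : ℂ) • T (B (z • unboundedResolvent P z x + x +
      Complex.I • unboundedResolvent P z x)) := by
    rw [derivRes, smul_apply, mul_apply_eq_comp, mul_apply_eq_comp, mul_apply_eq_comp, add_apply,
      smul_apply, pow_succ', mul_apply_eq_comp, ← hx, add_smul]
    congr 3
    abel
  have e2 : ‖wt n a (unboundedResolvent P z x)‖ ≤ ‖wres P a (j + 1) a z‖ * ‖f‖ := by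
    have := (wres P a (j + 1) a z).le_opNorm f
    rwa [wres_apply, pow_succ', mul_apply_eq_comp, ← hx] at this
  have e3 : ‖wt n a x‖ ≤ ‖wres P a j a z‖ * ‖f‖ := by
    have := (wres P a j a z).le_opNorm f
    rwa [wres_apply, ← hx] at this
  have e4 : ‖wt n a (unboundedResolvent P z x)‖ + ‖wt n a (z • unboundedResolvent P z x + x)‖ ≤
      (1 + Z) * ((‖wres P a (j + 1) a z‖ + ‖wres P a j a z‖) * ‖f‖) := by
    have h2 : ‖wt n a (z • unboundedResolvent P z x + x)‖ ≤
        Z * ‖wt n a (unboundedResolvent P z x)‖ + ‖wt n a x‖ := by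
      rw [map_add, map_smul]
      refine (norm_add_le _ _).trans ?_
      rw [norm_smul]
      exact add_le_add (mul_le_mul_of_nonneg_right hZ (norm_nonneg _)) le_rfl
    have h3 : 0 ≤ Z * ‖wt n a x‖ := by positivity
    have h4 : (1 + Z) * (‖wt n a (unboundedResolvent P z x)‖ + ‖wt n a x‖) ≤
        (1 + Z) * ((‖wres P a (j + 1) a z‖ + ‖wres P a j a z‖) * ‖f‖) :=
      mul_le_mul_of_nonneg_left (by linarith) (by linarith)
    linarith
  rw [e1, norm_smul, Complex.norm_natCast]
  calc _ ≤ (j.factorial : ℝ) * (C' * (C * ((1 + Z) *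
        ((‖wres P a (j + 1) a z‖ + ‖wres P a j a z‖) * ‖f‖)))) := by
        refine mul_le_mul_of_nonneg_left ?_ (by positivity)
        refine (T.le_of_opNorm_le hT _).trans (mul_le_mul_of_nonneg_left (h1.trans ?_) hC')
        exact mul_le_mul_of_nonneg_left e4 hC
    _ = _ := by ring

end WeightedDerivatives

/-! ### Assembly: exponents, uniform constants and the conclusion. -/

section Final

variable {n : ℕ}

lemma hasDerivAt_comp_re {X : Type*} [NormedAddCommGroup X] [NormedSpace ℂ X] [NormedSpace ℝ X]
    [IsScalarTower ℝ ℂ X] {F : ℂ → X} {F' : X} (w : ℂ) {x : ℝ} (hF : HasDerivAt F F' (x + w)) :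
    HasDerivAt (fun x : ℝ => F (x + w)) F' x := by
  have h1 : HasDerivAt (fun x : ℝ => (x : ℂ) + w) 1 x := by
    simpa using (hasDerivAt_id x).ofReal_comp.add_const w
  have h2 := HasDerivAt.scomp x hF h1
  rw [one_smul] at h2
  exact h2

lemma hasDerivAt_comp_im {X : Type*} [NormedAddCommGroup X] [NormedSpace ℂ X] [NormedSpace ℝ X]
    [IsScalarTower ℝ ℂ X] {F : ℂ → X} {F' : X} (x σ : ℂ) {y : ℝ}
    (hF : HasDerivAt F F' (x + σ * y * Complex.I)) :
    HasDerivAt (fun y : ℝ => F (x + σ * y * Complex.I)) ((σ * Complex.I) • F') y := by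
  have h1 : HasDerivAt (fun y : ℝ => x + σ * y * Complex.I) (σ * Complex.I) y := by
    simpa using (((hasDerivAt_id y).ofReal_comp.const_mul σ).mul_const Complex.I).const_add x
  exact HasDerivAt.scomp y hF h1

/-- For integer s a small auxiliary ν is chosen, because an integrable singularity is still needed
for the boundary values of the last derivative to exist and be continuous. The slack δ - 1 - s and ε
leaves room for it. -/
lemma exists_holder_exponent {s : ℝ≥0} {δ : ℝ} (hs : (s : ℝ) < δ - 1) {ε : ℝ≥0} (hε : 0 < ε) :
    ∃ ν : ℝ, 0 < ν ∧ ν < 1 ∧ (⌊s⌋₊ : ℝ) + ν < δ - 1 ∧ (⌊s⌋₊ : ℝ) + ν < s + ε ∧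
      (s ≠ (⌊s⌋₊ : ℝ≥0) → (s : ℝ) = ⌊s⌋₊ + ν) := by
  have hε' : (0 : ℝ) < ε := hε
  have hfl : (⌊s⌋₊ : ℝ) ≤ s := by exact_mod_cast Nat.floor_le (zero_le (a := s))
  have hfl' : (s : ℝ) < ⌊s⌋₊ + 1 := by exact_mod_cast Nat.lt_floor_add_one s
  by_cases h : s = (⌊s⌋₊ : ℝ≥0)
  · refine ⟨min (1 / 2) (min ((δ - 1 - s) / 2) (ε / 2)), ?_, ?_, ?_, ?_, fun h' => absurd h h'⟩
    · exact lt_min (by norm_num) (lt_min (by linarith) (by linarith))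
    · exact (min_le_left _ _).trans_lt (by norm_num)
    · have := (min_le_right (1 / 2 : ℝ) (min ((δ - 1 - s) / 2) (ε / 2))).trans (min_le_left _ _)
      linarith
    · have := (min_le_right (1 / 2 : ℝ) (min ((δ - 1 - s) / 2) (ε / 2))).trans (min_le_right _ _)
      linarith
  · have hne : (⌊s⌋₊ : ℝ) ≠ s := fun h' => h (by rw [← NNReal.coe_inj, ← h']; simp)
    have hlt := lt_of_le_of_ne hfl hne
    exact ⟨s - ⌊s⌋₊, by linarith, by linarith, by linarith, by linarith, fun _ => by ring⟩

namespace IsFamily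

variable {P : ℝ → L2 n →ₗ.[ℂ] L2 n} {μ : ℝ → ℝ} {δ E ε₀ c₀ : ℝ}
  {W : ℕ → ℝ × ℂ → L2 n →L[ℂ] L2 n}

lemma bound_pow (Φ : IsFamily P μ δ E ε₀ c₀ W) {m : ℕ} (hm : (m : ℝ) < δ - 1) {a : ℝ}
    (ha : 1 / 2 + (m : ℝ) < a) {j : ℕ} (hj : j ≤ m) : UBdd (rectangle μ E ε₀ c₀)
      (fun p => wnorm P a (j + 1) a p + wnorm P a j a p) (fun p => μ p.1 ^ (j + 1)) := by
  have hm0 : (0 : ℝ) ≤ m := by positivity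
  have H : ∀ i < m + 1, Est P μ E ε₀ c₀ 1 i := fun i hi => Φ.estimate one_pos le_rfl i (by
    have : (i : ℝ) ≤ m := by exact_mod_cast Nat.lt_succ_iff.mp hi
    linarith)
  have hj' : (j : ℝ) ≤ m := by exact_mod_cast hj
  have h1 : UBdd (strip μ E ε₀ c₀) (fun p => wnorm P a (j + 1) a p + wnorm P a j a p)
      (fun p => μ p.1 ^ (j + 1) * loss μ 1 p) := by
    refine UBdd.add
      (Φ.estimate_pow le_rfl H (by omega) le_rfl (by linarith) (by linarith) ?_ ?_)
      (Φ.estimate_pow le_rfl H (by omega) (by omega) (by linarith) (by linarith) ?_ ?_) <;>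
      push_cast <;> linarith
  simp only [loss_one, mul_one] at h1
  exact h1.mono Φ.rectangle_subset

lemma bound_last_pow (Φ : IsFamily P μ δ E ε₀ c₀ W) {ν : ℝ} (hν0 : 0 < ν) (hν1 : ν < 1)
    {m : ℕ} (hm : (m : ℝ) + ν < δ - 1) {a : ℝ} (ha : 1 / 2 + (m : ℝ) + ν < a) :
    UBdd (rectangle μ E ε₀ c₀) (fun p => wnorm P a (m + 2) a p + wnorm P a (m + 1) a p)
      (fun p => μ p.1 ^ (m + 2) * (|p.2.im| * μ p.1) ^ (-(1 - ν))) := by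
  refine (Φ.last_estimate hν0 hν1 hm ha).add ?_
  refine UBdd.trans_le (UBdd.le_trans (fun p _ => ?_)
    (Φ.bound_pow (by linarith : (m : ℝ) < δ - 1) (by linarith : 1 / 2 + (m : ℝ) < a) le_rfl))
    fun p hp => ?_
  · exact le_add_of_nonneg_right (norm_nonneg _)
  · exact (pow_le_pow_right₀ (Φ.one_le_μ _ hp.1) (Nat.le_succ _)).trans
      (le_mul_of_one_le_right (pow_nonneg (by linarith [Φ.one_le_μ _ hp.1]) _)
        (Φ.one_le_rpow (Φ.rectangle_subset hp) (by linarith)))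

/-- The derivatives of the weighted resolvent form a Hölder family. -/
lemma isHolderFamily (Φ : IsFamily P μ δ E ε₀ c₀ W) {ν : ℝ} (hν0 : 0 < ν) (hν1 : ν < 1)
    {m : ℕ} {a C : ℝ} {c₁ : ℕ → ℝ} {c₂ h σ : ℝ} (hh : h ∈ Ioc (0 : ℝ) 1)
    (hσ : σ ∈ ({1, -1} : Set ℝ)) {T B : L2 n →L[ℂ] L2 n}
    (hc₁ : ∀ j ≤ m, ∀ p ∈ rectangle μ E ε₀ c₀,
      wnorm P a (j + 1) a p + wnorm P a j a p ≤ c₁ j * μ p.1 ^ (j + 1))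
    (hc₂ : ∀ p ∈ rectangle μ E ε₀ c₀, wnorm P a (m + 2) a p + wnorm P a (m + 1) a p ≤
      c₂ * (μ p.1 ^ (m + 2) * (|p.2.im| * μ p.1) ^ (-(1 - ν)))) (hC : 0 ≤ C)
    (hTB : ∀ (j : ℕ) (z : ℂ), z.im ≠ 0 → ‖z‖ ≤ E + ε₀ + 2 → ‖derivRes (P h) a T B j z‖ ≤
      j.factorial * C * (wnorm P a (j + 1) a (h, z) + wnorm P a j a (h, z))) :
    IsHolderFamily (fun j x y => derivRes (P h) a T B j (x + σ * y * Complex.I)) (E - ε₀) (E + ε₀)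
      (c₀ / 2 / μ h) ν m (fun j => if j < m then (j + 1).factorial * C * (c₁ (j + 1) * μ h ^ (j + 2))
        else (m + 1).factorial * C * (c₂ * (μ h ^ (m + 2) * μ h ^ (-(1 - ν))))) ∧
    ∀ j ≤ m, ∀ x ∈ Icc (E - ε₀) (E + ε₀), ∀ y ∈ Ioc 0 (c₀ / 2 / μ h),
      ‖derivRes (P h) a T B j (x + σ * y * Complex.I)‖ ≤
        j.factorial * C * (c₁ j * μ h ^ (j + 1)) := by
  have hμ1 := Φ.one_le_μ h hh
  have hμ0 : 0 < μ h := by linarith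
  have hsa := Φ.isSelfAdjoint h hh
  have hσ0 : |σ| = 1 := by rcases hσ with rfl | hσ <;> simp_all
  have him : ∀ x y : ℝ, (x + σ * y * Complex.I : ℂ).im = σ * y := fun x y => by simp
  have hre : ∀ x y : ℝ, (x + σ * y * Complex.I : ℂ).re = x := fun x y => by simp
  have him0 : ∀ x y : ℝ, 0 < y → (x + σ * y * Complex.I : ℂ).im ≠ 0 := fun x y hy h => by
    rw [him] at h
    have := congrArg abs h
    rw [abs_mul, hσ0, one_mul, abs_of_pos hy, abs_zero] at this
    exact hy.ne' this
  have habs : ∀ x y : ℝ, 0 < y → |(x + σ * y * Complex.I : ℂ).im| = y := fun x y hy => by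
    rw [him, abs_mul, hσ0, one_mul, abs_of_pos hy]
  have hmem : ∀ x ∈ Icc (E - ε₀) (E + ε₀), ∀ y ∈ Ioc 0 (c₀ / 2 / μ h),
      ((h, x + σ * y * Complex.I) : ℝ × ℂ) ∈ rectangle μ E ε₀ c₀ := fun x hx y hy => by
    refine ⟨hh, him0 x y hy.1, ?_, ?_⟩
    · change |(x + σ * y * Complex.I : ℂ).re - E| ≤ ε₀
      rw [hre, abs_le]
      constructor <;> linarith [hx.1, hx.2]
    · change |(x + σ * y * Complex.I : ℂ).im| * μ h ≤ c₀ / 2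
      rw [habs x y hy.1]
      exact (le_div_iff₀ hμ0).mp hy.2
  have hA : ∀ j ≤ m, ∀ x ∈ Icc (E - ε₀) (E + ε₀), ∀ y ∈ Ioc 0 (c₀ / 2 / μ h),
      ‖derivRes (P h) a T B j (x + σ * y * Complex.I)‖ ≤
        j.factorial * C * (c₁ j * μ h ^ (j + 1)) := fun j hj x hx y hy => by
    have hp := hmem x hx y hy
    refine (hTB j _ (him0 x y hy.1) (Φ.norm_le (Φ.rectangle_subset hp))).trans ?_
    exact mul_le_mul_of_nonneg_left (hc₁ j hj _ hp) (by positivity)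
  refine ⟨⟨hν0, div_pos (half_pos Φ.c₀_pos) hμ0, fun j x y hy => ?_, fun j x y hy => ?_,
    fun j hj x hx y hy => ?_⟩, hA⟩
  · exact hasDerivAt_comp_re _ (hasDerivAt_derivRes hsa a T B j (him0 x y hy))
  · refine ⟨_, hasDerivAt_comp_im x σ (hasDerivAt_derivRes hsa a T B j (him0 x y hy)), ?_⟩
    rw [norm_smul, norm_mul, Complex.norm_I, Complex.norm_real, Real.norm_eq_abs, hσ0, one_mul,
      one_mul]
  · have hp := hmem x hx y hy
    -- Heights are at most c₀ / (2μ) ≤ 1, so for orders below m a plain bound implies one with the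
    -- singular factor.
    have hy1 : 1 ≤ y ^ (ν - 1) := by
      refine Real.one_le_rpow_of_pos_of_le_one_of_nonpos hy.1 ?_ (by linarith)
      refine hy.2.trans ((div_le_self (by linarith [Φ.c₀_pos]) hμ1).trans ?_)
      linarith [Φ.c₀_le_one]
    split_ifs with hjm
    · have h1 := hA (j + 1) hjm x hx y hy
      exact h1.trans (le_mul_of_one_le_right ((norm_nonneg _).trans h1) hy1)
    · obtain rfl : j = m := le_antisymm hj (not_lt.mp hjm)
      refine (hTB _ _ (him0 x y hy.1) (Φ.norm_le (Φ.rectangle_subset hp))).trans ?_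
      have h1 := mul_le_mul_of_nonneg_left (hc₂ _ hp)
        (by positivity : (0 : ℝ) ≤ (j + 1).factorial * C)
      refine h1.trans_eq ?_
      rw [habs x y hy.1, Real.mul_rpow hy.1.le hμ0.le, neg_sub]
      ring

end IsFamily

/-- Hölder regularity of the derivatives of the boundary values of the weighted resolvent. -/
theorem exists_memCs_boundaryResolvent (c : Coefficients n) (hreg : c.IsRegular)
    (δ : ℝ) (hδ : 1 < δ) (hshort : c.IsShortRange δ) (P : ℝ → L2 n →ₗ.[ℂ] L2 n)
    (hP : ∀ h ∈ Ioc (0 : ℝ) 1, IsSelfAdjointRealization c h (P h)) (hell : IsElliptic P)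
    (E ε₀ : ℝ) (hε₀ : 0 < ε₀) (hE : ε₀ < E) (μ : ℝ → ℝ) (hμ : ∀ h ∈ Ioc (0 : ℝ) 1, h⁻¹ ≤ μ h)
    (hlap : LimitingAbsorption P E ε₀ μ) (s : ℝ≥0) (hs : (s : ℝ) < δ - 1) (ε : ℝ≥0) (hε : 0 < ε) :
    ∃ C : ℝ, 0 < C ∧ ∀ h ∈ Ioc (0 : ℝ) 1, ∀ σ ∈ ({1, -1} : Set ℝ),
      ∀ k ≤ 2, ∀ α : Fin k → Fin n, ∃ T : ℝ → L2 n →L[ℂ] L2 n,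
        (∀ z ∈ Ioo (E - ε₀) (E + ε₀),
          IsSemiDerivComp h α (boundaryResolvent (P h) σ (1 / 2 + s + ε) z) (T z)) ∧
        MemCs s (Ioo (E - ε₀) (E + ε₀)) T ∧
        csNorm s (Ioo (E - ε₀) (E + ε₀)) T ≤ ENNReal.ofReal (C * μ h ^ (1 + (s : ℝ))) := by
  obtain ⟨c₀, W, Φ⟩ := exists_isFamily hreg hδ hshort hP hell hε₀ hE hμ hlap
  obtain ⟨ν, hν0, hν1, hνδ, hνs, hν⟩ := exists_holder_exponent hs hε
  obtain ⟨m, hm⟩ : ∃ m, m = ⌊s⌋₊ := ⟨_, rfl⟩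
  obtain ⟨a, ha⟩ : ∃ a : ℝ, a = ((1 / 2 + s + ε : ℝ≥0) : ℝ) := ⟨_, rfl⟩
  have ha' : a = 1 / 2 + s + ε := by rw [ha]; push_cast; rfl
  rw [← hm] at hνδ hνs hν
  have ham : 1 / 2 + (m : ℝ) + ν < a := by linarith
  have ha0 : 0 ≤ a := ha ▸ NNReal.coe_nonneg _
  have hms : (m : ℝ) ≤ s := by rw [hm]; exact_mod_cast Nat.floor_le (zero_le (a := s))
  obtain ⟨K, hK, hmod⟩ := exists_isModel hreg hδ.le hshort hP hell
  obtain ⟨CB, hCB, hB⟩ := exists_mul_weight n hK ha0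
  obtain ⟨CT, hT⟩ := hell
  have hbound : ∀ j, ∃ c₁ : ℝ, 0 ≤ c₁ ∧ (j ≤ m → ∀ p ∈ rectangle μ E ε₀ c₀,
      wnorm P a (j + 1) a p + wnorm P a j a p ≤ c₁ * μ p.1 ^ (j + 1)) := fun j => by
    by_cases hj : j ≤ m
    · obtain ⟨c₁, h0, h1⟩ := Φ.bound_pow (by linarith : (m : ℝ) < δ - 1)
        (by linarith : 1 / 2 + (m : ℝ) < a) hj
      exact ⟨c₁, h0, fun _ => h1⟩
    · exact ⟨0, le_rfl, fun h => absurd h hj⟩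
  choose c₁ hc₁0 hc₁ using hbound
  obtain ⟨c₂, hc₂0, hc₂⟩ := Φ.bound_last_pow hν0 hν1 hνδ ham
  obtain ⟨C₀, hC₀⟩ : ∃ C₀, C₀ = |CT| * (CB * (1 + (E + ε₀ + 2))) := ⟨_, rfl⟩
  have hC₀0 : 0 ≤ C₀ := hC₀ ▸ mul_nonneg (abs_nonneg _) (mul_nonneg hCB (by linarith))
  obtain ⟨S, hS⟩ : ∃ S, S = ∑ j ∈ Finset.range (m + 1), (j.factorial : ℝ) * C₀ * c₁ j := ⟨_, rfl⟩
  have hterm : ∀ j, 0 ≤ (j.factorial : ℝ) * C₀ * c₁ j := fun j =>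
    mul_nonneg (by positivity) (hc₁0 j)
  have hS0 : 0 ≤ S := hS ▸ Finset.sum_nonneg fun j _ => hterm j
  have hSj : ∀ j ≤ m, (j.factorial : ℝ) * C₀ * c₁ j ≤ S := fun j hj => by
    rw [hS]
    exact Finset.single_le_sum (f := fun j => (j.factorial : ℝ) * C₀ * c₁ j) (fun j _ => hterm j)
      (Finset.mem_range.mpr (by omega))
  have hc₀ := Φ.c₀_pos
  -- The Hölder constant without its power of μ: the first term for points closer than c₀ / (2μ),
  -- the second for points further apart.
  obtain ⟨H, hH⟩ : ∃ H : ℝ, H = (m + 1).factorial * C₀ * c₂ * (2 / ν + 1) +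
      2 * (m.factorial * C₀ * c₁ m) * (c₀ / 2) ^ (-ν) := ⟨_, rfl⟩
  have hH0 : 0 ≤ H := by
    have := hc₁0 m
    rw [hH]
    positivity
  refine ⟨(m + 2) * (S + H) + 1, by positivity, fun h hh σ hσ k hk α => ?_⟩
  have hμ1 := Φ.one_le_μ h hh
  have hμ0 : 0 < μ h := by linarith
  have hsa := Φ.isSelfAdjoint h hh
  obtain ⟨q, V₁, T', T₂, M⟩ := hmod h hh
  obtain ⟨B, hBw, hBn⟩ := hB M
  -- Ellipticity enters through the single resolvent (P + i)⁻¹, for both boundary values.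
  obtain ⟨T, hTd, hTn⟩ := hT h hh 1 (by simp) k hk α
  rw [Complex.ofReal_one, neg_one_mul] at hTd
  have hTB : ∀ (j : ℕ) (z : ℂ), z.im ≠ 0 → ‖z‖ ≤ E + ε₀ + 2 → ‖derivRes (P h) a T B j z‖ ≤
      j.factorial * C₀ * (wnorm P a (j + 1) a (h, z) + wnorm P a j a (h, z)) := fun j z hz hZ => by
    refine (norm_derivRes_le hsa hCB (hTn.trans (le_abs_self CT)) hBn j hz hZ).trans_eq ?_
    rw [hC₀, wnorm, wnorm]
    ring
  obtain ⟨hfam, hA⟩ := Φ.isHolderFamily hν0 hν1 hh hσ (fun j hj => hc₁ j hj) hc₂ hC₀0 hTB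
  have hrpow : ∀ j ≤ m, μ h ^ (j + 1) ≤ μ h ^ (1 + (s : ℝ)) := fun j hj => by
    rw [← Real.rpow_natCast]
    refine Real.rpow_le_rpow_of_exponent_le hμ1 ?_
    have : (j : ℝ) ≤ m := by exact_mod_cast hj
    push_cast
    linarith
  have hpos : 0 < μ h ^ (1 + (s : ℝ)) := Real.rpow_pos_of_pos hμ0 _
  have hcs : csNorm s (Ioo (E - ε₀) (E + ε₀)) (IsHolderFamily.boundary
      (fun j x y => derivRes (P h) a T B j ((x : ℝ) + σ * (y : ℝ) * Complex.I)) 0) ≤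
      ENNReal.ofReal (((m + 2) * (S + H) + 1) * μ h ^ (1 + (s : ℝ))) := by
    rw [hm] at hfam hA hν
    refine (hfam.csNorm_boundary_le (B := (S + H) * μ h ^ (1 + (s : ℝ))) hν hA
      (fun j hj => ?_) fun hs' => ?_).trans (ENNReal.ofReal_le_ofReal ?_)
    · rw [← hm] at hj
      rw [← mul_assoc]
      exact mul_le_mul ((hSj j hj).trans (by linarith)) (hrpow j hj) (by positivity)
        (by positivity)
    · have hse := hν hs'
      rw [if_neg (lt_irrefl _), ← hm]
      rw [← hm] at hse
      -- For s = m + ν both parts of the Hölder constant carry the same power: m + 2 - (1 - ν) = m +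
      -- 1 + ν = 1 + s.
      have e1 : μ h ^ (m + 2) * μ h ^ (-(1 - ν)) = μ h ^ (1 + (s : ℝ)) := by
        rw [← Real.rpow_natCast, ← Real.rpow_add hμ0, hse]
        congr 1
        push_cast
        ring
      have e2 : μ h ^ (m + 1) * μ h ^ ν = μ h ^ (1 + (s : ℝ)) := by
        rw [← Real.rpow_natCast, ← Real.rpow_add hμ0, hse]
        congr 1
        push_cast
        ring
      have e3 : (c₀ / 2 / μ h) ^ (-ν) = (c₀ / 2) ^ (-ν) * μ h ^ ν := by
        rw [Real.div_rpow (by positivity) hμ0.le, Real.rpow_neg hμ0.le, div_inv_eq_mul]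
      rw [e1, e3]
      calc _ = (((m + 1).factorial * C₀ * c₂ * (2 / ν + 1)) * μ h ^ (1 + (s : ℝ)) +
            2 * (m.factorial * C₀ * c₁ m) * (c₀ / 2) ^ (-ν) * (μ h ^ (m + 1) * μ h ^ ν)) := by ring
        _ = H * μ h ^ (1 + (s : ℝ)) := by rw [e2, hH]; ring
        _ ≤ _ := mul_le_mul_of_nonneg_right (by linarith) hpos.le
    · rw [← hm]
      nlinarith
  refine ⟨_, fun z hz f => ?_, ⟨?_, hcs.trans_lt ENNReal.ofReal_lt_top⟩, hcs⟩
  · have hz' := Ioo_subset_Icc_self hz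
    have hs2 : (1 / 2 : ℝ≥0) < 1 / 2 + s + ε := by
      rw [add_assoc]
      exact lt_add_of_pos_right _ (add_pos_of_nonneg_of_pos zero_le hε)
    obtain ⟨C', hl⟩ := hlap (1 / 2 + s + ε) hs2
    have h1 := (hl h hh σ hσ).1 z hz'
    have h2 := hfam.tendsto_boundary (Nat.zero_le _) hz'
    have happ := (ContinuousLinearMap.apply ℂ (L2 n) f).continuous
    refine isSemiDeriv_of_tendsto ?_ ((happ.tendsto _).comp h1) ((happ.tendsto _).comp h2)
    filter_upwards [self_mem_nhdsWithin] with y hy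
    have hy : 0 < y := hy
    change IsSemiDeriv h α
      (weightedResolvent (P h) (1 / 2 + s + ε) (z + σ * y * Complex.I) f)
      (derivRes (P h) a T B 0 (z + σ * y * Complex.I) f)
    rw [weightedResolvent_eq_wres, ← ha]
    refine isSemiDerivComp_derivRes hsa hBw hTd ?_ f
    rcases hσ with rfl | rfl <;> simp [hy.ne']
  · rw [← hm]
    exact hfam.contDiffOn_boundary

end Final

end Semiclassical

end

theorem proposition3p2 {n : ℕ} (hn : 2 ≤ n)
    (c : Semiclassical.Coefficients n) (hreg : c.IsRegular)
    (δ : ℝ) (hδ : 1 < δ) (hshort : c.IsShortRange δ)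
    (P : ℝ → Semiclassical.L2 n →ₗ.[ℂ] Semiclassical.L2 n)
    (hP : ∀ h ∈ Ioc (0 : ℝ) 1, Semiclassical.IsSelfAdjointRealization c h (P h))
    (hell : Semiclassical.IsElliptic P)
    (E ε₀ : ℝ) (hε₀ : 0 < ε₀) (hE : ε₀ < E)
    (μ : ℝ → ℝ) (hμ : ∀ h ∈ Ioc (0 : ℝ) 1, h⁻¹ ≤ μ h)
    (hlap : Semiclassical.LimitingAbsorption P E ε₀ μ)
    (s : ℝ≥0) (hs : (s : ℝ) < δ - 1) (ε : ℝ≥0) (hε : 0 < ε) :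
    ∃ C : ℝ, 0 < C ∧ ∀ h ∈ Ioc (0 : ℝ) 1, ∀ σ ∈ ({1, -1} : Set ℝ),
      ∀ k ≤ 2, ∀ α : Fin k → Fin n,
        ∃ T : ℝ → Semiclassical.L2 n →L[ℂ] Semiclassical.L2 n,
          (∀ z ∈ Ioo (E - ε₀) (E + ε₀),
            Semiclassical.IsSemiDerivComp h α
              (Semiclassical.boundaryResolvent (P h) σ (1 / 2 + s + ε) z) (T z)) ∧
          Semiclassical.MemCs s (Ioo (E - ε₀) (E + ε₀)) T ∧
          Semiclassical.csNorm s (Ioo (E - ε₀) (E + ε₀)) T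
            ≤ ENNReal.ofReal (C * μ h ^ (1 + (s : ℝ))) :=
  Semiclassical.exists_memCs_boundaryResolvent c hreg δ hδ hshort P hP hell E ε₀ hε₀ hE μ hμ
    hlap s hs ε hε
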